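/- Let $n \ge 2$ and $k \ge 1$, let $G$ be a simple undirected graph with $n$ vertices and $m$ edges, given as a list of its edges. Forests $F_1,\dots,F_k$ form a \emph{sparse certificate} of a graph $A$ if each $F_i$ is a maximal spanning forest of $A \setminus (F_1\cup\dots\cup F_{i-1})$. \emph{Algorithm.} Initialization runs the Nagamochi--Ibaraki scan on $G$: all ranks $r(v)$ and all edge classes start at $0$ and $\emptyset$; repeatedly choose an unscanned vertex $x$ of largest rank and, for each unscanned edge $e=\{x,y\}$, put $e$ into $E_{r(y)+1}$, increase $r(x)$ by one if $r(x)=r(y)$, increase $r(y)$ by one, and mark $e$ scanned; then mark $x$ scanned. It then stores the forests $F_i=(V,E_i)$, $1\le i\le k$, in $k$ link-cut trees (path decompositions of rooted forests, each path being kept in a binary tree with reversal bits, with a path-parent pointer at its root). The maintained graph is $H=F_1\cup\dots\cup F_k$. The addition of a new edge $\{u,v\}$ ($u\ne v$, $\{u,v\}\notin H$) is a cascade: $(u,v)$ is handed to $F_1$; a forest $F_i$ that is handed $(x,y)$ adds $\{x,y\}$ if $x,y$ lie in different trees of $F_i$, and the cascade stops; otherwise it replaces the first edge $\{x,p\}$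 of its tree path from $x$ to $y$ by $\{x,y\}$ and hands $(x,p)$ to $F_{i+1}$. An edge ejected by $F_k$ is discarded. \emph{Claim.} This algorithm can be implemented on a word RAM: there are an initialization program, an edge-addition program and constants $c, C$, all independent of $n,k,G$ and of the sequence of additions, such that, with words holding the numbers $0,\dots,(n+k+m+2)^c$ and unit-cost instructions (constants, addition, subtraction, comparison, indirect load and store), the following holds. 1. Initialization halts after at most $C\,(m+kn\log n)$ steps, and then $k$ link-cut trees representing $F_1,\dots,F_k$ are stored in memory. 2. After initialization every sequence of additions of new edges, each new with respect to the graph maintained at that moment, can be processed. Each addition halts, carries out the cascade, leaves $k$ link-cut trees representing the new forests in memory, and reports the discarded edge, if any. The amortized cost of an addition is $O(k\log n)$: for every $q\ge 0$, initialization and the first $q$ additions together take at most $C\,(m+kn\log n)+q\cdot C\,k\log n$ steps. 3. At all times the forests are a sparse certificate of the graph $A$ formed by $G$ and all edges added so far. If the addition of $e_{new}$ to $H$ discards no edge, the new maintained graph is $H\cup\{e_{new}\}$. If it discards $e_{old}=\{x,y\}$, then $e_{old}\in H$, $e_{old}\neq e_{new}$, the new maintained graph is $H'=(H\cup\{e_{new}\})\setminus\{e_{old}\}$,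 and $e_{old}$ is redundant: $H'$ contains $k$ pairwise edge-disjoint paths between $x$ and $y$. -/

import Mathlib

/-! ### A word RAM with step counting -/

/-- A machine state: registers and memory cells, all holding natural numbers. -/
structure RAMState where
  reg : ℕ → ℕ
  mem : ℕ → ℕ

/-- Assign a register. -/
def RAMState.setReg (s : RAMState) (r x : ℕ) : RAMState :=
  { s with reg := Function.update s.reg r x }

/-- Write a memory cell. -/
def RAMState.setMem (s : RAMState) (a x : ℕ) : RAMState :=
  { s with mem := Function.update s.mem a x }

/-- Tests compare two registers. -/
inductive RAMTest where
  | lt (a b : ℕ)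
  | eq (a b : ℕ)

/-- The test succeeds in the given state. -/
def RAMTest.Holds : RAMTest → RAMState → Prop
  | .lt a b, s => s.reg a < s.reg b
  | .eq a b, s => s.reg a = s.reg b

/-- Programs of the machine. A program is a finite text; its numbers are register names, except
for the constant `c` in `const`. -/
inductive RAMProg where
  /-- do nothing -/
  | skip
  /-- `r := c` -/
  | const (r c : ℕ)
  /-- `r := a + b` -/
  | add (r a b : ℕ)
  /-- `r := a - b` (truncated at `0`) -/
  | sub (r a b : ℕ)
  /-- `r := mem[a]` -/
  | load (r a : ℕ)
  /-- `mem[a] := r` -/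
  | store (a r : ℕ)
  | seq (p q : RAMProg)
  | ite (b : RAMTest) (p q : RAMProg)
  | loop (b : RAMTest) (p : RAMProg)

/-- `RAMExec W p s s' t`: on a machine whose words hold the numbers `0, …, W`, program `p` started
in state `s` halts in state `s'` after exactly `t` steps. Each elementary instruction and each
evaluation of a test is one step; an instruction whose result does not fit into a word has no
execution. -/
inductive RAMExec (W : ℕ) : RAMProg → RAMState → RAMState → ℕ → Prop where
  | skip (s : RAMState) : RAMExec W .skip s s 1
  | const (s : RAMState) (r c : ℕ) (h : c ≤ W) : RAMExec W (.const r c) s (s.setReg r c) 1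
  | add (s : RAMState) (r a b : ℕ) (h : s.reg a + s.reg b ≤ W) :
      RAMExec W (.add r a b) s (s.setReg r (s.reg a + s.reg b)) 1
  | sub (s : RAMState) (r a b : ℕ) :
      RAMExec W (.sub r a b) s (s.setReg r (s.reg a - s.reg b)) 1
  | load (s : RAMState) (r a : ℕ) :
      RAMExec W (.load r a) s (s.setReg r (s.mem (s.reg a))) 1
  | store (s : RAMState) (a r : ℕ) :
      RAMExec W (.store a r) s (s.setMem (s.reg a) (s.reg r)) 1
  | seq {p q : RAMProg} {s₁ s₂ s₃ : RAMState} {t₁ t₂ : ℕ}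
      (hp : RAMExec W p s₁ s₂ t₁) (hq : RAMExec W q s₂ s₃ t₂) :
      RAMExec W (.seq p q) s₁ s₃ (t₁ + t₂)
  | ite_true {b : RAMTest} {p q : RAMProg} {s s' : RAMState} {t : ℕ}
      (hb : b.Holds s) (hp : RAMExec W p s s' t) : RAMExec W (.ite b p q) s s' (t + 1)
  | ite_false {b : RAMTest} {p q : RAMProg} {s s' : RAMState} {t : ℕ}
      (hb : ¬ b.Holds s) (hq : RAMExec W q s s' t) : RAMExec W (.ite b p q) s s' (t + 1)
  | loop_done {b : RAMTest} {p : RAMProg} {s : RAMState}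
      (hb : ¬ b.Holds s) : RAMExec W (.loop b p) s s 1
  | loop_step {b : RAMTest} {p : RAMProg} {s₁ s₂ s₃ : RAMState} {t₁ t₂ : ℕ}
      (hb : b.Holds s₁) (hp : RAMExec W p s₁ s₂ t₁) (hl : RAMExec W (.loop b p) s₂ s₃ t₂) :
      RAMExec W (.loop b p) s₁ s₃ (t₁ + t₂ + 1)

/-! ### Link-cut trees -/

/-- The pointers of a link-cut structure on the node set `V`. The auxiliary binary trees are given
by `left` and `right`; `parent v` is the parent of `v` in its auxiliary tree, or, if `v` is the root
of its auxiliary tree, the path-parent of that tree; `rev v` is the lazy reversal bit of the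
auxiliary subtree at `v`. -/
structure LinkCut (V : Type) where
  parent : V → Option V
  left : V → Option V
  right : V → Option V
  rev : V → Bool

namespace LinkCut

variable {V : Type}

/-- `c` is a child of `v` in an auxiliary tree. -/
def IsChild (T : LinkCut V) (v c : V) : Prop := T.left v = some c ∨ T.right v = some c

/-- `r` is the root of its auxiliary tree. -/
def IsAuxRoot (T : LinkCut V) (r : V) : Prop := ∀ v, ¬ T.IsChild v r

/-- Consistency of the pointers: the auxiliary trees are disjoint binary trees with correct parent
pointers, and following parent and path-parent pointers never runs into a cycle. -/
structure WellFormed (T : LinkCut V) : Prop where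
  parent_of_child : ∀ v c, T.IsChild v c → T.parent c = some v
  left_ne_right : ∀ v c, T.left v = some c → T.right v ≠ some c
  acyclic : WellFounded fun p c => T.parent c = some p

/-- The node sequence of an auxiliary subtree, read in symmetric order, where a reversal bit
reverses the sequence of the whole subtree below it. -/
inductive InOrder (T : LinkCut V) : Option V → List V → Prop where
  | nil : InOrder T none []
  | node (v : V) (l₁ l₂ : List V) (h₁ : InOrder T (T.left v) l₁) (h₂ : InOrder T (T.right v) l₂) :
      InOrder T (some v) (if T.rev v then (l₁ ++ v :: l₂).reverse else l₁ ++ v :: l₂)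

/-- `l` is one of the vertical paths into which the represented forest is decomposed, listed from
its topmost to its deepest vertex, and `r` is the root of its auxiliary tree. -/
def IsSolidPath (T : LinkCut V) (r : V) (l : List V) : Prop :=
  T.IsAuxRoot r ∧ T.InOrder (some r) l

/-- In the represented rooted forest, `y` is the parent of `x`: either `y` immediately precedes `x`
on a path of the decomposition, or `x` is the top of a path whose path-parent is `y`. -/
def ForestParent (T : LinkCut V) (x y : V) : Prop :=
  (∃ r l, T.IsSolidPath r l ∧ [y, x] <:+: l) ∨
    ∃ r l, T.IsSolidPath r l ∧ l.head? = some x ∧ T.parent r = some y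

/-- The (unrooted) forest represented by a link-cut structure. -/
def forest (T : LinkCut V) : SimpleGraph V := SimpleGraph.fromRel T.ForestParent

end LinkCut

/-! ### Sparse certificates and their maintenance -/

section Certificate

variable {V : Type}

/-- `F₀, …, F₍ₖ₋₁₎` is a sparse certificate of `G`: each `Fᵢ` is a maximal spanning forest of `G`
minus the edges of the preceding forests. -/
def IsSparseCertificate {k : ℕ} (G : SimpleGraph V) (F : Fin k → SimpleGraph V) : Prop :=
  ∀ i, F i ≤ G \ (⨆ j, ⨆ _ : j < i, F j) ∧ (F i).IsAcyclic ∧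
    ∀ x y, (G \ (⨆ j, ⨆ _ : j < i, F j)).Reachable x y → (F i).Reachable x y

/-- There are `k` pairwise edge-disjoint paths between `x` and `y` in `G`, that is, the local
edge-connectivity of `x` and `y` is at least `k`. -/
def HasEdgeDisjointPaths (G : SimpleGraph V) (k : ℕ) (x y : V) : Prop :=
  ∃ P : Fin k → G.Path x y, ∀ i j, i ≠ j → List.Disjoint (P i).1.edges (P j).1.edges

/-- Inserting the edge `{u, v}` into a forest `F`. If `u` and `v` are in different trees, the edge is
added. Otherwise the tree is viewed as rooted at `v`, the edge from `u` to its parent `p` (the first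
edge of the tree path from `u` to `v`) is replaced by `{u, v}`, and `(u, p)` is ejected. -/
inductive TryAdd (F : SimpleGraph V) (u v : V) : SimpleGraph V → Option (V × V) → Prop where
  | link (h : ¬ F.Reachable u v) : TryAdd F u v (F ⊔ SimpleGraph.edge u v) none
  | swap (p : V) (h : F.Reachable u v) (hp : F.Adj u p)
      (hs : ¬ (F.deleteEdges {s(u, p)}).Reachable u v) :
      TryAdd F u v (F.deleteEdges {s(u, p)} ⊔ SimpleGraph.edge u v) (some (u, p))

/-- The cascade for an added edge `{u, v}`: it is inserted into the first forest, the ejected edge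
(if any) into the second one, and so on; `F'` are the resulting forests and `out` is the edge
ejected from the last forest, if any. Here `e i` is the edge handed to the forest with index `i`. -/
def HandleAddition {k : ℕ} (F : Fin k → SimpleGraph V) (u v : V) (F' : Fin k → SimpleGraph V)
    (out : Option (V × V)) : Prop :=
  ∃ e : ℕ → Option (V × V), e 0 = some (u, v) ∧ e k = out ∧
    ∀ i : Fin k,
      (e i = none → F' i = F i ∧ e (i + 1) = none) ∧
      ∀ x y, e i = some (x, y) → TryAdd (F i) x y (F' i) (e (i + 1))

end Certificate

/-! ### The Nagamochi–Ibaraki scan -/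

/-- State of the scan: `E i` is the `i`-th edge class (counted from `0`), `r` the rank of the
vertices, and `active` is the vertex that is being scanned, if any. -/
structure ScanState (V : Type) where
  E : ℕ → Set (Sym2 V)
  r : V → ℕ
  scannedV : Set V
  scannedE : Set (Sym2 V)
  active : Option V

/-- Nothing is scanned yet. -/
def ScanState.start (V : Type) : ScanState V where
  E := fun _ => ∅
  r := fun _ => 0
  scannedV := ∅
  scannedE := ∅
  active := none

open Classical in
/-- The steps of the scan: choose an unscanned vertex `x` of largest rank; put an unscanned edge
`{x, y}` into the class with index `r y` and raise the rank of `y`, and also that of `x` if both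
ranks were equal; close `x` when no unscanned edge is incident to it. -/
inductive ScanStep {V : Type} (G : SimpleGraph V) : ScanState V → ScanState V → Prop where
  | choose (S : ScanState V) (x : V) (ha : S.active = none) (hx : x ∉ S.scannedV)
      (hmax : ∀ y, y ∉ S.scannedV → S.r y ≤ S.r x) :
      ScanStep G S { S with active := some x }
  | edge (S : ScanState V) (x y : V) (ha : S.active = some x) (hxy : G.Adj x y)
      (hs : s(x, y) ∉ S.scannedE) :
      ScanStep G S
        { S with
          E := Function.update S.E (S.r y) (insert s(x, y) (S.E (S.r y)))
          r := fun z =>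
            if z = y then S.r y + 1
            else if z = x ∧ S.r x = S.r y then S.r x + 1
            else S.r z
          scannedE := insert s(x, y) S.scannedE }
  | close (S : ScanState V) (x : V) (ha : S.active = some x)
      (hall : ∀ y, G.Adj x y → s(x, y) ∈ S.scannedE) :
      ScanStep G S { S with scannedV := insert x S.scannedV, active := none }

/-- `E` is the edge partition computed by some complete scan of `G`. -/
def IsScanPartition {V : Type} (G : SimpleGraph V) (E : ℕ → Set (Sym2 V)) : Prop :=
  ∃ S : ScanState V, Relation.ReflTransGen (ScanStep G) (ScanState.start V) S ∧
    S.active = none ∧ (∀ x, x ∈ S.scannedV) ∧ S.E = E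

/-! ### Input, stored link-cut trees, and runs -/

/-- `L` lists every edge of `G` exactly once, in one of its two orientations. -/
def ListsEdges {V : Type} (G : SimpleGraph V) (L : List (V × V)) : Prop :=
  (L.map fun e => s(e.1, e.2)).Nodup ∧ ∀ e, e ∈ L.map (fun e => s(e.1, e.2)) ↔ e ∈ G.edgeSet

/-- The initial machine state: registers `0, 1, 2` hold the number `n` of vertices, `k`, and the
number of edges; cells `2 * i` and `2 * i + 1` hold the end vertices of the `i`-th edge;
everything else is `0`. -/
def inputState (n k : ℕ) (L : List (Fin n × Fin n)) : RAMState where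
  reg := fun r => if r = 0 then n else if r = 1 then k else if r = 2 then L.length else 0
  mem := fun a =>
    match L[a / 2]? with
    | none => 0
    | some e => if a % 2 = 0 then (e.1 : ℕ) else (e.2 : ℕ)

/-- Encoding of pointers: `v + 1` stands for the vertex `v`, `0` for no vertex. -/
def decodePtr (n x : ℕ) : Option (Fin n) :=
  if h : 0 < x ∧ x ≤ n then some ⟨x - 1, by omega⟩ else none

/-- The `i`-th link-cut structure stored in a machine state. Register `3` holds the address of an
array of records of four cells (parent, left child, right child, reversal bit), and the record of
vertex `v` in the `i`-th structure is the one with number `i * n + v`. -/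
def storedLinkCut (n : ℕ) (s : RAMState) (i : ℕ) : LinkCut (Fin n) where
  parent := fun v => decodePtr n (s.mem (s.reg 3 + 4 * (i * n + v)))
  left := fun v => decodePtr n (s.mem (s.reg 3 + 4 * (i * n + v) + 1))
  right := fun v => decodePtr n (s.mem (s.reg 3 + 4 * (i * n + v) + 2))
  rev := fun v => decide (s.mem (s.reg 3 + 4 * (i * n + v) + 3) ≠ 0)

/-- The forests represented by the first `k` stored link-cut structures. -/
def storedForests (n k : ℕ) (s : RAMState) (i : Fin k) : SimpleGraph (Fin n) :=
  (storedLinkCut n s i).forest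

/-- The graph that is maintained: the union of the `k` forests. -/
def storedGraph (n k : ℕ) (s : RAMState) : SimpleGraph (Fin n) := ⨆ i, storedForests n k s i

/-- `{u, v}` can be added as a new edge to the maintained graph. -/
def IsNewEdge (n k : ℕ) (s : RAMState) (u v : Fin n) : Prop :=
  u ≠ v ∧ ¬ (storedGraph n k s).Adj u v

/-- A request to add `{u, v}` is passed in registers `0` and `1`. -/
def withRequest {n : ℕ} (s : RAMState) (u v : Fin n) : RAMState := (s.setReg 0 u).setReg 1 v

/-- The answer to a request: register `0` is `0` if no edge was discarded, and `1` if an edge was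
discarded, whose end vertices are then in registers `1` and `2`. -/
def ReportsDiscarded {n : ℕ} (s : RAMState) : Option (Fin n × Fin n) → Prop
  | none => s.reg 0 = 0
  | some e => s.reg 0 = 1 ∧ s.reg 1 = e.1 ∧ s.reg 2 = e.2

/-- `IsRun W init ins k G L q A T s`: the machine executed `init` on the input graph `G`, listed by
`L`, and then `ins` for `q` additions of new edges; `A` is `G` together with all edges added so far,
`T` is the total number of steps, and `s` is the state that was reached. -/
inductive IsRun (W : ℕ) (init ins : RAMProg) {n : ℕ} (k : ℕ) (G : SimpleGraph (Fin n))
    (L : List (Fin n × Fin n)) : ℕ → SimpleGraph (Fin n) → ℕ → RAMState → Prop where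
  | start {s : RAMState} {t : ℕ} (h : RAMExec W init (inputState n k L) s t) :
      IsRun W init ins k G L 0 G t s
  | step {q T t : ℕ} {A : SimpleGraph (Fin n)} {s s' : RAMState} (u v : Fin n)
      (h : IsRun W init ins k G L q A T s) (hnew : IsNewEdge n k s u v)
      (hex : RAMExec W ins (withRequest s u v) s' t) :
      IsRun W init ins k G L (q + 1) (A ⊔ SimpleGraph.edge u v) (T + t) s'

set_option linter.unusedSectionVars false

/-! ### Determinism of the machine -/

/-! Two arguments are combined: a combinatorial one about forests, and the amortized analysis of
explicit machine programs.

Certificates. During the scan an unscanned vertex is isolated in every class whose index is at least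
its rank, and two unscanned vertices whose ranks both exceed `i` are connected in class `i`. An edge
{x, y} entering class r(y) therefore closes no cycle, and since x has the largest rank, its ends are
connected in all lower classes. So the classes are successive maximal spanning forests
(`ScanInv.step`, `IsScanPartition.isSparseCertificate`). In a cascade, the graph left over by the
first new forests exceeds the graph left over by the old ones by at most the edge that is handed on.
A swap preserves connectivity and takes up the handed edge, so maximality survives
(`Cascade.remaining`, `Cascade.certificate`). A discarded edge lies in no new forest; by maximality
each of the k edge-disjoint forests joins its ends, which gives the k paths (`Cascade.of_some`).

Link-cut trees. Parent and path-parent pointers together form one virtual tree per component of the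
represented forest. The potential is the sum of the binary logarithms of all virtual subtree sizes.
A double rotation raises it by at most three times the growth of the logarithm at the splayed
vertex, minus 2, and these 2 units pay for its running time (`potential_zigzig`, `splayLoopP_spec`).
Exchanging the lower part of a path changes no parent pointer and so is free of potential cost. A
full round of an access climbs over two path-parent pointers and ends with a zig-zig along them,
which pays for the constant cost of the round; the growth terms telescope (`accessLoopP_spec`).
Linking, or cutting the first edge of the tree path and then linking, takes a constant number of
accesses and splays, so its amortized time is logarithmic (`tryAddP_spec`). The descent that finds
this first edge is paid for by the splay that follows it.

Machine. The algorithms are structured commands over an abstract state, and `CExec.compile` carries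
them to the word RAM with a constant factor. The scan uses bucket lists and needs a number of steps
linear in the numbers of vertices and edges; the parent pointers that it records are read as
link-cut structures with one-vertex paths. Their initial potential, at most k n lg n, is charged to
initialization, and each later addition pays a constant multiple of k lg n (`RunInv.init`,
`RunInv.addition`). Correctness is proved in the form that some execution exists; determinism
transfers it to every run. -/

theorem RAMExec.deterministic {W : ℕ} {p : RAMProg} {s s₁ : RAMState} {t₁ : ℕ}
    (h₁ : RAMExec W p s s₁ t₁) :
    ∀ {s₂ : RAMState} {t₂ : ℕ}, RAMExec W p s s₂ t₂ → s₁ = s₂ ∧ t₁ = t₂ := by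
  induction h₁ with
  | skip s => intro s₂ t₂ h; cases h; exact ⟨rfl, rfl⟩
  | const s r c h => intro s₂ t₂ h; cases h; exact ⟨rfl, rfl⟩
  | add s r a b h => intro s₂ t₂ h; cases h; exact ⟨rfl, rfl⟩
  | sub s r a b => intro s₂ t₂ h; cases h; exact ⟨rfl, rfl⟩
  | load s r a => intro s₂ t₂ h; cases h; exact ⟨rfl, rfl⟩
  | store s a r => intro s₂ t₂ h; cases h; exact ⟨rfl, rfl⟩
  | seq _ _ ih₁ ih₂ =>
    intro s₂ t₂ h
    cases h with
    | seq hp hq =>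
      obtain ⟨rfl, rfl⟩ := ih₁ hp
      obtain ⟨rfl, rfl⟩ := ih₂ hq
      exact ⟨rfl, rfl⟩
  | ite_true hb _ ih =>
    intro s₂ t₂ h
    cases h with
    | ite_true _ hp => obtain ⟨rfl, rfl⟩ := ih hp; exact ⟨rfl, rfl⟩
    | ite_false hb' _ => exact absurd hb hb'
  | ite_false hb _ ih =>
    intro s₂ t₂ h
    cases h with
    | ite_true hb' _ => exact absurd hb' hb
    | ite_false _ hp => obtain ⟨rfl, rfl⟩ := ih hp; exact ⟨rfl, rfl⟩
  | loop_done hb =>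
    intro s₂ t₂ h
    cases h with
    | loop_done _ => exact ⟨rfl, rfl⟩
    | loop_step hb' _ _ => exact absurd hb' hb
  | loop_step hb _ _ ih₁ ih₂ =>
    intro s₂ t₂ h
    cases h with
    | loop_done hb' => exact absurd hb hb'
    | loop_step _ hp hl =>
      obtain ⟨rfl, rfl⟩ := ih₁ hp
      obtain ⟨rfl, rfl⟩ := ih₂ hl
      exact ⟨rfl, rfl⟩

/-! ### Total correctness of machine programs -/

/-- `p`, started in `s`, halts in a state and after a number of steps that satisfy `Q`. -/
def RAMTri (W : ℕ) (p : RAMProg) (s : RAMState) (Q : RAMState → ℕ → Prop) : Prop :=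
  ∃ s' t, RAMExec W p s s' t ∧ Q s' t

namespace RAMTri

variable {W : ℕ} {s : RAMState} {Q : RAMState → ℕ → Prop}

theorem mono {p : RAMProg} {Q' : RAMState → ℕ → Prop} (h : RAMTri W p s Q')
    (hQ : ∀ s' t, Q' s' t → Q s' t) : RAMTri W p s Q := by
  obtain ⟨s', t, he, h⟩ := h
  exact ⟨s', t, he, hQ _ _ h⟩

theorem skip (h : Q s 1) : RAMTri W .skip s Q := ⟨_, _, .skip s, h⟩

theorem const {r c : ℕ} (hc : c ≤ W) (h : Q (s.setReg r c) 1) : RAMTri W (.const r c) s Q :=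
  ⟨_, _, .const s r c hc, h⟩

theorem add {r a b : ℕ} (hc : s.reg a + s.reg b ≤ W) (h : Q (s.setReg r (s.reg a + s.reg b)) 1) :
    RAMTri W (.add r a b) s Q :=
  ⟨_, _, .add s r a b hc, h⟩

theorem sub {r a b : ℕ} (h : Q (s.setReg r (s.reg a - s.reg b)) 1) : RAMTri W (.sub r a b) s Q :=
  ⟨_, _, .sub s r a b, h⟩

theorem load {r a : ℕ} (h : Q (s.setReg r (s.mem (s.reg a))) 1) : RAMTri W (.load r a) s Q :=
  ⟨_, _, .load s r a, h⟩

theorem store {a r : ℕ} (h : Q (s.setMem (s.reg a) (s.reg r)) 1) : RAMTri W (.store a r) s Q :=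
  ⟨_, _, .store s a r, h⟩

theorem seq {p q : RAMProg}
    (h : RAMTri W p s fun s₁ t₁ => RAMTri W q s₁ fun s₂ t₂ => Q s₂ (t₁ + t₂)) :
    RAMTri W (.seq p q) s Q := by
  obtain ⟨s₁, t₁, h₁, s₂, t₂, h₂, hQ⟩ := h
  exact ⟨_, _, .seq h₁ h₂, hQ⟩

theorem ite {b : RAMTest} {p q : RAMProg} (ht : b.Holds s → RAMTri W p s fun s' t => Q s' (t + 1))
    (hf : ¬ b.Holds s → RAMTri W q s fun s' t => Q s' (t + 1)) : RAMTri W (.ite b p q) s Q := by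
  by_cases hb : b.Holds s
  · obtain ⟨s₁, t₁, h₁, h⟩ := ht hb
    exact ⟨_, _, .ite_true hb h₁, h⟩
  · obtain ⟨s₁, t₁, h₁, h⟩ := hf hb
    exact ⟨_, _, .ite_false hb h₁, h⟩

theorem loop_done {b : RAMTest} {p : RAMProg} (hb : ¬ b.Holds s) (h : Q s 1) :
    RAMTri W (.loop b p) s Q :=
  ⟨_, _, .loop_done hb, h⟩

theorem loop_step {b : RAMTest} {p : RAMProg} (hb : b.Holds s)
    (h : RAMTri W p s fun s₁ t₁ => RAMTri W (.loop b p) s₁ fun s₂ t₂ => Q s₂ (t₁ + t₂ + 1)) :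
    RAMTri W (.loop b p) s Q := by
  obtain ⟨s₁, t₁, h₁, s₂, t₂, h₂, hQ⟩ := h
  exact ⟨_, _, .loop_step hb h₁ h₂, hQ⟩

end RAMTri

/-! ### Structured commands over an abstract state -/

/-- Structured commands over primitive operations `P` and tests `B`. -/
inductive Cmd (P B : Type) where
  | skip
  | prim (p : P)
  | seq (c d : Cmd P B)
  | ite (b : B) (c d : Cmd P B)
  | loop (b : B) (c : Cmd P B)

/-- Meaning of the primitive operations and tests on states `σ`; `pre` tells when an operation is
defined. -/
structure CmdSem (σ P B : Type) where
  pre : P → σ → Prop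
  act : P → σ → σ
  holds : B → σ → Prop

/-- Big-step semantics with step counting. -/
inductive CExec {σ P B : Type} (S : CmdSem σ P B) : Cmd P B → σ → σ → ℕ → Prop where
  | skip (a : σ) : CExec S .skip a a 1
  | prim (p : P) (a : σ) (h : S.pre p a) : CExec S (.prim p) a (S.act p a) 1
  | seq {c d : Cmd P B} {a₁ a₂ a₃ : σ} {t₁ t₂ : ℕ} (hc : CExec S c a₁ a₂ t₁)
      (hd : CExec S d a₂ a₃ t₂) : CExec S (.seq c d) a₁ a₃ (t₁ + t₂)
  | ite_true {b : B} {c d : Cmd P B} {a a' : σ} {t : ℕ} (hb : S.holds b a)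
      (hc : CExec S c a a' t) : CExec S (.ite b c d) a a' (t + 1)
  | ite_false {b : B} {c d : Cmd P B} {a a' : σ} {t : ℕ} (hb : ¬ S.holds b a)
      (hd : CExec S d a a' t) : CExec S (.ite b c d) a a' (t + 1)
  | loop_done {b : B} {c : Cmd P B} {a : σ} (hb : ¬ S.holds b a) : CExec S (.loop b c) a a 1
  | loop_step {b : B} {c : Cmd P B} {a₁ a₂ a₃ : σ} {t₁ t₂ : ℕ} (hb : S.holds b a₁)
      (hc : CExec S c a₁ a₂ t₁) (hl : CExec S (.loop b c) a₂ a₃ t₂) :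
      CExec S (.loop b c) a₁ a₃ (t₁ + t₂ + 1)

/-- Translation of commands into machine programs. -/
def Cmd.compile {P B : Type} (cP : P → RAMProg) (cB : B → RAMTest) : Cmd P B → RAMProg
  | .skip => .skip
  | .prim p => cP p
  | .seq c d => .seq (c.compile cP cB) (d.compile cP cB)
  | .ite b c d => .ite (cB b) (c.compile cP cB) (d.compile cP cB)
  | .loop b c => .loop (cB b) (c.compile cP cB)

/-- If the translations of all primitive operations and tests are correct with respect to a
representation relation `R`, so is the translation of every command, with constant overhead. -/
theorem CExec.compile {σ P B : Type} {S : CmdSem σ P B} {cP : P → RAMProg} {cB : B → RAMTest}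
    {W K : ℕ} {R : RAMState → σ → Prop} (hK : 1 ≤ K)
    (hP : ∀ p s a, R s a → S.pre p a → RAMTri W (cP p) s fun s' t => R s' (S.act p a) ∧ t ≤ K)
    (hB : ∀ b s a, R s a → ((cB b).Holds s ↔ S.holds b a))
    {c : Cmd P B} {a a' : σ} {t : ℕ} (h : CExec S c a a' t) :
    ∀ s, R s a → RAMTri W (c.compile cP cB) s fun s' t' => R s' a' ∧ t' ≤ K * t := by
  induction h with
  | skip a => exact fun s hs => .skip ⟨hs, by omega⟩
  | prim p a h =>
    exact fun s hs => (hP p s a hs h).mono fun s' t ⟨h₁, h₂⟩ => ⟨h₁, by omega⟩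
  | seq _ _ ih₁ ih₂ =>
    refine fun s hs => .seq ((ih₁ s hs).mono fun s' t ⟨h₁, h₂⟩ => ?_)
    exact (ih₂ s' h₁).mono fun s'' t' ⟨h₃, h₄⟩ => ⟨h₃, by rw [mul_add]; omega⟩
  | ite_true hb _ ih =>
    intro s hs
    have hb' := (hB _ s _ hs).2 hb
    exact .ite (fun _ => (ih s hs).mono fun s' t ⟨h₁, h₂⟩ => ⟨h₁, by rw [mul_add]; omega⟩)
      fun h => absurd hb' h
  | ite_false hb _ ih =>
    intro s hs
    have hb' := fun h => hb ((hB _ s _ hs).1 h)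
    exact .ite (fun h => absurd h hb') fun _ =>
      (ih s hs).mono fun s' t ⟨h₁, h₂⟩ => ⟨h₁, by rw [mul_add]; omega⟩
  | loop_done hb => exact fun s hs => .loop_done (fun h => hb ((hB _ s _ hs).1 h)) ⟨hs, by omega⟩
  | loop_step hb _ _ ih₁ ih₂ =>
    refine fun s hs => .loop_step ((hB _ s _ hs).2 hb) ((ih₁ s hs).mono fun s' t ⟨h₁, h₂⟩ => ?_)
    exact (ih₂ s' h₁).mono fun s'' t' ⟨h₃, h₄⟩ => ⟨h₃, by rw [mul_add, mul_add]; omega⟩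

/-- `c`, started in `a`, halts in a state and after a number of steps that satisfy `Q`. -/
def CTri {σ P B : Type} (S : CmdSem σ P B) (c : Cmd P B) (a : σ) (Q : σ → ℕ → Prop) : Prop :=
  ∃ a' t, CExec S c a a' t ∧ Q a' t

namespace CTri

variable {σ P B : Type} {S : CmdSem σ P B} {a : σ} {Q : σ → ℕ → Prop}

theorem mono {c : Cmd P B} {Q' : σ → ℕ → Prop} (h : CTri S c a Q')
    (hQ : ∀ s' t, Q' s' t → Q s' t) : CTri S c a Q := by
  obtain ⟨s', t, he, h⟩ := h
  exact ⟨s', t, he, hQ _ _ h⟩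

theorem skip (h : Q a 1) : CTri S .skip a Q := ⟨_, _, .skip a, h⟩

theorem prim {p : P} (hp : S.pre p a) (h : Q (S.act p a) 1) : CTri S (.prim p) a Q :=
  ⟨_, _, .prim p a hp, h⟩

theorem seq {c d : Cmd P B} (h : CTri S c a fun s₁ t₁ => CTri S d s₁ fun s₂ t₂ => Q s₂ (t₁ + t₂)) :
    CTri S (.seq c d) a Q := by
  obtain ⟨s₁, t₁, h₁, s₂, t₂, h₂, hQ⟩ := h
  exact ⟨_, _, .seq h₁ h₂, hQ⟩

theorem ite {b : B} {c d : Cmd P B} (ht : S.holds b a → CTri S c a fun s' t => Q s' (t + 1))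
    (hf : ¬ S.holds b a → CTri S d a fun s' t => Q s' (t + 1)) : CTri S (.ite b c d) a Q := by
  by_cases hb : S.holds b a
  · obtain ⟨s₁, t₁, h₁, h⟩ := ht hb
    exact ⟨_, _, .ite_true hb h₁, h⟩
  · obtain ⟨s₁, t₁, h₁, h⟩ := hf hb
    exact ⟨_, _, .ite_false hb h₁, h⟩

theorem loop_done {b : B} {c : Cmd P B} (hb : ¬ S.holds b a) (h : Q a 1) :
    CTri S (.loop b c) a Q :=
  ⟨_, _, .loop_done hb, h⟩

theorem loop_step {b : B} {c : Cmd P B} (hb : S.holds b a)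
    (h : CTri S c a fun s₁ t₁ => CTri S (.loop b c) s₁ fun s₂ t₂ => Q s₂ (t₁ + t₂ + 1)) :
    CTri S (.loop b c) a Q := by
  obtain ⟨s₁, t₁, h₁, s₂, t₂, h₂, hQ⟩ := h
  exact ⟨_, _, .loop_step hb h₁ h₂, hQ⟩

end CTri

/-! ### Parent functions -/

section ParentFunctions

variable {V : Type}

/-- `z` is reached from `x` by following `par`. -/
def PAnc (par : V → Option V) (x z : V) : Prop :=
  Relation.ReflTransGen (fun c p => par c = some p) x z

/-- Following `par` never runs into a cycle. -/
def PAcyclic (par : V → Option V) : Prop := WellFounded fun p c => par c = some p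

variable {par : V → Option V}

theorem PAnc.refl (x : V) : PAnc par x x := Relation.ReflTransGen.refl

theorem PAnc.trans {x y z : V} (h : PAnc par x y) (h' : PAnc par y z) : PAnc par x z :=
  Relation.ReflTransGen.trans h h'

theorem PAnc.of_parent {x y : V} (h : par x = some y) : PAnc par x y :=
  Relation.ReflTransGen.single h

theorem PAnc.cases_left {x z : V} (h : PAnc par x z) : x = z ∨ ∃ y, par x = some y ∧ PAnc par y z :=
  Relation.ReflTransGen.cases_head h

theorem PAcyclic.not_transGen (hw : PAcyclic par) (x : V) :
    ¬ Relation.TransGen (fun c p => par c = some p) x x := by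
  intro h
  have h' : Relation.TransGen (fun p c => par c = some p) x x := by
    rw [← Relation.transGen_swap] at h
    exact h
  exact (WellFounded.transGen hw).irrefl.irrefl x h'

theorem PAcyclic.not_anc_of_parent (hw : PAcyclic par) {x y : V} (h : par x = some y) :
    ¬ PAnc par y x := fun h' => hw.not_transGen x (Relation.TransGen.head' h h')

theorem PAcyclic.ne_of_parent (hw : PAcyclic par) {x y : V} (h : par x = some y) : x ≠ y := by
  rintro rfl
  exact hw.not_anc_of_parent h (.refl x)

theorem PAcyclic.antisymm (hw : PAcyclic par) {x y : V} (h : PAnc par x y) (h' : PAnc par y x) :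
    x = y := by
  rcases h.cases_left with h₁ | ⟨z, h₁, h₂⟩
  · exact h₁
  · exact absurd (h₂.trans h') (hw.not_anc_of_parent h₁)

theorem PAnc.total {x y z : V} (h : PAnc par x y) (h' : PAnc par x z) :
    PAnc par y z ∨ PAnc par z y := by
  refine Relation.ReflTransGen.total_of_right_unique ?_ h h'
  intro a b c hb hc
  exact Option.some.inj (hb.symm.trans hc)

theorem PAnc.eq_of_root {x y : V} (h : PAnc par x y) (hx : par x = none) : x = y := by
  rcases h.cases_left with h₁ | ⟨z, h₁, _⟩
  · exact h₁
  · simp [hx] at h₁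

theorem PAnc.to_root {x y r : V} (h : PAnc par x y) (h' : PAnc par x r) (hr : par r = none) :
    PAnc par y r := by
  rcases h.total h' with h₁ | h₁
  · exact h₁
  · rw [h₁.eq_of_root hr]; exact .refl _

/-- A nontrivial ascent from `c` starts with the common parent `v`, and no ascent from `v` reaches a
child of `v`. Together with `PAnc.total`, this makes the subtrees of distinct children disjoint. -/
theorem PAcyclic.sibling (hw : PAcyclic par) {c d v : V} (hc : par c = some v) (hd : par d = some v)
    (h : PAnc par c d) : c = d := by
  rcases h.cases_left with h₁ | ⟨z, h₁, h₂⟩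
  · exact h₁
  · obtain rfl : v = z := Option.some.inj (hc.symm.trans h₁)
    exact absurd h₂ (hw.not_anc_of_parent hd)

theorem PAcyclic.exists_root (hw : PAcyclic par) (x : V) : ∃ r, PAnc par x r ∧ par r = none := by
  induction x using hw.induction with
  | h x ih =>
    cases hx : par x with
    | none => exact ⟨x, .refl x, hx⟩
    | some p =>
      obtain ⟨r, h, hr⟩ := ih p hx
      exact ⟨r, (PAnc.of_parent hx).trans h, hr⟩

/-- The relation from children to parents is well-founded, too, on a finite set. -/
theorem PAcyclic.wf_flip [Finite V] (hw : PAcyclic par) :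
    WellFounded fun c p => par c = some p := by
  have : IsTrans V (Relation.TransGen fun c p => par c = some p) := inferInstance
  have : Std.Irrefl (Relation.TransGen fun c p => par c = some p) := ⟨hw.not_transGen⟩
  exact Subrelation.wf (r := Relation.TransGen fun c p => par c = some p)
    (fun h => Relation.TransGen.single h) (Finite.wellFounded_of_trans_of_irrefl _)

end ParentFunctions

/-! ### Auxiliary trees and their node sequences -/

namespace LinkCut

variable {V : Type} {T T' : LinkCut V}

/-- The left or right child. -/
def child (T : LinkCut V) (b : Bool) (v : V) : Option V := if b then T.right v else T.left v

@[simp] theorem child_false (T : LinkCut V) (v : V) : T.child false v = T.left v := rfl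

@[simp] theorem child_true (T : LinkCut V) (v : V) : T.child true v = T.right v := rfl

theorem isChild_iff {v c : V} : T.IsChild v c ↔ ∃ b, T.child b v = some c := by
  simp [IsChild]

theorem WellFormed.pacyclic (h : T.WellFormed) : PAcyclic T.parent := h.acyclic

theorem WellFormed.parent_child (h : T.WellFormed) {b : Bool} {v c : V} (hc : T.child b v = some c) :
    T.parent c = some v :=
  h.parent_of_child v c (isChild_iff.2 ⟨b, hc⟩)

theorem WellFormed.child_not (h : T.WellFormed) {b : Bool} {v c : V} (hc : T.child b v = some c) :
    T.child (!b) v ≠ some c := by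
  cases b
  · exact h.left_ne_right v c hc
  · exact fun h' => h.left_ne_right v c h' hc

theorem isAuxRoot_of_parent (h : T.WellFormed) {v : V} (hv : T.parent v = none) : T.IsAuxRoot v := by
  intro w hw
  simp [h.parent_of_child w v hw] at hv

theorem inOrder_none {l : List V} : T.InOrder none l ↔ l = [] := by
  constructor
  · intro h; cases h; rfl
  · rintro rfl; exact .nil

theorem inOrder_some {v : V} {l : List V} : T.InOrder (some v) l ↔
    ∃ l₁ l₂, T.InOrder (T.left v) l₁ ∧ T.InOrder (T.right v) l₂ ∧
      l = if T.rev v then (l₁ ++ v :: l₂).reverse else l₁ ++ v :: l₂ := by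
  constructor
  · intro h
    cases h with
    | node v l₁ l₂ h₁ h₂ => exact ⟨l₁, l₂, h₁, h₂, rfl⟩
  · rintro ⟨l₁, l₂, h₁, h₂, rfl⟩
    exact .node v l₁ l₂ h₁ h₂

theorem inOrder_some_of_rev {v : V} {l : List V} (hr : T.rev v = false) : T.InOrder (some v) l ↔
    ∃ l₁ l₂, T.InOrder (T.left v) l₁ ∧ T.InOrder (T.right v) l₂ ∧ l = l₁ ++ v :: l₂ := by
  simp [inOrder_some, hr]

theorem InOrder.unique {o : Option V} {l : List V} (h : T.InOrder o l) :
    ∀ {l'}, T.InOrder o l' → l = l' := by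
  induction h with
  | nil => intro l' h'; cases h'; rfl
  | node v l₁ l₂ _ _ ih₁ ih₂ =>
    intro l' h'
    obtain ⟨l₁', l₂', h₁, h₂, rfl⟩ := inOrder_some.1 h'
    rw [ih₁ h₁, ih₂ h₂]

/-- The recursion goes from a node to its children. It is well-founded because an acyclic parent
relation on a finite set is well-founded in both directions. -/
theorem WellFormed.inOrder_exists [Finite V] (h : T.WellFormed) (o : Option V) :
    ∃ l, T.InOrder o l := by
  have main : ∀ v, ∃ l, T.InOrder (some v) l := by
    intro v
    induction v using h.pacyclic.wf_flip.induction with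
    | h v ih =>
      have aux : ∀ b, ∃ l, T.InOrder (T.child b v) l := by
        intro b
        cases hc : T.child b v with
        | none => exact ⟨[], .nil⟩
        | some c => exact ih c (h.parent_child hc)
      obtain ⟨l₁, h₁⟩ := aux false
      obtain ⟨l₂, h₂⟩ := aux true
      exact ⟨_, .node v l₁ l₂ h₁ h₂⟩
  cases o with
  | none => exact ⟨[], .nil⟩
  | some v => exact main v

/-- `r` is an ancestor of `w` in an auxiliary tree. -/
def AAnc (T : LinkCut V) (w r : V) : Prop := Relation.ReflTransGen (fun c v => T.IsChild v c) w r

theorem AAnc.panc (h : T.WellFormed) {w r : V} (hw : T.AAnc w r) : PAnc T.parent w r :=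
  Relation.ReflTransGen.mono (p := fun c p => T.parent c = some p)
    (fun c v hc => h.parent_of_child v c hc) _ _ hw

theorem WellFormed.isChild_unique (h : T.WellFormed) {u v c : V} (hu : T.IsChild u c)
    (hv : T.IsChild v c) : u = v :=
  Option.some.inj ((h.parent_of_child u c hu).symm.trans (h.parent_of_child v c hv))

theorem IsAuxRoot.eq_of_aanc {r w : V} (hr : T.IsAuxRoot r) (h : T.AAnc r w) : r = w := by
  rcases Relation.ReflTransGen.cases_head h with h₁ | ⟨z, h₁, _⟩
  · exact h₁
  · exact absurd h₁ (hr z)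

theorem WellFormed.auxRoot_unique (h : T.WellFormed) {w r r' : V} (hr : T.IsAuxRoot r)
    (hr' : T.IsAuxRoot r') (hw : T.AAnc w r) (hw' : T.AAnc w r') : r = r' := by
  have hu : Relator.RightUnique fun c v => T.IsChild v c := fun a b c hb hc =>
    h.isChild_unique hb hc
  rcases Relation.ReflTransGen.total_of_right_unique hu hw hw' with h₁ | h₁
  · exact hr.eq_of_aanc h₁
  · exact (hr'.eq_of_aanc h₁).symm

theorem WellFormed.auxRoot_exists (h : T.WellFormed) (w : V) : ∃ r, T.IsAuxRoot r ∧ T.AAnc w r := by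
  induction w using h.acyclic.induction with
  | h w ih =>
    by_cases hw : T.IsAuxRoot w
    · exact ⟨w, hw, .refl⟩
    · simp only [IsAuxRoot, not_forall, not_not] at hw
      obtain ⟨v, hv⟩ := hw
      obtain ⟨r, hr, h'⟩ := ih v (h.parent_of_child v w hv)
      exact ⟨r, hr, .head hv h'⟩

theorem InOrder.mem_iff {o : Option V} {l : List V} (h : T.InOrder o l) :
    ∀ w, w ∈ l ↔ ∃ r, o = some r ∧ T.AAnc w r := by
  induction h with
  | nil => simp
  | node v l₁ l₂ _ _ ih₁ ih₂ =>
    intro w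
    have hmem : w ∈ (if T.rev v then (l₁ ++ v :: l₂).reverse else l₁ ++ v :: l₂) ↔
        w ∈ l₁ ∨ w = v ∨ w ∈ l₂ := by
      (split_ifs <;> simp); tauto
    rw [hmem, ih₁, ih₂]
    constructor
    · rintro (⟨r, hr, h⟩ | rfl | ⟨r, hr, h⟩)
      · exact ⟨v, rfl, .tail h (.inl hr)⟩
      · exact ⟨w, rfl, .refl⟩
      · exact ⟨v, rfl, .tail h (.inr hr)⟩
    · rintro ⟨r, hr, h⟩
      obtain rfl := Option.some.inj hr
      rcases Relation.ReflTransGen.cases_tail h with rfl | ⟨c, h₁, hc | hc⟩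
      · exact .inr (.inl rfl)
      · exact .inl ⟨c, hc, h₁⟩
      · exact .inr (.inr ⟨c, hc, h₁⟩)

/-- A vertex occurring on both sides of `v` would lie below the left and the right child. These
would then be comparable siblings, hence equal, against `left_ne_right`. -/
theorem InOrder.nodup (hw : T.WellFormed) {o : Option V} {l : List V} (h : T.InOrder o l) :
    l.Nodup := by
  induction h with
  | nil => simp
  | node v l₁ l₂ h₁ h₂ ih₁ ih₂ =>
    have key : (l₁ ++ v :: l₂).Nodup := by
      have hroot : ∀ (b : Bool) (c : V), T.child b v = some c → ¬ T.AAnc v c := fun b c hc h =>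
        hw.pacyclic.not_anc_of_parent (hw.parent_child hc) (h.panc hw)
      rw [List.nodup_append, List.nodup_cons]
      refine ⟨ih₁, ⟨?_, ih₂⟩, ?_⟩
      · rw [h₂.mem_iff]
        rintro ⟨c, hc, h⟩
        exact hroot true c hc h
      · rintro a ha b hb rfl
        obtain ⟨c, hc, h⟩ := (h₁.mem_iff a).1 ha
        rcases List.mem_cons.1 hb with rfl | hb
        · exact hroot false c hc h
        · obtain ⟨d, hd, h'⟩ := (h₂.mem_iff a).1 hb
          have pc := hw.parent_child (b := false) hc
          have pd := hw.parent_child (b := true) hd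
          have hcd : c = d := by
            rcases (h.panc hw).total (h'.panc hw) with h₃ | h₃
            · exact hw.pacyclic.sibling pc pd h₃
            · exact (hw.pacyclic.sibling pd pc h₃).symm
          subst hcd
          exact hw.left_ne_right v c hc hd
    split_ifs
    · exact List.nodup_reverse.2 key
    · exact key

/-! ### The path decomposition -/

/-- `l` is a path of the decomposition, and `q` is its path-parent. -/
def Pth (T : LinkCut V) (l : List V) (q : Option V) : Prop :=
  ∃ r, T.IsSolidPath r l ∧ T.parent r = q

theorem forestParent_iff {x y : V} : T.ForestParent x y ↔
    ∃ l q, T.Pth l q ∧ ([y, x] <:+: l ∨ l.head? = some x ∧ q = some y) := by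
  constructor
  · rintro (⟨r, l, h, h'⟩ | ⟨r, l, h, h', h''⟩)
    · exact ⟨l, _, ⟨r, h, rfl⟩, .inl h'⟩
    · exact ⟨l, _, ⟨r, h, rfl⟩, .inr ⟨h', h''⟩⟩
  · rintro ⟨l, q, ⟨r, h, rfl⟩, h' | ⟨h', h''⟩⟩
    · exact .inl ⟨r, l, h, h'⟩
    · exact .inr ⟨r, l, h, h', h''⟩

theorem forest_adj {x y : V} :
    T.forest.Adj x y ↔ x ≠ y ∧ (T.ForestParent x y ∨ T.ForestParent y x) := by
  simp [forest]

theorem forestParent_congr (h : ∀ l q, T'.Pth l q ↔ T.Pth l q) (x y : V) :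
    T'.ForestParent x y ↔ T.ForestParent x y := by
  simp only [forestParent_iff, h]

theorem forest_congr (h : ∀ x y, T'.ForestParent x y ↔ T.ForestParent x y) :
    T'.forest = T.forest := by
  ext x y
  simp only [forest_adj, h]

theorem IsSolidPath.root_mem {r : V} {l : List V} (h : T.IsSolidPath r l) : r ∈ l :=
  (h.2.mem_iff r).2 ⟨r, rfl, .refl⟩

theorem Pth.nodup (hw : T.WellFormed) {l : List V} {q : Option V} (h : T.Pth l q) : l.Nodup := by
  obtain ⟨r, h, -⟩ := h
  exact h.2.nodup hw

theorem WellFormed.solidPath_unique (hw : T.WellFormed) {r r' w : V} {l l' : List V}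
    (h : T.IsSolidPath r l) (h' : T.IsSolidPath r' l') (hl : w ∈ l) (hl' : w ∈ l') :
    r = r' ∧ l = l' := by
  obtain ⟨r₁, e₁, h₁⟩ := (h.2.mem_iff w).1 hl
  obtain ⟨r₂, e₂, h₂⟩ := (h'.2.mem_iff w).1 hl'
  obtain rfl := Option.some.inj e₁
  obtain rfl := Option.some.inj e₂
  obtain rfl := hw.auxRoot_unique h.1 h'.1 h₁ h₂
  exact ⟨rfl, h.2.unique h'.2⟩

theorem WellFormed.pth_unique (hw : T.WellFormed) {w : V} {l l' : List V} {q q' : Option V}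
    (h : T.Pth l q) (h' : T.Pth l' q') (hl : w ∈ l) (hl' : w ∈ l') : l = l' ∧ q = q' := by
  obtain ⟨r, h, rfl⟩ := h
  obtain ⟨r', h', rfl⟩ := h'
  obtain ⟨rfl, rfl⟩ := hw.solidPath_unique h h' hl hl'
  exact ⟨rfl, rfl⟩

theorem WellFormed.solidPath_exists [Finite V] (hw : T.WellFormed) (w : V) :
    ∃ r l, T.IsSolidPath r l ∧ w ∈ l := by
  obtain ⟨r, hr, h⟩ := hw.auxRoot_exists w
  obtain ⟨l, hl⟩ := hw.inOrder_exists (some r)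
  exact ⟨r, l, ⟨hr, hl⟩, (hl.mem_iff w).2 ⟨r, rfl, h⟩⟩

theorem WellFormed.pth_exists [Finite V] (hw : T.WellFormed) (w : V) :
    ∃ l q, T.Pth l q ∧ w ∈ l := by
  obtain ⟨r, l, h, hl⟩ := hw.solidPath_exists w
  exact ⟨l, _, ⟨r, h, rfl⟩, hl⟩

/-- A path can be replaced by the path with the same root. -/
theorem IsAuxRoot.inOrder_of_pth {r : V} (hr : T.IsAuxRoot r) {l : List V}
    {q : Option V} (h : T.Pth l q) (hl : r ∈ l) : T.InOrder (some r) l ∧ T.parent r = q := by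
  obtain ⟨r', h, rfl⟩ := h
  obtain ⟨r₁, e₁, h₁⟩ := (h.2.mem_iff r).1 hl
  obtain rfl := Option.some.inj e₁
  obtain rfl := hr.eq_of_aanc h₁
  exact ⟨h.2, rfl⟩

/-- The tops of paths without path-parent have no parent. -/
theorem WellFormed.not_forestParent_head (hw : T.WellFormed) {x : V} {l : List V}
    (h : T.Pth (x :: l) none) (y : V) : ¬ T.ForestParent x y := by
  rw [forestParent_iff]
  rintro ⟨l', q', h', h''⟩
  have hx : x ∈ l' := by
    rcases h'' with h'' | ⟨h'', -⟩
    · exact h''.subset (by simp)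
    · exact List.mem_of_mem_head? h''
  obtain ⟨rfl, rfl⟩ := hw.pth_unique h h' (by simp) hx
  rcases h'' with ⟨a, b, h''⟩ | ⟨-, h''⟩
  · have hn := h'.nodup hw
    rw [← h''] at hn
    cases a with
    | nil =>
      simp only [List.nil_append, List.cons_append, List.cons.injEq] at h''
      obtain ⟨rfl, rfl⟩ := h''
      simp at hn
    | cons a₁ a =>
      simp only [List.cons_append, List.cons.injEq] at h''
      obtain ⟨rfl, -⟩ := h''
      simp at hn
  · simp at h''

/-- A vertex without parent is the top of its path, which has no path-parent. -/
theorem WellFormed.pth_of_not_forestParent [Finite V] (hw : T.WellFormed) {x : V}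
    (h : ∀ y, ¬ T.ForestParent x y) : ∃ l, T.Pth (x :: l) none := by
  obtain ⟨l, q, hl, hx⟩ := hw.pth_exists x
  obtain ⟨a, b, rfl⟩ := List.append_of_mem hx
  rcases List.eq_nil_or_concat a with rfl | ⟨a, y, rfl⟩
  · cases q with
    | none => exact ⟨b, hl⟩
    | some y => exact absurd (forestParent_iff.2 ⟨_, _, hl, .inr ⟨rfl, rfl⟩⟩) (h y)
  · exact absurd (forestParent_iff.2 ⟨_, _, hl, .inl ⟨a, b, by simp⟩⟩) (h y)

/-! ### Components of the represented forest -/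

theorem adj_of_infix (hw : T.WellFormed) {x y : V} {l : List V} {q : Option V} (h : T.Pth l q)
    (hl : [y, x] <:+: l) : T.forest.Adj x y := by
  refine forest_adj.2 ⟨?_, .inl (forestParent_iff.2 ⟨l, q, h, .inl hl⟩)⟩
  rintro rfl
  have := hl.sublist.nodup (h.nodup hw)
  simp at this

theorem reachable_of_pth (hw : T.WellFormed) {l : List V} {q : Option V} (h : T.Pth l q) {x y : V}
    (hx : x ∈ l) (hy : y ∈ l) : T.forest.Reachable x y := by
  have key : ∀ (t : List V) (a : V), a :: t <:+: l → ∀ b ∈ a :: t, T.forest.Reachable a b := by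
    intro t
    induction t with
    | nil => intro a _ b hb; simp at hb; subst hb; rfl
    | cons c t ih =>
      intro a ha b hb
      rcases List.mem_cons.1 hb with rfl | hb
      · rfl
      · have h₁ : [a, c] <:+: l := List.IsInfix.trans ⟨[], t, by simp⟩ ha
        have h₂ : c :: t <:+: l := List.IsInfix.trans ⟨[a], [], by simp⟩ ha
        exact (adj_of_infix hw h h₁).symm.reachable.trans (ih c h₂ b hb)
  cases l with
  | nil => simp at hx
  | cons a t => exact (key t a List.infix_rfl x hx).symm.trans (key t a List.infix_rfl y hy)

/-- A parent pointer either stays inside an auxiliary tree, whose nodes form one path, or is a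
path-parent pointer, which stands for an edge at the top of the path. Both cases remain in one
component. -/
theorem WellFormed.reachable_parent [Finite V] (hw : T.WellFormed) {c p : V}
    (h : T.parent c = some p) : T.forest.Reachable c p := by
  obtain ⟨r, l, hl, hc⟩ := hw.solidPath_exists c
  by_cases hr : T.IsAuxRoot c
  · obtain ⟨h₁, h₂⟩ := hr.inOrder_of_pth ⟨r, hl, rfl⟩ hc
    have hp : T.Pth l (some p) := ⟨c, ⟨hr, h₁⟩, h⟩
    obtain ⟨a, t, rfl⟩ : ∃ a t, l = a :: t := by
      cases l with
      | nil => simp at hc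
      | cons a t => exact ⟨a, t, rfl⟩
    refine (reachable_of_pth hw hp hc (List.mem_cons_self)).trans ?_
    by_cases hap : a = p
    · rw [hap]
    · exact (forest_adj.2 ⟨hap, .inl (forestParent_iff.2 ⟨_, _, hp, .inr ⟨rfl, rfl⟩⟩)⟩ :
        T.forest.Adj a p).reachable
  · simp only [IsAuxRoot, not_forall, not_not] at hr
    obtain ⟨v, hv⟩ := hr
    obtain rfl := Option.some.inj ((hw.parent_of_child v c hv).symm.trans h)
    obtain ⟨r₁, e₁, h₁⟩ := (hl.2.mem_iff c).1 hc
    have hcv : v ∈ l := by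
      rcases Relation.ReflTransGen.cases_head h₁ with rfl | ⟨z, h₂, h₃⟩
      · exact absurd hv ((Option.some.inj e₁ ▸ hl.1) v)
      · exact (hl.2.mem_iff v).2 ⟨r₁, e₁, hw.isChild_unique h₂ hv ▸ h₃⟩
    exact reachable_of_pth hw ⟨r, hl, rfl⟩ hc hcv

theorem WellFormed.reachable_of_panc [Finite V] (hw : T.WellFormed) {c p : V}
    (h : PAnc T.parent c p) : T.forest.Reachable c p := by
  induction h with
  | refl => rfl
  | tail _ h ih => exact ih.trans (hw.reachable_parent h)

/-- Converse of `WellFormed.reachable_parent`: adjacent vertices of the forest have a common virtual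
ancestor. Hence components correspond to virtual roots, and connectivity can be tested by comparing
roots. -/
theorem WellFormed.panc_of_adj (hw : T.WellFormed) {a b r : V} (h : T.forest.Adj a b)
    (hr : T.parent r = none) (ha : PAnc T.parent a r) : PAnc T.parent b r := by
  have key : ∀ x y, T.ForestParent x y → ∃ r', PAnc T.parent x r' ∧ PAnc T.parent y r' := by
    rintro x y (⟨r', l, h, h'⟩ | ⟨r', l, h, h', h''⟩)
    · obtain ⟨_, e₁, h₁⟩ := (h.2.mem_iff x).1 (h'.subset (by simp))
      obtain ⟨_, e₂, h₂⟩ := (h.2.mem_iff y).1 (h'.subset (by simp))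
      cases e₁
      cases e₂
      exact ⟨r', h₁.panc hw, h₂.panc hw⟩
    · obtain ⟨_, e₁, h₁⟩ := (h.2.mem_iff x).1 (List.mem_of_mem_head? h')
      cases e₁
      exact ⟨y, (h₁.panc hw).trans (.of_parent h''), .refl y⟩
  obtain ⟨r', h₁, h₂⟩ : ∃ r', PAnc T.parent a r' ∧ PAnc T.parent b r' := by
    rcases (forest_adj.1 h).2 with h | h
    · exact key a b h
    · exact (key b a h).imp fun _ h => h.symm
  exact h₂.trans (h₁.to_root ha hr)

theorem WellFormed.panc_of_reachable (hw : T.WellFormed) {a b r : V} (h : T.forest.Reachable a b)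
    (hr : T.parent r = none) (ha : PAnc T.parent a r) : PAnc T.parent b r := by
  obtain ⟨w⟩ := h
  induction w with
  | nil => exact ha
  | cons h _ ih => exact ih (hw.panc_of_adj h hr ha)

theorem WellFormed.not_reachable_of_roots (hw : T.WellFormed) {a b : V} (ha : T.parent a = none)
    (hb : T.parent b = none) (hab : a ≠ b) : ¬ T.forest.Reachable a b := fun h =>
  hab ((hw.panc_of_reachable h ha (.refl a)).eq_of_root hb).symm

/-- A criterion for two structures to have the same path decomposition. -/
theorem pth_congr [Finite V] (hw : T.WellFormed) (ρ : V → V)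
    (hρ : ∀ r, T.IsAuxRoot r → T'.IsAuxRoot (ρ r) ∧ T'.parent (ρ r) = T.parent r ∧
      ∀ l, T.InOrder (some r) l → T'.InOrder (some (ρ r)) l)
    (hρ' : ∀ r, T'.IsAuxRoot r → ∃ r₀, T.IsAuxRoot r₀ ∧ ρ r₀ = r) (l : List V) (q : Option V) :
    T'.Pth l q ↔ T.Pth l q := by
  constructor
  · rintro ⟨r', ⟨h₁, h₂⟩, h₃⟩
    obtain ⟨r, hr, rfl⟩ := hρ' r' h₁
    obtain ⟨l₀, hl₀⟩ := hw.inOrder_exists (some r)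
    obtain ⟨-, h₄, h₅⟩ := hρ r hr
    obtain rfl := (h₅ l₀ hl₀).unique h₂
    exact ⟨r, ⟨hr, hl₀⟩, h₄ ▸ h₃⟩
  · rintro ⟨r, ⟨h₁, h₂⟩, h₃⟩
    obtain ⟨h₄, h₅, h₆⟩ := hρ r h₁
    exact ⟨ρ r, ⟨h₄, h₆ l h₂⟩, h₅.trans h₃⟩

end LinkCut

namespace LinkCut

variable {V : Type} {T T' T'' : LinkCut V}

/-! ### Changes that keep the path decomposition -/

/-- `T'` arises from `T` by restructuring auxiliary trees at virtual ancestors of `x`: the path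
decomposition is kept, and so are the records of those roots of auxiliary trees that are no virtual
ancestors of `x`. -/
structure Restructures (x : V) (T T' : LinkCut V) : Prop where
  wf : T'.WellFormed
  pth : ∀ l q, T'.Pth l q ↔ T.Pth l q
  anc : ∀ z, PAnc T'.parent x z → PAnc T.parent x z
  frame : ∀ w, T.IsAuxRoot w → ¬ PAnc T.parent x w → T'.IsAuxRoot w ∧
    T'.parent w = T.parent w ∧ T'.left w = T.left w ∧ T'.right w = T.right w ∧ T'.rev w = T.rev w

theorem Restructures.refl (hw : T.WellFormed) (x : V) : Restructures x T T :=
  ⟨hw, fun _ _ => .rfl, fun _ h => h, fun _ h _ => ⟨h, rfl, rfl, rfl, rfl⟩⟩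

theorem Restructures.trans {x : V} (h : Restructures x T T') (h' : Restructures x T' T'') :
    Restructures x T T'' where
  wf := h'.wf
  pth l q := (h'.pth l q).trans (h.pth l q)
  anc z hz := h.anc z (h'.anc z hz)
  frame w hr ha := by
    obtain ⟨h₁, h₂, h₃, h₄, h₅⟩ := h.frame w hr ha
    obtain ⟨g₁, g₂, g₃, g₄, g₅⟩ := h'.frame w h₁ fun hz => ha (h.anc w hz)
    exact ⟨g₁, g₂.trans h₂, g₃.trans h₃, g₄.trans h₄, g₅.trans h₅⟩

theorem Restructures.forestParent {x : V} (h : Restructures x T T') (a b : V) :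
    T'.ForestParent a b ↔ T.ForestParent a b := forestParent_congr h.pth a b

theorem Restructures.forest {x : V} (h : Restructures x T T') : T'.forest = T.forest :=
  forest_congr h.forestParent

variable [DecidableEq V]

/-! ### Resolving a reversal bit -/

/-- Carry out the reversal at `v` that is noted there, passing it on to the children. -/
def push (T : LinkCut V) (v : V) : LinkCut V :=
  if T.rev v then
    { parent := T.parent
      left := Function.update T.left v (T.right v)
      right := Function.update T.right v (T.left v)
      rev := fun w => if w = v then false else
        if T.left v = some w ∨ T.right v = some w then !T.rev w else T.rev w }
  else T

@[simp] theorem push_parent (T : LinkCut V) (v : V) : (T.push v).parent = T.parent := by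
  unfold push; split_ifs <;> rfl

@[simp] theorem push_rev_self (T : LinkCut V) (v : V) : (T.push v).rev v = false := by
  unfold push
  split_ifs with h
  · simp
  · simpa using h

theorem push_of_not_rev {v : V} (h : T.rev v = false) : T.push v = T := by simp [push, h]

theorem push_left_of_ne {v w : V} (h : w ≠ v) : (T.push v).left w = T.left w := by
  unfold push; split_ifs <;> simp [h]

theorem push_right_of_ne {v w : V} (h : w ≠ v) : (T.push v).right w = T.right w := by
  unfold push; split_ifs <;> simp [h]

theorem push_child_of_ne {v w : V} (h : w ≠ v) (b : Bool) :
    (T.push v).child b w = T.child b w := by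
  cases b
  · exact push_left_of_ne h
  · exact push_right_of_ne h

theorem push_rev_of_ne {v w : V} (h : w ≠ v) (h' : ¬ T.IsChild v w) :
    (T.push v).rev w = T.rev w := by
  unfold push
  split_ifs
  · simp only [IsChild] at h'
    simp [h, h']
  · rfl

theorem push_isChild {v a c : V} : (T.push v).IsChild a c ↔ T.IsChild a c := by
  unfold push IsChild
  split_ifs
  · by_cases h : a = v
    · subst h; simp [or_comm]
    · simp [h]
  · rfl

theorem push_isAuxRoot {v r : V} : (T.push v).IsAuxRoot r ↔ T.IsAuxRoot r := by
  simp [IsAuxRoot, push_isChild]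

theorem WellFormed.push (h : T.WellFormed) (v : V) : (T.push v).WellFormed where
  parent_of_child a c hc := by
    rw [push_parent]
    exact h.parent_of_child a c (push_isChild.1 hc)
  left_ne_right a c hl hr := by
    by_cases ha : a = v
    · subst ha
      unfold LinkCut.push at hl hr
      split_ifs at hl hr
      · simp only [Function.update_self] at hl hr
        exact h.left_ne_right _ _ hr hl
      · exact h.left_ne_right _ _ hl hr
    · rw [push_left_of_ne ha] at hl
      rw [push_right_of_ne ha] at hr
      exact h.left_ne_right _ _ hl hr
  acyclic := by simpa using h.acyclic

-- Resolving the bit at `v` reverses `v` itself explicitly and toggles the bits of its children, so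
-- only the subtrees hanging directly below `v` change their sequences, namely to the reversed ones.
-- At `v` the two reversals of the children and the exchange of sides reproduce the old reading.
open Classical in
theorem InOrder.push (hw : T.WellFormed) {v : V} (hr : T.rev v = true) {o : Option V} {l : List V}
    (h : T.InOrder o l) :
    (T.push v).InOrder o (if ∃ c, o = some c ∧ T.IsChild v c then l.reverse else l) := by
  induction h with
  | nil => simpa using InOrder.nil
  | node w l₁ l₂ h₁ h₂ ih₁ ih₂ =>
    by_cases hwv : w = v
    · subst hwv
      have hn : ¬ ∃ c, some w = some c ∧ T.IsChild w c := by
        rintro ⟨c, hc, h⟩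
        cases hc
        exact hw.pacyclic.ne_of_parent (hw.parent_of_child _ _ h) rfl
      have e₁ : (T.push w).InOrder (T.left w) l₁.reverse := by
        cases hl : T.left w with
        | none => rw [hl] at h₁; cases h₁; exact .nil
        | some c => rw [hl] at ih₁; rwa [if_pos ⟨c, rfl, .inl hl⟩] at ih₁
      have e₂ : (T.push w).InOrder (T.right w) l₂.reverse := by
        cases hl : T.right w with
        | none => rw [hl] at h₂; cases h₂; exact .nil
        | some c => rw [hl] at ih₂; rwa [if_pos ⟨c, rfl, .inr hl⟩] at ih₂
      rw [if_neg hn, if_pos hr, inOrder_some_of_rev (push_rev_self T w)]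
      refine ⟨l₂.reverse, l₁.reverse, ?_, ?_, by simp⟩
      · simpa [LinkCut.push, hr] using e₂
      · simpa [LinkCut.push, hr] using e₁
    · have hne : ∀ b, ¬ ∃ c, T.child b w = some c ∧ T.IsChild v c := by
        rintro b ⟨c, hc, h⟩
        exact hwv (hw.isChild_unique (isChild_iff.2 ⟨b, hc⟩) h)
      have n₁ : ¬ ∃ c, T.left w = some c ∧ T.IsChild v c := hne false
      have n₂ : ¬ ∃ c, T.right w = some c ∧ T.IsChild v c := hne true
      rw [if_neg n₁, ← push_left_of_ne hwv] at ih₁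
      rw [if_neg n₂, ← push_right_of_ne hwv] at ih₂
      have h := InOrder.node w l₁ l₂ ih₁ ih₂
      by_cases hc : T.IsChild v w
      · rw [if_pos ⟨w, rfl, hc⟩]
        have hrev : (T.push v).rev w = !T.rev w := by
          simp only [IsChild] at hc
          simp [LinkCut.push, hr, hwv, hc]
        rw [hrev] at h
        cases hrw : T.rev w <;> simpa [hrw] using h
      · rw [if_neg (by rintro ⟨c, h, h'⟩; cases h; exact hc h')]
        rwa [push_rev_of_ne hwv hc] at h

theorem Restructures.push [Finite V] (hw : T.WellFormed) {x v : V} (hv : PAnc T.parent x v) :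
    Restructures x T (T.push v) := by
  cases hr : T.rev v with
  | false => rw [push_of_not_rev hr]; exact .refl hw x
  | true =>
    refine ⟨hw.push v, pth_congr hw id ?_ ?_, ?_, ?_⟩
    · intro r h
      refine ⟨push_isAuxRoot.2 h, by simp, fun l hl => ?_⟩
      have := hl.push hw hr
      rwa [if_neg] at this
      rintro ⟨c, hc, h'⟩
      cases hc
      exact h v h'
    · exact fun r h => ⟨r, push_isAuxRoot.1 h, rfl⟩
    · simp
    · intro w h h'
      have hne : w ≠ v := by rintro rfl; exact h' hv
      exact ⟨push_isAuxRoot.2 h, by simp, push_left_of_ne hne, push_right_of_ne hne,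
        push_rev_of_ne hne (h v)⟩

/-! ### Rotations -/

/-- Rotate `x`, the child of `p` at the side `b`, over `p`. -/
def rotate (T : LinkCut V) (b : Bool) (x p : V) : LinkCut V where
  parent w := if w = x then T.parent p else if w = p then some x else
    if T.child (!b) x = some w then some p else T.parent w
  left w := if w = p then (if b then T.left p else T.right x) else
    if w = x then (if b then some p else T.left x) else
    if T.left w = some p then some x else T.left w
  right w := if w = p then (if b then T.left x else T.right p) else
    if w = x then (if b then T.right x else some p) else
    if T.right w = some p then some x else T.right w
  rev := T.rev

theorem rotate_child (T : LinkCut V) (b c : Bool) (x p w : V) :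
    (T.rotate b x p).child c w =
      if w = p then (if c = b then T.child (!b) x else T.child c p) else
      if w = x then (if c = b then T.child b x else some p) else
      if T.child c w = some p then some x else T.child c w := by
  cases b <;> cases c <;> simp [child, rotate]

/-- The situation of a rotation. -/
structure RotCtx (T : LinkCut V) (b : Bool) (x p : V) : Prop where
  wf : T.WellFormed
  hx : T.child b p = some x


namespace RotCtx

variable {b : Bool} {x p : V} (h : RotCtx T b x p)
include h

theorem parent_x : T.parent x = some p := h.wf.parent_child h.hx

theorem ne : x ≠ p := h.wf.pacyclic.ne_of_parent h.parent_x

theorem anc_p : PAnc T.parent x p := .of_parent h.parent_x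

theorem parent_p_ne_x : T.parent p ≠ some x := fun h' =>
  h.wf.pacyclic.not_anc_of_parent h.parent_x (.of_parent h')

theorem parent_p_ne_p : T.parent p ≠ some p := fun h' => h.wf.pacyclic.ne_of_parent h' rfl

theorem parent_child_x {c : Bool} {w : V} (hc : T.child c x = some w) : T.parent w = some x :=
  h.wf.parent_child hc

theorem child_x_ne {c : Bool} : T.child c x ≠ some x := fun h' =>
  h.wf.pacyclic.ne_of_parent (h.wf.parent_child h') rfl

theorem child_x_ne_p {c : Bool} : T.child c x ≠ some p := fun h' =>
  h.parent_p_ne_x (h.wf.parent_child h')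

theorem child_p_ne {c : Bool} : T.child c p ≠ some p := fun h' =>
  h.wf.pacyclic.ne_of_parent (h.wf.parent_child h') rfl

theorem child_ne_x {c : Bool} {w : V} (hw : w ≠ p) : T.child c w ≠ some x := fun h' =>
  hw (Option.some.inj ((h.wf.parent_child h').symm.trans h.parent_x))

/-- The rotated subtree has `x` in the place of `p` and the same sequence. The old subtree of `x`
has no counterpart after the rotation, so for it only the sequences of its two parts are recorded;
they are regrouped when the induction reaches `p`. -/
theorem inOrder (hp : T.rev p = false) (hrx : T.rev x = false) {o : Option V} {l : List V}
    (hl : T.InOrder o l) :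
    (o ≠ some x → (T.rotate b x p).InOrder (o.map fun w => if w = p then x else w) l) ∧
      (o = some x → ∃ l₁ l₂, l = l₁ ++ x :: l₂ ∧ (T.rotate b x p).InOrder (T.left x) l₁ ∧
        (T.rotate b x p).InOrder (T.right x) l₂) := by
  have hchild : ∀ c w, w ≠ p → w ≠ x →
      (T.rotate b x p).child c w = (T.child c w).map fun w => if w = p then x else w := by
    intro c w h₁ h₂
    rw [rotate_child, if_neg h₁, if_neg h₂]
    cases hc : T.child c w with
    | none => simp
    | some d => by_cases hd : d = p <;> simp [hd]
  have hid : ∀ o : Option V, o ≠ some p → (o.map fun w => if w = p then x else w) = o := by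
    intro o ho
    cases o with
    | none => rfl
    | some d => simp only [ne_eq, Option.some.injEq] at ho; simp [ho]
  induction hl with
  | nil => exact ⟨fun _ => .nil, by simp⟩
  | node w l₁ l₂ h₁ h₂ ih₁ ih₂ =>
    constructor
    · intro hwx
      have hwx : w ≠ x := fun h => hwx (by rw [h])
      by_cases hwp : w = p
      · subst hwp
        have hx := h.hx
        have c₁ := rotate_child T b false x w w
        have c₂ := rotate_child T b true x w w
        have c₃ := rotate_child T b false x w x
        have c₄ := rotate_child T b true x w x
        have n₁ := h.child_p_ne (c := false)
        have n₂ := h.child_p_ne (c := true)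
        simp only [if_neg h.ne, if_true] at c₁ c₂ c₃ c₄
        simp only [Option.map_some, if_true, if_neg (by simp [hp] : ¬ T.rev w = true)]
        rw [inOrder_some_of_rev (by exact hrx)]
        cases b with
        | false =>
          simp only [child_false, child_true, Bool.not_false, reduceCtorEq, if_true, if_false]
            at hx c₁ c₂ c₃ c₄ n₁ n₂
          obtain ⟨l₃, l₄, rfl, h₃, h₄⟩ := ih₁.2 hx
          have h₅ := ih₂.1 (fun h' => h.wf.left_ne_right _ _ hx h')
          rw [hid _ n₂] at h₅
          refine ⟨l₃, l₄ ++ w :: l₂, by rwa [c₃], ?_, by simp⟩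
          rw [c₄, inOrder_some_of_rev (by exact hp)]
          exact ⟨l₄, l₂, by rwa [c₁], by rwa [c₂], rfl⟩
        | true =>
          simp only [child_false, child_true, Bool.not_true, reduceCtorEq, if_true, if_false]
            at hx c₁ c₂ c₃ c₄ n₁ n₂
          obtain ⟨l₃, l₄, rfl, h₃, h₄⟩ := ih₂.2 hx
          have h₅ := ih₁.1 (fun h' => h.wf.left_ne_right _ _ h' hx)
          rw [hid _ n₁] at h₅
          refine ⟨l₁ ++ w :: l₃, l₄, ?_, by rwa [c₄], by simp⟩
          rw [c₃, inOrder_some_of_rev (by exact hp)]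
          exact ⟨l₁, l₃, by rwa [c₁], by rwa [c₂], rfl⟩
      · have e₁ := ih₁.1 (h.child_ne_x (c := false) hwp)
        have e₂ := ih₂.1 (h.child_ne_x (c := true) hwp)
        have c₁ := hchild false w hwp hwx
        have c₂ := hchild true w hwp hwx
        rw [← child_false, ← c₁] at e₁
        rw [← child_true, ← c₂] at e₂
        simp only [Option.map_some, if_neg hwp]
        exact .node w l₁ l₂ e₁ e₂
    · intro hwx
      obtain rfl := Option.some.inj hwx
      have e₁ := ih₁.1 (h.child_x_ne (c := false))
      have e₂ := ih₂.1 (h.child_x_ne (c := true))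
      have d₁ := hid _ (h.child_x_ne_p (c := false))
      have d₂ := hid _ (h.child_x_ne_p (c := true))
      simp only [child_false, child_true] at d₁ d₂
      rw [d₁] at e₁
      rw [d₂] at e₂
      exact ⟨l₁, l₂, by simp [hrx], e₁, e₂⟩

theorem wf_rotate : (T.rotate b x p).WellFormed where
  parent_of_child := by
    intro a c h'
    obtain ⟨d, hc⟩ := isChild_iff.1 h'
    clear h'
    rw [rotate_child] at hc
    change (if c = x then T.parent p else if c = p then some x else
      if T.child (!b) x = some c then some p else T.parent c) = some a
    by_cases hap : a = p
    · subst hap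
      rw [if_pos rfl] at hc
      by_cases hd : d = b
      · rw [if_pos hd] at hc
        have h₁ : c ≠ x := by rintro rfl; exact h.child_x_ne hc
        have h₂ : c ≠ a := by rintro rfl; exact h.child_x_ne_p hc
        simp [h₁, h₂, hc]
      · rw [if_neg hd] at hc
        have hd : d = !b := by cases d <;> cases b <;> simp_all
        subst hd
        have h₁ : c ≠ x := by rintro rfl; exact h.wf.child_not h.hx hc
        have h₂ : c ≠ a := by rintro rfl; exact h.child_p_ne hc
        have hp := h.wf.parent_child hc
        have h₃ : T.child (!b) x ≠ some c := fun h' =>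
          h.ne (Option.some.inj ((h.parent_child_x h').symm.trans hp))
        simp [h₁, h₂, h₃, hp]
    · rw [if_neg hap] at hc
      by_cases hax : a = x
      · subst hax
        rw [if_pos rfl] at hc
        by_cases hd : d = b
        · rw [if_pos hd] at hc
          have h₁ : c ≠ a := by rintro rfl; exact h.child_x_ne hc
          have h₂ : c ≠ p := by rintro rfl; exact h.child_x_ne_p hc
          have h₃ : T.child (!b) a ≠ some c := h.wf.child_not hc
          simp [h₁, h₂, h₃, h.parent_child_x hc]
        · rw [if_neg hd] at hc
          obtain rfl := Option.some.inj hc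
          simp [h.ne.symm]
      · rw [if_neg hax] at hc
        by_cases hcp : T.child d a = some p
        · rw [if_pos hcp] at hc
          obtain rfl := Option.some.inj hc
          simp [h.wf.parent_child hcp]
        · rw [if_neg hcp] at hc
          have h₁ : c ≠ x := by rintro rfl; exact h.child_ne_x hap hc
          have h₂ : c ≠ p := by rintro rfl; exact hcp hc
          have hp := h.wf.parent_child hc
          have h₃ : T.child (!b) x ≠ some c := fun h' =>
            hax (Option.some.inj (hp.symm.trans (h.parent_child_x h')))
          simp [h₁, h₂, h₃, hp]
  left_ne_right := by
    intro a c hl hr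
    rw [← child_false, rotate_child] at hl
    rw [← child_true, rotate_child] at hr
    by_cases hap : a = p
    · subst hap
      rw [if_pos rfl] at hl hr
      have key : ∀ d, T.child d a = some c → T.child (!b) x ≠ some c := fun d h₁ h₂ =>
        h.ne (Option.some.inj ((h.parent_child_x h₂).symm.trans (h.wf.parent_child h₁)))
      cases b <;> simp only [reduceCtorEq, if_true, if_false] at hl hr
      · exact key _ hr hl
      · exact key _ hl hr
    · rw [if_neg hap] at hl hr
      by_cases hax : a = x
      · subst hax
        rw [if_pos rfl] at hl hr
        cases b <;> simp only [reduceCtorEq, if_true, if_false] at hl hr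
        · cases hr; exact h.child_x_ne_p hl
        · cases hl; exact h.child_x_ne_p hr
      · rw [if_neg hax] at hl hr
        have n : ∀ d, T.child d a ≠ some x := fun d => h.child_ne_x hap
        split_ifs at hl hr with h₁ h₂ h₂
        · exact h.wf.left_ne_right _ _ h₁ h₂
        · cases hl; exact n _ hr
        · cases hr; exact n _ hl
        · exact h.wf.left_ne_right _ _ hl hr
  acyclic := by
    have key : ∀ w, Acc (fun p' c => (T.rotate b x p).parent c = some p') w := by
      intro w
      have hwf := h.wf.pacyclic
      -- The induction hypothesis is needed for all proper ancestors, since the new parent of `x` is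
      -- its old grandparent.
      induction w using (WellFounded.transGen hwf).induction with
      | h w ih =>
        have acc_x : (w = x ∨ Relation.TransGen (fun p c => T.parent c = some p) x w) →
            Acc (fun p' c => (T.rotate b x p).parent c = some p') x := by
          intro hx
          refine ⟨_, fun g hg => ih g ?_⟩
          have hg : T.parent p = some g := by simpa [rotate] using hg
          have : Relation.TransGen (fun p c => T.parent c = some p) g x :=
            .tail (.single hg) h.parent_x
          rcases hx with rfl | hx
          · exact this
          · exact this.trans hx
        by_cases hx : w = x
        · subst hx; exact acc_x (.inl rfl)
        · refine ⟨_, fun g hg => ?_⟩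
          simp only [rotate, if_neg hx] at hg
          split_ifs at hg with h₁ h₂
          · obtain rfl := Option.some.inj hg
            subst h₁
            -- `x` lies below `p`, but its new parent lies above `p`
            refine ⟨_, fun g hg => ih g (.single ?_)⟩
            simpa [rotate] using hg
          · obtain rfl := Option.some.inj hg
            exact ih _ (.tail (.single h.parent_x) (h.parent_child_x h₂))
          · exact ih g (.single hg)
    exact ⟨key⟩

theorem isAuxRoot_rotate (hr : T.IsAuxRoot p) : (T.rotate b x p).IsAuxRoot x := by
  intro a ha
  obtain ⟨d, hd⟩ := isChild_iff.1 ha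
  rw [rotate_child] at hd
  split_ifs at hd with h₁ h₂ h₃ h₄ h₅
  · exact h.child_x_ne hd
  · have : d = !b := by cases d <;> cases b <;> simp_all
    subst this
    exact h.wf.child_not h.hx hd
  · exact h.child_x_ne hd
  · exact h.ne (Option.some.inj hd).symm
  · exact hr a (isChild_iff.2 ⟨d, h₅⟩)
  · exact h.child_ne_x h₁ hd

/-- If `p` was an auxiliary root, `x` takes over this role together with the outgoing pointer, so
auxiliary roots correspond under `p ↦ x`. Every new pointer on an ascent from `y` leads to a vertex
that was already an ancestor of `y`. -/
theorem restructures [Finite V] {y : V} (hy : PAnc T.parent y x) (hp : T.rev p = false)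
    (hrx : T.rev x = false) : Restructures y T (T.rotate b x p) := by
  have hroot : ∀ r, T.IsAuxRoot r → r ≠ x := by
    rintro r hr rfl
    exact hr p (isChild_iff.2 ⟨b, h.hx⟩)
  have hβ : ∀ r, T.IsAuxRoot r → T.child (!b) x ≠ some r := fun r hr h' =>
    hr x (isChild_iff.2 ⟨_, h'⟩)
  have hisroot : ∀ r, T.IsAuxRoot r → r ≠ p → (T.rotate b x p).IsAuxRoot r := by
    intro r hr hrp a ha
    have h' := h.wf_rotate.parent_of_child a r ha
    obtain ⟨d, hd⟩ := isChild_iff.1 ha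
    have hr' : ∀ d a, T.child d a ≠ some r := fun d a h' => hr a (isChild_iff.2 ⟨d, h'⟩)
    rw [rotate_child] at hd
    split_ifs at hd
    · exact hr' _ _ hd
    · exact hr' _ _ hd
    · exact hr' _ _ hd
    · exact hrp (Option.some.inj hd).symm
    · exact hroot r hr (Option.some.inj hd).symm
    · exact hr' _ _ hd
  refine ⟨h.wf_rotate, pth_congr h.wf (fun w => if w = p then x else w) ?_ ?_, ?_, ?_⟩
  · intro r hr
    refine ⟨?_, ?_, fun l hl => (h.inOrder hp hrx hl).1 (by simpa using hroot r hr)⟩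
    · by_cases hrp : r = p
      · subst hrp
        simp only [if_true]
        exact h.isAuxRoot_rotate hr
      · simp only [if_neg hrp]
        exact hisroot r hr hrp
    · by_cases hrp : r = p
      · simp [hrp, rotate]
      · simp [hrp, rotate, hroot r hr, hβ r hr]
  · intro r hr
    by_cases hrx : r = x
    · subst hrx
      refine ⟨p, fun a ha => ?_, by simp⟩
      have hap : a ≠ p := by
        rintro rfl
        exact h.wf.pacyclic.ne_of_parent (h.wf.parent_of_child _ _ ha) rfl
      have hax : a ≠ r := by
        rintro rfl
        exact h.parent_p_ne_x (h.wf.parent_of_child _ _ ha)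
      obtain ⟨d, hd⟩ := isChild_iff.1 ha
      exact hr a (isChild_iff.2 ⟨d, by rw [rotate_child]; simp [hap, hax, hd]⟩)
    · have hrp : r ≠ p := by
        rintro rfl
        exact hr x (isChild_iff.2 ⟨!b, by rw [rotate_child]; cases b <;> simp [h.ne]⟩)
      refine ⟨r, fun a ha => ?_, by simp [hrp]⟩
      obtain ⟨d, hd⟩ := isChild_iff.1 ha
      by_cases hap : a = p
      · subst hap
        by_cases hdb : d = b
        · subst hdb
          exact hrx (Option.some.inj (hd.symm.trans h.hx))
        · exact hr a (isChild_iff.2 ⟨d, by rw [rotate_child]; simp [hdb, hd]⟩)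
      · by_cases hax : a = x
        · subst hax
          by_cases hdb : d = b
          · subst hdb
            exact hr a (isChild_iff.2 ⟨d, by rw [rotate_child]; simp [hap, hd]⟩)
          · have : d = !b := by cases d <;> cases b <;> simp_all
            subst this
            exact hr p (isChild_iff.2 ⟨b, by rw [rotate_child]; simp [hd]⟩)
        · refine hr a (isChild_iff.2 ⟨d, ?_⟩)
          rw [rotate_child]
          simp [hap, hax, hd, hrp]
  · have hstep : ∀ z w, PAnc T.parent y z → (T.rotate b x p).parent z = some w →
        PAnc T.parent y w := by
      intro z w hz hw
      simp only [rotate] at hw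
      split_ifs at hw with h₁ h₂ h₃
      · exact (hy.trans h.anc_p).trans (.of_parent hw)
      · obtain rfl := Option.some.inj hw
        exact hy
      · obtain rfl := Option.some.inj hw
        exact hy.trans h.anc_p
      · exact hz.trans (.of_parent hw)
    intro z hz
    induction hz with
    | refl => exact .refl y
    | tail _ h' ih => exact hstep _ _ ih h'
  · intro w hw ha
    have hwx : w ≠ x := by rintro rfl; exact ha hy
    have hwp : w ≠ p := by rintro rfl; exact ha (hy.trans h.anc_p)
    have hc : ∀ d, T.child d w ≠ some p := fun d h' =>
      ha ((hy.trans h.anc_p).trans (.of_parent (h.wf.parent_child h')))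
    refine ⟨hisroot w hw hwp, by simp [rotate, hwx, hwp, hβ w hw], ?_, ?_, rfl⟩
    · have := hc false
      simp only [child_false] at this
      simp [rotate, hwp, hwx, this]
    · have := hc true
      simp only [child_true] at this
      simp [rotate, hwp, hwx, this]

end RotCtx

end LinkCut

/-! ### Transfer of node sequences and elementary pointer assignments -/

namespace LinkCut

variable {V : Type} {T T' T'' : LinkCut V}

theorem InOrder.congr {o : Option V} {l : List V} (h : T.InOrder o l)
    (hl : ∀ w ∈ l, T'.left w = T.left w ∧ T'.right w = T.right w ∧ T'.rev w = T.rev w) :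
    T'.InOrder o l := by
  induction h with
  | nil => exact .nil
  | node v l₁ l₂ _ _ ih₁ ih₂ =>
    have hmem : ∀ w, w ∈ (if T.rev v then (l₁ ++ v :: l₂).reverse else l₁ ++ v :: l₂) ↔
        w ∈ l₁ ∨ w = v ∨ w ∈ l₂ := by
      intro w
      (split_ifs <;> simp); tauto
    obtain ⟨e₁, e₂, e₃⟩ := hl v ((hmem v).2 (.inr (.inl rfl)))
    rw [← e₃]
    refine .node v l₁ l₂ ?_ ?_
    · rw [e₁]; exact ih₁ fun w hw => hl w ((hmem w).2 (.inl hw))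
    · rw [e₂]; exact ih₂ fun w hw => hl w ((hmem w).2 (.inr (.inr hw)))

theorem InOrder.root_unique {r u : V} {l : List V} (h : T.InOrder (some r) l)
    (hu : T.IsAuxRoot u) (hl : u ∈ l) : u = r := by
  obtain ⟨_, e, h'⟩ := (h.mem_iff u).1 hl
  cases e
  exact hu.eq_of_aanc h'

variable [DecidableEq V]

/-- Assign a parent pointer. -/
def setParent (T : LinkCut V) (v : V) (o : Option V) : LinkCut V :=
  { T with parent := Function.update T.parent v o }

/-- Assign the pointer to a left child. -/
def setLeft (T : LinkCut V) (v : V) (o : Option V) : LinkCut V :=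
  { T with left := Function.update T.left v o }

/-- Assign the pointer to a right child. -/
def setRight (T : LinkCut V) (v : V) (o : Option V) : LinkCut V :=
  { T with right := Function.update T.right v o }

/-- Toggle a reversal bit. -/
def flip (T : LinkCut V) (v : V) : LinkCut V :=
  { T with rev := Function.update T.rev v (!T.rev v) }

/-! ### Exchanging the lower part of a path -/

/-- The situation in which the auxiliary tree with root `o` is spliced below `u`. -/
structure SpliceCtx (T : LinkCut V) (u : V) (o : Option V) : Prop where
  wf : T.WellFormed
  root : T.IsAuxRoot u
  rev : T.rev u = false
  new : ∀ w, o = some w → T.IsAuxRoot w ∧ T.parent w = some u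


namespace SpliceCtx

variable {u : V} {o : Option V} (h : SpliceCtx T u o)
include h

theorem isChild {a c : V} : (T.setRight u o).IsChild a c ↔
    a ≠ u ∧ T.IsChild a c ∨ a = u ∧ (T.left u = some c ∨ o = some c) := by
  by_cases ha : a = u
  · subst ha; simp [IsChild, setRight]
  · simp [IsChild, setRight, ha]

theorem wf' : (T.setRight u o).WellFormed where
  parent_of_child a c hc := by
    change T.parent c = some a
    rcases h.isChild.1 hc with ⟨-, hc⟩ | ⟨rfl, hc | hc⟩
    · exact h.wf.parent_of_child a c hc
    · exact h.wf.parent_of_child _ c (.inl hc)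
    · exact (h.new c hc).2
  left_ne_right a c hl hr := by
    change T.left a = some c at hl
    by_cases ha : a = u
    · subst ha
      simp only [setRight, Function.update_self] at hr
      exact (h.new c hr).1 a (.inl hl)
    · simp only [setRight, Function.update_of_ne ha] at hr
      exact h.wf.left_ne_right _ _ hl hr
  acyclic := h.wf.acyclic

theorem isAuxRoot {r : V} : (T.setRight u o).IsAuxRoot r ↔
    T.IsAuxRoot r ∧ o ≠ some r ∨ T.right u = some r := by
  constructor
  · intro hr
    by_cases h' : T.right u = some r
    · exact .inr h'
    · refine .inl ⟨fun a ha => hr a (h.isChild.2 ?_), fun ho => hr u (h.isChild.2 ?_)⟩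
      · by_cases hau : a = u
        · subst hau
          exact .inr ⟨rfl, .inl (ha.resolve_right h')⟩
        · exact .inl ⟨hau, ha⟩
      · exact .inr ⟨rfl, .inr ho⟩
  · rintro (⟨hr, ho⟩ | hr) a ha
    · rcases h.isChild.1 ha with ⟨-, hc⟩ | ⟨rfl, hc | hc⟩
      · exact hr a hc
      · exact hr _ (.inl hc)
      · exact ho hc
    · rcases h.isChild.1 ha with ⟨hau, hc⟩ | ⟨rfl, hc | hc⟩
      · exact hau (h.wf.isChild_unique hc (.inr hr))
      · exact h.wf.left_ne_right _ _ hc hr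
      · exact (h.new r hc).1 a (.inr hr)

theorem inOrder_of_notMem {o' : Option V} {l : List V} (hl : T.InOrder o' l) (hu : u ∉ l) :
    (T.setRight u o).InOrder o' l := by
  refine hl.congr fun w hw => ⟨rfl, ?_, rfl⟩
  have : w ≠ u := by rintro rfl; exact hu hw
  simp [setRight, this]

theorem inOrder_child {b : Bool} {l : List V} (hl : T.InOrder (T.child b u) l) :
    (T.setRight u o).InOrder (T.child b u) l := by
  refine h.inOrder_of_notMem hl fun hu => ?_
  obtain ⟨c, hc, h'⟩ := (hl.mem_iff u).1 hu
  exact h.wf.pacyclic.not_anc_of_parent (h.wf.parent_child hc) (h'.panc h.wf)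

theorem inOrder_new {l : List V} (hl : T.InOrder o l) : (T.setRight u o).InOrder o l := by
  refine h.inOrder_of_notMem hl fun hu => ?_
  obtain ⟨c, hc, h'⟩ := (hl.mem_iff u).1 hu
  exact h.wf.pacyclic.not_anc_of_parent (h.new c hc).2 (h'.panc h.wf)

/-- Splicing is undone by splicing the old right child back: it has become an auxiliary root, and
its unchanged pointer to `u` now acts as path-parent. So only one implication about edges needs a
direct proof. -/
theorem symm : SpliceCtx (T.setRight u o) u (T.right u) where
  wf := h.wf'
  root := h.isAuxRoot.2 (.inl ⟨h.root, fun ho =>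
    h.wf.pacyclic.ne_of_parent (h.new u ho).2 rfl⟩)
  rev := h.rev
  new _ hw := ⟨h.isAuxRoot.2 (.inr hw), h.wf.parent_child (b := true) hw⟩

/-- Splicing changes only how edges at `u` are represented. The edge from `u` to the top of the
detached part turns from a consecutive pair into a path-parent edge, and for the attached part it is
the other way round. -/
theorem forestParent_mp [Finite V] {x y : V} (hxy : T.ForestParent x y) :
    (T.setRight u o).ForestParent x y := by
  obtain ⟨l, q, ⟨r, ⟨hr, hl⟩, hq⟩, hxy⟩ := forestParent_iff.1 hxy
  obtain ⟨c, hc⟩ := h.wf.inOrder_exists o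
  obtain ⟨l₁, l₂, h₁, h₂, -⟩ := (inOrder_some_of_rev h.rev).1
    (h.wf.inOrder_exists (some u)).choose_spec
  have hu' : (T.setRight u o).InOrder (some u) (l₁ ++ u :: c) := by
    rw [inOrder_some_of_rev (by exact h.rev)]
    refine ⟨l₁, c, h.inOrder_child (b := false) h₁, ?_, rfl⟩
    simpa [setRight] using h.inOrder_new hc
  have hpu : (T.setRight u o).Pth (l₁ ++ u :: c) (T.parent u) := ⟨u, ⟨h.symm.root, hu'⟩, rfl⟩
  by_cases hru : r = u
  · subst hru
    obtain rfl := hl.unique ((inOrder_some_of_rev h.rev).2 ⟨l₁, l₂, h₁, h₂, rfl⟩)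
    rcases hxy with hxy | ⟨hx, rfl⟩
    · cases hd : T.right r with
      | none =>
        rw [hd] at h₂
        cases h₂
        refine forestParent_iff.2 ⟨_, _, hpu, .inl (hxy.trans ⟨[], c, by simp⟩)⟩
      | some d =>
        have hd' : (T.setRight r o).Pth l₂ (some r) :=
          ⟨d, ⟨h.isAuxRoot.2 (.inr hd), hd ▸ h.inOrder_child (b := true) h₂⟩,
            h.wf.parent_child (b := true) hd⟩
        -- The consecutive pair lies in the part down to the splicing vertex, or it starts at this
        -- vertex and becomes a path-parent edge, or it lies inside the detached part.
        obtain ⟨e, f, hef⟩ := hxy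
        rcases List.append_eq_append_iff.1
          (show (e ++ [y]) ++ x :: f = l₁ ++ r :: l₂ by simpa using hef) with
          ⟨a', h₃, h₄⟩ | ⟨a', h₃, h₄⟩
        · refine forestParent_iff.2 ⟨_, _, hpu, .inl ?_⟩
          cases a' with
          | nil =>
            simp only [List.append_nil, List.nil_append, List.cons.injEq] at h₃ h₄
            rw [h₃, h₄.1]
            exact ⟨e, c, by simp⟩
          | cons z a' =>
            simp only [List.cons_append, List.cons.injEq] at h₄
            rw [h₃, ← h₄.1]
            exact ⟨e, a' ++ r :: c, by simp⟩
        · cases a' with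
          | nil =>
            simp only [List.append_nil, List.nil_append, List.cons.injEq] at h₃ h₄
            refine forestParent_iff.2 ⟨_, _, hpu, .inl ?_⟩
            rw [← h₃, h₄.1]
            exact ⟨e, c, by simp⟩
          | cons z a' =>
            simp only [List.cons_append, List.cons.injEq] at h₄
            obtain ⟨rfl, h₄⟩ := h₄
            rcases List.eq_nil_or_concat a' with rfl | ⟨a'', y', rfl⟩
            · have h₅ := List.append_inj_right' h₃ (by simp)
              simp only [List.cons.injEq, and_true] at h₅
              subst h₅
              refine forestParent_iff.2 ⟨_, _, hd', .inr ⟨by simp [h₄], rfl⟩⟩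
            · have h₅ : y = y' := by
                have h₅ : e ++ [y] = (l₁ ++ r :: a'') ++ [y'] := by simpa using h₃
                simpa using List.append_inj_right' h₅ rfl
              subst h₅
              exact forestParent_iff.2 ⟨_, _, hd', .inl ⟨a'', f, by simp [h₄]⟩⟩
    · refine forestParent_iff.2 ⟨_, _, hpu, .inr ⟨?_, hq⟩⟩
      cases l₁ <;> simpa using hx
  · by_cases ho : o = some r
    · subst ho
      obtain rfl := hc.unique hl
      obtain rfl : some u = q := by rw [← hq, (h.new r rfl).2]
      refine forestParent_iff.2 ⟨_, _, hpu, .inl ?_⟩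
      rcases hxy with hxy | ⟨hx, hy⟩
      · exact hxy.trans ⟨l₁ ++ [u], [], by simp⟩
      · obtain rfl := Option.some.inj hy
        cases c with
        | nil => simp at hx
        | cons z c =>
          obtain rfl : z = x := by simpa using hx
          exact ⟨l₁, c, by simp⟩
    · exact forestParent_iff.2 ⟨l, q, ⟨r, ⟨h.isAuxRoot.2 (.inl ⟨hr, ho⟩),
        h.inOrder_of_notMem hl fun hu => hru (hl.root_unique h.root hu).symm⟩, hq⟩, hxy⟩

theorem forestParent [Finite V] (x y : V) :
    (T.setRight u o).ForestParent x y ↔ T.ForestParent x y := by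
  refine ⟨fun hxy => ?_, h.forestParent_mp⟩
  have := h.symm.forestParent_mp hxy
  simpa [setRight] using this

end SpliceCtx

/-! ### Choosing a new root -/

theorem WellFormed.flip (h : T.WellFormed) (u : V) : (T.flip u).WellFormed :=
  ⟨h.parent_of_child, h.left_ne_right, h.acyclic⟩

theorem inOrder_flip {u : V} {l : List V} (hw : T.WellFormed) (h : T.InOrder (some u) l) :
    (T.flip u).InOrder (some u) l.reverse := by
  obtain ⟨l₁, l₂, h₁, h₂, rfl⟩ := inOrder_some.1 h
  have key : ∀ (b : Bool) (l' : List V), T.InOrder (T.child b u) l' →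
      (T.flip u).InOrder (T.child b u) l' := by
    intro b l' hl
    refine hl.congr fun w hw' => ⟨rfl, rfl, ?_⟩
    have : w ≠ u := by
      rintro rfl
      obtain ⟨c, hc, h'⟩ := (hl.mem_iff w).1 hw'
      exact hw.pacyclic.not_anc_of_parent (hw.parent_child hc) (h'.panc hw)
    simp [LinkCut.flip, this]
  refine inOrder_some.2 ⟨l₁, l₂, key false _ h₁, key true _ h₂, ?_⟩
  cases hr : T.rev u <;> simp [LinkCut.flip, hr]

theorem inOrder_flip_of_ne {u r : V} {l : List V} (hu : T.IsAuxRoot u) (hne : r ≠ u) (h : T.InOrder (some r) l) :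
    (T.flip u).InOrder (some r) l := by
  refine h.congr fun w hl => ⟨rfl, rfl, ?_⟩
  have : w ≠ u := by rintro rfl; exact hne (h.root_unique hu hl).symm
  simp [LinkCut.flip, this]

/-- The path whose auxiliary root is a virtual root has no path-parent, so its reversal only
reverses the orientation of its own edges. The paths hanging from it keep their path-parents. The
rooted forest changes, the unrooted one does not. -/
theorem forest_flip_adj [Finite V] {u : V} (hw : T.WellFormed) (hp : T.parent u = none) {x y : V}
    (h : T.forest.Adj x y) : (T.flip u).forest.Adj x y := by
  have hu := isAuxRoot_of_parent hw hp
  have key : ∀ x y, T.ForestParent x y →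
      (T.flip u).ForestParent x y ∨ (T.flip u).ForestParent y x := by
    intro x y h
    obtain ⟨l, q, ⟨r, ⟨hr, hl⟩, rfl⟩, hxy⟩ := forestParent_iff.1 h
    by_cases hru : r = u
    · subst hru
      rcases hxy with hxy | ⟨-, h'⟩
      · refine .inr (forestParent_iff.2 ⟨_, _, ⟨r, ⟨hu, inOrder_flip hw hl⟩, rfl⟩, .inl ?_⟩)
        simpa using List.reverse_infix.2 hxy
      · simp [hp] at h'
    · exact .inl (forestParent_iff.2 ⟨l, _, ⟨r, ⟨hr, inOrder_flip_of_ne hu hru hl⟩, rfl⟩, hxy⟩)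
  obtain ⟨hne, h⟩ := forest_adj.1 h
  refine forest_adj.2 ⟨hne, ?_⟩
  rcases h with h | h
  · exact key x y h
  · exact (key y x h).symm

theorem flip_flip (T : LinkCut V) (u : V) : (T.flip u).flip u = T := by
  simp [flip]

theorem forest_flip [Finite V] {u : V} (hw : T.WellFormed) (hp : T.parent u = none) :
    (T.flip u).forest = T.forest := by
  ext x y
  refine ⟨fun h => ?_, forest_flip_adj hw hp⟩
  have := forest_flip_adj (hw.flip u) hp h
  rwa [flip_flip] at this

/-! ### Adding and deleting edges -/

theorem WellFormed.link (hw : T.WellFormed) {u v : V} (hu : T.parent u = none)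
    (hv : T.parent v = none) (huv : u ≠ v) : (T.setParent u (some v)).WellFormed where
  parent_of_child a c hc := by
    have hc' := hw.parent_of_child a c hc
    have : c ≠ u := by rintro rfl; simp [hu] at hc'
    simpa [setParent, this] using hc'
  left_ne_right := hw.left_ne_right
  acyclic := by
    refine ⟨fun w => ?_⟩
    -- `v` still has no parent, so the chain through the new pointer ends there.
    have hv' : Acc (fun p c => (T.setParent u (some v)).parent c = some p) v :=
      ⟨_, fun y hy => by simp [setParent, huv.symm, hv] at hy⟩
    induction w using hw.acyclic.induction with
    | h w ih =>
      refine ⟨_, fun y hy => ?_⟩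
      by_cases hwu : w = u
      · subst hwu
        simp only [setParent, Function.update_self, Option.some.injEq] at hy
        exact hy ▸ hv'
      · simp only [setParent, Function.update_of_ne hwu] at hy
        exact ih y hy

/-- A path-parent pointer stored at an auxiliary root belongs to the top of the path, which need not
be that root. Here `hfu` makes `u` the top of its path, so the pointer does stand for the edge
between `u` and `v`. -/
theorem forest_link [Finite V] (hw : T.WellFormed) {u v : V} (hu : T.parent u = none)
    (hfu : ∀ y, ¬ T.ForestParent u y) :
    (T.setParent u (some v)).forest = T.forest ⊔ SimpleGraph.edge u v := by
  have hur := isAuxRoot_of_parent hw hu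
  have hin : ∀ o l, (T.setParent u (some v)).InOrder o l ↔ T.InOrder o l := fun o l =>
    ⟨fun h => h.congr fun _ _ => ⟨rfl, rfl, rfl⟩, fun h => h.congr fun _ _ => ⟨rfl, rfl, rfl⟩⟩
  obtain ⟨l₀, hl₀⟩ := hw.pth_of_not_forestParent hfu
  have hul : T.InOrder (some u) (u :: l₀) := (hur.inOrder_of_pth hl₀ (by simp)).1
  have hfp : ∀ x y, (T.setParent u (some v)).ForestParent x y ↔
      T.ForestParent x y ∨ x = u ∧ y = v := by
    intro x y
    constructor
    · rintro (⟨r, l, ⟨hr, hl⟩, h⟩ | ⟨r, l, ⟨hr, hl⟩, h, h'⟩)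
      · exact .inl (.inl ⟨r, l, ⟨hr, (hin _ _).1 hl⟩, h⟩)
      · rw [hin] at hl
        by_cases hru : r = u
        · subst hru
          obtain rfl := hl.unique hul
          simp only [setParent, Function.update_self, Option.some.injEq] at h'
          simp only [List.head?_cons, Option.some.injEq] at h
          exact .inr ⟨h.symm, h'.symm⟩
        · simp only [setParent, Function.update_of_ne hru] at h'
          exact .inl (.inr ⟨r, l, ⟨hr, hl⟩, h, h'⟩)
    · rintro ((⟨r, l, ⟨hr, hl⟩, h⟩ | ⟨r, l, ⟨hr, hl⟩, h, h'⟩) | ⟨rfl, rfl⟩)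
      · exact .inl ⟨r, l, ⟨hr, (hin _ _).2 hl⟩, h⟩
      · have hru : r ≠ u := by rintro rfl; simp [hu] at h'
        exact .inr ⟨r, l, ⟨hr, (hin _ _).2 hl⟩, h, by simpa [setParent, hru] using h'⟩
      · exact .inr ⟨x, _, ⟨hur, (hin _ _).2 hul⟩, rfl, by simp [setParent]⟩
  ext x y
  simp only [forest_adj, hfp, SimpleGraph.sup_adj, SimpleGraph.edge_adj]
  tauto

/-- The situation in which the edge between `u` and `w` is deleted, where `u` precedes `w` at the top
of a path. -/
structure CutCtx (T : LinkCut V) (u w : V) (m : List V) : Prop where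
  wf : T.WellFormed
  root : T.parent w = none
  rev : T.rev w = false
  left : T.left w = some u
  path : T.InOrder (some w) (u :: w :: m)

/-- The result of deleting the edge between `u` and `w`. -/
def cut (T : LinkCut V) (u w : V) : LinkCut V := (T.setLeft w none).setParent u none

namespace CutCtx

variable {u w : V} {m : List V} (h : CutCtx T u w m)
include h

theorem ne : u ≠ w := h.wf.pacyclic.ne_of_parent (h.wf.parent_child (b := false) h.left)

theorem nodup : (u :: w :: m).Nodup := h.path.nodup h.wf

/-- The sequence of the left subtree is an initial part of `u :: w :: m` that contains `u` and
avoids `w`, so it is `[u]`. -/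
theorem sub : T.InOrder (some u) [u] ∧ T.InOrder (T.right w) m := by
  obtain ⟨l₁, l₂, h₁, h₂, h₃⟩ := (inOrder_some_of_rev h.rev).1 h.path
  rw [h.left] at h₁
  have hn := h.nodup
  have hu : u ∈ l₁ := (h₁.mem_iff u).2 ⟨u, rfl, .refl⟩
  have hw : w ∉ l₁ := by
    rw [h₃] at hn
    exact fun hw => (List.nodup_append.1 hn).2.2 w hw w (by simp) rfl
  cases l₁ with
  | nil => simp at hu
  | cons a l₁ =>
    cases l₁ with
    | nil =>
      simp only [List.cons_append, List.nil_append, List.cons.injEq, true_and] at h₃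
      obtain ⟨rfl, rfl⟩ := h₃
      exact ⟨h₁, h₂⟩
    | cons c l₁ =>
      simp only [List.cons_append, List.cons.injEq] at h₃
      exact absurd (by simp [h₃.2.1]) hw

theorem isChild {a c : V} : (T.cut u w).IsChild a c ↔ T.IsChild a c ∧ c ≠ u := by
  have hu : ∀ a, T.IsChild a u → a = w := fun a ha => h.wf.isChild_unique ha (.inl h.left)
  by_cases ha : a = w
  · subst ha
    have := h.left
    have h₂ := h.wf.left_ne_right _ _ this
    simp only [IsChild, cut, setLeft, setParent, Function.update_self, this, reduceCtorEq, false_or,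
      Option.some.injEq]
    constructor
    · intro hc
      exact ⟨.inr hc, by rintro rfl; exact h₂ hc⟩
    · rintro ⟨h' | h', hc⟩
      · exact absurd h'.symm hc
      · exact h'
  · simp only [IsChild, cut, setLeft, setParent, Function.update_of_ne ha]
    refine ⟨fun hc => ⟨hc, ?_⟩, fun hc => hc.1⟩
    rintro rfl
    exact ha (hu a hc)

theorem parent_cut (a : V) : (T.cut u w).parent a = if a = u then none else T.parent a := by
  simp [cut, setParent, setLeft, Function.update_apply]

theorem wf' : (T.cut u w).WellFormed where
  parent_of_child a c hc := by
    obtain ⟨hc, hcu⟩ := h.isChild.1 hc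
    rw [h.parent_cut, if_neg hcu]
    exact h.wf.parent_of_child a c hc
  left_ne_right a c hl hr := by
    by_cases ha : a = w
    · subst ha
      simp [cut, setLeft, setParent] at hl
    · simp only [cut, setLeft, setParent, Function.update_of_ne ha] at hl hr
      exact h.wf.left_ne_right _ _ hl hr
  acyclic := by
    refine Subrelation.wf (r := fun p c => T.parent c = some p) ?_ h.wf.acyclic
    intro p c hc
    rw [h.parent_cut] at hc
    split_ifs at hc
    exact hc

theorem isAuxRoot {r : V} : (T.cut u w).IsAuxRoot r ↔ T.IsAuxRoot r ∨ r = u := by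
  constructor
  · intro hr
    by_cases hru : r = u
    · exact .inr hru
    · exact .inl fun a ha => hr a (h.isChild.2 ⟨ha, hru⟩)
  · rintro (hr | rfl) a ha
    · exact hr a (h.isChild.1 ha).1
    · exact (h.isChild.1 ha).2 rfl

theorem inOrder_of_notMem {o : Option V} {l : List V} (hl : T.InOrder o l) (hw : w ∉ l) :
    (T.cut u w).InOrder o l := by
  refine hl.congr fun a ha => ⟨?_, rfl, rfl⟩
  have : a ≠ w := by rintro rfl; exact hw ha
  simp [cut, setLeft, setParent, this]

theorem pth_u : (T.cut u w).Pth [u] none := by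
  refine ⟨u, ⟨h.isAuxRoot.2 (.inr rfl), h.inOrder_of_notMem h.sub.1 ?_⟩, by simp [h.parent_cut]⟩
  simpa using h.ne.symm

theorem inOrder_w : (T.cut u w).InOrder (some w) (w :: m) := by
  rw [inOrder_some_of_rev (by exact h.rev)]
  refine ⟨[], m, ?_, h.inOrder_of_notMem h.sub.2 ?_, rfl⟩
  · simpa [cut, setLeft, setParent] using InOrder.nil
  · have := h.nodup
    simp only [List.nodup_cons] at this
    exact this.2.1

theorem root_w : T.IsAuxRoot w := isAuxRoot_of_parent h.wf h.root

theorem pth_w : (T.cut u w).Pth (w :: m) none :=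
  ⟨w, ⟨h.isAuxRoot.2 (.inl h.root_w), h.inOrder_w⟩, by
    rw [h.parent_cut, if_neg h.ne.symm, h.root]⟩

/-- The top path splits into `[u]` and `w :: m`, both without path-parent, and only the consecutive
pair at the split disappears. All other paths avoid `w`, the only node whose child pointers change.
-/
theorem forestParent {x y : V} : (T.cut u w).ForestParent x y ↔
    T.ForestParent x y ∧ ¬ (x = w ∧ y = u) := by
  have hn := h.nodup
  have hnu : ¬ T.IsAuxRoot u := fun hu => hu w (.inl h.left)
  constructor
  · intro h₀
    obtain ⟨l, q, ⟨r, ⟨hr, hl⟩, hq⟩, hxy⟩ := forestParent_iff.1 h₀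
    clear h₀
    by_cases hru : r = u
    · subst hru
      have h₁ := (h.isAuxRoot.2 (.inr rfl)).inOrder_of_pth h.pth_u (by simp)
      obtain rfl := h₁.1.unique hl
      rw [h₁.2] at hq
      subst hq
      rcases hxy with hxy | ⟨-, hxy⟩
      · have := hxy.length_le
        simp at this
      · simp at hxy
    · by_cases hrw : r = w
      · subst hrw
        obtain rfl := h.inOrder_w.unique hl
        rw [h.parent_cut, if_neg hru, h.root] at hq
        subst hq
        rcases hxy with hxy | ⟨-, hxy⟩
        · refine ⟨forestParent_iff.2 ⟨_, _, ⟨r, ⟨h.root_w, h.path⟩, rfl⟩,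
            .inl (hxy.trans ⟨[u], [], by simp⟩)⟩, ?_⟩
          rintro ⟨rfl, rfl⟩
          have : y ∈ x :: m := hxy.subset (by simp)
          exact (List.nodup_cons.1 hn).1 this
        · simp at hxy
      · have hr₀ := (h.isAuxRoot.1 hr).resolve_right hru
        have hw : w ∉ l := fun hw =>
          hrw (hl.root_unique (h.isAuxRoot.2 (.inl h.root_w)) hw).symm
        have hl₀ : T.InOrder (some r) l := by
          refine hl.congr fun a ha => ⟨?_, rfl, rfl⟩
          have : a ≠ w := by rintro rfl; exact hw ha
          simp [cut, setLeft, setParent, this]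
        rw [h.parent_cut, if_neg hru] at hq
        refine ⟨forestParent_iff.2 ⟨l, q, ⟨r, ⟨hr₀, hl₀⟩, hq⟩, hxy⟩, ?_⟩
        rintro ⟨rfl, rfl⟩
        rcases hxy with hxy | ⟨hxy, -⟩
        · exact hw (hxy.subset (by simp))
        · exact hw (List.mem_of_mem_head? hxy)
  · rintro ⟨hxy, hne⟩
    obtain ⟨l, q, ⟨r, ⟨hr, hl⟩, hq⟩, hxy⟩ := forestParent_iff.1 hxy
    have hru : r ≠ u := by rintro rfl; exact hnu hr
    by_cases hrw : r = w
    · subst hrw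
      obtain rfl := h.path.unique hl
      rw [h.root] at hq
      subst hq
      rcases hxy with ⟨e, f, hxy⟩ | ⟨-, hxy⟩
      · refine forestParent_iff.2 ⟨_, _, h.pth_w, .inl ?_⟩
        cases e with
        | nil =>
          simp only [List.nil_append, List.cons_append, List.cons.injEq] at hxy
          exact absurd ⟨hxy.2.1, hxy.1⟩ hne
        | cons a e =>
          simp only [List.cons_append, List.cons.injEq] at hxy
          exact ⟨e, f, hxy.2⟩
      · simp at hxy
    · have hw : w ∉ l := fun hw => hrw (hl.root_unique h.root_w hw).symm
      exact forestParent_iff.2 ⟨l, q, ⟨r, ⟨h.isAuxRoot.2 (.inl hr), h.inOrder_of_notMem hl hw⟩,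
        by rw [h.parent_cut, if_neg hru, hq]⟩, hxy⟩

theorem adj : T.forest.Adj u w := by
  refine (adj_of_infix h.wf ⟨w, ⟨h.root_w, h.path⟩, rfl⟩ ?_).symm
  exact ⟨[], m, rfl⟩

theorem forest : (T.cut u w).forest = T.forest.deleteEdges {s(u, w)} := by
  have hu : ¬ T.ForestParent u w := h.wf.not_forestParent_head
    ⟨w, ⟨h.root_w, h.path⟩, h.root⟩ w
  ext x y
  simp only [forest_adj, h.forestParent, SimpleGraph.deleteEdges_adj, Set.mem_singleton_iff,
    Sym2.eq_iff]
  constructor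
  · rintro ⟨hne, ⟨h₁, h₂⟩ | ⟨h₁, h₂⟩⟩
    · refine ⟨⟨hne, .inl h₁⟩, ?_⟩
      rintro (⟨rfl, rfl⟩ | ⟨rfl, rfl⟩)
      · exact hu h₁
      · exact h₂ ⟨rfl, rfl⟩
    · refine ⟨⟨hne, .inr h₁⟩, ?_⟩
      rintro (⟨rfl, rfl⟩ | ⟨rfl, rfl⟩)
      · exact h₂ ⟨rfl, rfl⟩
      · exact hu h₁
  · rintro ⟨⟨hne, h₁⟩, h₂⟩
    refine ⟨hne, ?_⟩
    rcases h₁ with h₁ | h₁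
    · exact .inl ⟨h₁, fun h₃ => h₂ (.inr h₃)⟩
    · exact .inr ⟨h₁, fun h₃ => h₂ (.inl ⟨h₃.2, h₃.1⟩)⟩

end CutCtx

end LinkCut

/-! ### Subtree sizes and the potential -/

section Sizes

variable {V : Type} [Fintype V] [DecidableEq V]

/-- `sz v` is the number of vertices from which `v` is reached by following `par`. -/
def IsSize (par : V → Option V) (sz : V → ℕ) : Prop :=
  ∀ v, sz v = 1 + ∑ c, if par c = some v then sz c else 0

variable {par : V → Option V} {sz : V → ℕ}

theorem IsSize.pos (h : IsSize par sz) (v : V) : 1 ≤ sz v := by rw [h v]; omega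

theorem IsSize.sum_le (h : IsSize par sz) {v : V} (s : Finset V) (hs : ∀ c ∈ s, par c = some v) :
    ∑ c ∈ s, sz c + 1 ≤ sz v := by
  rw [h v, add_comm]
  gcongr
  rw [← Finset.sum_filter]
  exact Finset.sum_le_sum_of_subset fun c hc => by simp [hs c hc]

theorem IsSize.child_lt (h : IsSize par sz) {c v : V} (hc : par c = some v) : sz c + 1 ≤ sz v := by
  simpa using h.sum_le {c} (v := v) (by simpa using hc)

theorem IsSize.siblings (h : IsSize par sz) {c d v : V} (hc : par c = some v) (hd : par d = some v)
    (hcd : c ≠ d) : sz c + sz d + 1 ≤ sz v := by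
  have := h.sum_le {c, d} (v := v) (by simp [hc, hd])
  rwa [Finset.sum_pair hcd] at this

theorem IsSize.mono (h : IsSize par sz) {c v : V} (hc : PAnc par c v) : sz c ≤ sz v := by
  induction hc with
  | refl => exact le_rfl
  | tail _ h' ih => have := h.child_lt h'; omega

/-- Summing the defining equation over all vertices counts the size of every non-root on both sides;
hence the sizes of the roots add up to the number of vertices. -/
theorem IsSize.le_card (h : IsSize par sz) (hw : PAcyclic par) (v : V) : sz v ≤ Fintype.card V := by
  obtain ⟨r, hv, hr⟩ := hw.exists_root v
  refine (h.mono hv).trans ?_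
  have h₁ : ∑ v, sz v = Fintype.card V + ∑ c, if par c = none then 0 else sz c := by
    conv_lhs => rw [Finset.sum_congr rfl fun v _ => h v]
    rw [Finset.sum_add_distrib, Finset.sum_comm]
    congr 1
    · simp
    · refine Finset.sum_congr rfl fun c _ => ?_
      cases hc : par c <;> simp
  have h₂ : ∑ v, sz v = (∑ c, if par c = none then sz c else 0) +
      ∑ c, if par c = none then 0 else sz c := by
    rw [← Finset.sum_add_distrib]
    refine Finset.sum_congr rfl fun c _ => ?_
    split_ifs <;> simp
  have h₃ : sz r ≤ ∑ c, if par c = none then sz c else 0 := by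
    have := Finset.single_le_sum (f := fun c => if par c = none then sz c else 0)
      (fun c _ => Nat.zero_le _) (Finset.mem_univ r)
    simpa [hr] using this
  omega

/-- Subtree sizes exist. -/
theorem PAcyclic.exists_isSize (hw : PAcyclic par) : ∃ sz, IsSize par sz := by
  classical
  refine ⟨fun v => (Finset.univ.filter fun w => PAnc par w v).card, fun v => ?_⟩
  have hset : (Finset.univ.filter fun w => PAnc par w v) =
      {v} ∪ (Finset.univ.filter fun c => par c = some v).biUnion
        fun c => Finset.univ.filter fun w => PAnc par w c := by
    ext w
    simp only [Finset.mem_filter, Finset.mem_univ, true_and, Finset.mem_union, Finset.mem_singleton,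
      Finset.mem_biUnion]
    constructor
    · intro h
      rcases Relation.ReflTransGen.cases_tail h with h | ⟨c, h₁, h₂⟩
      · exact .inl h.symm
      · exact .inr ⟨c, h₂, h₁⟩
    · rintro (rfl | ⟨c, h₁, h₂⟩)
      · exact .refl _
      · exact h₂.trans (.of_parent h₁)
  simp only [hset]
  rw [Finset.card_union_of_disjoint, Finset.card_singleton, Finset.card_biUnion, Finset.sum_filter]
  · intro c hc d hd hcd
    simp only [Finset.coe_filter, Finset.mem_univ, true_and, Set.mem_ofPred_eq] at hc hd
    refine Finset.disjoint_left.2 fun w h₁ h₂ => hcd ?_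
    simp only [Finset.mem_filter, Finset.mem_univ, true_and] at h₁ h₂
    rcases h₁.total h₂ with h | h
    · exact hw.sibling hc hd h
    · exact (hw.sibling hd hc h).symm
  · refine Finset.disjoint_left.2 fun w h₁ h₂ => ?_
    simp only [Finset.mem_singleton] at h₁
    subst h₁
    simp only [Finset.mem_biUnion, Finset.mem_filter, Finset.mem_univ, true_and] at h₂
    obtain ⟨c, hc, h⟩ := h₂
    exact hw.not_anc_of_parent hc h

/-- Since `v` is a root, no vertex above it is affected, and its own size is the only one that
changes. The same reason applies to `IsSize.cut`. -/
theorem IsSize.link (h : IsSize par sz) {u v : V} (hu : par u = none) (hv : par v = none)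
    (huv : u ≠ v) :
    IsSize (Function.update par u (some v)) (Function.update sz v (sz v + sz u)) := by
  intro w
  have hsum : ∀ w, (∑ c, if Function.update par u (some v) c = some w then
      Function.update sz v (sz v + sz u) c else 0) =
      (∑ c, if par c = some w then sz c else 0) + if w = v then sz u else 0 := by
    intro w
    rw [← Finset.add_sum_erase _ _ (Finset.mem_univ u), ← Finset.add_sum_erase _ (fun c =>
      if par c = some w then sz c else 0) (Finset.mem_univ u)]
    simp only [Function.update_self, hu, Option.some.injEq, Function.update_of_ne huv]
    have : ∑ c ∈ Finset.univ.erase u, (if Function.update par u (some v) c = some w then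
        Function.update sz v (sz v + sz u) c else 0) =
        ∑ c ∈ Finset.univ.erase u, if par c = some w then sz c else 0 := by
      refine Finset.sum_congr rfl fun c hc => ?_
      rw [Function.update_of_ne (Finset.ne_of_mem_erase hc)]
      split_ifs with h'
      · rw [Function.update_of_ne]
        rintro rfl
        simp [hv] at h'
      · rfl
    rw [this]
    by_cases hwv : w = v
    · subst hwv; simp; omega
    · simp [hwv, Ne.symm hwv]
  rw [hsum]
  by_cases hwv : w = v
  · subst hwv
    rw [Function.update_self, h w]
    simp; ring
  · rw [Function.update_of_ne hwv, h w]
    simp [hwv]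

theorem IsSize.cut (h : IsSize par sz) {u w : V} (hu : par u = some w) (hw : par w = none) :
    IsSize (Function.update par u none) (Function.update sz w (sz w - sz u)) := by
  have huw : u ≠ w := by rintro rfl; simp [hu] at hw
  intro v
  have hsum : ∀ v, (∑ c, if Function.update par u none c = some v then
      Function.update sz w (sz w - sz u) c else 0) + (if v = w then sz u else 0) =
      ∑ c, if par c = some v then sz c else 0 := by
    intro v
    rw [← Finset.add_sum_erase _ _ (Finset.mem_univ u), ← Finset.add_sum_erase _ (fun c =>
      if par c = some v then sz c else 0) (Finset.mem_univ u)]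
    simp only [Function.update_self, hu, Option.some.injEq, reduceCtorEq, if_false]
    have : ∑ c ∈ Finset.univ.erase u, (if Function.update par u none c = some v then
        Function.update sz w (sz w - sz u) c else 0) =
        ∑ c ∈ Finset.univ.erase u, if par c = some v then sz c else 0 := by
      refine Finset.sum_congr rfl fun c hc => ?_
      rw [Function.update_of_ne (Finset.ne_of_mem_erase hc)]
      split_ifs with h'
      · rw [Function.update_of_ne]
        rintro rfl
        simp [hw] at h'
      · rfl
    rw [this]
    by_cases hvw : v = w
    · subst hvw; simp; omega
    · simp [hvw, Ne.symm hvw]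
  have := hsum v
  have hv := h v
  by_cases hvw : v = w
  · subst hvw
    rw [Function.update_self]
    simp only [if_true] at this
    omega
  · rw [Function.update_of_ne hvw]
    simp only [hvw, if_false] at this
    omega

/-- The binary logarithm of a natural number. -/
noncomputable def lg (a : ℕ) : ℝ := Real.logb 2 a

theorem lg_nonneg (a : ℕ) : 0 ≤ lg a := by
  rcases Nat.eq_zero_or_pos a with rfl | h
  · simp [lg]
  · exact Real.logb_nonneg (by norm_num) (by exact_mod_cast h)

theorem lg_mono {a b : ℕ} (ha : 1 ≤ a) (h : a ≤ b) : lg a ≤ lg b :=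
  Real.logb_le_logb_of_le (by norm_num) (by exact_mod_cast ha) (by exact_mod_cast h)

/-- The inequality 4ab ≤ (a + b)² in logarithmic form. The summand 2 is the unit of payment in the
amortized analysis. -/
theorem lg_add_lg {a b c : ℕ} (ha : 1 ≤ a) (hb : 1 ≤ b) (h : a + b ≤ c) :
    lg a + lg b + 2 ≤ 2 * lg c := by
  have ha' : (1 : ℝ) ≤ a := by exact_mod_cast ha
  have hb' : (1 : ℝ) ≤ b := by exact_mod_cast hb
  have h' : (a : ℝ) + b ≤ c := by exact_mod_cast h
  have h4 : Real.logb 2 4 = 2 := by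
    rw [show (4 : ℝ) = 2 ^ (2 : ℕ) by norm_num, Real.logb_pow, Real.logb_self_eq_one (by norm_num)]
    norm_num
  have h₁ : lg a + lg b + 2 = Real.logb 2 (a * b * 4) := by
    rw [Real.logb_mul (by positivity) (by norm_num), Real.logb_mul (by positivity) (by positivity),
      h4]
    rfl
  have h₂ : 2 * lg c = Real.logb 2 ((c : ℝ) ^ 2) := by
    rw [Real.logb_pow]; rfl
  rw [h₁, h₂]
  refine Real.logb_le_logb_of_le (by norm_num) (by positivity) ?_
  nlinarith [sq_nonneg ((a : ℝ) - b)]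

/-- The potential of a structure with subtree sizes `sz`. -/
noncomputable def potential (sz : V → ℕ) : ℝ := ∑ v, lg (sz v)

theorem potential_nonneg (sz : V → ℕ) : 0 ≤ potential sz :=
  Finset.sum_nonneg fun _ _ => lg_nonneg _

theorem potential_le (h : IsSize par sz) (hw : PAcyclic par) :
    potential sz ≤ Fintype.card V * lg (Fintype.card V) := by
  refine (Finset.sum_le_sum fun v _ => lg_mono (h.pos v) (h.le_card hw v)).trans ?_
  simp

theorem potential_of_eq_off {sz' : V → ℕ} (s : Finset V) (h : ∀ v ∉ s, sz' v = sz v) :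
    potential sz' - potential sz = ∑ v ∈ s, (lg (sz' v) - lg (sz v)) := by
  rw [potential, potential, ← Finset.sum_sub_distrib]
  refine (Finset.sum_subset (Finset.subset_univ s) fun v _ hv => ?_).symm
  simp [h v hv]

/-- The number of steps from a vertex to its root. -/
inductive PDepth (par : V → Option V) : V → ℕ → Prop where
  | root {x : V} (h : par x = none) : PDepth par x 0
  | step {x p : V} {d : ℕ} (h : par x = some p) (hp : PDepth par p d) : PDepth par x (d + 1)

theorem PAcyclic.exists_depth (hw : PAcyclic par) (x : V) : ∃ d, PDepth par x d := by
  induction x using hw.induction with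
  | h x ih =>
    cases hx : par x with
    | none => exact ⟨0, .root hx⟩
    | some p =>
      obtain ⟨d, hd⟩ := ih p hx
      exact ⟨d + 1, .step hx hd⟩

theorem PDepth.unique {x : V} {d : ℕ} (h : PDepth par x d) : ∀ {e}, PDepth par x e → d = e := by
  induction h with
  | root h =>
    intro e he
    cases he with
    | root _ => rfl
    | step h' _ => simp [h] at h'
  | step h _ ih =>
    intro e he
    cases he with
    | root h' => simp [h] at h'
    | step h' hp =>
      obtain rfl := Option.some.inj (h.symm.trans h')
      rw [ih hp]

end Sizes

/-! ### Amortized analysis of rotations in the virtual tree -/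

namespace LinkCut

variable {V : Type} [Fintype V] [DecidableEq V] {T T' T'' : LinkCut V}

/-- Only `x` and `p` change their sets of descendants: `x` takes over those of `p`, and `p` loses
those of `x` except for the inner subtree. Vertices attached by path-parent pointers are counted too
and stay where they are. -/
theorem RotCtx.isSize {b : Bool} {x p : V} (h : RotCtx T b x p) {sz : V → ℕ}
    (hs : IsSize T.parent sz) :
    ∃ sz', IsSize (T.rotate b x p).parent sz' ∧ sz' x = sz p ∧ (∀ w, w ≠ x → w ≠ p → sz' w = sz w) ∧
      sz' p + sz x = sz p + (T.child (!b) x).elim 0 sz := by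
  have hxp := h.ne
  have hpx := hs.child_lt h.parent_x
  set β := (T.child (!b) x).elim 0 sz with hβ
  refine ⟨Function.update (Function.update sz x (sz p)) p (sz p - sz x + β), ?_, by simp [hxp],
    fun w h₁ h₂ => by simp [h₁, h₂], by simp; omega⟩
  set sz' := Function.update (Function.update sz x (sz p)) p (sz p - sz x + β)
  -- the vertices whose parent pointers do not change
  set R : V → ℕ := fun v => ∑ c, if c = x ∨ c = p ∨ T.child (!b) x = some c then 0 else
    if T.parent c = some v then sz c else 0 with hR
  have split : ∀ f : V → ℕ, ∑ c, f c = (∑ c, if c = x ∨ c = p ∨ T.child (!b) x = some c then 0 else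
      f c) + f x + f p + (T.child (!b) x).elim 0 f := by
    intro f
    have h₁ : ∑ c, f c = ∑ c, ((if c = x ∨ c = p ∨ T.child (!b) x = some c then 0 else f c) +
        (if c = x then f c else 0) + (if c = p then f c else 0) +
        if T.child (!b) x = some c then f c else 0) := by
      refine Finset.sum_congr rfl fun c _ => ?_
      by_cases c₁ : c = x
      · subst c₁; simp [hxp, h.child_x_ne]
      · by_cases c₂ : c = p
        · subst c₂; simp [hxp.symm, h.child_x_ne_p]
        · by_cases c₃ : T.child (!b) x = some c <;> simp [c₁, c₂, c₃]
    rw [h₁, Finset.sum_add_distrib, Finset.sum_add_distrib, Finset.sum_add_distrib]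
    congr 1
    · simp
    · cases T.child (!b) x <;> simp
  have old : ∀ v, sz v = 1 + (R v + (if p = v then sz x else 0) +
      (if T.parent p = some v then sz p else 0) + if x = v then β else 0) := by
    intro v
    rw [hs v, split]
    congr 1
    simp only [hR, h.parent_x, Option.some.injEq]
    congr 1
    cases hc : T.child (!b) x with
    | none => simp [hβ, hc]
    | some c => simp [hβ, hc, h.parent_child_x hc]
  have new : ∀ v, (∑ c, if (T.rotate b x p).parent c = some v then sz' c else 0) =
      R v + (if T.parent p = some v then sz p else 0) +
      (if x = v then sz p - sz x + β else 0) + if p = v then β else 0 := by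
    intro v
    rw [split]
    congr 1
    · congr 1
      · congr 1
        · refine Finset.sum_congr rfl fun c _ => ?_
          by_cases hc : c = x ∨ c = p ∨ T.child (!b) x = some c
          · simp [hc]
          · have hc' := hc
            push Not at hc'
            simp [rotate, hc', sz']
        · simp [rotate, sz', hxp]
      · simp [rotate, sz', hxp.symm]
    · cases hc : T.child (!b) x with
      | none => simp [hβ, hc]
      | some c =>
        have c₁ : c ≠ x := by rintro rfl; exact h.child_x_ne hc
        have c₂ : c ≠ p := by rintro rfl; exact h.child_x_ne_p hc
        simp [hβ, hc, rotate, sz', c₁, c₂]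
  intro v
  rw [new]
  have ox := old x
  have op := old p
  have ov := old v
  have e₁ := h.parent_p_ne_x
  have e₂ := h.parent_p_ne_p
  simp only [hxp, hxp.symm, e₁, e₂, if_true, if_false] at ox op
  by_cases hvx : v = x
  · subst hvx
    simp only [sz', hxp, hxp.symm, e₁, if_true, if_false, ne_eq, not_false_eq_true,
      Function.update_of_ne, Function.update_self]
    omega
  · by_cases hvp : v = p
    · subst hvp
      simp only [sz', hxp, e₂, if_true, if_false, Function.update_self]
      omega
    · simp only [sz', hvx, hvp, Ne.symm hvx, Ne.symm hvp, if_false, ne_eq, not_false_eq_true,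
        Function.update_of_ne] at ov ⊢
      omega

/-- None of the redirected pointers starts strictly above `p`, so the proper ancestors of `p` keep
their depths and `x` inherits the depth of `p`. -/
theorem RotCtx.depth {b : Bool} {x p : V} (h : RotCtx T b x p) {d : ℕ}
    (hd : PDepth T.parent p d) : PDepth (T.rotate b x p).parent x d := by
  have hac := h.wf.pacyclic
  have key : ∀ z d, PDepth T.parent z d → (∃ g, T.parent p = some g ∧ PAnc T.parent g z) →
      PDepth (T.rotate b x p).parent z d := by
    intro z d hz
    induction hz with
    | root hz =>
      rename_i z
      rintro ⟨g, hg, ha⟩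
      have h₁ : z ≠ x := by rintro rfl; simp [h.parent_x] at hz
      have h₂ : z ≠ p := by rintro rfl; simp [hg] at hz
      have h₃ : T.child (!b) x ≠ some z := fun h' => by simp [h.parent_child_x h'] at hz
      exact .root (by simp [rotate, h₁, h₂, h₃, hz])
    | step hz _ ih =>
      rename_i z q d _
      rintro ⟨g, hg, ha⟩
      have hpz : PAnc T.parent p z := (PAnc.of_parent hg).trans ha
      have h₁ : z ≠ x := by
        rintro rfl; exact hac.not_anc_of_parent h.parent_x hpz
      have h₂ : z ≠ p := by
        rintro rfl; exact hac.not_anc_of_parent hg ha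
      have h₃ : T.child (!b) x ≠ some z := fun h' =>
        hac.not_anc_of_parent (h.parent_child_x h') (h.anc_p.trans hpz)
      exact .step (by simp [rotate, h₁, h₂, h₃, hz]) (ih ⟨g, hg, ha.trans (.of_parent hz)⟩)
  cases hd with
  | root hp => exact .root (by simp [rotate, hp])
  | step hp hd' => exact .step (by simp [rotate, hp]) (key _ _ hd' ⟨_, hp, .refl _⟩)

/-- Resolve the reversal bits at `p` and at its child `x`, and rotate `x` over `p`. -/
def RotStep (T : LinkCut V) (x p : V) (T' : LinkCut V) : Prop :=
  ∃ b, ((T.push p).push x).child b p = some x ∧ T' = ((T.push p).push x).rotate b x p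

theorem rotStep_ctx (hw : T.WellFormed) {x p : V} {b : Bool}
    (hb : ((T.push p).push x).child b p = some x) : RotCtx ((T.push p).push x) b x p :=
  ⟨(hw.push p).push x, hb⟩

theorem not_isChild_parent (hw : T.WellFormed) {x p : V} (h : T.parent x = some p) :
    ¬ T.IsChild x p := fun h' =>
  hw.pacyclic.not_anc_of_parent h (.of_parent (hw.parent_of_child _ _ h'))

theorem push_push_rev (hw : T.WellFormed) {x p : V} (h : T.parent x = some p) :
    ((T.push p).push x).rev p = false ∧ ((T.push p).push x).rev x = false := by
  refine ⟨?_, push_rev_self _ _⟩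
  rw [push_rev_of_ne (hw.pacyclic.ne_of_parent h).symm, push_rev_self]
  exact not_isChild_parent (hw.push p) (by simpa using h)

theorem RotStep.parent {x p : V} (hw : T.WellFormed) (h : RotStep T x p T') :
    T.parent x = some p := by
  obtain ⟨b, hb, -⟩ := h
  simpa using (rotStep_ctx hw hb).parent_x

theorem RotStep.restructures {x p y : V} (hw : T.WellFormed) (h : RotStep T x p T')
    (hy : PAnc T.parent y x) : Restructures y T T' := by
  have hpar := h.parent hw
  obtain ⟨b, hb, rfl⟩ := h
  have h₁ := Restructures.push hw (x := y) (hy.trans (.of_parent hpar))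
  have h₂ := Restructures.push (hw.push p) (x := y) (v := x) (by simpa using hy)
  obtain ⟨r₁, r₂⟩ := push_push_rev hw hpar
  exact (h₁.trans h₂).trans ((rotStep_ctx hw hb).restructures (by simpa using hy) r₁ r₂)

theorem RotStep.depth {x p : V} (hw : T.WellFormed) (h : RotStep T x p T') {d : ℕ}
    (hd : PDepth T.parent p d) : PDepth T'.parent x d := by
  obtain ⟨b, hb, rfl⟩ := h
  exact (rotStep_ctx hw hb).depth (by simpa using hd)

theorem RotStep.isAuxRoot {x p : V} (hw : T.WellFormed) (h : RotStep T x p T')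
    (hp : T.IsAuxRoot p) : T'.IsAuxRoot x := by
  obtain ⟨b, hb, rfl⟩ := h
  exact (rotStep_ctx hw hb).isAuxRoot_rotate (push_isAuxRoot.2 (push_isAuxRoot.2 hp))

/-- The new size of `x` equals the old size of `p`, so these two terms cancel, and the new size of
`p` is at most the new size of `x`. Nothing is left to pay for the rotation itself; it occurs at
most once per splay. -/
theorem RotStep.zig {x p : V} (hw : T.WellFormed) (h : RotStep T x p T') {sz : V → ℕ}
    (hs : IsSize T.parent sz) : ∃ sz', IsSize T'.parent sz' ∧
      (∀ w, w ≠ x → w ≠ p → sz' w = sz w) ∧ lg (sz x) ≤ lg (sz' x) ∧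
      potential sz' ≤ potential sz + (lg (sz' x) - lg (sz x)) ∧ sz' x = sz p := by
  obtain ⟨b, hb, rfl⟩ := h
  have hc := rotStep_ctx hw hb
  obtain ⟨sz', h₁, h₂, h₃, h₄⟩ := hc.isSize (sz := sz) (by simpa using hs)
  have hx := hs.child_lt (by simpa using hc.parent_x)
  refine ⟨sz', h₁, h₃, lg_mono (hs.pos x) (by omega), ?_, h₂⟩
  have hp := potential_of_eq_off (sz := sz) (sz' := sz') {x, p} (by
    intro v hv
    simp only [Finset.mem_insert, Finset.mem_singleton, not_or] at hv
    exact h₃ v hv.1 hv.2)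
  rw [Finset.sum_pair hc.ne, h₂] at hp
  have hpx : (((T.push p).push x).rotate b x p).parent p = some x := by
    simp [rotate, hc.ne.symm]
  have := lg_mono (h₁.pos p) (Nat.le_of_succ_le (h₁.child_lt hpx))
  rw [h₂] at this ⊢
  linarith

/-- As `sz' x = sz g`, the change of potential is lg(sz' p) + lg(sz' g) − lg(sz x) − lg(sz p). In a
double rotation two of the subtrees involved are disjoint within the new subtree of `x`: the old one
of `x` and the new one of `g` on equal sides, the new ones of `p` and `g` otherwise. Applying
`lg_add_lg` to this pair yields the gain of 2. -/
theorem potential_zigzig {sz sz' : V → ℕ} {x p g : V} (hxp : x ≠ p) (hxg : x ≠ g) (hpg : p ≠ g)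
    (hx : 1 ≤ sz x) (hxp' : sz x ≤ sz p) (hg : 1 ≤ sz' g) (hp : 1 ≤ sz' p) (hxg' : sz' x = sz g)
    (hoff : ∀ w, w ≠ x → w ≠ p → w ≠ g → sz' w = sz w)
    (h : (sz x + sz' g ≤ sz' x ∧ sz' p ≤ sz' x) ∨ sz' p + sz' g ≤ sz' x) (hxx : sz x ≤ sz' x) :
    potential sz' + 2 ≤ potential sz + 3 * (lg (sz' x) - lg (sz x)) := by
  have h₁ := potential_of_eq_off (sz := sz) (sz' := sz') {x, p, g} (by
    intro v hv
    simp only [Finset.mem_insert, Finset.mem_singleton, not_or] at hv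
    exact hoff v hv.1 hv.2.1 hv.2.2)
  rw [Finset.sum_insert (by simp [hxp, hxg]), Finset.sum_pair hpg, ← hxg'] at h₁
  have h₂ := lg_mono hx hxp'
  have h₃ := lg_mono hx hxx
  rcases h with ⟨h, h'⟩ | h
  · have h₄ := lg_add_lg hx hg h
    have h₅ := lg_mono hp h'
    linarith
  · have h₄ := lg_add_lg hp hg h
    linarith

/-- Resolving a set bit would exchange the sides. With the bit of `p` already cleared, the side seen
before the step is the side of the rotation, so the shape of a double step can be decided before its
first rotation. -/
theorem RotStep.of_clean {x p : V} {b : Bool} (hw : T.WellFormed) (h : RotStep T x p T')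
    (hb : T.child b p = some x) (hp : T.rev p = false) :
    RotCtx (T.push x) b x p ∧ T' = (T.push x).rotate b x p := by
  obtain ⟨c, hc, rfl⟩ := h
  rw [push_of_not_rev hp] at hc ⊢
  have hxp : p ≠ x := (hw.pacyclic.ne_of_parent (hw.parent_child hb)).symm
  have hb' : (T.push x).child b p = some x := by rwa [push_child_of_ne hxp]
  have : c = b := by
    by_contra hcb
    have hcb : c = !b := by cases c <;> cases b <;> simp_all
    subst hcb
    exact (hw.push x).child_not hb' hc
  subst this
  exact ⟨⟨hw.push x, hc⟩, rfl⟩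

/-- Two rotations at a grandchild `x` on the same side. -/
theorem zigzig {b : Bool} {x p g : V} (hw : T.WellFormed) (hg : T.child b g = some p)
    (hp : T.child b p = some x) (rg : T.rev g = false) (rp : T.rev p = false)
    (h₁ : RotStep T p g T') (h₂ : RotStep T' x p T'') {sz : V → ℕ} (hs : IsSize T.parent sz) :
    (∃ sz', IsSize T''.parent sz' ∧ sz' x = sz g ∧ (∀ w, w ≠ x → w ≠ p → w ≠ g → sz' w = sz w) ∧
      potential sz' + 2 ≤ potential sz + 3 * (lg (sz' x) - lg (sz x))) ∧
    ∀ d, PDepth T.parent g d → PDepth T''.parent x d := by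
  obtain ⟨c₁, e₁⟩ := h₁.of_clean hw hg rg
  rw [push_of_not_rev rp] at c₁ e₁
  subst e₁
  have hw' := c₁.wf_rotate
  have ppx := hw.parent_child hp
  have ppg := hw.parent_child hg
  have hxp := hw.pacyclic.ne_of_parent ppx
  have hpg := hw.pacyclic.ne_of_parent ppg
  have hxg : x ≠ g := by
    rintro rfl
    exact c₁.parent_p_ne_x ppx
  have hp' : (T.rotate b p g).child b p = some x := by
    rw [rotate_child, if_neg hpg]; simp [hp]
  obtain ⟨c₂, e₂⟩ := h₂.of_clean hw' hp' rp
  obtain ⟨s₁, i₁, a₁, a₂, a₃⟩ := c₁.isSize hs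
  obtain ⟨s₂, i₂, b₁, b₂, b₃⟩ := c₂.isSize (sz := s₁) (by simpa using i₁)
  have hx₁ : s₁ x = sz x := a₂ x hxp hxg
  have hg₂ : s₂ g = s₁ g := b₂ g hxg.symm hpg.symm
  constructor
  · have hoff : ∀ w, w ≠ x → w ≠ p → w ≠ g → s₂ w = sz w := fun w w₁ w₂ w₃ => by
      rw [b₂ w w₁ w₂, a₂ w w₂ w₃]
    refine ⟨s₂, e₂ ▸ i₂, by rw [b₁, a₁], hoff, ?_⟩
    have hxlp := hs.child_lt ppx
    have hplg := hs.child_lt ppg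
    -- `x` and its sibling lie below `p`. Therefore the old subtree of `x` and the new subtree of
    -- `g`, which receives the sibling, fit together into the old subtree of `g`.
    have hβ : sz x + (T.child (!b) p).elim 0 sz ≤ sz p := by
      cases hc : T.child (!b) p with
      | none => simp; omega
      | some c =>
        have hxc : x ≠ c := by rintro rfl; exact hw.child_not hp hc
        have := hs.siblings ppx (hw.parent_child hc) hxc
        simp; omega
    have hp₂ : s₂ p + 1 ≤ s₂ x := i₂.child_lt (by simp [rotate, hxp.symm])
    refine potential_zigzig hxp hxg hpg (hs.pos x) (by omega) (i₂.pos g) (i₂.pos p)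
      (by rw [b₁, a₁]) hoff (.inl ⟨?_, by omega⟩) (by omega)
    rw [b₁, a₁, hg₂]
    omega
  · intro d hd
    exact h₂.depth hw' (c₁.depth hd)

/-- Two rotations at a grandchild `x` on different sides. -/
theorem zigzag {b : Bool} {x p g : V} (hw : T.WellFormed) (hg : T.child (!b) g = some p)
    (hp : T.child b p = some x) (rg : T.rev g = false) (rp : T.rev p = false)
    (h₁ : RotStep T x p T') (h₂ : RotStep T' x g T'') {sz : V → ℕ} (hs : IsSize T.parent sz) :
    (∃ sz', IsSize T''.parent sz' ∧ sz' x = sz g ∧ (∀ w, w ≠ x → w ≠ p → w ≠ g → sz' w = sz w) ∧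
      potential sz' + 2 ≤ potential sz + 3 * (lg (sz' x) - lg (sz x))) ∧
    ∀ d, PDepth T.parent g d → PDepth T''.parent x d := by
  obtain ⟨c₁, e₁⟩ := h₁.of_clean hw hp rp
  have hw' : T'.WellFormed := e₁ ▸ c₁.wf_rotate
  have ppx := hw.parent_child hp
  have ppg := hw.parent_child hg
  have hxp := hw.pacyclic.ne_of_parent ppx
  have hpg := hw.pacyclic.ne_of_parent ppg
  have hxg : x ≠ g := by
    rintro rfl
    exact hw.pacyclic.not_anc_of_parent ppx (.of_parent ppg)
  have hg' : T'.child (!b) g = some x := by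
    rw [e₁, rotate_child, if_neg hpg.symm, if_neg hxg.symm, push_child_of_ne hxg.symm]
    simp [hg]
  have rg' : T'.rev g = false := by
    rw [e₁]
    change (T.push x).rev g = false
    rw [push_rev_of_ne hxg.symm, rg]
    intro hc
    have := hw.parent_of_child _ _ hc
    exact hw.pacyclic.not_anc_of_parent this ((PAnc.of_parent ppx).trans (.of_parent ppg))
  have rx' : T'.rev x = false := by
    rw [e₁]
    exact push_rev_self T x
  obtain ⟨c₂, e₂⟩ := h₂.of_clean hw' hg' rg'
  rw [push_of_not_rev rx'] at c₂ e₂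
  obtain ⟨s₁, i₁, a₁, a₂, a₃⟩ := c₁.isSize (sz := sz) (by simpa using hs)
  rw [← e₁] at i₁
  obtain ⟨s₂, i₂, b₁, b₂, b₃⟩ := c₂.isSize (sz := s₁) i₁
  rw [← e₂] at i₂
  constructor
  · have hoff : ∀ w, w ≠ x → w ≠ p → w ≠ g → s₂ w = sz w := fun w w₁ w₂ w₃ => by
      rw [b₂ w w₁ w₃, a₂ w w₁ w₂]
    refine ⟨s₂, i₂, by rw [b₁, a₂ g hxg.symm hpg.symm], hoff, ?_⟩
    have hxlp := hs.child_lt ppx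
    have hplg := hs.child_lt ppg
    have hg₁ : s₁ g = sz g := a₂ g hxg.symm hpg.symm
    have pg : T''.parent g = some x := by rw [e₂]; simp [rotate, hxg.symm]
    have pp : T''.parent p = some x := by
      have hcp : T'.child (!b) x = some p := by rw [e₁, rotate_child]; simp [hxp]
      have hcp' : T'.child b x ≠ some p := by simpa using hw'.child_not hcp
      rw [e₂]
      simp only [rotate, hxp.symm, if_false, hpg, Bool.not_not, hcp']
      exact hw'.parent_child hcp
    refine potential_zigzig hxp hxg hpg (hs.pos x) (by omega) (i₂.pos g) (i₂.pos p)
      (by rw [b₁, hg₁]) hoff (.inr (Nat.le_of_succ_le (i₂.siblings pp pg hpg))) (by omega)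
  · intro d hd
    -- The depth of `g` after the first rotation is read off from that of `x`, whose parent it then
    -- is.
    refine h₂.depth hw' ?_
    have hx' := h₁.depth hw (.step ppg hd)
    cases hx' with
    | step h₃ h₄ =>
      obtain rfl := Option.some.inj (h₃.symm.trans (hw'.parent_child hg'))
      exact h₄

end LinkCut

/-! ### Programs on link-cut structures -/

/-- Registers that hold pointers; the first groups are the scratch registers of the subroutines. -/
inductive LReg where
  | pl | pr | pf
  | rp | rg | rb | rc
  | sp | sg | sc | sd | se
  | aa | ab
  | u | v | w | o
  deriving DecidableEq

/-- Scratch registers of a subroutine are overwritten by the subroutines of higher levels. -/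
def LReg.level : LReg → ℕ
  | .pl | .pr | .pf => 0
  | .rp | .rg | .rb | .rc => 1
  | .sp | .sg | .sc | .sd | .se => 2
  | .aa | .ab => 3
  | .u | .v | .w | .o => 4

/-- Primitive operations on a link-cut structure and pointer registers. -/
inductive LPrim where
  | move (d s : LReg)
  | null (d : LReg)
  | getParent (d a : LReg)
  | getChild (b : Bool) (d a : LReg)
  | setParent (a s : LReg)
  | setChild (b : Bool) (a s : LReg)
  | flip (a : LReg)
  /-- `d := a` if the reversal bit of `a` is set, and `d := null` otherwise -/
  | getRev (d a : LReg)

/-- Tests on pointer registers. -/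
inductive LTest where
  | isNull (a : LReg)
  | notNull (a : LReg)
  | eq (a b : LReg)

/-- A link-cut structure together with pointer registers. -/
structure LState (V : Type) where
  env : LReg → Option V
  T : LinkCut V

namespace LinkCut

variable {V : Type} [DecidableEq V]

/-- Assign the pointer to a left or right child. -/
def setChild (T : LinkCut V) (b : Bool) (v : V) (o : Option V) : LinkCut V :=
  if b then T.setRight v o else T.setLeft v o

@[simp] theorem setChild_child (T : LinkCut V) (b c : Bool) (v w : V) (o : Option V) :
    (T.setChild b v o).child c w = if w = v ∧ c = b then o else T.child c w := by
  cases b <;> cases c <;> by_cases h : w = v <;> simp [setChild, setLeft, setRight, child, h]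

@[simp] theorem setChild_left (T : LinkCut V) (b : Bool) (v w : V) (o : Option V) :
    (T.setChild b v o).left w = if w = v ∧ b = false then o else T.left w := by
  simpa [eq_comm] using T.setChild_child b false v w o

@[simp] theorem setChild_right (T : LinkCut V) (b : Bool) (v w : V) (o : Option V) :
    (T.setChild b v o).right w = if w = v ∧ b = true then o else T.right w := by
  simpa [eq_comm] using T.setChild_child b true v w o

@[simp] theorem setParent_left (T : LinkCut V) (v : V) (o : Option V) :
    (T.setParent v o).left = T.left := rfl

@[simp] theorem setParent_right (T : LinkCut V) (v : V) (o : Option V) :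
    (T.setParent v o).right = T.right := rfl

@[simp] theorem flip_left (T : LinkCut V) (v : V) : (T.flip v).left = T.left := rfl

@[simp] theorem flip_right (T : LinkCut V) (v : V) : (T.flip v).right = T.right := rfl

@[simp] theorem setChild_parent (T : LinkCut V) (b : Bool) (v : V) (o : Option V) :
    (T.setChild b v o).parent = T.parent := by cases b <;> rfl

@[simp] theorem setChild_rev (T : LinkCut V) (b : Bool) (v : V) (o : Option V) :
    (T.setChild b v o).rev = T.rev := by cases b <;> rfl

@[simp] theorem setParent_child (T : LinkCut V) (c : Bool) (v w : V) (o : Option V) :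
    (T.setParent v o).child c w = T.child c w := by cases c <;> rfl

@[simp] theorem setParent_rev (T : LinkCut V) (v : V) (o : Option V) :
    (T.setParent v o).rev = T.rev := rfl

@[simp] theorem setParent_parent (T : LinkCut V) (v w : V) (o : Option V) :
    (T.setParent v o).parent w = if w = v then o else T.parent w := by
  simp [setParent, Function.update_apply]

@[simp] theorem flip_child (T : LinkCut V) (c : Bool) (v w : V) :
    (T.flip v).child c w = T.child c w := by cases c <;> rfl

@[simp] theorem flip_parent (T : LinkCut V) (v : V) : (T.flip v).parent = T.parent := rfl

@[simp] theorem flip_rev (T : LinkCut V) (v w : V) :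
    (T.flip v).rev w = if w = v then !T.rev v else T.rev w := by
  simp [flip, Function.update_apply]

theorem ext_child {T T' : LinkCut V} (hp : ∀ w, T.parent w = T'.parent w)
    (hc : ∀ b w, T.child b w = T'.child b w) (hr : ∀ w, T.rev w = T'.rev w) : T = T' := by
  cases T
  cases T'
  simp only [LinkCut.mk.injEq]
  exact ⟨funext hp, funext (hc false), funext (hc true), funext hr⟩

theorem push_child_self {T : LinkCut V} {v : V} (h : T.rev v = true) (b : Bool) :
    (T.push v).child b v = T.child (!b) v := by
  cases b <;> simp [push, h, child]

end LinkCut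

section Programs

open LinkCut

variable {V : Type} [DecidableEq V]

/-- The meaning of operations and tests. -/
def lcSem (V : Type) [DecidableEq V] : CmdSem (LState V) LPrim LTest where
  pre p a := match p with
    | .move _ _ | .null _ => True
    | .getParent _ x | .getChild _ _ x | .setParent x _ | .setChild _ x _ | .flip x | .getRev _ x =>
      (a.env x).isSome
  act p a := match p with
    | .move d s => { a with env := Function.update a.env d (a.env s) }
    | .null d => { a with env := Function.update a.env d none }
    | .getParent d x => { a with env := Function.update a.env d ((a.env x).bind a.T.parent) }
    | .getChild b d x => { a with env := Function.update a.env d ((a.env x).bind (a.T.child b)) }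
    | .setParent x s => { a with T := (a.env x).elim a.T fun y => a.T.setParent y (a.env s) }
    | .setChild b x s => { a with T := (a.env x).elim a.T fun y => a.T.setChild b y (a.env s) }
    | .flip x => { a with T := (a.env x).elim a.T a.T.flip }
    | .getRev d x => { a with
        env := Function.update a.env d ((a.env x).bind fun y => if a.T.rev y then some y else none) }
  holds b a := match b with
    | .isNull x => a.env x = none
    | .notNull x => a.env x ≠ none
    | .eq x y => a.env x = a.env y

/-- Total correctness of a program on a link-cut structure. -/
def LTri (c : Cmd LPrim LTest) (env : LReg → Option V) (T : LinkCut V)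
    (Q : (LReg → Option V) → LinkCut V → ℕ → Prop) : Prop :=
  CTri (lcSem V) c ⟨env, T⟩ fun a t => Q a.env a.T t

namespace LTri

variable {env : LReg → Option V} {T : LinkCut V} {Q : (LReg → Option V) → LinkCut V → ℕ → Prop}

theorem mono {c : Cmd LPrim LTest} {Q' : (LReg → Option V) → LinkCut V → ℕ → Prop}
    (h : LTri c env T Q') (hQ : ∀ e T' t, Q' e T' t → Q e T' t) : LTri c env T Q :=
  CTri.mono h fun _ _ => hQ _ _ _

theorem skip (h : Q env T 1) : LTri .skip env T Q := CTri.skip h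

theorem seq {c d : Cmd LPrim LTest}
    (h : LTri c env T fun e T₁ t₁ => LTri d e T₁ fun e' T₂ t₂ => Q e' T₂ (t₁ + t₂)) :
    LTri (.seq c d) env T Q := CTri.seq h

theorem move {d s : LReg} (h : Q (Function.update env d (env s)) T 1) :
    LTri (.prim (.move d s)) env T Q := CTri.prim trivial h

theorem null {d : LReg} (h : Q (Function.update env d none) T 1) :
    LTri (.prim (.null d)) env T Q := CTri.prim trivial h

theorem getParent {d a : LReg} {x : V} (ha : env a = some x)
    (h : Q (Function.update env d (T.parent x)) T 1) : LTri (.prim (.getParent d a)) env T Q :=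
  CTri.prim (by simp [lcSem, ha]) (by simpa [lcSem, ha] using h)

theorem getChild {b : Bool} {d a : LReg} {x : V} (ha : env a = some x)
    (h : Q (Function.update env d (T.child b x)) T 1) : LTri (.prim (.getChild b d a)) env T Q :=
  CTri.prim (by simp [lcSem, ha]) (by simpa [lcSem, ha] using h)

theorem setParent {a s : LReg} {x : V} (ha : env a = some x)
    (h : Q env (T.setParent x (env s)) 1) : LTri (.prim (.setParent a s)) env T Q :=
  CTri.prim (by simp [lcSem, ha]) (by simpa [lcSem, ha] using h)

theorem setChild {b : Bool} {a s : LReg} {x : V} (ha : env a = some x)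
    (h : Q env (T.setChild b x (env s)) 1) : LTri (.prim (.setChild b a s)) env T Q :=
  CTri.prim (by simp [lcSem, ha]) (by simpa [lcSem, ha] using h)

theorem flip {a : LReg} {x : V} (ha : env a = some x) (h : Q env (T.flip x) 1) :
    LTri (.prim (.flip a)) env T Q :=
  CTri.prim (by simp [lcSem, ha]) (by simpa [lcSem, ha] using h)

theorem getRev {d a : LReg} {x : V} (ha : env a = some x)
    (h : Q (Function.update env d (if T.rev x then some x else none)) T 1) :
    LTri (.prim (.getRev d a)) env T Q :=
  CTri.prim (by simp [lcSem, ha]) (by simpa [lcSem, ha] using h)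

theorem isNull {a : LReg} {c d : Cmd LPrim LTest}
    (h₁ : env a = none → LTri c env T fun e T' t => Q e T' (t + 1))
    (h₂ : env a ≠ none → LTri d env T fun e T' t => Q e T' (t + 1)) :
    LTri (.ite (.isNull a) c d) env T Q := CTri.ite h₁ h₂

theorem loop_done {a : LReg} {c : Cmd LPrim LTest} (ha : env a = none) (h : Q env T 1) :
    LTri (.loop (.notNull a) c) env T Q := CTri.loop_done (fun h => h ha) h

theorem loop_step {a : LReg} {c : Cmd LPrim LTest} (ha : env a ≠ none)
    (h : LTri c env T fun e T₁ t₁ => LTri (.loop (.notNull a) c) e T₁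
      fun e' T₂ t₂ => Q e' T₂ (t₁ + t₂ + 1)) :
    LTri (.loop (.notNull a) c) env T Q := CTri.loop_step ha h

theorem eq {a b : LReg} {c d : Cmd LPrim LTest}
    (h₁ : env a = env b → LTri c env T fun e T' t => Q e T' (t + 1))
    (h₂ : env a ≠ env b → LTri d env T fun e T' t => Q e T' (t + 1)) :
    LTri (.ite (.eq a b) c d) env T Q := CTri.ite h₁ h₂

end LTri

/-- Resolve the reversal bit of `a`. -/
def pushP (a : LReg) : Cmd LPrim LTest :=
  .seq (.prim (.getRev .pf a)) <| .ite (.isNull .pf) .skip <|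
  .seq (.prim (.getChild false .pl a)) <| .seq (.prim (.getChild true .pr a)) <|
  .seq (.prim (.setChild false a .pr)) <| .seq (.prim (.setChild true a .pl)) <|
  .seq (.prim (.flip a)) <|
  .seq (.ite (.isNull .pl) .skip (.prim (.flip .pl))) (.ite (.isNull .pr) .skip (.prim (.flip .pr)))

variable {env : LReg → Option V} {T : LinkCut V} {Q : (LReg → Option V) → LinkCut V → ℕ → Prop}

theorem pushP_spec {a : LReg} {x : V} (ha : 1 ≤ a.level) (hx : env a = some x) (hw : T.WellFormed)
    (h : ∀ env' t, (∀ r : LReg, 1 ≤ r.level → env' r = env r) → t ≤ 14 → Q env' (T.push x) t) :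
    LTri (pushP a) env T Q := by
  have hframe : ∀ r : LReg, 1 ≤ r.level → r ≠ .pl ∧ r ≠ .pr ∧ r ≠ .pf := by
    intro r hr
    refine ⟨?_, ?_, ?_⟩ <;> rintro rfl <;> simp [LReg.level] at hr
  obtain ⟨h₁, h₂, h₃⟩ := hframe a ha
  refine .seq (.getRev hx (.isNull (fun hn => .skip ?_) fun hn => ?_))
  · have hr : T.rev x = false := by simpa using hn
    have := h (Function.update env .pf none) 3 (fun r hr => by simp [hframe r hr]) (by norm_num)
    rw [push_of_not_rev hr] at this
    simpa [hr] using this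
  · have hr : T.rev x = true := by
      by_contra hr
      simp [hr] at hn
    refine .seq (.getChild (x := x) (by simp [h₃, hx]) ?_)
    refine .seq (.getChild (x := x) (by simp [h₁, h₃, hx]) ?_)
    refine .seq (.setChild (x := x) (by simp [h₁, h₂, h₃, hx]) ?_)
    refine .seq (.setChild (x := x) (by simp [h₁, h₂, h₃, hx]) ?_)
    refine .seq (.flip (x := x) (by simp [h₁, h₂, h₃, hx]) ?_)
    have hl := fun c (hc : T.left x = some c) => hw.parent_child (b := false) hc
    have hrr := fun c (hc : T.right x = some c) => hw.parent_child (b := true) hc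
    have hne : ∀ c, T.parent c = some x → c ≠ x := fun c hc => hw.pacyclic.ne_of_parent hc
    refine .seq ?_
    -- the final structure, whichever of the children exist
    have hfin : ∀ env' (T' : LinkCut V) t, (∀ r : LReg, 1 ≤ r.level → env' r = env r) → t ≤ 14 →
        (∀ w, T'.parent w = T.parent w) →
        (∀ b w, T'.child b w = if w = x then T.child (!b) x else T.child b w) →
        (∀ w, T'.rev w = if w = x then false else
          if T.left x = some w ∨ T.right x = some w then !T.rev w else T.rev w) → Q env' T' t := by
      intro env' T' t f b h₁ h₂ h₃
      suffices T' = T.push x by rw [this]; exact h env' t f b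
      refine ext_child (by simpa using h₁) (fun b w => ?_) fun w => ?_
      · rw [h₂]
        split_ifs with hwx
        · rw [hwx, push_child_self hr]
        · rw [push_child_of_ne hwx]
      · rw [h₃]; simp [push, hr]
    cases cl : T.left x with
    | none =>
      refine .isNull (fun _ => .skip ?_) (fun h => absurd (by simp [cl]) h)
      cases cr : T.right x with
      | none =>
        refine .isNull (fun _ => .skip ?_) (fun h => absurd (by simp [cr]) h)
        refine hfin _ _ _ (fun r hr => by simp [hframe r hr]) (by norm_num) (by simp)
          (fun b w => ?_) (fun w => ?_)
        · by_cases hwx : w = x <;> cases b <;> simp [hwx, cl, cr]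
        · by_cases hwx : w = x <;> simp [hwx, cl, cr, hr]
      | some d =>
        refine .isNull (fun h => absurd h (by simp [cr])) (fun _ => .flip (x := d) (by simp [cr]) ?_)
        have hd := hne d (hrr d cr)
        refine hfin _ _ _ (fun r hr => by simp [hframe r hr]) (by norm_num) (by simp)
          (fun b w => ?_) (fun w => ?_)
        · by_cases hwx : w = x <;> cases b <;> simp [hwx, cl, cr]
        · by_cases hwx : w = x
          · subst hwx; simp [hd.symm, hr]
          · by_cases hwd : w = d
            · subst hwd; simp [hwx, cr]
            · simp [hwx, cl, cr, hwd, Ne.symm hwd]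
    | some c =>
      have hc := hne c (hl c cl)
      refine .isNull (fun h => absurd h (by simp [cl])) (fun _ => .flip (x := c) (by simp [cl]) ?_)
      cases cr : T.right x with
      | none =>
        refine .isNull (fun _ => .skip ?_) (fun h => absurd (by simp [cr]) h)
        refine hfin _ _ _ (fun r hr => by simp [hframe r hr]) (by norm_num) (by simp)
          (fun b w => ?_) (fun w => ?_)
        · by_cases hwx : w = x <;> cases b <;> simp [hwx, cl, cr]
        · by_cases hwx : w = x
          · subst hwx; simp [hc.symm, hr]
          · by_cases hwc : w = c
            · subst hwc; simp [hwx, cl]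
            · simp [hwx, cl, cr, hwc, Ne.symm hwc]
      | some d =>
        refine .isNull (fun h => absurd h (by simp [cr])) (fun _ => .flip (x := d) (by simp [cr]) ?_)
        have hd := hne d (hrr d cr)
        have hcd : c ≠ d := by rintro rfl; exact hw.left_ne_right _ _ cl cr
        refine hfin _ _ _ (fun r hr => by simp [hframe r hr]) (by norm_num) (by simp)
          (fun b w => ?_) (fun w => ?_)
        · by_cases hwx : w = x <;> cases b <;> simp [hwx, cl, cr]
        · by_cases hwx : w = x
          · subst hwx; simp [hc.symm, hd.symm, hr]
          · by_cases hwc : w = c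
            · subst hwc; simp [hwx, cl, hcd]
            · by_cases hwd : w = d
              · subst hwd; simp [hwx, cr, hcd.symm]
              · simp [hwx, cl, cr, hwc, hwd, Ne.symm hwc, Ne.symm hwd]

/-- Make `a` instead of `rp` a child of `rg`, if `rp` is one. -/
def replaceP (a : LReg) : Cmd LPrim LTest :=
  .ite (.isNull .rg) .skip <| .seq (.prim (.getChild false .rc .rg)) <|
  .ite (.eq .rc .rp) (.prim (.setChild false .rg a)) <| .seq (.prim (.getChild true .rc .rg)) <|
  .ite (.eq .rc .rp) (.prim (.setChild true .rg a)) .skip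

/-- If the pointer from `p` to `g` is a path-parent pointer, neither child of `g` is `p` and nothing
is written, as it should be. `hlr` ensures that at most one child pointer needs replacement. -/
theorem replaceP_spec {a : LReg} {x p : V} (ha : 2 ≤ a.level) (hx : env a = some x)
    (hp : env .rp = some p) (hlr : ∀ g, T.left g = some p → T.right g ≠ some p)
    (h : ∀ env' T' t, (∀ r : LReg, r ≠ .rc → env' r = env r) → t ≤ 6 →
      (∀ w, T'.parent w = T.parent w) → (∀ w, T'.rev w = T.rev w) →
      (∀ b w, T'.child b w =
        if env .rg = some w ∧ T.child b w = some p then some x else T.child b w) → Q env' T' t) :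
    LTri (replaceP a) env T Q := by
  have har : a ≠ .rc := by rintro rfl; simp [LReg.level] at ha
  refine .isNull (fun hn => .skip (h _ _ _ (fun _ _ => rfl) (by norm_num) (by simp) (by simp)
    (by simp [hn]))) fun hn => ?_
  obtain ⟨g, hg⟩ := Option.ne_none_iff_exists'.1 hn
  refine .seq (.getChild hg (.eq (fun he => ?_) fun he => .seq (.getChild (x := g) (by simpa) ?_)))
  · refine .setChild (x := g) (by simpa) (h _ _ _ (fun r hr => by simp [hr]) (by norm_num) (by simp)
      (by simp) ?_)
    have he : T.left g = some p := by simpa [hp] using he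
    intro b w
    by_cases hwg : w = g
    · subst hwg
      have := hlr _ he
      cases b <;> simp [hg, he, har, hx, this]
    · simp [hg, hwg, Ne.symm hwg]
  · have he : T.left g ≠ some p := by simpa [hp] using he
    refine .eq (fun he' => ?_) fun he' => .skip ?_
    · refine .setChild (x := g) (by simpa) (h _ _ _ (fun r hr => by simp [hr]) (by norm_num)
        (by simp) (by simp) ?_)
      have he' : T.right g = some p := by simpa [hp] using he'
      intro b w
      by_cases hwg : w = g
      · subst hwg
        cases b <;> simp [hg, he, he', har, hx]
      · simp [hg, hwg, Ne.symm hwg]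
    · have he' : T.right g ≠ some p := by simpa [hp] using he'
      refine h _ _ _ (fun r hr => by simp [hr]) (by norm_num) (by simp) (by simp) ?_
      intro b w
      by_cases hwg : w = g
      · subst hwg
        cases b <;> simp [he, he']
      · simp [hg, Ne.symm hwg]

/-- Rotate `a` over its parent `rp`, whose parent is `rg`, where `a` is the child at the side `b`. -/
def rotateP (b : Bool) (a : LReg) : Cmd LPrim LTest :=
  .seq (.prim (.getChild (!b) .rb a)) <| .seq (.prim (.setChild b .rp .rb)) <|
  .seq (.ite (.isNull .rb) .skip (.prim (.setParent .rb .rp))) <|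
  .seq (.prim (.setChild (!b) a .rp)) <| .seq (replaceP a) <|
  .seq (.prim (.setParent .rp a)) (.prim (.setParent a .rg))

theorem rotateP_spec {a : LReg} {b : Bool} {x p : V} (ha : 2 ≤ a.level) (hx : env a = some x)
    (hp : env .rp = some p) (hg : env .rg = T.parent p) (hc : RotCtx T b x p)
    (h : ∀ env' t, (∀ r : LReg, 2 ≤ r.level → env' r = env r) → t ≤ 14 →
      Q env' (T.rotate b x p) t) :
    LTri (rotateP b a) env T Q := by
  have hframe : ∀ r : LReg, 2 ≤ r.level → r ≠ .rp ∧ r ≠ .rg ∧ r ≠ .rb ∧ r ≠ .rc := by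
    intro r hr
    refine ⟨?_, ?_, ?_, ?_⟩ <;> rintro rfl <;> simp [LReg.level] at hr
  obtain ⟨h₁, h₂, h₃, h₄⟩ := hframe a ha
  have hxp := hc.ne
  refine .seq (.getChild hx ?_)
  refine .seq (.setChild (x := p) (by simp [hp]) ?_)
  refine .seq ?_
  have e₁ : Function.update env .rb (T.child (!b) x) a = some x := by simp [h₃, hx]
  have e₂ : Function.update env .rb (T.child (!b) x) .rp = some p := by simp [hp]
  have e₃ : Function.update env .rb (T.child (!b) x) .rb = T.child (!b) x := by simp
  have e₄ : Function.update env .rb (T.child (!b) x) .rg = T.parent p := by simp [hg]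
  have e₅ : ∀ r, 2 ≤ r.level → Function.update env .rb (T.child (!b) x) r = env r := by
    intro r hr; simp [hframe r hr]
  generalize Function.update env .rb (T.child (!b) x) = env₁ at e₁ e₂ e₃ e₄ e₅ ⊢
  -- the structure after the subtree between `x` and `p` was handed over
  suffices key : ∀ (A : LinkCut V) (t : ℕ), t ≤ 2 →
      (∀ w, A.parent w = if T.child (!b) x = some w then some p else T.parent w) →
      (∀ w, A.rev w = T.rev w) →
      (∀ c w, A.child c w = if w = p ∧ c = b then T.child (!b) x else T.child c w) →
      LTri (.seq (.prim (.setChild (!b) a .rp)) <| .seq (replaceP a) <|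
        .seq (.prim (.setParent .rp a)) (.prim (.setParent a .rg))) env₁ A
        fun e T' t' => Q e T' (1 + (1 + (t + t'))) by
    cases hβ : T.child (!b) x with
    | none =>
      refine .isNull (fun _ => .skip (key _ _ le_rfl ?_ ?_ ?_)) fun h => absurd (by rw [e₃, hβ]) h
      · simp [hβ]
      · simp
      · intro c w; simp [e₃]
    | some β =>
      refine .isNull (fun h => absurd h (by simp [e₃, hβ]))
        fun _ => .setParent (x := β) (by rw [e₃, hβ]) (key _ _ le_rfl ?_ ?_ ?_)
      · intro w
        by_cases hw : w = β
        · subst hw; simp [hβ, e₂]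
        · simp [hβ, hw, Ne.symm hw]
      · simp
      · intro c w; simp [e₃]
  intro A t ht hA₁ hA₂ hA₃
  refine .seq (.setChild e₁ (.seq (replaceP_spec ha e₁ e₂ ?_ ?_)))
  · intro g hl hr
    rw [← child_false] at hl
    rw [← child_true] at hr
    rw [setChild_child, hA₃, e₂] at hl hr
    by_cases hgx : g = x
    · subst hgx
      cases b
      · simp [hxp] at hl
        exact hc.child_x_ne_p (c := false) hl
      · simp [hxp] at hr
        exact hc.child_x_ne_p (c := true) hr
    · by_cases hgp : g = p
      · subst hgp
        have n₁ := hc.child_p_ne (c := false)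
        have n₂ := hc.child_p_ne (c := true)
        cases b <;> simp [hgx] at hl hr n₁ n₂ <;> contradiction
      · simp [hgx, hgp] at hl hr
        exact hc.wf.left_ne_right _ _ hl hr
  · intro env₂ B t₂ f₁ f₂ hB₁ hB₂ hB₃
    have g₁ : env₂ a = some x := by rw [f₁ a h₄, e₁]
    have g₂ : env₂ .rp = some p := by rw [f₁ _ (by simp), e₂]
    have g₃ : env₂ .rg = T.parent p := by rw [f₁ _ (by simp), e₄]
    refine .seq (.setParent g₂ (.setParent g₁ ?_))
    have : (B.setParent p (env₂ a)).setParent x (env₂ .rg) = T.rotate b x p := by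
      refine ext_child (fun w => ?_) (fun c w => ?_) fun w => ?_
      · rw [g₁, g₃]
        simp only [setParent_parent, hB₁, setChild_parent, hA₁, rotate]
      · rw [setParent_child, setParent_child, hB₃, setChild_child, hA₃, rotate_child, e₄, e₂]
        by_cases hwp : w = p
        · subst hwp
          by_cases hcb : c = b
          · simp [hc.parent_p_ne_p, hcb, hxp.symm]
          · simp [hc.parent_p_ne_p, hcb, hxp.symm]
        · by_cases hwx : w = x
          · subst hwx
            have : ∀ c, (c = !b) ↔ ¬ c = b := by intro c; cases c <;> cases b <;> simp
            by_cases hcb : c = b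
            · simp [hc.parent_p_ne_x, hxp, hcb]
            · simp [hc.parent_p_ne_x, hxp, this, hcb]
          · by_cases hcp : T.child c w = some p
            · simp [hwp, hwx, hcp, hc.wf.parent_child hcp]
            · simp [hwp, hwx, hcp]
      · simp [hB₂, hA₂, rotate]
    rw [this]
    exact h _ _ (fun r hr => by rw [f₁ r (hframe r hr).2.2.2, e₅ r hr]) (by omega)

/-- Resolve the reversal bits of the parent of `a` and of `a`, and rotate `a` over its parent. -/
def rotP (a : LReg) : Cmd LPrim LTest :=
  .seq (.prim (.getParent .rp a)) <| .seq (pushP .rp) <| .seq (pushP a) <|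
  .seq (.prim (.getParent .rg .rp)) <| .seq (.prim (.getChild false .rc .rp)) <|
  .ite (.eq .rc a) (rotateP false a) (rotateP true a)

theorem rotP_spec {a : LReg} {x p : V} (ha : 2 ≤ a.level) (hx : env a = some x)
    (hw : T.WellFormed) (hp : T.IsChild p x)
    (h : ∀ env' T' t, (∀ r : LReg, 2 ≤ r.level → env' r = env r) → t ≤ 50 → RotStep T x p T' →
      Q env' T' t) : LTri (rotP a) env T Q := by
  have hframe : ∀ r : LReg, 2 ≤ r.level → r ≠ .rp ∧ r ≠ .rg ∧ r ≠ .rb ∧ r ≠ .rc := by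
    intro r hr
    refine ⟨?_, ?_, ?_, ?_⟩ <;> rintro rfl <;> simp [LReg.level] at hr
  have hl : ∀ r : LReg, 2 ≤ r.level → 1 ≤ r.level := fun r hr => by omega
  obtain ⟨h₁, h₂, h₃, h₄⟩ := hframe a ha
  refine .seq (.getParent hx ?_)
  rw [hw.parent_of_child _ _ hp]
  refine .seq (pushP_spec (x := p) (by simp [LReg.level]) (by simp) hw fun env₁ t₁ f₁ b₁ => ?_)
  refine .seq (pushP_spec (x := x) (by omega) (by rw [f₁ a (by omega)]; simp [h₁, hx])
    (hw.push p) fun env₂ t₂ f₂ b₂ => ?_)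
  have g₁ : env₂ a = some x := by rw [f₂ a (by omega), f₁ a (by omega)]; simp [h₁, hx]
  have g₂ : env₂ .rp = some p := by
    rw [f₂ _ (by simp [LReg.level]), f₁ _ (by simp [LReg.level])]; simp
  have g₃ : ∀ r : LReg, 2 ≤ r.level → env₂ r = env r := fun r hr => by
    rw [f₂ r (by omega), f₁ r (by omega)]; simp [hframe r hr]
  refine .seq (.getParent g₂ (.seq (.getChild (x := p) (by simpa) ?_)))
  set T₂ := (T.push p).push x with hT₂
  have hw₂ : T₂.WellFormed := (hw.push p).push x
  have hc : T₂.IsChild p x := push_isChild.2 (push_isChild.2 hp)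
  refine .eq (fun he => ?_) (fun he => ?_)
  · have he : T₂.child false p = some x := by simpa [h₂, h₄, g₁] using he
    refine rotateP_spec (x := x) (p := p) ha (by simp [h₂, h₄, g₁]) (by simp [g₂]) (by simp)
      ⟨hw₂, he⟩ fun env' t f b => h _ _ _ (fun r hr => ?_) (by omega) ⟨_, he, rfl⟩
    rw [f r hr]
    simp [hframe r hr, g₃ r hr]
  · have he : T₂.child true p = some x := by
      have he : T₂.child false p ≠ some x := by simpa [h₂, h₄, g₁] using he
      exact hc.resolve_left he
    refine rotateP_spec (x := x) (p := p) ha (by simp [h₂, h₄, g₁]) (by simp [g₂]) (by simp)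
      ⟨hw₂, he⟩ fun env' t f b => h _ _ _ (fun r hr => ?_) (by omega) ⟨_, he, rfl⟩
    rw [f r hr]
    simp [hframe r hr, g₃ r hr]

end Programs

/-! ### Splaying -/

section Programs

open LinkCut

variable {V : Type} [DecidableEq V]
variable {env : LReg → Option V} {T : LinkCut V} {Q : (LReg → Option V) → LinkCut V → ℕ → Prop}

/-- Set `f` to the parent of `a` in its auxiliary tree, if there is one. -/
def auxParentP (f a : LReg) : Cmd LPrim LTest :=
  .seq (.prim (.getParent .sp a)) <| .seq (.prim (.null f)) <| .ite (.isNull .sp) .skip <|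
  .seq (.prim (.getChild false .sc .sp)) <| .ite (.eq .sc a) (.prim (.move f .sp)) <|
  .seq (.prim (.getChild true .sc .sp)) <| .ite (.eq .sc a) (.prim (.move f .sp)) .skip

/-- A parent pointer does not reveal whether it belongs to an auxiliary tree or is a path-parent
pointer. The child pointers of its target decide, and reversal bits are irrelevant because they
exchange the children without changing their set. -/
theorem auxParentP_spec {f a : LReg} {x : V} (hx : env a = some x) (hw : T.WellFormed)
    (hfa : a ≠ f) (ha : a ≠ .sp ∧ a ≠ .sc) (hf : f ≠ .sp ∧ f ≠ .sc)
    (h : ∀ env' t, (∀ r : LReg, r ≠ f → r ≠ .sp → r ≠ .sc → env' r = env r) → t ≤ 10 →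
      (∀ p, env' f = some p ↔ T.IsChild p x) → Q env' T t) : LTri (auxParentP f a) env T Q := by
  obtain ⟨ha₁, ha₂⟩ := ha
  obtain ⟨hf₁, hf₂⟩ := hf
  refine .seq (.getParent hx (.seq (.null (.isNull (fun hn => .skip ?_) fun hn => ?_))))
  · have hn : T.parent x = none := by simpa [hf₁.symm] using hn
    refine h _ _ (fun r h₁ h₂ h₃ => by simp [h₁, h₂]) (by norm_num) fun p => ?_
    simp only [Function.update_self, reduceCtorEq, false_iff]
    intro hp
    simp [hw.parent_of_child _ _ hp] at hn
  · obtain ⟨q, hq⟩ := Option.ne_none_iff_exists'.1 hn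
    have hq' : T.parent x = some q := by simpa [hf₁.symm] using hq
    have huniq : ∀ p, T.IsChild p x → p = q := fun p hp =>
      Option.some.inj ((hw.parent_of_child _ _ hp).symm.trans hq')
    refine .seq (.getChild hq (.eq (fun he => .move ?_) fun he => .seq (.getChild (x := q) ?_
      (.eq (fun he' => .move ?_) fun he' => .skip ?_))))
    · have he : T.left q = some x := by simpa [ha₂, hfa, ha₁, hx] using he
      refine h _ _ (fun r h₁ h₂ h₃ => by simp [h₁, h₂, h₃]) (by norm_num) fun p => ?_
      simp only [Function.update_self, ne_eq, reduceCtorEq, not_false_eq_true,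
        Function.update_of_ne, hf₁.symm, hq', Option.some.injEq]
      exact ⟨fun hpq => hpq ▸ .inl he, fun hp => (huniq p hp).symm⟩
    · simpa [hf₁.symm] using hq
    · have he' : T.right q = some x := by simpa [ha₂, hfa, ha₁, hx] using he'
      refine h _ _ (fun r h₁ h₂ h₃ => by simp [h₁, h₂, h₃]) (by norm_num) fun p => ?_
      simp only [Function.update_self, ne_eq, reduceCtorEq, not_false_eq_true,
        Function.update_of_ne, hf₁.symm, hq', Option.some.injEq]
      exact ⟨fun hpq => hpq ▸ .inr he', fun hp => (huniq p hp).symm⟩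
    · have he : T.left q ≠ some x := by simpa [ha₂, hfa, ha₁, hx] using he
      have he' : T.right q ≠ some x := by simpa [ha₂, hfa, ha₁, hx] using he'
      refine h _ _ (fun r h₁ h₂ h₃ => by simp [h₁, h₂, h₃]) (by norm_num) fun p => ?_
      simp only [ne_eq, hf₂, not_false_eq_true, Function.update_of_ne, Function.update_self,
        reduceCtorEq, false_iff]
      intro hp
      obtain rfl := huniq p hp
      exact hp.elim he he'

/-- The two rotations of a splaying step at `a`, where `sd` and `se` are the parent and the
grandparent of `a` in the auxiliary tree. -/
def doubleP (a : LReg) : Cmd LPrim LTest :=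
  .seq (pushP .se) <| .seq (pushP .sd) <|
  .seq (.prim (.getChild false .sc .se)) <| .seq (.prim (.getChild false .sp .sd)) <|
  .ite (.eq .sc .sd)
    (.ite (.eq .sp a) (.seq (rotP .sd) (rotP a)) (.seq (rotP a) (rotP a)))
    (.ite (.eq .sp a) (.seq (rotP a) (rotP a)) (.seq (rotP .sd) (rotP a)))

variable [Fintype V]

/-- The bits at `g` and `p` are resolved from the top down before sides are compared, because a bit
at `g` toggles the one at `p`. After that `zigzig` or `zigzag` applies, and the further resolutions
inside the rotations do not alter the decision. -/
theorem doubleP_spec {a : LReg} {x p g : V} {sz : V → ℕ} (ha : 3 ≤ a.level) (hx : env a = some x)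
    (hp : env .sd = some p) (hg : env .se = some g) (hw : T.WellFormed) (hpx : T.IsChild p x)
    (hgp : T.IsChild g p) (hs : IsSize T.parent sz)
    (h : ∀ env' T' sz' t, (∀ r : LReg, 3 ≤ r.level → env' r = env r) → t ≤ 140 →
      Restructures x T T' → IsSize T'.parent sz' → (∀ w, ¬ PAnc T.parent x w → sz' w = sz w) →
      potential sz' + 2 ≤ potential sz + 3 * (lg (sz' x) - lg (sz x)) →
      sz x ≤ sz' x → (∀ d, PDepth T.parent g d → PDepth T'.parent x d) → Q env' T' t) :
    LTri (doubleP a) env T Q := by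
  have hframe : ∀ r : LReg, 3 ≤ r.level →
      r ≠ .sp ∧ r ≠ .sg ∧ r ≠ .sc ∧ r ≠ .sd ∧ r ≠ .se := by
    intro r hr
    refine ⟨?_, ?_, ?_, ?_, ?_⟩ <;> rintro rfl <;> simp [LReg.level] at hr
  obtain ⟨h₁, -, h₃, h₄, h₅⟩ := hframe a ha
  have pgp := hw.parent_of_child _ _ hgp
  have ppx := hw.parent_of_child _ _ hpx
  have hxp := hw.pacyclic.ne_of_parent ppx
  have hpg := hw.pacyclic.ne_of_parent pgp
  refine .seq (pushP_spec (x := g) (by simp [LReg.level]) hg hw fun env₁ t₁ f₁ b₁ => ?_)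
  refine .seq (pushP_spec (x := p) (by simp [LReg.level]) (by rw [f₁ _ (by simp [LReg.level]), hp])
    (hw.push g) fun env₂ t₂ f₂ b₂ => ?_)
  have f : ∀ r : LReg, 2 ≤ r.level → env₂ r = env r := fun r hr => by
    rw [f₂ r (by omega), f₁ r (by omega)]
  obtain ⟨rg, rp⟩ := push_push_rev hw pgp
  have ax : PAnc T.parent x g := (PAnc.of_parent ppx).trans (.of_parent pgp)
  have hR : Restructures x T ((T.push g).push p) :=
    (Restructures.push hw ax).trans
      (Restructures.push (hw.push g) (by simpa using PAnc.of_parent ppx))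
  have hpar : ((T.push g).push p).parent = T.parent := by simp
  have hpx₁ : ((T.push g).push p).IsChild p x := push_isChild.2 (push_isChild.2 hpx)
  have hgp₁ : ((T.push g).push p).IsChild g p := push_isChild.2 (push_isChild.2 hgp)
  generalize (T.push g).push p = T₁ at rg rp hR hpar hpx₁ hgp₁ ⊢
  have hw₁ := hR.wf
  have hs₁ : IsSize T₁.parent sz := by rwa [hpar]
  have hx₂ : env₂ a = some x := by rw [f a (by omega), hx]
  have hp₂ : env₂ .sd = some p := by rw [f _ (by simp [LReg.level]), hp]
  have hg₂ : env₂ .se = some g := by rw [f _ (by simp [LReg.level]), hg]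
  refine .seq (.getChild hg₂ (.seq (.getChild (x := p) (by simp [hp₂]) ?_)))
  set env₃ := Function.update (Function.update env₂ .sc (T₁.child false g)) .sp (T₁.child false p)
    with henv₃
  have k₁ : env₃ a = some x := by simp [henv₃, h₁, h₃, hx₂]
  have k₂ : env₃ .sd = some p := by simp [henv₃, hp₂]
  have k₃ : ∀ r : LReg, 3 ≤ r.level → env₃ r = env r := fun r hr => by
    simp [henv₃, hframe r hr, f r (by omega)]
  have hfin : ∀ T' sz' env' t, (∀ r : LReg, 3 ≤ r.level → env' r = env₃ r) → t ≤ 140 →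
      Restructures x T₁ T' → IsSize T'.parent sz' → (∀ w, w ≠ x → w ≠ p → w ≠ g → sz' w = sz w) →
      potential sz' + 2 ≤ potential sz + 3 * (lg (sz' x) - lg (sz x)) →
      sz' x = sz g → (∀ d, PDepth T₁.parent g d → PDepth T'.parent x d) → Q env' T' t := by
    intro T' sz' env' t e₁ e₂ e₃ e₄ e₅ e₆ e₈ e₇
    refine h env' T' sz' t (fun r hr => by rw [e₁ r hr, k₃ r hr]) e₂ (hR.trans e₃) e₄
      (fun w hw => e₅ w ?_ ?_ ?_) e₆ (e₈ ▸ hs.mono ax) (by rwa [hpar] at e₇)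
    · rintro rfl; exact hw (.refl w)
    · rintro rfl; exact hw (.of_parent ppx)
    · rintro rfl; exact hw ax
  -- both rotations on the same side
  have same : ∀ b, T₁.child b g = some p → T₁.child b p = some x → ∀ c, c ≤ 32 →
      LTri (.seq (rotP .sd) (rotP a)) env₃ T₁ fun e T' t => Q e T' (c + t) := by
    intro b bg bp c hc
    refine .seq (rotP_spec (x := p) (p := g) (by simp [LReg.level]) k₂ hw₁ hgp₁
      fun env₄ T₂ t₄ f₄ b₄ s₄ => ?_)
    have R₂ := s₄.restructures hw₁ (y := x) (by rw [hpar]; exact .of_parent ppx)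
    have cpx : T₂.IsChild p x := by
      obtain ⟨c₁, e₁⟩ := s₄.of_clean hw₁ bg rg
      refine isChild_iff.2 ⟨b, ?_⟩
      rw [e₁, rotate_child, push_of_not_rev rp, if_neg hpg]
      simp [bp]
    refine rotP_spec (x := x) (p := p) (by omega) (by rw [f₄ a (by omega), k₁]) R₂.wf cpx
      fun env₅ T₃ t₅ f₅ b₅ s₅ => ?_
    obtain ⟨⟨sz', i₁, i₀, i₂, i₃⟩, i₄⟩ := zigzig hw₁ bg bp rg rp s₄ s₅ hs₁
    exact hfin T₃ sz' _ _ (fun r hr => by rw [f₅ r (by omega), f₄ r (by omega)]) (by omega)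
      (R₂.trans (s₅.restructures R₂.wf (.refl x))) i₁ i₂ i₃ i₀ i₄
  have diff : ∀ b, T₁.child (!b) g = some p → T₁.child b p = some x → ∀ c, c ≤ 32 →
      LTri (.seq (rotP a) (rotP a)) env₃ T₁ fun e T' t => Q e T' (c + t) := by
    intro b bg bp c hc
    refine .seq (rotP_spec (x := x) (p := p) (by omega) k₁ hw₁ hpx₁
      fun env₄ T₂ t₄ f₄ b₄ s₄ => ?_)
    have R₂ := s₄.restructures hw₁ (.refl x)
    have hxg : g ≠ x := by
      rintro rfl
      exact hw.pacyclic.not_anc_of_parent ppx (.of_parent pgp)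
    have cgx : T₂.IsChild g x := by
      obtain ⟨c₁, e₁⟩ := s₄.of_clean hw₁ bp rp
      refine isChild_iff.2 ⟨!b, ?_⟩
      rw [e₁, rotate_child, if_neg hpg.symm, if_neg hxg, push_child_of_ne hxg]
      simp [bg]
    refine rotP_spec (x := x) (p := g) (by omega) (by rw [f₄ a (by omega), k₁]) R₂.wf cgx
      fun env₅ T₃ t₅ f₅ b₅ s₅ => ?_
    obtain ⟨⟨sz', i₁, i₀, i₂, i₃⟩, i₄⟩ := zigzag hw₁ bg bp rg rp s₄ s₅ hs₁
    exact hfin T₃ sz' _ _ (fun r hr => by rw [f₅ r (by omega), f₄ r (by omega)]) (by omega)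
      (R₂.trans (s₅.restructures R₂.wf (.refl x))) i₁ i₂ i₃ i₀ i₄
  have e₁ : env₃ .sc = T₁.left g := by simp [henv₃]
  have e₂ : env₃ .sp = T₁.left p := by simp [henv₃]
  -- 32 = 14 + 14 + 4: two resolutions of reversal bits, two loads and two tests. Two rotations of
  -- at most 50 steps each keep the total below 140.
  have fin : ∀ c : Cmd LPrim LTest, (∀ k ≤ 32, LTri c env₃ T₁ fun e T' t => Q e T' (k + t)) →
      LTri c env₃ T₁ fun e T' t => Q e T' (t₁ + (t₂ + (1 + (1 + (t + 1 + 1))))) := by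
    intro c hc
    refine (hc (t₁ + t₂ + 4) (by omega)).mono fun e T' t hq => ?_
    convert hq using 1
    omega
  refine .eq (fun q₁ => .eq (fun q₂ => fin _ ?_) fun q₂ => fin _ ?_)
    (fun q₁ => .eq (fun q₂ => fin _ ?_) fun q₂ => fin _ ?_)
  · rw [e₁, k₂] at q₁; rw [e₂, k₁] at q₂
    exact same false q₁ q₂
  · rw [e₁, k₂] at q₁; rw [e₂, k₁] at q₂
    exact diff true q₁ (hpx₁.resolve_left q₂)
  · rw [e₁, k₂] at q₁; rw [e₂, k₁] at q₂
    exact diff false (hgp₁.resolve_left q₁) q₂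
  · rw [e₁, k₂] at q₁; rw [e₂, k₁] at q₂
    exact same true (hgp₁.resolve_left q₁) (hpx₁.resolve_left q₂)

/-- The loop of `splayP`. -/
def splayLoopP (a : LReg) : Cmd LPrim LTest :=
  .loop (.notNull .sd) <| .seq (auxParentP .se .sd) <|
  .seq (.ite (.isNull .se) (rotP a) (doubleP a)) (auxParentP .sd a)

/-- Splay `a` to the root of its auxiliary tree. -/
def splayP (a : LReg) : Cmd LPrim LTest :=
  .seq (auxParentP .sd a) <| .seq (splayLoopP a) (pushP a)

/-- The effect of splaying `x` by `N` double rotations, and possibly a single one. -/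
structure Splayed (x : V) (N : ℕ) (T : LinkCut V) (sz : V → ℕ) (T' : LinkCut V) (sz' : V → ℕ) :
    Prop where
  restr : Restructures x T T'
  size : IsSize T'.parent sz'
  off : ∀ w, ¬ PAnc T.parent x w → sz' w = sz w
  pot : potential sz' + 2 * N ≤ potential sz + 3 * (lg (sz' x) - lg (sz x))
  root : T'.IsAuxRoot x
  mono : sz x ≤ sz' x
  depth : ∀ d, PDepth T.parent x d → ∃ d', PDepth T'.parent x d' ∧ d ≤ d' + 2 * N + 1

/-- Induction on the virtual depth of `x`, which drops by two in every double step. Each double step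
adds one to `N` and releases two units of potential. A final single rotation is covered by the
additive constant and by the summand 1 in the depth bound. -/
theorem splayLoopP_spec {a : LReg} {x : V} (ha : 3 ≤ a.level) {d : ℕ} : ∀ {env T sz Q},
    PDepth T.parent x d → T.WellFormed → IsSize T.parent sz → env a = some x →
    (∀ p, env .sd = some p ↔ T.IsChild p x) →
    (∀ env' T' sz' N t, (∀ r : LReg, 3 ≤ r.level → env' r = env r) → Splayed x N T sz T' sz' →
      t ≤ 200 * N + 100 → Q env' T' t) → LTri (splayLoopP a) env T Q := by
  have hframe : ∀ r : LReg, 3 ≤ r.level →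
      r ≠ .sp ∧ r ≠ .sg ∧ r ≠ .sc ∧ r ≠ .sd ∧ r ≠ .se := by
    intro r hr
    refine ⟨?_, ?_, ?_, ?_, ?_⟩ <;> rintro rfl <;> simp [LReg.level] at hr
  obtain ⟨h₁, -, h₃, h₄, h₅⟩ := hframe a ha
  induction d using Nat.strong_induction_on with
  | _ d ih =>
    intro env T sz Q hd hw hs hx hsd h
    cases hp : env .sd with
    | none =>
      refine .loop_done hp (h env T sz 0 1 (fun _ _ => rfl) ⟨.refl hw x, hs, fun _ _ => rfl, ?_,
        fun p hp' => ?_, le_rfl, fun d hd => ⟨d, hd, by omega⟩⟩ (by norm_num))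
      · simp
      · simp [(hsd p).2 hp'] at hp
    | some p =>
      have hpx : T.IsChild p x := (hsd p).1 hp
      have ppx := hw.parent_of_child _ _ hpx
      refine .loop_step (by simp [hp]) (.seq (auxParentP_spec hp hw (by simp) (by simp) (by simp)
        fun env₁ t₁ f₁ b₁ g₁ => .seq ?_))
      have hx₁ : env₁ a = some x := by rw [f₁ a h₅ h₁ h₃, hx]
      have hp₁ : env₁ .sd = some p := by rw [f₁ _ (by simp) (by simp) (by simp), hp]
      refine .isNull (fun hg => ?_) fun hg => ?_
      · have hpr : T.IsAuxRoot p := fun g hgp => by simp [(g₁ g).2 hgp] at hg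
        refine rotP_spec (x := x) (p := p) (by omega) hx₁ hw hpx fun env₂ T₂ t₂ f₂ b₂ s₂ => ?_
        have R₂ := s₂.restructures hw (.refl x)
        have hr := s₂.isAuxRoot hw hpr
        refine auxParentP_spec (x := x) (by rw [f₂ a (by omega), hx₁]) R₂.wf h₄ ⟨h₁, h₃⟩ (by simp)
          fun env₃ t₃ f₃ b₃ g₃ => ?_
        obtain ⟨sz', i₁, i₂, i₃, i₄, i₅⟩ := s₂.zig hw hs
        refine .loop_done ?_ (h env₃ T₂ sz' 0 _ (fun r hr => ?_) ⟨R₂, i₁, fun w hw' => i₂ w ?_ ?_,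
          ?_, hr, i₅ ▸ hs.mono (.of_parent ppx), fun d hd => ?_⟩ (by omega))
        · cases hc : env₃ .sd with
          | none => rfl
          | some q => exact absurd ((g₃ q).1 hc) (hr q)
        · obtain ⟨k₁, k₂, k₃, k₄, k₅⟩ := hframe r hr
          rw [f₃ r k₄ k₁ k₃, f₂ r (by omega), f₁ r k₅ k₁ k₃]
        · rintro rfl; exact hw' (.refl w)
        · rintro rfl; exact hw' (.of_parent ppx)
        · push_cast; linarith
        · cases hd with
          | root h' => simp [ppx] at h'
          | step h' hd' =>
            obtain rfl := Option.some.inj (ppx.symm.trans h')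
            exact ⟨_, s₂.depth hw hd', by omega⟩
      · obtain ⟨g, hg⟩ := Option.ne_none_iff_exists'.1 hg
        have hgp : T.IsChild g p := (g₁ g).1 hg
        have pgp := hw.parent_of_child _ _ hgp
        obtain ⟨e, he, hde⟩ : ∃ e, PDepth T.parent g e ∧ d = e + 2 := by
          cases hd with
          | root h' => simp [ppx] at h'
          | step h' hd' =>
            obtain rfl := Option.some.inj (ppx.symm.trans h')
            cases hd' with
            | root h'' => simp [pgp] at h''
            | step h'' hd'' =>
              obtain rfl := Option.some.inj (pgp.symm.trans h'')
              exact ⟨_, hd'', rfl⟩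
        refine doubleP_spec ha hx₁ hp₁ hg hw hpx hgp hs fun env₂ T₂ s₂ t₂ f₂ b₂ R₂ i₁ i₂ i₃ i₅ i₄ =>
          ?_
        refine auxParentP_spec (x := x) (by rw [f₂ a ha, hx₁]) R₂.wf h₄ ⟨h₁, h₃⟩ (by simp)
          fun env₃ t₃ f₃ b₃ g₃ => ?_
        refine ih e (by omega) (i₄ e he) R₂.wf i₁ (by rw [f₃ a h₄ h₁ h₃, f₂ a ha, hx₁]) g₃
          fun env₄ T₄ sz₄ N t₄ f₄ S₄ b₄ => ?_
        refine h env₄ T₄ sz₄ (N + 1) _ (fun r hr => ?_) ⟨R₂.trans S₄.restr, S₄.size,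
          fun w hw' => ?_, ?_, S₄.root, i₅.trans S₄.mono, fun d' hd' => ?_⟩ (by omega)
        · obtain ⟨k₁, k₂, k₃, k₄, k₅⟩ := hframe r hr
          rw [f₄ r hr, f₃ r k₄ k₁ k₃, f₂ r hr, f₁ r k₅ k₁ k₃]
        · rw [S₄.off w fun h' => hw' (R₂.anc w h'), i₂ w hw']
        · have := S₄.pot
          push_cast
          linarith
        · obtain ⟨d'', h₆, h₇⟩ := S₄.depth e (i₄ e he)
          have := hd.unique hd'
          exact ⟨d'', h₆, by omega⟩

/-- The closing resolution of the bit at `x` lets later instructions treat its children as the upper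
and the lower part of the path. -/
theorem splayP_spec {a : LReg} {x : V} {sz : V → ℕ} (ha : 3 ≤ a.level) (hx : env a = some x)
    (hw : T.WellFormed) (hs : IsSize T.parent sz)
    (h : ∀ env' T' sz' N t, (∀ r : LReg, 3 ≤ r.level → env' r = env r) → Splayed x N T sz T' sz' →
      T'.rev x = false → t ≤ 200 * N + 130 → Q env' T' t) : LTri (splayP a) env T Q := by
  have hframe : ∀ r : LReg, 3 ≤ r.level → r ≠ .sp ∧ r ≠ .sc ∧ r ≠ .sd := by
    intro r hr
    refine ⟨?_, ?_, ?_⟩ <;> rintro rfl <;> simp [LReg.level] at hr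
  obtain ⟨h₁, h₃, h₄⟩ := hframe a ha
  refine .seq (auxParentP_spec hx hw h₄ ⟨h₁, h₃⟩ (by simp) fun env₁ t₁ f₁ b₁ g₁ => .seq ?_)
  obtain ⟨d, hd⟩ := hw.pacyclic.exists_depth x
  refine splayLoopP_spec ha hd hw hs (by rw [f₁ a h₄ h₁ h₃, hx]) g₁
    fun env₂ T₂ sz₂ N t₂ f₂ S₂ b₂ => ?_
  refine pushP_spec (x := x) (by omega) (by rw [f₂ a ha, f₁ a h₄ h₁ h₃, hx]) S₂.restr.wf
    fun env₃ t₃ f₃ b₃ => ?_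
  refine h env₃ _ sz₂ N _ (fun r hr => ?_) ⟨S₂.restr.trans (.push S₂.restr.wf (.refl x)), ?_, S₂.off,
    S₂.pot, push_isAuxRoot.2 S₂.root, S₂.mono, ?_⟩ (push_rev_self _ _) (by omega)
  · obtain ⟨k₁, k₃, k₄⟩ := hframe r hr
    rw [f₃ r (by omega), f₂ r hr, f₁ r k₄ k₁ k₃]
  · rw [push_parent]; exact S₂.size
  · rw [push_parent]; exact S₂.depth

end Programs

/-! ### Access to a vertex -/

section Programs

open LinkCut

variable {V : Type} [DecidableEq V] [Fintype V]
variable {env : LReg → Option V} {T T' T'' : LinkCut V}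
  {Q : (LReg → Option V) → LinkCut V → ℕ → Prop}

/-- `T'` represents the same rooted forest as `T`, and roots outside of the tree of `x` have not
become children. -/
structure LinkCut.SameForest (x : V) (T T' : LinkCut V) : Prop where
  wf : T'.WellFormed
  fp : ∀ a b, T'.ForestParent a b ↔ T.ForestParent a b
  roots : ∀ w, T.parent w = none → T'.parent w = none ∨ T.forest.Reachable w x

theorem LinkCut.SameForest.refl (hw : T.WellFormed) (x : V) : SameForest x T T :=
  ⟨hw, fun _ _ => .rfl, fun _ h => .inl h⟩

theorem LinkCut.SameForest.trans {x : V} (h : SameForest x T T') (h' : SameForest x T' T'') :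
    SameForest x T T'' where
  wf := h'.wf
  fp a b := (h'.fp a b).trans (h.fp a b)
  roots w hr := by
    rcases h.roots w hr with h₁ | h₁
    · rcases h'.roots w h₁ with h₂ | h₂
      · exact .inl h₂
      · exact .inr (by rwa [forest_congr h.fp] at h₂)
    · exact .inr h₁

/-- A virtual root can receive a parent only if it is a virtual ancestor of `y`, and then it lies in
the component of `y`. This bookkeeping later turns the test for a null parent into a connectivity
test. -/
theorem LinkCut.Restructures.sameForest {x y : V} (hw : T.WellFormed) (h : Restructures y T T')
    (hy : T.forest.Reachable y x) : SameForest x T T' where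
  wf := h.wf
  fp := h.forestParent
  roots w hr := by
    by_cases ha : PAnc T.parent y w
    · exact .inr ((hw.reachable_of_panc ha).symm.trans hy)
    · rw [(h.frame w (isAuxRoot_of_parent hw hr) ha).2.1]
      exact .inl hr

theorem LinkCut.SpliceCtx.sameForest {u : V} {o : Option V} (h : SpliceCtx T u o) (x : V) :
    SameForest x T (T.setRight u o) :=
  ⟨h.wf', h.forestParent, fun _ hr => .inl hr⟩

/-- The loop of `accessP`. -/
def accessLoopP (a : LReg) : Cmd LPrim LTest :=
  .loop (.notNull .aa) <| .seq (splayP .aa) <| .seq (.prim (.getParent .ab .aa)) <|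
  .seq (.ite (.isNull .ab) (.seq (.prim (.setChild true .aa a)) (rotP a))
    (.seq (splayP .ab) <| .seq (.prim (.setChild true .aa a)) <|
      .seq (.prim (.setChild true .ab .aa)) <| .seq (rotP .aa) (rotP a)))
    (.prim (.getParent .aa a))

/-- Make the path from the root of the tree to `a` a path of the decomposition, with `a` at the root
of its auxiliary tree. -/
def accessP (a : LReg) : Cmd LPrim LTest :=
  .seq (splayP a) <| .seq (.prim (.null .ab)) <| .seq (.prim (.setChild true a .ab)) <|
  .seq (.prim (.getParent .aa a)) (accessLoopP a)

/-- The effect of `accessP` at `x`, except for the time. -/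
structure Accessed (x : V) (N : ℕ) (T : LinkCut V) (sz : V → ℕ) (T' : LinkCut V) (sz' : V → ℕ) :
    Prop where
  same : SameForest x T T'
  size : IsSize T'.parent sz'
  pot : potential sz' + 2 * N ≤ potential sz + 6 * (lg (sz' x) - lg (sz x))
  parent : T'.parent x = none
  right : T'.right x = none
  rev : T'.rev x = false

/-- In a round, the path-parent `y` of `x` and then the path-parent `z` of `y` are splayed in their
auxiliary trees. This does not touch `x`, which is an auxiliary root and no ancestor of either. Both
path-parent pointers are then made right child pointers, which leaves all parent pointers and hence
the potential unchanged, and a zig-zig brings `x` to the place of `z`. Its two units pay for the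
constant cost of the round, so the number of rounds never enters the bound. Termination is measured
by the growing subtree of `x`. -/
theorem accessLoopP_spec {a : LReg} {x : V} (ha : 4 ≤ a.level) {d : ℕ} : ∀ {env T sz Q},
    Fintype.card V - sz x = d → T.WellFormed → T.IsAuxRoot x → IsSize T.parent sz →
    env a = some x → env .aa = T.parent x → T.right x = none → T.rev x = false →
    (∀ env' T' sz' N t, (∀ r : LReg, 4 ≤ r.level → env' r = env r) → Accessed x N T sz T' sz' →
      t ≤ 500 * N + 300 → Q env' T' t) → LTri (accessLoopP a) env T Q := by
  have hframe : ∀ r : LReg, 4 ≤ r.level → r ≠ .aa ∧ r ≠ .ab := by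
    intro r hr
    refine ⟨?_, ?_⟩ <;> rintro rfl <;> simp [LReg.level] at hr
  obtain ⟨h₁, h₂⟩ := hframe a ha
  induction d using Nat.strong_induction_on with
  | _ d ih =>
    intro env T sz Q hd hw hr hs hx haa hright hrev h
    cases hy : T.parent x with
    | none =>
      refine .loop_done (by rw [haa, hy]) (h env T sz 0 1 (fun _ _ => rfl) ⟨.refl hw x, hs, by simp,
        hy, hright, hrev⟩ (by norm_num))
    | some y =>
      rw [hy] at haa
      have hxy := hw.pacyclic.ne_of_parent hy
      refine .loop_step (by simp [haa]) (.seq (splayP_spec (x := y) (by simp [LReg.level]) haa hw hs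
        fun env₁ T₁ s₁ N₁ t₁ f₁ S₁ r₁ b₁ => ?_))
      have hw₁ := S₁.restr.wf
      obtain ⟨x₁, x₂, -, x₃, x₄⟩ := S₁.restr.frame x hr (hw.pacyclic.not_anc_of_parent hy)
      rw [hy] at x₂
      rw [hright] at x₃
      rw [hrev] at x₄
      have F₁ : SameForest x T T₁ := S₁.restr.sameForest hw (hw.reachable_parent hy).symm
      have sx₁ : s₁ x = sz x := S₁.off x (hw.pacyclic.not_anc_of_parent hy)
      have hay : env₁ .aa = some y := by rw [f₁ _ (by simp [LReg.level]), haa]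
      have hax : env₁ a = some x := by rw [f₁ a (by omega), hx]
      have l₁ : lg (sz x) ≤ lg (sz y) := lg_mono (hs.pos x) (hs.mono (.of_parent hy))
      have p₁ := S₁.pot
      refine .seq (.getParent hay (.seq ?_))
      refine .isNull (fun hz => ?_) fun hz => ?_
      -- The last round when `y` has no path-parent: a single rotation releases nothing, and its
      -- cost goes into the additive constant 300.
      · have hz : T₁.parent y = none := by simpa using hz
        refine .seq (.setChild (x := y) (by simp [hay]) ?_)
        have e₁ : Function.update env₁ .ab (T₁.parent y) a = some x := by simp [h₂, hax]
        rw [e₁]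
        have C : SpliceCtx T₁ y (some x) :=
          ⟨hw₁, S₁.root, r₁, by rintro w ⟨⟩; exact ⟨x₁, x₂⟩⟩
        change LTri _ _ (T₁.setRight y (some x)) _
        have hw₂ := C.wf'
        refine rotP_spec (x := x) (p := y) (by omega) e₁ hw₂ (.inr (by simp [setRight]))
          fun env₃ T₃ t₃ f₃ b₃ R₃ => ?_
        obtain ⟨s₃, i₁, i₂, i₃, i₄, i₅⟩ := R₃.zig (sz := s₁) hw₂ S₁.size
        have RR := R₃.restructures hw₂ (.refl x)
        obtain ⟨c₃, e₃⟩ := R₃.of_clean (b := true) hw₂ (by simp [setRight]) r₁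
        rw [push_of_not_rev (by exact x₄)] at e₃
        have par₃ : T₃.parent x = none := by simp [e₃, rotate, setRight, hz]
        refine .getParent (x := x) (by rw [f₃ a (by omega), e₁]) ?_
        refine .loop_done (by simp [par₃]) (h _ T₃ s₃ N₁ _ (fun r hr => ?_) ⟨?_, i₁, ?_, par₃, ?_,
          ?_⟩ (by omega))
        · obtain ⟨k₁, k₂⟩ := hframe r hr
          rw [Function.update_of_ne k₁, f₃ r (by omega), Function.update_of_ne k₂, f₁ r (by omega)]
        · exact (F₁.trans (C.sameForest x)).trans (RR.sameForest hw₂ (.refl x))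
        · rw [sx₁] at i₃ i₄
          rw [i₅] at i₃ i₄ ⊢
          linarith
        · simp [e₃, rotate, setRight, hxy, x₃]
        · rw [e₃]; exact x₄
      · obtain ⟨z, hz⟩ := Option.ne_none_iff_exists'.1 hz
        have hyz : T₁.parent y = some z := by simpa using hz
        have nyz := hw₁.pacyclic.ne_of_parent hyz
        have axz : PAnc T₁.parent x z := (PAnc.of_parent x₂).trans (.of_parent hyz)
        have nxz : x ≠ z := by
          rintro rfl
          exact hw₁.pacyclic.not_anc_of_parent hyz (.of_parent x₂)
        refine .seq (splayP_spec (x := z) (by simp [LReg.level]) hz hw₁ S₁.size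
          fun env₂ T₂ s₂ N₂ t₂ f₂ S₂ r₂ b₂ => ?_)
        have hw₂ := S₂.restr.wf
        have nzx : ¬ PAnc T₁.parent z x := fun h' => nxz (hw₁.pacyclic.antisymm axz h')
        obtain ⟨x₅, x₆, -, x₇, x₈⟩ := S₂.restr.frame x x₁ nzx
        obtain ⟨y₁, y₂, -, -, y₃⟩ := S₂.restr.frame y S₁.root (hw₁.pacyclic.not_anc_of_parent hyz)
        rw [x₂] at x₆
        rw [x₃] at x₇
        rw [x₄] at x₈
        rw [hyz] at y₂
        rw [r₁] at y₃
        have F₂ : SameForest x T₁ T₂ := S₂.restr.sameForest hw₁ (hw₁.reachable_of_panc axz).symm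
        have sx₂ : s₂ x = sz x := by rw [S₂.off x nzx, sx₁]
        have e₁ : env₂ .aa = some y := by rw [f₂ _ (by simp [LReg.level])]; simp [hay]
        have e₂ : env₂ .ab = some z := by rw [f₂ _ (by simp [LReg.level])]; exact hz
        have e₃ : env₂ a = some x := by rw [f₂ a (by omega)]; simp [h₂, hax]
        have C₁ : SpliceCtx T₂ y (some x) := ⟨hw₂, y₁, y₃, by rintro w ⟨⟩; exact ⟨x₅, x₆⟩⟩
        have C₂ : SpliceCtx (T₂.setRight y (some x)) z (some y) := by
          refine ⟨C₁.wf', C₁.isAuxRoot.2 (.inl ⟨S₂.root, by simp [nxz]⟩), r₂, ?_⟩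
          rintro w ⟨⟩
          exact ⟨C₁.symm.root, y₂⟩
        refine .seq (.setChild e₁ (.seq (.setChild e₂ ?_)))
        rw [e₃, e₁]
        change LTri _ _ ((T₂.setRight y (some x)).setRight z (some y)) _
        set T₄ := (T₂.setRight y (some x)).setRight z (some y) with hT₄
        have hw₄ := C₂.wf'
        have k₁ : T₄.child true z = some y := by simp [hT₄, setRight]
        have k₂ : T₄.child true y = some x := by simp [hT₄, setRight, nyz]
        have k₃ : T₄.rev z = false := r₂
        have k₄ : T₄.rev y = false := y₃
        have k₅ : T₄.rev x = false := x₈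
        have k₆ : T₄.right x = none := by simp [hT₄, setRight, nxz, hxy, x₇]
        have k₇ : T₄.IsAuxRoot z := C₂.symm.root
        have k₈ : IsSize T₄.parent s₂ := S₂.size
        have k₉ : T₄.parent = T₂.parent := rfl
        refine .seq (rotP_spec (x := y) (p := z) (by simp [LReg.level]) e₁ hw₄ (.inr k₁)
          fun env₅ T₅ t₅ f₅ b₅ R₅ => ?_)
        obtain ⟨c₅, g₅⟩ := R₅.of_clean hw₄ k₁ k₃
        rw [push_of_not_rev k₄] at g₅ c₅
        have RR₅ := R₅.restructures hw₄ (y := x) (by rw [k₉]; exact .of_parent x₆)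
        have hw₅ := RR₅.wf
        have k₁₀ : T₅.child true y = some x := by
          rw [g₅, rotate_child, if_neg nyz]; simp [k₂]
        refine rotP_spec (x := x) (p := y) (by omega) (by rw [f₅ a (by omega), e₃]) hw₅ (.inr k₁₀)
          fun env₆ T₆ t₆ f₆ b₆ R₆ => ?_
        obtain ⟨c₆, g₆⟩ := R₆.of_clean hw₅ k₁₀ (by rw [g₅]; exact k₄)
        have k₁₁ : T₅.rev x = false := by rw [g₅]; exact k₅
        rw [push_of_not_rev k₁₁] at g₆ c₆
        have RR₆ := R₆.restructures hw₅ (.refl x)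
        obtain ⟨⟨s₆, i₁, i₂, -, i₃⟩, -⟩ := zigzig hw₄ k₁ k₂ k₃ k₄ R₅ R₆ k₈
        have F₆ : SameForest x T T₆ :=
          ((((F₁.trans F₂).trans (C₁.sameForest x)).trans (C₂.sameForest x)).trans
            (RR₅.sameForest hw₄ (.refl x))).trans (RR₆.sameForest hw₅ (.refl x))
        have hr₆ : T₆.IsAuxRoot x := R₆.isAuxRoot hw₅ (R₅.isAuxRoot hw₄ k₇)
        have hright₆ : T₆.right x = none := by
          have : T₅.child true x = none := by
            rw [g₅, rotate_child, if_neg nxz, if_neg hxy]; simp [k₆]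
          rw [← child_true, g₆, rotate_child, if_neg hxy]
          simpa using this
        have hrev₆ : T₆.rev x = false := by rw [g₆]; exact k₁₁
        -- `x` has taken the place of its proper virtual ancestor `z`, so its subtree has grown.
        have hsx : sz x < s₆ x := by
          rw [i₂, ← sx₂]
          have h₃ := S₂.size.child_lt x₆
          have h₄ := S₂.size.child_lt y₂
          omega
        have hcard := i₁.le_card F₆.wf.pacyclic x
        refine .getParent (x := x) (by rw [f₆ a (by omega), f₅ a (by omega), e₃]) ?_
        refine ih (Fintype.card V - s₆ x) (by omega) rfl F₆.wf hr₆ i₁ ?_ (by simp) hright₆ hrev₆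
          fun env₇ T₇ s₇ N₇ t₇ f₇ A₇ b₇ => ?_
        · rw [Function.update_of_ne h₁, f₆ a (by omega), f₅ a (by omega), e₃]
        · refine h env₇ T₇ s₇ (N₁ + N₂ + N₇ + 1) _ (fun r hr => ?_) ⟨F₆.trans A₇.same, A₇.size, ?_,
            A₇.parent, A₇.right, A₇.rev⟩ (by omega)
          · obtain ⟨m₁, m₂⟩ := hframe r hr
            rw [f₇ r hr, Function.update_of_ne m₁, f₆ r (by omega), f₅ r (by omega),
              f₂ r (by omega), Function.update_of_ne m₂, f₁ r (by omega)]
          -- The two splays cost 3 (lg s₁(y) − lg sz(y)) and 3 (lg s₂(z) − lg s₁(z)). By lg sz(x) ≤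
          -- lg sz(y) and lg s₁(y) ≤ lg s₁(z) their sum is at most 3 (lg s₂(z) − lg sz(x)). The
          -- zig-zig contributes the same amount, with s₂(z) = s₆(x); this explains the factor 6 and
          -- lets the rounds telescope.
          · have q₁ := A₇.pot
            have q₂ := S₂.pot
            have q₃ : lg (s₁ y) ≤ lg (s₁ z) :=
              lg_mono (S₁.size.pos y) (S₁.size.mono (.of_parent hyz))
            rw [i₂, sx₂] at i₃
            rw [i₂] at q₁
            push_cast
            linarith

/-- After the splay the right subtree of `x` is the part of its path below `x`. Detaching it makes
`x` the deepest vertex of the path, and the loop preserves this. -/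
theorem accessP_spec {a : LReg} {x : V} {sz : V → ℕ} (ha : 4 ≤ a.level) (hx : env a = some x)
    (hw : T.WellFormed) (hs : IsSize T.parent sz)
    (h : ∀ env' T' sz' N t, (∀ r : LReg, 4 ≤ r.level → env' r = env r) → Accessed x N T sz T' sz' →
      t ≤ 500 * N + 500 → Q env' T' t) : LTri (accessP a) env T Q := by
  have hframe : ∀ r : LReg, 4 ≤ r.level → r ≠ .aa ∧ r ≠ .ab := by
    intro r hr
    refine ⟨?_, ?_⟩ <;> rintro rfl <;> simp [LReg.level] at hr
  obtain ⟨h₁, h₂⟩ := hframe a ha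
  refine .seq (splayP_spec (x := x) (by omega) hx hw hs fun env₁ T₁ s₁ N₁ t₁ f₁ S₁ r₁ b₁ => ?_)
  have C : SpliceCtx T₁ x none := ⟨S₁.restr.wf, S₁.root, r₁, by simp⟩
  have e₁ : env₁ a = some x := by rw [f₁ a (by omega), hx]
  refine .seq (.null (.seq (.setChild (x := x) (by simp [h₂, e₁]) ?_)))
  rw [Function.update_self]
  change LTri _ _ (T₁.setRight x none) _
  refine .seq (.getParent (x := x) (by simp [h₂, e₁]) ?_)
  refine accessLoopP_spec ha rfl C.wf' C.symm.root (sz := s₁) S₁.size (by simp [h₁, h₂, e₁])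
    (by simp) (by simp [setRight]) r₁ fun env₂ T₂ s₂ N₂ t₂ f₂ A₂ b₂ => ?_
  refine h env₂ T₂ s₂ (N₁ + N₂) _ (fun r hr => ?_) ⟨?_, A₂.size, ?_, A₂.parent, A₂.right, A₂.rev⟩
    (by omega)
  · obtain ⟨k₁, k₂⟩ := hframe r hr
    rw [f₂ r hr, Function.update_of_ne k₁, Function.update_of_ne k₂, f₁ r (by omega)]
  · exact ((S₁.restr.sameForest hw (.refl x)).trans (C.sameForest x)).trans A₂.same
  · have q₁ := A₂.pot
    have q₂ := S₁.pot
    push_cast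
    have hm : lg (sz x) ≤ lg (s₁ x) := lg_mono (hs.pos x) S₁.mono
    linarith

end Programs

/-! ### Insertion of an edge into one forest -/

section Programs

open LinkCut

variable {V : Type} [DecidableEq V] [Fintype V]
variable {env : LReg → Option V} {T T' : LinkCut V} {Q : (LReg → Option V) → LinkCut V → ℕ → Prop}

theorem IsSize.lg_sub_le {par' : V → Option V} {sz sz' : V → ℕ} (h : IsSize par' sz')
    (hw : PAcyclic par') (x : V) : lg (sz' x) - lg (sz x) ≤ lg (Fintype.card V) := by
  have h₁ := lg_mono (h.pos x) (h.le_card hw x)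
  have h₂ := lg_nonneg (sz x)
  linarith

theorem potential_update (sz : V → ℕ) (v : V) (a : ℕ) :
    potential (Function.update sz v a) = potential sz + (lg a - lg (sz v)) := by
  have := potential_of_eq_off (sz := sz) (sz' := Function.update sz v a) {v}
    (fun w hw => by simp at hw; simp [hw])
  simp at this
  linarith

/-- From `w`, whose reversal bit is cleared, descend to the first vertex of its auxiliary subtree. -/
def leftmostLoopP : Cmd LPrim LTest :=
  .loop (.notNull .aa) <| .seq (.prim (.move .w .aa)) <| .seq (pushP .w) <|
    .prim (.getChild false .aa .w)

/-- No rotation takes place, so the potential cannot pay for the descent here. Instead the number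
`e` of steps is recorded in the virtual depth of the vertex reached; the splay that follows will
pay. -/
theorem leftmostLoopP_spec {p : V} {n : ℕ} : ∀ {env T Q c lc d}, lc.length = n → T.WellFormed →
    env .w = some c → env .aa = T.left c → T.rev c = false → T.InOrder (some c) (p :: lc) →
    PDepth T.parent c d →
    (∀ env' T' e t, env' .w = some p → env' .u = env .u → env' .v = env .v → env' .o = env .o →
      Restructures p T T' → T'.parent = T.parent → PDepth T'.parent p (d + e) → t ≤ 20 * e + 20 →
      Q env' T' t) → LTri leftmostLoopP env T (V := V) Q := by
  induction n using Nat.strong_induction_on with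
  | _ n ih =>
    intro env T Q c lc d hn hw hc haa hr hl hd h
    obtain ⟨l₁, l₂, h₁, h₂, e⟩ := (inOrder_some_of_rev hr).1 hl
    cases hb : T.left c with
    | none =>
      rw [hb] at h₁ haa
      cases h₁
      obtain ⟨rfl, -⟩ : p = c ∧ lc = l₂ := by simpa using e
      exact .loop_done haa (h env T 0 1 hc rfl rfl rfl (.refl hw p) rfl hd (by norm_num))
    | some b =>
      have pb := hw.parent_child (b := false) hb
      rw [hb] at h₁ haa
      have hbl := (h₁.mem_iff b).2 ⟨b, rfl, .refl⟩
      obtain ⟨l', rfl, e'⟩ : ∃ l', l₁ = p :: l' ∧ lc = l' ++ c :: l₂ := by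
        cases l₁ with
        | nil => simp at hbl
        | cons a l' => simp at e; exact ⟨l', by rw [e.1], e.2⟩
      refine .loop_step (by simp [haa]) (.seq (.move (.seq (pushP_spec (x := b) (by simp [LReg.level])
        (by simp [haa]) hw fun env₁ t₁ f₁ b₁ => ?_))))
      have hwb : env₁ .w = some b := by rw [f₁ _ (by simp [LReg.level])]; simp [haa]
      have hpb : PAnc T.parent p b := by
        obtain ⟨r, hr, hpr⟩ := (h₁.mem_iff p).1 (by simp)
        cases hr
        exact hpr.panc hw
      have hlb : (T.push b).InOrder (some b) (p :: l') := by
        cases hrb : T.rev b with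
        | false => rwa [push_of_not_rev hrb]
        | true =>
          have := h₁.push hw hrb
          rwa [if_neg] at this
          rintro ⟨c, hc, h'⟩
          cases hc
          exact hw.pacyclic.ne_of_parent (hw.parent_of_child _ _ h') rfl
      refine .getChild hwb ?_
      refine ih l'.length (by rw [← hn, e', List.length_append, List.length_cons]; omega) rfl (hw.push b) (by simp [hwb]) (by simp)
        (push_rev_self T b) hlb (d := d + 1) (by rw [push_parent]; exact .step pb hd)
        fun env₂ T₂ e₂ t₂ g₁ g₂ g₃ g₄ g₅ g₆ g₇ g₈ => ?_
      refine h env₂ T₂ (e₂ + 1) _ g₁ (g₂.trans ?_) (g₃.trans ?_) (g₄.trans ?_)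
        ((Restructures.push hw hpb).trans g₅) (by simp [g₆]) (by convert g₇ using 1; omega) (by omega)
      all_goals
        rw [Function.update_of_ne (by simp), f₁ _ (by simp [LReg.level]),
          Function.update_of_ne (by simp)]

/-- Insert the edge between `u` and `v`, where both are different. If `u` and `v` are already
connected, the edge from `u` to its parent `o` in the tree rooted at `v` is deleted, otherwise
`o` is null. -/
def tryAddP : Cmd LPrim LTest :=
  .seq (accessP .u) <| .seq (.prim (.flip .u)) <| .seq (accessP .v) <| .seq (.prim (.null .o)) <|
  .seq (.prim (.getParent .w .u)) <|
  .seq (.ite (.isNull .w) .skip <|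
    .seq (splayP .u) <| .seq (.prim (.getChild true .w .u)) <| .seq (pushP .w) <|
    .seq (.prim (.getChild false .aa .w)) <| .seq leftmostLoopP <| .seq (splayP .w) <|
    .seq (.prim (.null .aa)) <| .seq (.prim (.setChild false .w .aa)) <|
    .seq (.prim (.setParent .u .aa)) <| .seq (splayP .v) (.prim (.move .o .w)))
  (.prim (.setParent .u .v))

/-- After access and reversal `x` is the root of its tree, and after the second access `y` is a
virtual root. If `x` is still a virtual root, the trees are different and one pointer links them.
Otherwise the path between them is a single path of the decomposition starting at `x`, and its
second vertex `p` is the vertex following `x` in symmetric order. Splaying `p` isolates `x` as its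
left subtree, the edge is cut, and the same linking step finishes. -/
theorem tryAddP_spec {x y : V} {sz : V → ℕ} (hx : env .u = some x) (hy : env .v = some y)
    (hxy : x ≠ y) (hw : T.WellFormed) (hs : IsSize T.parent sz)
    (h : ∀ env' T' sz' N t, env' .u = some x → env' .v = some y → T'.WellFormed →
      IsSize T'.parent sz' → TryAdd T.forest x y T'.forest ((env' .o).map fun p => (x, p)) →
      potential sz' + 2 * (N : ℕ) ≤ potential sz + 22 * lg (Fintype.card V) →
      t ≤ 500 * N + 2000 → Q env' T' t) : LTri tryAddP env T Q := by
  refine .seq (accessP_spec (x := x) (by simp [LReg.level]) hx hw hs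
    fun env₁ T₁ s₁ N₁ t₁ f₁ A₁ b₁ => ?_)
  have hx₁ : env₁ .u = some x := by rw [f₁ _ (by simp [LReg.level]), hx]
  have hw₁ := A₁.same.wf
  -- `x` becomes the root of its tree
  have hfx : ∀ z, ¬ (T₁.flip x).ForestParent x z := by
    obtain ⟨l, hl⟩ := hw₁.inOrder_exists (some x)
    obtain ⟨l₁, l₂, h₁, h₂, e⟩ := (inOrder_some_of_rev A₁.rev).1 hl
    rw [A₁.right] at h₂
    cases h₂
    have hl' := inOrder_flip hw₁ hl
    rw [e, List.reverse_append] at hl'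
    exact (hw₁.flip x).not_forestParent_head ⟨x, ⟨isAuxRoot_of_parent (hw₁.flip x) A₁.parent, hl'⟩,
      A₁.parent⟩
  have F₂ : (T₁.flip x).forest = T.forest :=
    (forest_flip hw₁ A₁.parent).trans (forest_congr A₁.same.fp)
  refine .seq (.flip hx₁ (.seq (accessP_spec (x := y) (sz := s₁) (by simp [LReg.level])
    (by rw [f₁ _ (by simp [LReg.level]), hy]) (hw₁.flip x) A₁.size
    fun env₃ T₃ s₃ N₃ t₃ f₃ A₃ b₃ => ?_)))
  have hw₃ := A₃.same.wf
  have F₃ : T₃.forest = T.forest := (forest_congr A₃.same.fp).trans F₂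
  have hfx₃ : ∀ z, ¬ T₃.ForestParent x z := fun z h => hfx z ((A₃.same.fp x z).1 h)
  have hx₃ : env₃ .u = some x := by rw [f₃ _ (by simp [LReg.level]), hx₁]
  have hy₃ : env₃ .v = some y := by
    rw [f₃ _ (by simp [LReg.level]), f₁ _ (by simp [LReg.level]), hy]
  have pot₁ := A₁.pot
  have pot₃ := A₃.pot
  have lg₁ := A₁.size.lg_sub_le (sz := sz) hw₁.pacyclic x
  have lg₃ := A₃.size.lg_sub_le (sz := s₁) hw₃.pacyclic y
  refine .seq (.null (.seq (.getParent (x := x) (by simp [hx₃]) (.seq ?_))))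
  set env₄ := Function.update (Function.update env₃ .o none) .w (T₃.parent x) with henv₄
  -- The common last step of both branches. The growth of the subtree of `y` accounts for the
  -- difference between 21 and 22 logarithms.
  have link : ∀ env' (T' : LinkCut V) s' (N' : ℕ) t', env' .u = some x → env' .v = some y →
      T'.WellFormed → IsSize T'.parent s' → T'.parent x = none → T'.parent y = none →
      (∀ z, ¬ T'.ForestParent x z) →
      TryAdd T.forest x y (T'.forest ⊔ SimpleGraph.edge x y) ((env' .o).map fun p => (x, p)) →
      potential s' + 2 * N' ≤ potential sz + 21 * lg (Fintype.card V) → t' ≤ 500 * N' + 1990 →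
      LTri (.prim (.setParent .u .v)) env' T' fun e T'' t => Q e T'' (t' + t) := by
    intro env' T' s' N' t' h₁ h₂ h₃ h₄ h₅ h₆ h₇ h₈ h₉ h₁₀
    refine .setParent h₁ ?_
    rw [h₂]
    have hwf := h₃.link h₅ h₆ hxy
    have hsz := h₄.link h₅ h₆ hxy
    refine h env' _ _ N' _ h₁ h₂ hwf hsz (by rw [forest_link h₃ h₅ h₇]; exact h₈) ?_ (by omega)
    rw [potential_update]
    have := hsz.lg_sub_le (sz := s') hwf.pacyclic y
    simp only [Function.update_self] at this
    linarith
  refine .isNull (fun hn => .skip ?_) fun hn => ?_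
  · have hn : T₃.parent x = none := by simpa [henv₄] using hn
    refine LTri.mono (link env₄ T₃ s₃ (N₁ + N₃) (t₁ + (1 + (t₃ + (1 + (1 + 2))))) (by simp [henv₄, hx₃])
      (by simp [henv₄, hy₃]) hw₃ A₃.size hn A₃.parent hfx₃ ?_ ?_ (by omega))
      fun e T' t hq => by convert hq using 1; omega
    · rw [F₃]
      simp only [henv₄, ne_eq, reduceCtorEq, not_false_eq_true, Function.update_of_ne,
        Function.update_self, Option.map_none]
      exact .link (F₃ ▸ hw₃.not_reachable_of_roots hn A₃.parent hxy)
    · have := lg_nonneg (Fintype.card V)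
      push_cast
      linarith
  · have hn : T₃.parent x ≠ none := by simpa [henv₄] using hn
    -- `x` was a virtual root before the access at `y` and no longer is. `SameForest.roots` permits
    -- this only in the component of `y`.
    have hreach : T₃.forest.Reachable x y := by
      have := (A₃.same.roots x A₁.parent).resolve_left hn
      rwa [forest_congr A₃.same.fp]
    -- the path of `x` contains `y`
    obtain ⟨l, hl⟩ := hw₃.pth_of_not_forestParent hfx₃
    have hyl : y ∈ x :: l := by
      obtain ⟨r, hr, hr'⟩ := hl
      obtain ⟨_, e, hxr⟩ := (hr.2.mem_iff x).1 (by simp)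
      cases e
      have hxy' : PAnc T₃.parent x y :=
        hw₃.panc_of_reachable hreach.symm A₃.parent (.refl y)
      have : r = y := ((hxy'.to_root (hxr.panc hw₃) hr').eq_of_root A₃.parent).symm
      exact this ▸ hr.root_mem
    refine .seq (splayP_spec (x := x) (sz := s₃) (by simp [LReg.level]) (by simp [henv₄, hx₃]) hw₃
      A₃.size fun env₅ T₅ s₅ N₅ t₅ f₅ S₅ r₅ b₅ => ?_)
    have hw₅ := S₅.restr.wf
    obtain ⟨hl₅, px₅⟩ := S₅.root.inOrder_of_pth ((S₅.restr.pth _ _).2 hl) (by simp)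
    obtain ⟨l₁, l₂, h₁, h₂, e⟩ := (inOrder_some_of_rev r₅).1 hl₅
    have hnd := hl₅.nodup hw₅
    -- `x` is the top of its path, so nothing precedes it and the whole rest of the path is its
    -- right subtree.
    obtain ⟨rfl, rfl⟩ : l₁ = [] ∧ l = l₂ := by
      cases l₁ with
      | nil => simpa using e
      | cons a l₁ =>
        simp at e
        rw [e.2] at hnd
        simp at hnd
    obtain ⟨p, m, rfl⟩ : ∃ p m, l = p :: m := by
      cases l with
      | nil => simp [hxy.symm] at hyl
      | cons p m => exact ⟨p, m, rfl⟩
    obtain ⟨c, hc⟩ : ∃ c, T₅.right x = some c := by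
      cases hc : T₅.right x with
      | none => rw [hc] at h₂; cases h₂
      | some c => exact ⟨c, rfl⟩
    have pcx := hw₅.parent_child (b := true) hc
    rw [hc] at h₂
    have hx₅ : env₅ .u = some x := by rw [f₅ _ (by simp [LReg.level])]; simp [henv₄, hx₃]
    have hy₅ : env₅ .v = some y := by rw [f₅ _ (by simp [LReg.level])]; simp [henv₄, hy₃]
    refine .seq (.getChild hx₅ (.seq (pushP_spec (x := c) (by simp [LReg.level])
      (by simp [hc]) hw₅ fun env₆ t₆ f₆ b₆ => ?_)))
    have hw₆ : env₆ .w = some c := by rw [f₆ _ (by simp [LReg.level])]; simp [hc]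
    have hx₆ : env₆ .u = some x := by rw [f₆ _ (by simp [LReg.level])]; simp [hx₅]
    have hy₆ : env₆ .v = some y := by rw [f₆ _ (by simp [LReg.level])]; simp [hy₅]
    have hpc : PAnc T₅.parent p c := by
      obtain ⟨r, hr, hpr⟩ := (h₂.mem_iff p).1 (by simp)
      cases hr
      exact hpr.panc hw₅
    have hlc : (T₅.push c).InOrder (some c) (p :: m) := by
      cases hrc : T₅.rev c with
      | false => rwa [push_of_not_rev hrc]
      | true =>
        have := h₂.push hw₅ hrc
        rwa [if_neg] at this
        rintro ⟨c, hc, h'⟩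
        cases hc
        exact hw₅.pacyclic.ne_of_parent (hw₅.parent_of_child _ _ h') rfl
    refine .seq (.getChild hw₆ (.seq ?_))
    refine leftmostLoopP_spec (d := 1) rfl (hw₅.push c) (by simp [hw₆]) (by simp)
      (push_rev_self _ _) hlc (by rw [push_parent]; exact .step pcx (.root px₅))
      fun env₇ T₇ e t₇ w₇ u₇ v₇ o₇ R₇ par₇ d₇ b₇ => ?_
    rw [Function.update_of_ne (by simp), hx₆] at u₇
    rw [Function.update_of_ne (by simp), hy₆] at v₇
    have R₅₇ := (Restructures.push hw₅ hpc).trans R₇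
    refine .seq (splayP_spec (x := p) (sz := s₅) (by simp [LReg.level]) w₇ R₇.wf
      (by rw [par₇, push_parent]; exact S₅.size) fun env₈ T₈ s₈ N₈ t₈ f₈ S₈ r₈ b₈ => ?_)
    have w₈ : env₈ .w = some p := by rw [f₈ _ (by simp [LReg.level]), w₇]
    have u₈ : env₈ .u = some x := by rw [f₈ _ (by simp [LReg.level]), u₇]
    have v₈ : env₈ .v = some y := by rw [f₈ _ (by simp [LReg.level]), v₇]
    have hw₈ := S₈.restr.wf
    have R₅₈ := R₅₇.trans S₈.restr
    have hp₈ : T₈.Pth (x :: p :: m) none := (R₅₈.pth _ _).2 ((S₅.restr.pth _ _).2 hl)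
    obtain ⟨hl₈, pp₈⟩ := S₈.root.inOrder_of_pth hp₈ (by simp)
    -- The virtual depth of `p` was `1 + e` before the splay and is 0 after it. The depth bound for
    -- `N₈` double rotations allows a drop of at most `2 * N₈ + 1`.
    have he : e ≤ 2 * N₈ := by
      obtain ⟨d', k₁, k₂⟩ := S₈.depth _ d₇
      have := k₁.unique (.root pp₈)
      omega
    have F₈ : T₈.forest = T.forest :=
      (R₅₈.forest.trans S₅.restr.forest).trans F₃
    have hleft : T₈.left p = some x := by
      obtain ⟨k₁, k₂, k₃, -, k₄⟩ := (inOrder_some_of_rev r₈).1 hl₈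
      have hnd := hl₈.nodup hw₈
      obtain rfl : k₁ = [x] := by
        rcases k₁ with _ | ⟨a, _ | ⟨b, k₁⟩⟩
        · simp at k₄
          rw [k₄.1] at hnd
          simp at hnd
        · simp at k₄; simp [k₄.1]
        · simp at k₄
          rw [k₄.2.2] at hnd
          simp at hnd
      cases hq : T₈.left p with
      | none => rw [hq] at k₃; cases k₃
      | some q =>
        rw [hq] at k₃
        have := (k₃.mem_iff q).2 ⟨q, rfl, .refl⟩
        simp at this
        rw [this]
    have C : CutCtx T₈ x p m := ⟨hw₈, pp₈, r₈, hleft, hl₈⟩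
    refine .seq (.null (.seq (.setChild (x := p) (by simp [w₈]) (.seq (.setParent (x := x)
      (by simp [u₈]) ?_)))))
    rw [Function.update_self]
    change LTri _ _ (T₈.cut x p) _
    have hsz := S₈.size.cut (hw₈.parent_child (b := false) hleft) pp₈
    change IsSize (T₈.cut x p).parent _ at hsz
    have hyp : y ∈ p :: m := by simpa [hxy.symm] using hyl
    refine .seq (splayP_spec (x := y) (by simp [LReg.level]) (by simp [v₈]) C.wf' hsz
      fun env₉ T₉ s₉ N₉ t₉ f₉ S₉ r₉ b₉ => ?_)
    have hw₉ := S₉.restr.wf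
    obtain ⟨-, py₉⟩ := S₉.root.inOrder_of_pth ((S₉.restr.pth _ _).2 C.pth_w) hyp
    -- After the cut, `x` and `y` have different virtual roots; therefore the splay at `y` leaves
    -- the record of `x` untouched.
    have hnyx : ¬ PAnc (T₈.cut x p).parent y x := by
      intro hyx
      obtain ⟨r, hr, hr'⟩ := C.pth_w
      obtain ⟨_, e, hyr⟩ := (hr.2.mem_iff y).1 hyp
      cases e
      have pxc : (T₈.cut x p).parent x = none := by simp [C.parent_cut]
      have : x = r := (hyx.to_root (hyr.panc C.wf') hr').eq_of_root pxc
      have hxr := hr.root_mem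
      rw [← this] at hxr
      have := C.nodup
      rw [List.nodup_cons] at this
      exact this.1 hxr
    have px₉ : T₉.parent x = none := by
      rw [(S₉.restr.frame x (C.isAuxRoot.2 (.inr rfl)) hnyx).2.1]
      simp [C.parent_cut]
    have hfx₉ := hw₉.not_forestParent_head ((S₉.restr.pth _ _).2 C.pth_u)
    have F₉ : T₉.forest = T.forest.deleteEdges {s(x, p)} := by
      rw [S₉.restr.forest, C.forest, F₈]
    refine .move ?_
    refine LTri.mono (link (Function.update env₉ .o (env₉ .w)) T₉ s₉ (N₁ + N₃ + N₅ + N₈ + N₉)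
      (t₁ + (1 + (t₃ + (1 + (1 + (t₅ + t₆ + t₇ + t₈ + t₉ + 7)))))) ?_ ?_ hw₉ S₉.size px₉ py₉ hfx₉ ?_ ?_ ?_)
      fun e T' t hq => by convert hq using 1; omega
    · rw [Function.update_of_ne (by simp), f₉ _ (by simp [LReg.level]),
        Function.update_of_ne (by simp), u₈]
    · rw [Function.update_of_ne (by simp), f₉ _ (by simp [LReg.level]),
        Function.update_of_ne (by simp), v₈]
    · rw [Function.update_self, f₉ _ (by simp [LReg.level]), Function.update_of_ne (by simp), w₈, F₉]
      refine .swap p (F₃ ▸ hreach) (F₈ ▸ C.adj) ?_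
      rw [← F₉]
      exact hw₉.not_reachable_of_roots px₉ py₉ hxy
    -- Two accesses contribute 6 logarithms each and three splays contribute 3 each, 21 in total.
    -- The cut only lowers the size of `p`.
    · have q₅ := S₅.pot
      have q₈ := S₈.pot
      have q₉ := S₉.pot
      rw [potential_update] at q₉
      have g₅ := S₅.size.lg_sub_le (sz := s₃) hw₅.pacyclic x
      have g₈ := S₈.size.lg_sub_le (sz := s₅) hw₈.pacyclic p
      have g₉ := S₉.size.lg_sub_le (sz := Function.update s₈ p (s₈ p - s₈ x)) hw₉.pacyclic y
      have g : lg (s₈ p - s₈ x) ≤ lg (s₈ p) := by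
        refine lg_mono ?_ (by omega)
        have := S₈.size.child_lt (hw₈.parent_child (b := false) hleft)
        omega
      push_cast
      linarith
    · omega

end Programs

/-! ### Link-cut programs on the word RAM -/

@[simp] theorem RAMState.setReg_reg (s : RAMState) (r x q : ℕ) :
    (s.setReg r x).reg q = if q = r then x else s.reg q := by
  simp [RAMState.setReg, Function.update_apply]

@[simp] theorem RAMState.setReg_mem (s : RAMState) (r x : ℕ) : (s.setReg r x).mem = s.mem := rfl

@[simp] theorem RAMState.setMem_reg (s : RAMState) (a x : ℕ) : (s.setMem a x).reg = s.reg := rfl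

@[simp] theorem RAMState.setMem_mem (s : RAMState) (a x b : ℕ) :
    (s.setMem a x).mem b = if b = a then x else s.mem b := by
  simp [RAMState.setMem, Function.update_apply]

/-- The machine register that holds a pointer register. -/
def LReg.idx : LReg → ℕ
  | .pl => 20 | .pr => 21 | .pf => 22 | .rp => 23 | .rg => 24 | .rb => 25 | .rc => 26
  | .sp => 27 | .sg => 28 | .sc => 29 | .sd => 30 | .se => 31 | .aa => 32 | .ab => 33
  | .u => 34 | .v => 35 | .w => 36 | .o => 37

theorem LReg.le_idx (r : LReg) : 20 ≤ r.idx := by cases r <;> simp [LReg.idx]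

/-- The inverse of `LReg.idx`. -/
def LReg.ofIdx : ℕ → LReg
  | 20 => .pl | 21 => .pr | 22 => .pf | 23 => .rp | 24 => .rg | 25 => .rb | 26 => .rc
  | 27 => .sp | 28 => .sg | 29 => .sc | 30 => .sd | 31 => .se | 32 => .aa | 33 => .ab
  | 34 => .u | 35 => .v | 36 => .w | _ => .o

theorem LReg.ofIdx_idx (r : LReg) : LReg.ofIdx r.idx = r := by cases r <;> rfl

@[simp] theorem LReg.idx_inj {a b : LReg} : a.idx = b.idx ↔ a = b :=
  ⟨fun h => by rw [← ofIdx_idx a, h, ofIdx_idx], fun h => h ▸ rfl⟩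

/-- Encoding of pointers. -/
def encodePtr {n : ℕ} : Option (Fin n) → ℕ
  | none => 0
  | some v => v + 1

@[simp] theorem decodePtr_encodePtr {n : ℕ} (o : Option (Fin n)) :
    decodePtr n (encodePtr o) = o := by
  cases o with
  | none => simp [decodePtr, encodePtr]
  | some v => simp [decodePtr, encodePtr]

theorem encodePtr_inj {n : ℕ} {o o' : Option (Fin n)} : encodePtr o = encodePtr o' ↔ o = o' :=
  ⟨fun h => by rw [← decodePtr_encodePtr o, h, decodePtr_encodePtr], fun h => h ▸ rfl⟩

theorem encodePtr_eq_zero {n : ℕ} {o : Option (Fin n)} : encodePtr o = 0 ↔ o = none := by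
  cases o <;> simp [encodePtr]

theorem encodePtr_le {n : ℕ} (o : Option (Fin n)) : encodePtr o ≤ n := by
  cases o with
  | none => simp [encodePtr]
  | some v => exact v.2

/-- The value of a field of a record. -/
def LinkCut.field {n : ℕ} (T : LinkCut (Fin n)) (f : Fin 4) (v : Fin n) : ℕ :=
  match f with
  | 0 => encodePtr (T.parent v)
  | 1 => encodePtr (T.left v)
  | 2 => encodePtr (T.right v)
  | 3 => (T.rev v).toNat

/-- `T` is stored in the records from address `base` on. -/
def Stores {n : ℕ} (s : RAMState) (base : ℕ) (T : LinkCut (Fin n)) : Prop :=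
  ∀ (f : Fin 4) (v : Fin n), s.mem (base + 4 * v + f) = T.field f v

theorem Stores.storedLinkCut {n : ℕ} {s : RAMState} {i : ℕ} {T : LinkCut (Fin n)}
    (h : Stores s (s.reg 3 + 4 * (i * n)) T) : storedLinkCut n s i = T := by
  have key : ∀ (f : Fin 4) (v : Fin n), s.mem (s.reg 3 + 4 * (i * n + v) + f) = T.field f v := by
    intro f v
    rw [← h f v]
    congr 1
    ring
  cases T
  simp only [_root_.storedLinkCut, LinkCut.mk.injEq]
  refine ⟨funext fun v => ?_, funext fun v => ?_, funext fun v => ?_, funext fun v => ?_⟩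
  · have := key 0 v
    simp [LinkCut.field] at this
    simp [this]
  · have := key 1 v
    simp [LinkCut.field] at this
    simp [this]
  · have := key 2 v
    simp [LinkCut.field] at this
    simp [this]
  · have := key 3 v
    simp [LinkCut.field] at this
    rw [this]
    cases ‹Fin n → Bool› v <;> rfl

/-- Compute the address of field `f` of the record of `a` in register `7`; register `6` holds the
address of the records. -/
def addrP (a : LReg) (f : Fin 4) : RAMProg :=
  .seq (.add 7 a.idx a.idx) <| .seq (.add 7 7 7) <| .seq (.add 7 7 6) <|
  .seq (.const 8 (4 - f)) (.sub 7 7 8)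

/-- Implementation of the primitive operations; register `10` holds `0`. -/
def compilePrim : LPrim → RAMProg
  | .move d s => .add d.idx s.idx 10
  | .null d => .const d.idx 0
  | .getParent d a => .seq (addrP a 0) (.load d.idx 7)
  | .getChild false d a => .seq (addrP a 1) (.load d.idx 7)
  | .getChild true d a => .seq (addrP a 2) (.load d.idx 7)
  | .setParent a s => .seq (addrP a 0) (.store 7 s.idx)
  | .setChild false a s => .seq (addrP a 1) (.store 7 s.idx)
  | .setChild true a s => .seq (addrP a 2) (.store 7 s.idx)
  | .flip a => .seq (addrP a 3) <| .seq (.load 9 7) <| .seq (.const 8 1) <|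
      .seq (.sub 9 8 9) (.store 7 9)
  | .getRev d a => .seq (addrP a 3) <| .seq (.load 9 7) <| .ite (.eq 9 10) (.const d.idx 0)
      (.add d.idx a.idx 10)

/-- Implementation of the tests. -/
def compileTest : LTest → RAMTest
  | .isNull a => .eq a.idx 10
  | .notNull a => .lt 10 a.idx
  | .eq a b => .eq a.idx b.idx

/-- Implementation of programs on link-cut structures. -/
def LProg (c : Cmd LPrim LTest) : RAMProg := c.compile compilePrim compileTest

/-- The machine state `s` represents the state `a`, and agrees with `s₀` in other parts of the
memory and in some registers. -/
structure Simulates {n : ℕ} (base : ℕ) (s₀ s : RAMState) (a : LState (Fin n)) : Prop where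
  env : ∀ r : LReg, s.reg r.idx = encodePtr (a.env r)
  stores : Stores s base a.T
  cur : s.reg 6 = base
  zero : s.reg 10 = 0
  reg : ∀ r, r < 6 ∨ r = 12 → s.reg r = s₀.reg r
  mem : ∀ x, x < base ∨ base + 4 * n ≤ x → s.mem x = s₀.mem x

section

variable {W n base : ℕ} {s₀ s : RAMState} {a : LState (Fin n)}

/-- Pointers are stored as `x + 1`, so four times the code overshoots by 4. Subtracting `4 - f`
corrects this and adds the field offset at once. -/
theorem addrP_spec {r : LReg} {x : Fin n} {f : Fin 4} {Q : RAMState → ℕ → Prop}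
    (hW : base + 4 * n + 4 ≤ W) (hs : Simulates base s₀ s a) (hr : a.env r = some x)
    (h : ∀ s', Simulates base s₀ s' a → s'.reg 7 = base + 4 * x + f → Q s' 5) :
    RAMTri W (addrP r f) s Q := by
  have hx := x.2
  have hf := f.2
  have e₁ : s.reg r.idx = x + 1 := by rw [hs.env, hr]; rfl
  have e₂ := hs.cur
  have h20 := LReg.le_idx r
  refine .seq (.add (by omega) (.seq (.add ?_ (.seq (.add ?_ (.seq (.const (by omega) (.sub ?_))))))))
  · simp; omega
  · simp; omega
  · refine h _ ⟨fun q => ?_, fun f v => ?_, ?_, ?_, fun q hq => ?_, fun y hy => ?_⟩ ?_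
    · have := LReg.le_idx q
      rw [← hs.env q]
      simp
      repeat rw [if_neg (by omega)]
    · exact hs.stores f v
    · simpa using e₂
    · simpa using hs.zero
    · rw [← hs.reg q hq]
      simp
      repeat rw [if_neg (by omega)]
    · simpa using hs.mem y hy
    · simp [e₁, e₂]
      omega

theorem Simulates.setReg (hs : Simulates base s₀ s a) (d : LReg) {o : Option (Fin n)} {x : ℕ}
    (hx : x = encodePtr o) :
    Simulates base s₀ (s.setReg d.idx x) ⟨Function.update a.env d o, a.T⟩ := by
  have hd := LReg.le_idx d
  refine ⟨fun q => ?_, hs.stores, ?_, ?_, fun q hq => ?_, hs.mem⟩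
  · by_cases hq : q = d
    · subst hq; simp [hx]
    · simp [hq, hs.env]
  · simp only [RAMState.setReg_reg]; rw [if_neg (by omega), hs.cur]
  · simp only [RAMState.setReg_reg]; rw [if_neg (by omega), hs.zero]
  · simp only [RAMState.setReg_reg]; rw [if_neg (by omega), hs.reg q hq]

theorem Simulates.setTemp (hs : Simulates base s₀ s a) {r x : ℕ} (hr : 7 ≤ r ∧ r ≤ 9) :
    Simulates base s₀ (s.setReg r x) a := by
  refine ⟨fun q => ?_, hs.stores, ?_, ?_, fun q hq => ?_, hs.mem⟩
  · have := LReg.le_idx q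
    simp only [RAMState.setReg_reg]; rw [if_neg (by omega), hs.env]
  · simp only [RAMState.setReg_reg]; rw [if_neg (by omega), hs.cur]
  · simp only [RAMState.setReg_reg]; rw [if_neg (by omega), hs.zero]
  · simp only [RAMState.setReg_reg]; rw [if_neg (by omega), hs.reg q hq]

theorem Simulates.setField (hs : Simulates base s₀ s a) {f : Fin 4} {v : Fin n} {x : ℕ}
    {T' : LinkCut (Fin n)}
    (hT : ∀ g w, T'.field g w = if g = f ∧ w = v then x else a.T.field g w) :
    Simulates base s₀ (s.setMem (base + 4 * v + f) x) ⟨a.env, T'⟩ := by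
  have hv := v.2
  have hf := f.2
  refine ⟨hs.env, fun g w => ?_, hs.cur, hs.zero, hs.reg, fun y hy => ?_⟩
  · have hg := g.2
    rw [hT, RAMState.setMem_mem, hs.stores g w]
    congr 1
    rw [Fin.ext_iff, Fin.ext_iff, eq_iff_iff]
    omega
  · rw [RAMState.setMem_mem, if_neg (by omega), hs.mem y hy]

theorem compilePrim_spec (hW : base + 4 * n + 4 ≤ W) (p : LPrim) (s : RAMState)
    (a : LState (Fin n)) (hs : Simulates base s₀ s a) (hp : (lcSem (Fin n)).pre p a) :
    RAMTri W (compilePrim p) s fun s' t => Simulates base s₀ s' ((lcSem (Fin n)).act p a) ∧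
      t ≤ 10 := by
  have hle : ∀ r : LReg, s.reg r.idx ≤ n := fun r => by rw [hs.env]; exact encodePtr_le _
  cases p with
  | move d r =>
    refine .add (by have := hle r; have := hs.zero; omega) ⟨hs.setReg d ?_, by norm_num⟩
    rw [hs.zero, hs.env, add_zero]
  | null d => exact .const (by omega) ⟨hs.setReg d rfl, by norm_num⟩
  | getParent d r =>
    obtain ⟨x, hx⟩ := Option.isSome_iff_exists.1 hp
    refine .seq (addrP_spec hW hs hx fun s' hs' h7 => .load ⟨hs'.setReg d ?_, by norm_num⟩)
    rw [h7, hs'.stores 0 x]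
    simp [hx, LinkCut.field]
  | getChild b d r =>
    obtain ⟨x, hx⟩ := Option.isSome_iff_exists.1 hp
    cases b
    · refine .seq (addrP_spec hW hs hx fun s' hs' h7 => .load ⟨hs'.setReg d ?_, by norm_num⟩)
      rw [h7, hs'.stores 1 x]
      simp [hx, LinkCut.field]
    · refine .seq (addrP_spec hW hs hx fun s' hs' h7 => .load ⟨hs'.setReg d ?_, by norm_num⟩)
      rw [h7, hs'.stores 2 x]
      simp [hx, LinkCut.field]
  | setParent r q =>
    obtain ⟨x, hx⟩ := Option.isSome_iff_exists.1 hp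
    refine .seq (addrP_spec hW hs hx fun s' hs' h7 => .store ⟨?_, by norm_num⟩)
    rw [h7]
    refine hs'.setField fun g w => ?_
    rw [hs'.env]
    fin_cases g <;> by_cases hw : w = x <;>
      simp [hx, LinkCut.field, LinkCut.setParent, hw]
  | setChild b r q =>
    obtain ⟨x, hx⟩ := Option.isSome_iff_exists.1 hp
    cases b
    · refine .seq (addrP_spec hW hs hx fun s' hs' h7 => .store ⟨?_, by norm_num⟩)
      rw [h7]
      refine hs'.setField fun g w => ?_
      rw [hs'.env]
      fin_cases g <;> by_cases hw : w = x <;>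
        simp [hx, LinkCut.field, LinkCut.setChild, LinkCut.setLeft, hw]
    · refine .seq (addrP_spec hW hs hx fun s' hs' h7 => .store ⟨?_, by norm_num⟩)
      rw [h7]
      refine hs'.setField fun g w => ?_
      rw [hs'.env]
      fin_cases g <;> by_cases hw : w = x <;>
        simp [hx, LinkCut.field, LinkCut.setChild, LinkCut.setRight, hw]
  | flip r =>
    obtain ⟨x, hx⟩ := Option.isSome_iff_exists.1 hp
    refine .seq (addrP_spec hW hs hx fun s' hs' h7 => .seq (.load (.seq (.const (by omega)
      (.seq (.sub (.store ⟨?_, by norm_num⟩)))))))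
    have := (((hs'.setTemp (r := 9) (x := s'.mem (s'.reg 7)) (by omega)).setTemp (r := 8) (x := 1)
      (by omega)).setTemp (r := 9) (x := 1 - s'.mem (s'.reg 7)) (by omega))
    have h3 := hs'.stores 3 x
    simp only [RAMState.setReg_reg, h7] at this ⊢
    rw [h3] at this ⊢
    refine this.setField fun g w => ?_
    fin_cases g <;> by_cases hw : w = x <;>
      simp [hx, LinkCut.field, LinkCut.flip, hw]
    cases a.T.rev x <;> rfl
  | getRev d r =>
    obtain ⟨x, hx⟩ := Option.isSome_iff_exists.1 hp
    refine .seq (addrP_spec hW hs hx fun s' hs' h7 => .seq (.load ?_))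
    have h3 := hs'.stores 3 x
    rw [h7, h3]
    have hs'' := hs'.setTemp (r := 9) (x := a.T.field 3 x) (by omega)
    have h0 := hs''.zero
    refine .ite (fun hb => .const (by omega) ⟨hs''.setReg d ?_, by norm_num⟩)
      fun hb => .add ?_ ⟨hs''.setReg d ?_, by norm_num⟩
    · simp only [RAMTest.Holds, h0] at hb
      have : a.T.rev x = false := by simpa [LinkCut.field] using hb
      simp [hx, this, encodePtr]
    · rw [h0, hs''.env]
      have := encodePtr_le (a.env r)
      omega
    · simp only [RAMTest.Holds, h0] at hb
      have : a.T.rev x = true := by simpa [LinkCut.field] using hb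
      rw [h0, hs''.env]
      simp [hx, this]

theorem LProg_spec {c : Cmd LPrim LTest} {Q : (LReg → Option (Fin n)) → LinkCut (Fin n) → ℕ → Prop}
    (hW : base + 4 * n + 4 ≤ W) (hs : Simulates base s₀ s a) (h : LTri c a.env a.T Q) :
    RAMTri W (LProg c) s fun s' t => ∃ env T t', Simulates base s₀ s' ⟨env, T⟩ ∧ Q env T t' ∧
      t ≤ 10 * t' := by
  obtain ⟨⟨env, T⟩, t', he, hQ⟩ := h
  refine (he.compile (cP := compilePrim) (cB := compileTest) (K := 10) (W := W)
    (R := Simulates base s₀) (by norm_num) (compilePrim_spec hW) (fun b s a hs => ?_) s hs).mono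
    fun s' t h => ⟨env, T, t', h.1, hQ, h.2⟩
  cases b with
  | isNull r => simp [compileTest, RAMTest.Holds, lcSem, hs.env, hs.zero, encodePtr_eq_zero]
  | notNull r =>
    simp [compileTest, RAMTest.Holds, lcSem, hs.env, hs.zero, Nat.pos_iff_ne_zero,
      encodePtr_eq_zero]
  | eq r q => simp [compileTest, RAMTest.Holds, lcSem, hs.env, encodePtr_inj]

end

/-! ### The cascade -/

/-- Clear some registers. -/
def clearP : List ℕ → RAMProg
  | [] => .skip
  | r :: l => .seq (.const r 0) (clearP l)

theorem clearP_spec {W : ℕ} (l : List ℕ) : ∀ {s : RAMState} {Q : RAMState → ℕ → Prop},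
    (∀ s', (∀ r ∈ l, s'.reg r = 0) → (∀ r, r ∉ l → s'.reg r = s.reg r) → s'.mem = s.mem →
      Q s' (l.length + 1)) → RAMTri W (clearP l) s Q := by
  induction l with
  | nil => exact fun h => .skip (h _ (by simp) (by simp) rfl)
  | cons a l ih =>
    refine fun h => .seq (.const (by omega) (ih fun s' h₁ h₂ h₃ => ?_))
    have := h s' (fun r hr => ?_) (fun r hr => ?_) h₃
    · rwa [List.length_cons, add_comm l.length, add_assoc] at this
    · by_cases hl : r ∈ l
      · exact h₁ r hl
      · rw [h₂ r hl]
        simp_all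
    · simp only [List.mem_cons, not_or] at hr
      rw [h₂ r hr.2]
      simp [hr.1]

/-- `k` link-cut structures are stored from address `B` on, and their position is noted in
registers. -/
structure Maintains (n k B : ℕ) (s : RAMState) (T : ℕ → LinkCut (Fin n)) : Prop where
  reg3 : s.reg 3 = B
  reg4 : s.reg 4 = 4 * n
  reg5 : s.reg 5 = B + 4 * (k * n)
  stores : ∀ j < k, Stores s (B + 4 * (j * n)) (T j)

/-- Hand the edge between `u` and `v` to the structure at the address in register `6`, and ejected
edges to the subsequent structures. -/
def cascadeLoopP : RAMProg :=
  .loop (.lt 6 12) <| .seq (LProg tryAddP) <|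
    .ite (.eq LReg.o.idx 10) (.add 12 6 10) (.seq (.add 6 6 4) (.add LReg.v.idx LReg.o.idx 10))

/-- The result of a cascade as it is found in the registers. -/
def CascadeOut {n : ℕ} (s : RAMState) : Option (Fin n × Fin n) → Prop
  | none => s.reg LReg.o.idx = 0
  | some e => s.reg LReg.o.idx ≠ 0 ∧ s.reg LReg.u.idx = e.1 + 1 ∧ s.reg LReg.v.idx = e.2 + 1

theorem one_le_lg {n : ℕ} (hn : 2 ≤ n) : 1 ≤ lg n := by
  have : lg 2 ≤ lg n := lg_mono (by norm_num) hn
  rwa [show lg 2 = 1 from by simp [lg]] at this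

/-- `d + 1` is the number of forests from position `i` on. An ejected edge is always incident with
`x`, so the register of `x` stays fixed throughout and only the other end is replaced. When nothing
is ejected, the end marker in register `12` is set to the current address, which stops the loop. The
potentials of the forests already passed do not enter the bound. -/
theorem cascadeLoop_spec {W n k B : ℕ} (hW : B + 4 * (k * n) + 4 ≤ W) (hn : 2 ≤ n) {d : ℕ} :
    ∀ {i : ℕ} {s : RAMState} {env : LReg → Option (Fin n)} {T : ℕ → LinkCut (Fin n)}
      {sz : ℕ → Fin n → ℕ} {x y : Fin n}, i + d + 1 = k → Maintains n k B s T → s.reg 10 = 0 →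
    (∀ r : LReg, s.reg r.idx = encodePtr (env r)) → s.reg 6 = B + 4 * (i * n) →
    s.reg 12 = B + 4 * (k * n) → env .u = some x → env .v = some y → x ≠ y →
    (∀ j < k, (T j).WellFormed ∧ IsSize (T j).parent (sz j)) →
    RAMTri W cascadeLoopP s fun s' t => ∃ (T' : ℕ → LinkCut (Fin n)) (sz' : ℕ → Fin n → ℕ)
      (e : ℕ → Option (Fin n × Fin n)), Maintains n k B s' T' ∧ s'.reg 10 = 0 ∧
      (∀ j < k, (T' j).WellFormed ∧ IsSize (T' j).parent (sz' j)) ∧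
      (∀ j < i, T' j = T j ∧ sz' j = sz j) ∧ e i = some (x, y) ∧
      (∀ j, i ≤ j → j < k → (e j = none → (T' j).forest = (T j).forest ∧ e (j + 1) = none) ∧
        ∀ x y, e j = some (x, y) → TryAdd (T j).forest x y (T' j).forest (e (j + 1))) ∧
      CascadeOut s' (e k) ∧
      (t : ℝ) + 2500 * ∑ j ∈ Finset.Ico i k, potential (sz' j) ≤
        1 + 2500 * ∑ j ∈ Finset.Ico i k, potential (sz j) + (d + 1) * (80000 * lg n) := by
  induction d with
  | zero | succ d ih => ?_
  all_goals
    intro i s env T sz x y hik hM h10 henv h6 h12 hx hy hxy hT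
    have hlg := one_le_lg hn
    have hin : i * n + n ≤ k * n := by
      rw [← Nat.succ_mul]; exact Nat.mul_le_mul_right n (by omega)
    obtain ⟨hw, hs⟩ := hT i (by omega)
    have sim : Simulates (B + 4 * (i * n)) s s ⟨env, T i⟩ :=
      ⟨henv, hM.stores i (by omega), h6, h10, fun _ _ => rfl, fun _ _ => rfl⟩
    refine .loop_step (by simp only [RAMTest.Holds, h6, h12]; omega) (.seq ?_)
    refine (LProg_spec (W := W) (by omega) sim (tryAddP_spec (Q := fun env' T' t => ∃ sz' N,
      env' .u = some x ∧ env' .v = some y ∧ T'.WellFormed ∧ IsSize T'.parent sz' ∧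
      TryAdd (T i).forest x y T'.forest ((env' .o).map fun p => (x, p)) ∧
      potential sz' + 2 * (N : ℕ) ≤ potential (sz i) + 22 * lg n ∧ t ≤ 500 * N + 2000) hx hy hxy hw hs
      fun env' T' sz' N t h₁ h₂ h₃ h₄ h₅ h₆ h₇ => ⟨sz', N, h₁, h₂, h₃, h₄, h₅, by simpa using h₆, h₇⟩)).mono
      ?_
    rintro s₁ t₁ ⟨env₁, T₁, t', sim₁, ⟨sz₁, N, hx₁, hy₁, hw₁, hs₁, hadd, hpot, ht'⟩, ht₁⟩
    have hM₁ : Maintains n k B s₁ (Function.update T i T₁) := by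
      refine ⟨(sim₁.reg 3 (by omega)).trans hM.reg3, (sim₁.reg 4 (by omega)).trans hM.reg4,
        (sim₁.reg 5 (by omega)).trans hM.reg5, fun j hj => ?_⟩
      by_cases hji : j = i
      · subst hji; simpa using sim₁.stores
      · rw [Function.update_of_ne hji]
        intro f v
        rw [← hM.stores j hj f v]
        refine sim₁.mem _ ?_
        have := f.2
        have := v.2
        rcases Nat.lt_or_gt_of_ne hji with h | h
        · have : j * n + n ≤ i * n := by rw [← Nat.succ_mul]; exact Nat.mul_le_mul_right n h
          omega
        · have : i * n + n ≤ j * n := by rw [← Nat.succ_mul]; exact Nat.mul_le_mul_right n h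
          omega
    have hT₁ : ∀ j < k, (Function.update T i T₁ j).WellFormed ∧
        IsSize (Function.update T i T₁ j).parent (Function.update sz i sz₁ j) := by
      intro j hj
      by_cases hji : j = i
      · subst hji; simpa using ⟨hw₁, hs₁⟩
      · simpa [hji] using hT j hj
    have off : ∀ j < i, Function.update T i T₁ j = T j ∧ Function.update sz i sz₁ j = sz j := by
      intro j hj
      simp [hj.ne]
    have hu := sim₁.env .u
    have hv := sim₁.env .v
    have ho := sim₁.env .o
    simp only [hx₁, hy₁] at hu hv ho
    have hsum : ∀ f : ℕ → ℝ, ∑ j ∈ Finset.Ico i k, f j = f i + ∑ j ∈ Finset.Ico (i + 1) k, f j :=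
      fun f => Finset.sum_eq_sum_Ico_succ_bot (by omega) f
    have hsame : ∑ j ∈ Finset.Ico (i + 1) k, potential (Function.update sz i sz₁ j) =
        ∑ j ∈ Finset.Ico (i + 1) k, potential (sz j) := by
      refine Finset.sum_congr rfl fun j hj => ?_
      rw [Finset.mem_Ico] at hj
      rw [Function.update_of_ne (by omega)]
    -- The compiled program takes at most 10 (500 N + 2000) steps. The weight 2500 turns the two
    -- units of potential per `N` into 5000, which cancels 5000 N. What remains, 55000 lg n + 20000,
    -- is absorbed by lg n ≥ 1, with room for the control instructions.
    have ht : (t₁ : ℝ) + 2500 * potential sz₁ ≤ 2500 * potential (sz i) + 79980 * lg n - 20 := by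
      have h₁ : (t₁ : ℝ) ≤ 10 * (500 * N + 2000) := by exact_mod_cast ht₁.trans (by omega)
      linarith
    -- nothing is ejected
    have halted : env₁ .o = none → ∀ (s' : RAMState) (t : ℕ),
        s' = s₁.setReg 12 (s₁.reg 6) → t ≤ t₁ + 10 →
        ∃ (T' : ℕ → LinkCut (Fin n)) (sz' : ℕ → Fin n → ℕ)
      (e : ℕ → Option (Fin n × Fin n)), Maintains n k B s' T' ∧ s'.reg 10 = 0 ∧
        (∀ j < k, (T' j).WellFormed ∧ IsSize (T' j).parent (sz' j)) ∧
        (∀ j < i, T' j = T j ∧ sz' j = sz j) ∧ e i = some (x, y) ∧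
        (∀ j, i ≤ j → j < k → (e j = none → (T' j).forest = (T j).forest ∧ e (j + 1) = none) ∧
          ∀ x y, e j = some (x, y) → TryAdd (T j).forest x y (T' j).forest (e (j + 1))) ∧
        CascadeOut s' (e k) ∧
        (t : ℝ) + 2500 * ∑ j ∈ Finset.Ico i k, potential (sz' j) ≤
          1 + 2500 * ∑ j ∈ Finset.Ico i k, potential (sz j) + 80000 * lg n := by
      rintro hnone s' t rfl htt
      refine ⟨Function.update T i T₁, Function.update sz i sz₁,
        fun j => if j = i then some (x, y) else none,
        ⟨hM₁.reg3, hM₁.reg4, hM₁.reg5, hM₁.stores⟩, sim₁.zero, hT₁, off, by simp,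
        fun j h₁ h₂ => ⟨fun hj => ?_, fun a b hj => ?_⟩, ?_, ?_⟩
      · have hji : j ≠ i := by rintro rfl; simp at hj
        simp only [hji, ne_eq, not_false_eq_true, Function.update_of_ne, true_and]
        rw [if_neg (by omega)]
      · by_cases hji : j = i
        · subst hji
          simp only [if_true, Option.some.injEq, Prod.mk.injEq] at hj
          obtain ⟨rfl, rfl⟩ := hj
          simpa [hnone] using hadd
        · simp [hji] at hj
      · dsimp only
        rw [if_neg (by omega)]
        rw [hnone] at ho
        simpa [CascadeOut, LReg.idx, encodePtr] using ho
      · rw [hsum, hsum, hsame, Function.update_self]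
        have h₁ : (t : ℝ) ≤ t₁ + 10 := by exact_mod_cast htt
        linarith
    have h6₁ := sim₁.cur
    have h12₁ := sim₁.reg 12 (by omega)
    have h10₁ := sim₁.zero
    refine .ite (fun hb => .add (by omega) (.loop_done ?_ ?_)) fun hb => .seq (.add ?_ (.add ?_ ?_))
  · simp [RAMTest.Holds, h10₁]
  · have hnone : env₁ .o = none := by
      simp only [RAMTest.Holds, h10₁, ho, encodePtr_eq_zero] at hb
      exact hb
    have := halted hnone _ (t₁ + (1 + 1) + 1 + 1) rfl (by omega)
    rw [h10₁, add_zero]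
    push_cast at this ⊢
    simpa using this
  · rw [h6₁, hM₁.reg4]; omega
  · simp only [RAMState.setReg_reg, h10₁, LReg.idx]
    have := encodePtr_le (env₁ .o)
    simp [LReg.idx] at ho
    simp [ho]
    omega
  · obtain ⟨p, hp⟩ : ∃ p, env₁ .o = some p := by
      simp only [RAMTest.Holds, h10₁, ho, encodePtr_eq_zero] at hb
      exact Option.ne_none_iff_exists'.1 hb
    rw [hp] at ho hadd
    simp only [LReg.idx, encodePtr] at hu hv ho
    refine .loop_done ?_ ?_
    · simp only [RAMTest.Holds, RAMState.setReg_reg, LReg.idx]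
      simp [h6₁, h12₁, h12, hM₁.reg4]
      subst hik
      ring_nf
      omega
    -- In the last forest the ejected edge is not handed on; it stays in the registers as the
    -- discarded edge.
    · refine ⟨Function.update T i T₁, Function.update sz i sz₁,
        fun j => if j = i then some (x, y) else some (x, p),
        ⟨hM₁.reg3, hM₁.reg4, hM₁.reg5, hM₁.stores⟩, sim₁.zero, hT₁, off, by simp,
        fun j h₁ h₂ => ⟨fun hj => ?_, fun a b hj => ?_⟩, ?_, ?_⟩
      · dsimp only at hj; split_ifs at hj
      · obtain rfl : j = i := by omega
        simp only [if_true, Option.some.injEq, Prod.mk.injEq] at hj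
        obtain ⟨rfl, rfl⟩ := hj
        simpa using hadd
      · dsimp only
        rw [if_neg (by omega)]
        simp [CascadeOut, LReg.idx, ho, hu, h10₁]
      · rw [hsum, hsum, hsame, Function.update_self]
        push_cast
        linarith
  · simp [RAMTest.Holds, h10₁]
  · have hnone : env₁ .o = none := by
      simp only [RAMTest.Holds, h10₁, ho, encodePtr_eq_zero] at hb
      exact hb
    have := halted hnone _ (t₁ + (1 + 1) + 1 + 1) rfl (by omega)
    rw [h10₁, add_zero]
    obtain ⟨T', sz', e, g₁, g₂, g₃, g₄, g₅, g₆, g₇, g₈⟩ := this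
    refine ⟨T', sz', e, g₁, g₂, g₃, g₄, g₅, g₆, g₇, g₈.trans ?_⟩
    have : (0 : ℝ) ≤ d * (80000 * lg n) := by positivity
    push_cast
    linarith
  · rw [h6₁, hM₁.reg4]; omega
  · simp only [RAMState.setReg_reg, h10₁, LReg.idx]
    have := encodePtr_le (env₁ .o)
    simp [LReg.idx] at ho
    simp [ho]
    omega
  · obtain ⟨p, hp⟩ : ∃ p, env₁ .o = some p := by
      simp only [RAMTest.Holds, h10₁, ho, encodePtr_eq_zero] at hb
      exact Option.ne_none_iff_exists'.1 hb
    rw [hp] at ho hadd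
    -- The edge handed on must not be a loop, which holds because it was an edge of the forest.
    have hxp : x ≠ p := by
      generalize T₁.forest = F' at hadd
      cases hadd with
      | swap p h hp hs => exact hp.ne
    refine (ih (i := i + 1) (env := Function.update env₁ .v (some p)) (T := Function.update T i T₁)
      (sz := Function.update sz i sz₁) (x := x) (y := p) (by omega) ?_ ?_ ?_ ?_ ?_ (by simp [hx₁])
      (by simp) hxp hT₁).mono ?_
    · exact ⟨by simpa [LReg.idx] using hM₁.reg3, by simpa [LReg.idx] using hM₁.reg4,
        by simpa [LReg.idx] using hM₁.reg5, hM₁.stores⟩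
    · simpa [LReg.idx] using h10₁
    · intro r
      by_cases hr : r = .v
      · subst hr
        rw [Function.update_self, ← ho]
        simp [LReg.idx, h10₁]
      · rw [Function.update_of_ne hr, ← sim₁.env r]
        have := LReg.le_idx r
        simp only [RAMState.setReg_reg, LReg.idx_inj, hr, if_false]
        rw [if_neg (by omega)]
    · simp [LReg.idx, h6₁, hM₁.reg4]; ring
    · simp [LReg.idx, h12₁, h12]
    · rintro s₂ t₂ ⟨T', sz', e, g₁, g₂, g₃, g₄, g₅, g₆, g₇, g₈⟩
      obtain ⟨g₉, g₁₀⟩ := g₄ i (by omega)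
      rw [Function.update_self] at g₉ g₁₀
      refine ⟨T', sz', fun j => if j = i then some (x, y) else e j, g₁, g₂, g₃,
        fun j hj => ?_, by simp, fun j h₁ h₂ => ?_, ?_, ?_⟩
      · have := g₄ j (by omega)
        rwa [(off j hj).1, (off j hj).2] at this
      · by_cases hji : j = i
        · subst hji
          refine ⟨fun h => by simp at h, fun a b hj => ?_⟩
          simp only [if_true, Option.some.injEq, Prod.mk.injEq] at hj
          obtain ⟨rfl, rfl⟩ := hj
          dsimp only
          rw [if_neg (by omega), g₅, g₉]
          simpa using hadd
        · have := g₆ j (by omega) h₂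
          rw [Function.update_of_ne hji] at this
          simp only [hji, if_false]
          rwa [if_neg (by omega)]
      · dsimp only
        rwa [if_neg (by omega)]
      · rw [hsum, hsum]
        rw [hsame] at g₈
        rw [g₁₀]
        push_cast
        linarith

/-- The program for the addition of an edge. -/
def insP : RAMProg :=
  .seq (clearP (10 :: List.range' 20 18)) <| .seq (.const 7 1) <| .seq (.add LReg.u.idx 0 7) <|
  .seq (.add LReg.v.idx 1 7) <| .seq (.add 6 3 10) <| .seq (.add 12 5 10) <|
  .seq cascadeLoopP <| .ite (.eq LReg.o.idx 10) (.const 0 0) <| .seq (.const 0 1) <|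
  .seq (.const 7 1) <| .seq (.sub 1 LReg.u.idx 7) (.sub 2 LReg.v.idx 7)

/-- Requests and answers use plain vertex numbers, registers of link-cut programs use codes shifted
by one; hence the additions of 1 at the beginning and the subtractions at the end. -/
theorem insP_spec {W n k B : ℕ} (hW : B + 4 * (k * n) + 4 ≤ W) (hn : 2 ≤ n) (hk : 1 ≤ k)
    {s : RAMState} {T : ℕ → LinkCut (Fin n)} {sz : ℕ → Fin n → ℕ} {x y : Fin n} (hxy : x ≠ y)
    (hM : Maintains n k B s T)
    (hT : ∀ j < k, (T j).WellFormed ∧ IsSize (T j).parent (sz j)) :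
    RAMTri W insP (withRequest s x y) fun s' t => ∃ (T' : ℕ → LinkCut (Fin n))
      (sz' : ℕ → Fin n → ℕ) (out : Option (Fin n × Fin n)), Maintains n k B s' T' ∧
      (∀ j < k, (T' j).WellFormed ∧ IsSize (T' j).parent (sz' j)) ∧
      HandleAddition (fun i : Fin k => (T i).forest) x y (fun i : Fin k => (T' i).forest) out ∧
      ReportsDiscarded s' out ∧
      (t : ℝ) + 2500 * ∑ j ∈ Finset.range k, potential (sz' j) ≤
        2500 * ∑ j ∈ Finset.range k, potential (sz j) + k * (80100 * lg n) := by
  have hlg := one_le_lg hn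
  have hx := x.2
  have hy := y.2
  have hnk : n ≤ k * n := Nat.le_mul_of_pos_left n (by omega)
  refine .seq (clearP_spec _ fun s₁ c₁ c₂ c₃ => ?_)
  have r0 : s₁.reg 0 = x := by rw [c₂ 0 (by simp [List.mem_range'_1])]; simp [withRequest]
  have r1 : s₁.reg 1 = y := by rw [c₂ 1 (by simp [List.mem_range'_1])]; simp [withRequest]
  have r3 : s₁.reg 3 = B := by
    rw [c₂ 3 (by simp [List.mem_range'_1])]; simp [withRequest, hM.reg3]
  have r4 : s₁.reg 4 = 4 * n := by
    rw [c₂ 4 (by simp [List.mem_range'_1])]; simp [withRequest, hM.reg4]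
  have r5 : s₁.reg 5 = B + 4 * (k * n) := by
    rw [c₂ 5 (by simp [List.mem_range'_1])]; simp [withRequest, hM.reg5]
  have r10 : s₁.reg 10 = 0 := c₁ 10 (by simp)
  have rr : ∀ r : LReg, s₁.reg r.idx = 0 := by
    intro r
    refine c₁ _ (List.mem_cons_of_mem _ (List.mem_range'_1.2 ⟨LReg.le_idx r, ?_⟩))
    cases r <;> simp [LReg.idx]
  refine .seq (.const (by omega) (.seq (.add ?_ (.seq (.add ?_ (.seq (.add ?_ (.seq (.add ?_
    (.seq ?_))))))))))
  · simp [r0]; omega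
  · simp [r1, LReg.idx]; omega
  · simp [r3, r10, LReg.idx]; omega
  · simp [r5, r10, LReg.idx]; omega
  refine (cascadeLoop_spec hW hn (d := k - 1) (i := 0) (T := T) (sz := sz) (x := x) (y := y)
    (env := fun r => if r = .u then some x else if r = .v then some y else none) (by omega)
    ⟨?_, ?_, ?_, fun j hj f v => ?_⟩ ?_ (fun r => ?_) ?_ ?_ (by simp) (by simp) hxy hT).mono ?_
  · simpa [LReg.idx] using r3
  · simpa [LReg.idx] using r4
  · simpa [LReg.idx] using r5
  · rw [← hM.stores j hj f v]
    simp [c₃, withRequest]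
  · simpa [LReg.idx] using r10
  · have := rr r
    cases r <;> simp [LReg.idx] at this <;> simp [LReg.idx, encodePtr, r0, r1, this]
  · simp [LReg.idx, r3, r10]
  · simp [LReg.idx, r5, r10]
  · rintro s₂ t₂ ⟨T', sz', e, g₁, g₂, g₃, -, g₅, g₆, g₇, g₈⟩
    rw [← Finset.range_eq_Ico] at g₈
    -- The work outside the loop is absorbed by raising 80000 to 80100, since k lg n ≥ 1.
    have time : ∀ t : ℕ, t ≤ t₂ + 49 →
        (t : ℝ) + 2500 * ∑ j ∈ Finset.range k, potential (sz' j) ≤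
        2500 * ∑ j ∈ Finset.range k, potential (sz j) + k * (80100 * lg n) := by
      intro t ht
      have h₁ : (t : ℝ) ≤ t₂ + 49 := by exact_mod_cast ht
      have hk' : ((k - 1 : ℕ) : ℝ) + 1 = k := by rw [Nat.cast_sub hk]; simp
      rw [hk'] at g₈
      have h₂ : (1 : ℝ) ≤ k * lg n := by
        have : (1 : ℝ) ≤ k := by exact_mod_cast hk
        nlinarith
      linarith
    have hH : HandleAddition (fun i : Fin k => (T i).forest) x y (fun i : Fin k => (T' i).forest)
        (e k) := ⟨e, g₅, rfl, fun i => g₆ i (Nat.zero_le _) i.2⟩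
    have done : ∀ s' : RAMState, s'.mem = s₂.mem → (∀ r, 3 ≤ r → r < 6 → s'.reg r = s₂.reg r) →
        ∀ t : ℕ, t ≤ t₂ + 49 → ReportsDiscarded s' (e k) →
        ∃ (T' : ℕ → LinkCut (Fin n))
      (sz' : ℕ → Fin n → ℕ) (out : Option (Fin n × Fin n)), Maintains n k B s' T' ∧
        (∀ j < k, (T' j).WellFormed ∧ IsSize (T' j).parent (sz' j)) ∧
        HandleAddition (fun i : Fin k => (T i).forest) x y (fun i : Fin k => (T' i).forest) out ∧
        ReportsDiscarded s' out ∧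
        (t : ℝ) + 2500 * ∑ j ∈ Finset.range k, potential (sz' j) ≤
          2500 * ∑ j ∈ Finset.range k, potential (sz j) + k * (80100 * lg n) := by
      intro s' h₁ h₂ t ht hr
      refine ⟨T', sz', e k, ⟨?_, ?_, ?_, fun j hj f v => ?_⟩, g₃, hH, hr, time t ht⟩
      · rw [h₂ 3 (by omega) (by omega), g₁.reg3]
      · rw [h₂ 4 (by omega) (by omega), g₁.reg4]
      · rw [h₂ 5 (by omega) (by omega), g₁.reg5]
      · rw [h₁]; exact g₁.stores j hj f v
    refine .ite (fun hb => .const (by omega) ?_) fun hb => .seq (.const (by omega)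
      (.seq (.const (by omega) (.seq (.sub (.sub ?_))))))
    · simp only [RAMTest.Holds, g₂] at hb
      cases he : e k with
      | none =>
        refine done _ (by rfl) (fun r h₁ h₂ => ?_) _ (by simp; omega) (by simp [he, ReportsDiscarded])
        simp
        omega
      | some q =>
        rw [he] at g₇
        exact absurd hb g₇.1
    · simp only [RAMTest.Holds, g₂] at hb
      cases he : e k with
      | none =>
        rw [he] at g₇
        exact absurd g₇ hb
      | some q =>
        rw [he] at g₇
        obtain ⟨-, g₈, g₉⟩ := g₇
        simp only [LReg.idx] at g₈ g₉
        refine done _ (by rfl) (fun r h₁ h₂ => ?_) _ (by simp; omega) ?_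
        · simp only [RAMState.setReg_reg]
          repeat rw [if_neg (by omega)]
        · simp [he, ReportsDiscarded, LReg.idx, g₈, g₉]

/-! ### Sparse certificates -/

section Certificate

variable {V : Type} {F F' : SimpleGraph V} {x y : V} {o : Option (V × V)}

/-- `o` is the edge `z`, in one of its two orientations. -/
def Hands (o : Option (V × V)) (z : Sym2 V) : Prop := ∃ e, o = some e ∧ s(e.1, e.2) = z

@[simp] theorem hands_none (z : Sym2 V) : ¬ Hands none z := by simp [Hands]

@[simp] theorem hands_some (e : V × V) (z : Sym2 V) : Hands (some e) z ↔ z = s(e.1, e.2) := by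
  simp [Hands, eq_comm]

theorem SimpleGraph.Reachable.of_adj_reachable {G F : SimpleGraph V}
    (h : ∀ a b, G.Adj a b → F.Reachable a b) {a b : V} (hab : G.Reachable a b) : F.Reachable a b := by
  obtain ⟨w⟩ := hab
  induction w with
  | nil => rfl
  | cons hadj _ ih => exact (h _ _ hadj).trans ih

/-- Follow the walk from `b` until it is about to use the deleted edge; at that moment it stands at
an end of this edge. -/
theorem SimpleGraph.reachable_deleteEdges_or {G : SimpleGraph V} {x p b : V} (h : G.Reachable b x) :
    (G.deleteEdges {s(x, p)}).Reachable b x ∨ (G.deleteEdges {s(x, p)}).Reachable b p := by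
  obtain ⟨w⟩ := h
  induction w with
  | nil => exact .inl (by rfl)
  | @cons b c x hadj _ ih =>
    by_cases hz : s(b, c) = s(x, p)
    · rcases Sym2.eq_iff.1 hz with ⟨rfl, -⟩ | ⟨rfl, -⟩
      · exact .inl (by rfl)
      · exact .inr (by rfl)
    · have hbc : (G.deleteEdges {s(x, p)}).Adj b c := by simpa [hadj] using hz
      exact ih.imp hbc.reachable.trans hbc.reachable.trans

theorem mem_edgeSet_sup_edge (F : SimpleGraph V) (hxy : x ≠ y) (z : Sym2 V) :
    z ∈ (F ⊔ SimpleGraph.edge x y).edgeSet ↔ z ∈ F.edgeSet ∨ z = s(x, y) := by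
  induction z with
  | _ a b =>
    simp only [SimpleGraph.mem_edgeSet, SimpleGraph.sup_adj, SimpleGraph.edge_adj, Sym2.eq_iff]
    constructor
    · exact Or.imp id And.left
    · refine Or.imp id fun h => ⟨h, ?_⟩
      rcases h with ⟨rfl, rfl⟩ | ⟨rfl, rfl⟩
      · exact hxy
      · exact hxy.symm

theorem TryAdd.hands_mem (h : TryAdd F x y F' o) {z : Sym2 V} (hz : Hands o z) :
    z ∈ F.edgeSet := by
  cases h with
  | link h => simp at hz
  | swap p h hp hs =>
    obtain rfl := (hands_some _ _).1 hz
    exact hp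

theorem TryAdd.mem_edgeSet (h : TryAdd F x y F' o) (hxy : x ≠ y) (hn : s(x, y) ∉ F.edgeSet)
    (z : Sym2 V) : z ∈ F'.edgeSet ↔ (z ∈ F.edgeSet ∨ z = s(x, y)) ∧ ¬ Hands o z := by
  cases h with
  | link h => simp only [mem_edgeSet_sup_edge F hxy, hands_none, not_false_eq_true, and_true]
  | swap p h hp hs =>
    rw [mem_edgeSet_sup_edge _ hxy, SimpleGraph.edgeSet_deleteEdges, hands_some]
    simp only [Set.mem_sdiff, Set.mem_singleton_iff]
    constructor
    · rintro (⟨h₁, h₂⟩ | rfl)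
      · exact ⟨.inl h₁, h₂⟩
      · exact ⟨.inr rfl, fun h => hn (h ▸ hp)⟩
    · rintro ⟨h₁ | rfl, h₂⟩
      · exact .inl ⟨h₁, h₂⟩
      · exact .inr rfl

theorem TryAdd.isAcyclic (h : TryAdd F x y F' o) (hF : F.IsAcyclic) : F'.IsAcyclic := by
  cases h with
  | link h => exact hF.sup_edge_of_not_reachable h
  | swap p h hp hs => exact (hF.anti (SimpleGraph.deleteEdges_le _)).sup_edge_of_not_reachable hs

/-- After a swap `y` is still connected to `x` or to `p`, and by the choice of the ejected edge not
to `x`. So `x`, the new edge and the old connection from `y` to `p` replace the ejected edge. -/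
theorem TryAdd.reachable (h : TryAdd F x y F' o) (hxy : x ≠ y) {a b : V} (hab : F.Reachable a b) :
    F'.Reachable a b := by
  cases h with
  | link h => exact hab.mono le_sup_left
  | swap p h hp hs =>
    have hle : F.deleteEdges {s(x, p)} ≤ F.deleteEdges {s(x, p)} ⊔ SimpleGraph.edge x y :=
      le_sup_left
    have hyp := (SimpleGraph.reachable_deleteEdges_or (p := p) h.symm).resolve_left
      fun h => hs h.symm
    have hxp : (F.deleteEdges {s(x, p)} ⊔ SimpleGraph.edge x y).Reachable x p := by
      refine SimpleGraph.Reachable.trans (SimpleGraph.Adj.reachable ?_) (hyp.mono hle)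
      exact .inr ((SimpleGraph.edge_adj _ _ _ _).2 ⟨.inl ⟨rfl, rfl⟩, hxy⟩)
    refine .of_adj_reachable (fun c d hcd => ?_) hab
    by_cases hz : s(c, d) = s(x, p)
    · rcases Sym2.eq_iff.1 hz with ⟨rfl, rfl⟩ | ⟨rfl, rfl⟩
      · exact hxp
      · exact hxp.symm
    · refine SimpleGraph.Adj.reachable (.inl ?_)
      simpa [hcd] using hz

theorem mem_edgeSet_iSup {ι : Type*} (F : ι → SimpleGraph V) (z : Sym2 V) :
    z ∈ (⨆ i, F i).edgeSet ↔ ∃ i, z ∈ (F i).edgeSet := by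
  induction z with
  | _ a b => simp [SimpleGraph.iSup_adj]

theorem mem_edgeSet_remaining {k : ℕ} (A : SimpleGraph V) (F : Fin k → SimpleGraph V) (i : Fin k)
    (z : Sym2 V) : z ∈ (A \ ⨆ j, ⨆ _ : j < i, F j).edgeSet ↔
      z ∈ A.edgeSet ∧ ∀ j < i, z ∉ (F j).edgeSet := by
  induction z with
  | _ a b => simp [SimpleGraph.iSup_adj]

section Cascade

variable {k : ℕ} {A : SimpleGraph V} {F F' : Fin k → SimpleGraph V} {u v : V} {out : Option (V × V)}

theorem IsSparseCertificate.mem (hA : IsSparseCertificate A F) {i : Fin k} {z : Sym2 V}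
    (hz : z ∈ (F i).edgeSet) : z ∈ A.edgeSet ∧ ∀ j < i, z ∉ (F j).edgeSet :=
  (mem_edgeSet_remaining A F i z).1 (SimpleGraph.edgeSet_subset_edgeSet.2 (hA i).1 hz)

theorem IsSparseCertificate.disjoint (hA : IsSparseCertificate A F) {i j : Fin k} {z : Sym2 V}
    (hi : z ∈ (F i).edgeSet) (hj : z ∈ (F j).edgeSet) : i = j := by
  rcases lt_trichotomy i j with h | h | h
  · exact absurd hi ((hA.mem hj).2 i h)
  · exact h
  · exact absurd hj ((hA.mem hi).2 j h)

/-- One step of a cascade in terms of edge sets. -/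
structure CascadeStep (F F' : SimpleGraph V) (e e' : Option (V × V)) : Prop where
  mem : ∀ z, z ∈ F'.edgeSet ↔ (z ∈ F.edgeSet ∨ Hands e z) ∧ ¬ Hands e' z
  ejected : ∀ z, Hands e' z → z ∈ F.edgeSet
  acyclic : F.IsAcyclic → F'.IsAcyclic
  reach : ∀ a b, F.Reachable a b → F'.Reachable a b

/-- A cascade in terms of edge sets; `e i` is the edge that is handed to the `i`-th forest. -/
structure Cascade (A : SimpleGraph V) (F F' : Fin k → SimpleGraph V) (u v : V)
    (e : ℕ → Option (V × V)) : Prop where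
  cert : IsSparseCertificate A F
  pos : 0 < k
  ne : u ≠ v
  start : e 0 = some (u, v)
  step : ∀ i : Fin k, CascadeStep (F i) (F' i) (e i) (e (i + 1))
  handed : ∀ i, i ≤ k → ∀ z, Hands (e i) z → (z ∈ A.edgeSet ∨ z = s(u, v)) ∧
    (∀ j : Fin k, i ≤ j → z ∉ (F j).edgeSet) ∧ ∀ j : Fin k, j < i → z ∉ (F' j).edgeSet

/-- This step translates the cascade into statements about edge sets. That an edge on its way is new
to every forest it will still meet follows from the disjointness of the old forests, and for the
first edge from the assumption on the request. -/
theorem HandleAddition.cascade (h : HandleAddition F u v F' out) (hA : IsSparseCertificate A F)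
    (hk : 0 < k) (huv : u ≠ v) (hnew : ¬ (⨆ i, F i).Adj u v) :
    ∃ e, Cascade A F F' u v e ∧ e k = out := by
  obtain ⟨e, h0, hk', he⟩ := h
  have hnew' : ∀ i, s(u, v) ∉ (F i).edgeSet := fun i hi => hnew (SimpleGraph.iSup_adj.2 ⟨i, hi⟩)
  have hstep : ∀ i : Fin k, (∀ z, Hands (e i) z → ¬ z.IsDiag ∧ z ∉ (F i).edgeSet) →
      CascadeStep (F i) (F' i) (e i) (e (i + 1)) := by
    intro i hi
    cases hei : e i with
    | none =>
      obtain ⟨h₁, h₂⟩ := (he i).1 hei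
      rw [h₁, h₂]
      exact ⟨by simp, by simp, id, fun _ _ => id⟩
    | some q =>
      obtain ⟨x, y⟩ := q
      have hT := (he i).2 x y hei
      obtain ⟨h₁, h₂⟩ := hi s(x, y) (by simp [hei])
      have hxy : x ≠ y := by simpa using h₁
      exact ⟨by simpa using hT.mem_edgeSet hxy h₂, fun z => hT.hands_mem, hT.isAcyclic,
        fun a b => hT.reachable hxy⟩
  have main : ∀ i, i ≤ k → (∀ z, Hands (e i) z → ¬ z.IsDiag) ∧
      (∀ z, Hands (e i) z → (z ∈ A.edgeSet ∨ z = s(u, v)) ∧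
      (∀ j : Fin k, i ≤ j → z ∉ (F j).edgeSet) ∧ ∀ j : Fin k, j < i → z ∉ (F' j).edgeSet) ∧
      ∀ j : Fin k, j < i → CascadeStep (F j) (F' j) (e j) (e (j + 1)) ∧
        ∀ z, Hands (e j) z → ∀ l : Fin k, j ≤ l → z ∉ (F l).edgeSet := by
    intro i
    induction i with
    | zero =>
      refine fun _ => ⟨fun z hz => ?_, fun z hz => ?_, fun j hj => by omega⟩
      · rw [h0, hands_some] at hz
        subst hz
        simpa using huv
      · rw [h0, hands_some] at hz
        exact ⟨.inr hz, fun j _ => hz ▸ hnew' j, fun j hj => by omega⟩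
    | succ i ih =>
      intro hi
      obtain ⟨h₁, h₂, h₃⟩ := ih (by omega)
      have hs := hstep ⟨i, by omega⟩ fun z hz => ⟨h₁ z hz, (h₂ z hz).2.1 ⟨i, by omega⟩ le_rfl⟩
      have h₃' : ∀ j : Fin k, j < i + 1 → CascadeStep (F j) (F' j) (e j) (e (j + 1)) ∧
          ∀ z, Hands (e j) z → ∀ l : Fin k, j ≤ l → z ∉ (F l).edgeSet := by
        intro j hj
        rcases Nat.lt_succ_iff_lt_or_eq.1 hj with hj | hj
        · exact h₃ j hj
        · subst hj
          exact ⟨hs, fun z hz l hl => (h₂ z hz).2.1 l hl⟩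
      refine ⟨fun z hz hd => ?_, fun z hz => ⟨?_, fun j hj hzj => ?_, fun j hj hzj => ?_⟩, h₃'⟩
      · exact (F ⟨i, by omega⟩).not_isDiag_of_mem_edgeSet (hs.ejected z hz) hd
      · exact .inl (hA.mem (hs.ejected z hz)).1
      · have := hA.disjoint hzj (hs.ejected z hz)
        rw [this] at hj
        simp at hj
      -- An edge of a new forest was there before or was handed to it. In the first case
      -- disjointness makes this the ejecting forest, which no longer contains `z`. In the second
      -- case `z` would have been absent from all later old forests, including the one that ejects
      -- it.
      · obtain ⟨g₁, g₂⟩ := h₃' j hj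
        obtain ⟨g₃, g₄⟩ := (g₁.mem z).1 hzj
        rcases g₃ with g₃ | g₃
        · obtain rfl := hA.disjoint g₃ (hs.ejected z hz)
          exact g₄ hz
        · exact g₂ z g₃ ⟨i, by omega⟩ (by rw [Fin.le_def]; simp; omega) (hs.ejected z hz)
  refine ⟨e, ⟨hA, hk, huv, h0, fun i => ((main k le_rfl).2.2 i i.2).1,
    fun i hi => (main i hi).2.1⟩, hk'⟩

namespace Cascade

variable {e : ℕ → Option (V × V)} (h : Cascade A F F' u v e)
include h

/-- The central invariant: the graph left over by the first `i` new forests is contained in the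
graph left over by the old ones, except possibly for the edge handed to position `i`. -/
theorem remaining {z : Sym2 V} (hz : z ∈ A.edgeSet ∨ z = s(u, v)) : ∀ i, i ≤ k →
    (∀ j : Fin k, j < i → z ∉ (F' j).edgeSet) →
    (z ∈ A.edgeSet ∧ ∀ j : Fin k, j < i → z ∉ (F j).edgeSet) ∨ Hands (e i) z := by
  intro i
  induction i with
  | zero =>
    intro _ _
    rcases hz with hz | hz
    · exact .inl ⟨hz, fun j hj => by omega⟩
    · exact .inr (by simp [h.start, hz])
  | succ i ih =>
    intro hi hF
    have hs := h.step ⟨i, by omega⟩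
    have hni := hF ⟨i, by omega⟩ (Nat.lt_succ_self i)
    rw [hs.mem, not_and, not_not] at hni
    rcases ih (by omega) fun j hj => hF j (by omega) with ⟨h₁, h₂⟩ | h₁
    · by_cases hzi : z ∈ (F ⟨i, by omega⟩).edgeSet
      · exact .inr (hni (.inl hzi))
      · refine .inl ⟨h₁, fun j hj => ?_⟩
        rcases Nat.lt_succ_iff_lt_or_eq.1 hj with hj | hj
        · exact h₂ j hj
        · subst hj
          exact hzi
    · exact .inr (hni (.inr h₁))

/-- A forest never ejects the edge it has just received, because the ejected edge belonged to the
old forest and the received one did not. -/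
theorem handed_mem {i : Fin k} {z : Sym2 V} (hz : Hands (e i) z) : z ∈ (F' i).edgeSet := by
  refine ((h.step i).mem z).2 ⟨.inr hz, fun hz' => ?_⟩
  exact (h.handed i i.2.le z hz).2.1 i le_rfl ((h.step i).ejected z hz')

theorem remaining_le {i j : Fin k} (hji : j < i) {z : Sym2 V} (hz : z ∈ (F' i).edgeSet) :
    z ∉ (F' j).edgeSet := by
  intro hz'
  rcases (((h.step i).mem z).1 hz).1 with h₁ | h₁
  · obtain ⟨h₂ | h₂, h₃⟩ := ((h.step j).mem z).1 hz'
    · exact hji.ne (h.cert.disjoint h₂ h₁)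
    · exact (h.handed j j.2.le z h₂).2.1 i hji.le h₁
  · exact (h.handed i i.2.le z h₁).2.2 j hji hz'

/-- For maximality it suffices to treat single edges of the leftover graph. By `remaining` such an
edge was left over before, so its ends are connected in the old forest and stay connected, or it is
the handed edge, which is now in the forest. -/
theorem certificate : IsSparseCertificate (A ⊔ SimpleGraph.edge u v) F' := by
  intro i
  refine ⟨SimpleGraph.edgeSet_subset_edgeSet.1 fun z hz => ?_, (h.step i).acyclic (h.cert i).2.1, ?_⟩
  · rw [mem_edgeSet_remaining, mem_edgeSet_sup_edge _ h.ne]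
    refine ⟨?_, fun j hj => h.remaining_le hj hz⟩
    rcases (((h.step i).mem z).1 hz).1 with h₁ | h₁
    · exact .inl (h.cert.mem h₁).1
    · exact (h.handed i i.2.le z h₁).1
  · intro a b hab
    refine .of_adj_reachable (fun c d hcd => ?_) hab
    have hz := (mem_edgeSet_remaining _ F' i s(c, d)).1 hcd
    rw [mem_edgeSet_sup_edge _ h.ne] at hz
    rcases h.remaining hz.1 i i.2.le hz.2 with h₁ | h₁
    · refine (h.step i).reach c d ((h.cert i).2.2 c d (SimpleGraph.Adj.reachable ?_))
      exact (mem_edgeSet_remaining A F i s(c, d)).2 h₁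
    · exact SimpleGraph.Adj.reachable (h.handed_mem h₁)

theorem mem_union (z : Sym2 V) : z ∈ (⨆ i, F' i).edgeSet ↔
    (z ∈ (⨆ i, F i).edgeSet ∨ z = s(u, v)) ∧ ¬ Hands (e k) z := by
  have handed : ∀ i, i ≤ k → Hands (e i) z → z ∈ (⨆ i, F i).edgeSet ∨ z = s(u, v) := by
    intro i hi hz
    cases i with
    | zero => exact .inr (by simpa [h.start] using hz)
    | succ i =>
      exact .inl ((mem_edgeSet_iSup _ _).2 ⟨_, (h.step ⟨i, by omega⟩).ejected z hz⟩)
  constructor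
  · intro hz
    obtain ⟨i, hi⟩ := (mem_edgeSet_iSup _ _).1 hz
    refine ⟨?_, fun hk => (h.handed k le_rfl z hk).2.2 i i.2 hi⟩
    rcases (((h.step i).mem z).1 hi).1 with h₁ | h₁
    · exact .inl ((mem_edgeSet_iSup _ _).2 ⟨i, h₁⟩)
    · exact handed i i.2.le h₁
  · rintro ⟨hz, hn⟩
    rw [mem_edgeSet_iSup]
    by_contra hF
    push Not at hF
    have hz' : z ∈ A.edgeSet ∨ z = s(u, v) := hz.imp
      (fun hz => by obtain ⟨i, hi⟩ := (mem_edgeSet_iSup _ _).1 hz; exact (h.cert.mem hi).1) id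
    rcases h.remaining hz' k le_rfl fun j _ => hF j with ⟨h₁, h₂⟩ | h₁
    · rcases hz with hz | hz
      · obtain ⟨i, hi⟩ := (mem_edgeSet_iSup _ _).1 hz
        exact h₂ i i.2 hi
      · exact hF ⟨0, h.pos⟩ (h.handed_mem (i := ⟨0, h.pos⟩) (by simp [h.start, hz]))
    · exact hn h₁

theorem union_of_none (hk : e k = none) : ⨆ i, F' i = (⨆ i, F i) ⊔ SimpleGraph.edge u v := by
  refine SimpleGraph.edgeSet_injective (Set.ext fun z => ?_)
  rw [h.mem_union, mem_edgeSet_sup_edge _ h.ne, hk]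
  simp

/-- The discarded edge lies in the enlarged graph but in no new forest. So it survives in every
leftover graph, and each new forest connects its ends. The forests are pairwise disjoint, hence so
are their paths. -/
theorem of_some {x y : V} (hk : e k = some (x, y)) : s(x, y) ≠ s(u, v) ∧ (⨆ i, F i).Adj x y ∧
    ⨆ i, F' i = ((⨆ i, F i) ⊔ SimpleGraph.edge u v).deleteEdges {s(x, y)} ∧
    HasEdgeDisjointPaths (⨆ i, F' i) k x y := by
  have hz : Hands (e k) s(x, y) := by simp [hk]
  obtain ⟨h₁, -, h₂⟩ := h.handed k le_rfl _ hz
  have hne : s(x, y) ≠ s(u, v) := fun he =>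
    h₂ ⟨0, h.pos⟩ h.pos (h.handed_mem (i := ⟨0, h.pos⟩) (by simp [h.start, he]))
  refine ⟨hne, ?_, ?_, ?_⟩
  · obtain ⟨l, rfl⟩ : ∃ l, k = l + 1 := ⟨k - 1, by have := h.pos; omega⟩
    exact SimpleGraph.iSup_adj.2 ⟨_, (h.step ⟨l, by omega⟩).ejected _ hz⟩
  · refine SimpleGraph.edgeSet_injective (Set.ext fun z => ?_)
    rw [h.mem_union, SimpleGraph.edgeSet_deleteEdges, Set.mem_sdiff, mem_edgeSet_sup_edge _ h.ne, hk]
    simp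
  · have hr : ∀ i, (F' i).Reachable x y := fun i => by
      refine (h.certificate i).2.2 x y (SimpleGraph.Adj.reachable ?_)
      refine (mem_edgeSet_remaining _ F' i s(x, y)).2
        ⟨(mem_edgeSet_sup_edge _ h.ne _).2 h₁, fun j _ => h₂ j j.2⟩
    have hp : ∀ i, ∃ w : (F' i).Walk x y, w.IsPath := fun i => by
      classical
      obtain ⟨w⟩ := hr i
      exact ⟨w.toPath.1, w.toPath.2⟩
    choose w hw using hp
    have hle : ∀ i, F' i ≤ ⨆ i, F' i := fun i => le_iSup F' i
    refine ⟨fun i => ⟨(w i).mapLe (hle i), (hw i).mapLe (hle i)⟩, fun i j hij z hi hj => ?_⟩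
    simp only [SimpleGraph.Walk.edges_mapLe_eq_edges] at hi hj
    have hi := (w i).edges_subset_edgeSet hi
    have hj := (w j).edges_subset_edgeSet hj
    rcases lt_or_gt_of_ne hij with hlt | hlt
    · exact h.remaining_le hlt hj hi
    · exact h.remaining_le hlt hi hj

end Cascade

end Cascade

end Certificate

/-! ### The scan computes a sparse certificate -/

section Scan

variable {V : Type} {G : SimpleGraph V}

/-- Invariants of the scan. -/
structure ScanInv (G : SimpleGraph V) (S : ScanState V) : Prop where
  sub : ∀ i, ∀ e ∈ S.E i, e ∈ S.scannedE
  cover : ∀ e ∈ S.scannedE, e ∈ G.edgeSet ∧ ∃ i, e ∈ S.E i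
  disjoint : ∀ i j, ∀ e ∈ S.E i, e ∈ S.E j → i = j
  active : ∀ x, S.active = some x → x ∉ S.scannedV ∧ ∀ y, y ∉ S.scannedV → S.r y ≤ S.r x
  closed : ∀ x ∈ S.scannedV, ∀ y, G.Adj x y → s(x, y) ∈ S.scannedE
  isolated : ∀ z, z ∉ S.scannedV → ∀ i, S.r z ≤ i → ∀ y, s(z, y) ∉ S.E i
  reach : ∀ z w, z ∉ S.scannedV → w ∉ S.scannedV → ∀ i, i < S.r z → i < S.r w →
    (SimpleGraph.fromEdgeSet (S.E i)).Reachable z w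
  acyclic : ∀ i, (SimpleGraph.fromEdgeSet (S.E i)).IsAcyclic
  maximal : ∀ i j, i ≤ j → ∀ a b, s(a, b) ∈ S.E j →
    (SimpleGraph.fromEdgeSet (S.E i)).Reachable a b

theorem ScanInv.start : ScanInv G (ScanState.start V) := by
  constructor <;> simp [ScanState.start]

theorem SimpleGraph.not_reachable_of_isolated {F : SimpleGraph V} {x y : V} (hxy : x ≠ y)
    (h : ∀ z, ¬ F.Adj y z) : ¬ F.Reachable x y := by
  intro hr
  obtain ⟨w⟩ := hr.symm
  cases w with
  | nil => exact hxy rfl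
  | cons hadj _ => exact h _ hadj

/-- Only scanning an edge {x, y} needs work. Isolation of `y` at its rank gives acyclicity, and the
connections at lower levels between `x` and `y` give maximality. Raising the rank of `x` in case of
equal ranks keeps both invariants and the maximality of the rank of `x`. -/
theorem ScanInv.step {S S' : ScanState V} (h : ScanInv G S) (hs : ScanStep G S S') :
    ScanInv G S' := by
  classical
  cases hs with
  | choose x ha hx hmax =>
    exact ⟨h.sub, h.cover, h.disjoint, fun y hy => by cases hy; exact ⟨hx, hmax⟩, h.closed,
      h.isolated, h.reach, h.acyclic, h.maximal⟩
  | close x ha hall =>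
    refine ⟨h.sub, h.cover, h.disjoint, by simp, fun y hy z hyz => ?_, fun z hz => ?_,
      fun z w hz hw => ?_, h.acyclic, h.maximal⟩
    · rcases hy with rfl | hy
      · exact hall z hyz
      · exact h.closed y hy z hyz
    · exact h.isolated z fun h' => hz (.inr h')
    · exact h.reach z w (fun h' => hz (.inr h')) fun h' => hw (.inr h')
  | edge x y ha hxy hs =>
    obtain ⟨hx, hmax⟩ := h.active x ha
    have hne := hxy.ne
    -- All edges at a scanned vertex are scanned, so the other end of an unscanned edge is unscanned
    -- and its rank is at most that of `x`.
    have hy : y ∉ S.scannedV := fun hy => hs (by rw [Sym2.eq_swap]; exact h.closed y hy x hxy.symm)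
    have hyx := hmax y hy
    have hnot : ∀ i, s(x, y) ∉ S.E i := fun i hi => hs (h.sub i _ hi)
    have hiso : ∀ z, ¬ (SimpleGraph.fromEdgeSet (S.E (S.r y))).Adj y z := fun z hz => by
      rw [SimpleGraph.fromEdgeSet_adj] at hz
      exact h.isolated y hy _ le_rfl z hz.1
    set E' := Function.update S.E (S.r y) (insert s(x, y) (S.E (S.r y))) with hE'
    have mem : ∀ i e, e ∈ E' i ↔ e ∈ S.E i ∨ i = S.r y ∧ e = s(x, y) := by
      intro i e
      by_cases hi : i = S.r y
      · subst hi; simp [hE', or_comm]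
      · simp [hE', hi]
    have hle : ∀ i, SimpleGraph.fromEdgeSet (S.E i) ≤ SimpleGraph.fromEdgeSet (E' i) := fun i =>
      SimpleGraph.fromEdgeSet_mono fun e he => (mem i e).2 (.inl he)
    have hadj : (SimpleGraph.fromEdgeSet (E' (S.r y))).Adj x y :=
      (SimpleGraph.fromEdgeSet_adj _).2 ⟨(mem _ _).2 (.inr ⟨rfl, rfl⟩), hne⟩
    -- the rank of unscanned vertices and the levels at which they are connected
    have connect : ∀ z, z ∉ S.scannedV → ∀ i, i < (if z = y then S.r y + 1 else
        if z = x ∧ S.r x = S.r y then S.r x + 1 else S.r z) → i < S.r z ∨ i = S.r y ∧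
        (z = y ∨ z = x ∧ S.r x = S.r y) := by
      intro z hz i hi
      split_ifs at hi with h₁ h₂
      · subst h₁
        rcases Nat.lt_succ_iff_lt_or_eq.1 hi with h₂ | h₂
        · exact .inl h₂
        · exact .inr ⟨h₂, .inl rfl⟩
      · obtain ⟨rfl, h₃⟩ := h₂
        rcases Nat.lt_succ_iff_lt_or_eq.1 hi with h₂ | h₂
        · exact .inl h₂
        · exact .inr ⟨h₂.trans h₃, .inr ⟨rfl, h₃⟩⟩
      · exact .inl hi
    -- whoever is connected at the level of `y` is connected to `x`
    have toX : ∀ z, z ∉ S.scannedV → (S.r y < S.r z ∨ z = y ∨ z = x ∧ S.r x = S.r y) →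
        (SimpleGraph.fromEdgeSet (E' (S.r y))).Reachable z x := by
      rintro z hz (h₁ | rfl | ⟨rfl, -⟩)
      · exact (h.reach z x hz hx _ h₁ (h₁.trans_le (hmax z hz))).mono (hle _)
      · exact hadj.symm.reachable
      · rfl
    refine ⟨fun i e he => ?_, fun e he => ?_, fun i j e hi hj => ?_, fun z hz => ?_,
      fun z hz w hzw => .inr (h.closed z hz w hzw), fun z hz i hi w hw => ?_,
      fun z w hz hw i hi hj => ?_, fun i => ?_, fun i j hij a b hab => ?_⟩
    · rcases (mem i e).1 he with he | ⟨-, rfl⟩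
      · exact .inr (h.sub i e he)
      · exact .inl rfl
    · rcases he with rfl | he
      · exact ⟨hxy, S.r y, (mem _ _).2 (.inr ⟨rfl, rfl⟩)⟩
      · obtain ⟨h₁, i, hi⟩ := h.cover _ he
        exact ⟨h₁, i, (mem _ _).2 (.inl hi)⟩
    · rcases (mem i e).1 hi with hi | ⟨rfl, rfl⟩ <;> rcases (mem j _).1 hj with hj | ⟨rfl, h₂⟩
      · exact h.disjoint i j _ hi hj
      · exact absurd (h₂ ▸ hi) (hnot i)
      · exact absurd hj (hnot j)
      · rfl
    · obtain rfl : x = z := Option.some.inj (ha.symm.trans hz)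
      refine ⟨hx, fun w hw => ?_⟩
      have := hmax w hw
      by_cases hwy : w = y
      · subst hwy
        by_cases hr : S.r x = S.r w
        · simp [hne, hr]
        · simp [hne, hr]; omega
      · by_cases hwx : w = x
        · simp [hwx]
        · simp only [hwy, hwx, hne, if_false, false_and, true_and]
          split_ifs <;> omega
    · have hi' : S.r z ≤ i := by
        refine le_trans ?_ hi
        dsimp only
        split_ifs with h₁ h₂
        · subst h₁; omega
        · rw [h₂.1]; omega
        · exact le_rfl
      rcases (mem i _).1 hw with hw | ⟨rfl, hwe⟩
      · exact h.isolated z hz i hi' w hw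
      · dsimp only at hi
        rcases Sym2.eq_iff.1 hwe with ⟨rfl, rfl⟩ | ⟨rfl, rfl⟩
        · split_ifs at hi with h₁ h₂
          · omega
          · omega
          · exact h₂ ⟨rfl, le_antisymm hi hyx⟩
        · simp at hi
    · rcases connect z hz i hi with h₁ | ⟨rfl, h₁⟩
      · rcases connect w hw i hj with h₂ | ⟨rfl, h₂⟩
        · exact (h.reach z w hz hw i h₁ h₂).mono (hle i)
        · exact (toX z hz (.inl h₁)).trans (toX w hw (.inr h₂)).symm
      · rcases connect w hw _ hj with h₂ | ⟨-, h₂⟩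
        · exact (toX z hz (.inr h₁)).trans (toX w hw (.inl h₂)).symm
        · exact (toX z hz (.inr h₁)).trans (toX w hw (.inr h₂)).symm
    -- Only the class of index `r y` grows, and `y` was isolated in it, so the new edge closes no
    -- cycle.
    · by_cases hi : i = S.r y
      · subst hi
        have : SimpleGraph.fromEdgeSet (E' (S.r y)) =
            SimpleGraph.fromEdgeSet (S.E (S.r y)) ⊔ SimpleGraph.edge x y := by
          rw [hE', Function.update_self, Set.insert_eq, Set.union_comm, SimpleGraph.edge,
            SimpleGraph.fromEdgeSet_union]
        rw [this]
        exact (h.acyclic _).sup_edge_of_not_reachable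
          (SimpleGraph.not_reachable_of_isolated hne hiso)
      · simpa [hE', hi] using h.acyclic i
    · rcases (mem j _).1 hab with hab | ⟨rfl, habe⟩
      · exact (h.maximal i j hij a b hab).mono (hle i)
      -- Below the rank of `y` both ends have larger rank than `i` and are already connected; at the
      -- rank itself the new edge connects them.
      · have key : (SimpleGraph.fromEdgeSet (E' i)).Reachable x y := by
          rcases Nat.lt_or_eq_of_le hij with hlt | rfl
          · exact (h.reach x y hx hy i (hlt.trans_le hyx) hlt).mono (hle i)
          · exact hadj.reachable
        rcases Sym2.eq_iff.1 habe with ⟨rfl, rfl⟩ | ⟨rfl, rfl⟩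
        · exact key
        · exact key.symm

theorem ScanInv.of_steps {S : ScanState V}
    (h : Relation.ReflTransGen (ScanStep G) (ScanState.start V) S) : ScanInv G S := by
  induction h with
  | refl => exact .start
  | tail _ hs ih => exact ih.step hs

/-- At the end every edge of `G` is in a class. An edge left over by the first `i` classes is in a
class of index at least `i`, and the invariant `maximal` connects its ends in class `i`. -/
theorem IsScanPartition.isSparseCertificate {E : ℕ → Set (Sym2 V)} (h : IsScanPartition G E)
    (k : ℕ) : IsSparseCertificate G fun i : Fin k => SimpleGraph.fromEdgeSet (E i) := by
  obtain ⟨S, hS, -, hall, rfl⟩ := h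
  have hI := ScanInv.of_steps hS
  have hE : ∀ i (e : Sym2 V), e ∈ (SimpleGraph.fromEdgeSet (S.E i)).edgeSet ↔ e ∈ S.E i := by
    intro i e
    rw [SimpleGraph.edgeSet_fromEdgeSet]
    refine ⟨And.left, fun he => ⟨he, ?_⟩⟩
    exact G.not_isDiag_of_mem_edgeSet (hI.cover e (hI.sub i e he)).1
  intro i
  refine ⟨SimpleGraph.edgeSet_subset_edgeSet.1 fun e he => ?_, hI.acyclic i, fun x y hxy => ?_⟩
  · rw [mem_edgeSet_remaining]
    rw [hE] at he
    refine ⟨(hI.cover e (hI.sub i e he)).1, fun j hj hej => ?_⟩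
    rw [hE] at hej
    exact hj.ne (Fin.ext (hI.disjoint j i e hej he))
  · refine .of_adj_reachable (fun a b hab => ?_) hxy
    obtain ⟨h₁, h₂⟩ := (mem_edgeSet_remaining G (fun i : Fin k => SimpleGraph.fromEdgeSet (S.E i)) i
      s(a, b)).1 hab
    obtain ⟨j, hj⟩ := (hI.cover _ (hI.closed a (hall a) b h₁)).2
    refine hI.maximal i j (not_lt.1 fun hlt => ?_) a b hj
    exact h₂ ⟨j, hlt.trans i.2⟩ hlt ((hE _ _).2 hj)

end Scan

/-! ### The scan with bucket lists -/

/-- Working memory of the scan. `rank v` is `none` once `v` has been chosen; `par i v` is the other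
end of the edge that put `v` on level `i`; the list `bucket b` contains the vertices of rank `b` and
possibly outdated entries; ranks are smaller than `top`; `ptr` are the neighbours of the active
vertex `cur` that remain to be visited; `used` counts the allocated list cells. -/
structure ScanMem (V : Type) where
  rank : V → Option ℕ
  par : ℕ → V → Option V
  adj : V → List V
  bucket : ℕ → List V
  top : ℕ
  cur : Option V
  ptr : List V
  used : ℕ

namespace ScanMem

variable {V : Type} [DecidableEq V]

/-- Take an entry off the highest bucket. -/
def pop (a : ScanMem V) : ScanMem V :=
  match a.bucket (a.top - 1) with
  | [] => { a with top := a.top - 1 }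
  | v :: l =>
    if a.rank v = some (a.top - 1) then
      { a with
        bucket := Function.update a.bucket (a.top - 1) l
        rank := Function.update a.rank v none
        cur := some v
        ptr := a.adj v }
    else { a with bucket := Function.update a.bucket (a.top - 1) l }

/-- Scan the edge from the active vertex to the next neighbour. -/
def visit (a : ScanMem V) : ScanMem V :=
  match a.ptr with
  | [] => a
  | y :: l =>
    match a.rank y with
    | none => { a with ptr := l }
    | some ρ =>
      { a with
        ptr := l
        rank := Function.update a.rank y (some (ρ + 1))
        par := Function.update a.par ρ (Function.update (a.par ρ) y a.cur)
        bucket := Function.update a.bucket (ρ + 1) (y :: a.bucket (ρ + 1))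
        top := max a.top (ρ + 2)
        used := a.used + 1 }

variable {a : ScanMem V} {v y : V} {l : List V} {ρ : ℕ}

theorem pop_nil (hb : a.bucket (a.top - 1) = []) : a.pop = { a with top := a.top - 1 } := by
  simp [pop, hb]

theorem pop_live (hb : a.bucket (a.top - 1) = v :: l) (hv : a.rank v = some (a.top - 1)) :
    a.pop = { a with
      bucket := Function.update a.bucket (a.top - 1) l
      rank := Function.update a.rank v none
      cur := some v
      ptr := a.adj v } := by
  simp [pop, hb, hv]

theorem pop_stale (hb : a.bucket (a.top - 1) = v :: l) (hv : a.rank v ≠ some (a.top - 1)) :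
    a.pop = { a with bucket := Function.update a.bucket (a.top - 1) l } := by
  simp [pop, hb, hv]

theorem visit_done (hp : a.ptr = y :: l) (hy : a.rank y = none) :
    a.visit = { a with ptr := l } := by
  simp [visit, hp, hy]

theorem visit_live (hp : a.ptr = y :: l) (hy : a.rank y = some ρ) :
    a.visit = { a with
      ptr := l
      rank := Function.update a.rank y (some (ρ + 1))
      par := Function.update a.par ρ (Function.update (a.par ρ) y a.cur)
      bucket := Function.update a.bucket (ρ + 1) (y :: a.bucket (ρ + 1))
      top := max a.top (ρ + 2)
      used := a.used + 1 } := by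
  simp [visit, hp, hy]

end ScanMem

/-- Nothing points to `y`, so chains from other vertices never meet the new pointer and remain
finite. -/
theorem PAcyclic.update_leaf {V : Type} [DecidableEq V] {par : V → Option V} (hw : PAcyclic par)
    {x y : V} (hxy : x ≠ y) (hy : ∀ w, par w ≠ some y) :
    PAcyclic (Function.update par y (some x)) := by
  have key : ∀ z, z ≠ y → Acc (fun p c => Function.update par y (some x) c = some p) z := by
    intro z
    induction z using hw.induction with
    | h z ih =>
      refine fun hz => ⟨_, fun p hp => ?_⟩
      rw [Function.update_of_ne hz] at hp
      exact ih p hp fun h => hy z (h ▸ hp)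
  refine ⟨fun z => ?_⟩
  by_cases hz : z = y
  · subst hz
    refine ⟨_, fun p hp => ?_⟩
    rw [Function.update_self] at hp
    exact Option.some.inj hp ▸ key x hxy
  · exact key z hz

inductive ScanPrim where
  | pop
  | visit

inductive ScanTest where
  | more
  | next

/-- Meaning of the operations of the scan, for `M` buckets and `U` list cells. -/
def scanSem (V : Type) [DecidableEq V] (M U : ℕ) : CmdSem (ScanMem V) ScanPrim ScanTest where
  pre
    | .pop, a => 0 < a.top
    | .visit, a => a.ptr ≠ [] ∧ a.used < U ∧ a.top < M ∧ ∀ v ρ, a.rank v = some ρ → ρ < a.top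
  act
    | .pop, a => a.pop
    | .visit, a => a.visit
  holds
    | .more, a => 0 < a.top
    | .next, a => a.ptr ≠ []

/-- The scan. -/
def scanC : Cmd ScanPrim ScanTest :=
  .loop .more (.seq (.prim .pop) (.loop .next (.prim .visit)))

section ScanCorrect

variable {V : Type} [DecidableEq V] {G : SimpleGraph V}

/-- The working memory `a` represents the state `S` of the scan of `G`. -/
structure ScanMem.Represents (G : SimpleGraph V) (S : ScanState V) (a : ScanMem V) : Prop where
  unranked : ∀ v, a.rank v = none ↔ v ∈ S.scannedV ∨ S.active = some v
  rank : ∀ v ρ, a.rank v = some ρ → S.r v = ρ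
  bucket : ∀ v ρ, a.rank v = some ρ → v ∈ a.bucket ρ ∧ ρ < a.top
  edges : ∀ i e, e ∈ S.E i ↔ ∃ x y, a.par i y = some x ∧ e = s(x, y)
  adj : ∀ v w, w ∈ a.adj v ↔ G.Adj v w
  nodup : ∀ v, (a.adj v).Nodup
  scanned : ∀ v w, G.Adj v w → (s(v, w) ∈ S.scannedE ↔ v ∈ S.scannedV ∨ w ∈ S.scannedV ∨
    S.active = some v ∧ w ∉ a.ptr ∨ S.active = some w ∧ v ∉ a.ptr)
  active : ∀ v, S.active = some v → v ∉ S.scannedV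
  ptr : ∀ v, S.active = some v → a.cur = some v ∧ a.ptr.Nodup ∧ ∀ w ∈ a.ptr, G.Adj v w
  idle : S.active = none → a.ptr = []
  acyclic : ∀ i, PAcyclic (a.par i)
  fresh : ∀ v ρ, a.rank v = some ρ → ∀ i, ρ ≤ i → a.par i v = none
  leaf : ∀ v ρ, a.rank v = some ρ → ∀ i w, a.par i w ≠ some v

open ScanMem

/-- Ranks are smaller than `top`, so a current entry of the highest bucket is a vertex of largest
rank and may be chosen. An empty bucket or an outdated entry does not change the represented state.
No rank needs to be kept for a chosen vertex: the scan only uses that it is the largest. -/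
theorem ScanMem.Represents.pop {S : ScanState V} {a : ScanMem V} (h : a.Represents G S)
    (ha : S.active = none) :
    ∃ S', Relation.ReflTransGen (ScanStep G) S S' ∧ a.pop.Represents G S' := by
  have hptr := h.idle ha
  cases hb : a.bucket (a.top - 1) with
  | nil =>
    rw [pop_nil hb]
    refine ⟨S, .refl, { h with bucket := fun v ρ hv => ⟨(h.bucket v ρ hv).1, ?_⟩ }⟩
    obtain ⟨h₁, h₂⟩ := h.bucket v ρ hv
    have hne : ρ ≠ a.top - 1 := by rintro rfl; simp [hb] at h₁
    change ρ < a.top - 1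
    omega
  | cons v l =>
    have hmem : ∀ w ρ, a.rank w = some ρ → (w = v → ρ ≠ a.top - 1) →
        w ∈ Function.update a.bucket (a.top - 1) l ρ ∧ ρ < a.top := by
      intro w ρ hw hne
      obtain ⟨h₁, h₂⟩ := h.bucket w ρ hw
      refine ⟨?_, h₂⟩
      by_cases hρ : ρ = a.top - 1
      · subst hρ
        rw [hb] at h₁
        rcases List.mem_cons.1 h₁ with h₁ | h₁
        · exact absurd rfl (hne h₁)
        · simpa using h₁
      · simpa [hρ] using h₁
    by_cases hv : a.rank v = some (a.top - 1)
    · rw [pop_live hb hv]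
      have hvS : v ∉ S.scannedV := fun hvS => by
        simp [(h.unranked v).2 (.inl hvS)] at hv
      have upd : ∀ w ρ, Function.update a.rank v none w = some ρ → w ≠ v ∧ a.rank w = some ρ := by
        intro w ρ hw
        by_cases hwv : w = v
        · subst hwv; simp at hw
        · exact ⟨hwv, by simpa [hwv] using hw⟩
      refine ⟨_, .single (.choose S v ha hvS fun w hw => ?_), ?_⟩
      · cases hr : a.rank w with
        | none => rcases (h.unranked w).1 hr with h₁ | h₁ <;> simp_all
        | some ρ =>
          have := (h.bucket w ρ hr).2
          rw [h.rank w ρ hr, h.rank v _ hv]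
          omega
      · exact
        { unranked := fun w => by
            by_cases hw : w = v
            · simp [hw]
            · have := h.unranked w
              simp only [Function.update_of_ne hw, this, ha, Option.some_inj]
              simp [Ne.symm hw]
          rank := fun w ρ hw => h.rank w ρ (upd w ρ hw).2
          bucket := fun w ρ hw => hmem w ρ (upd w ρ hw).2 fun he => absurd he (upd w ρ hw).1
          edges := h.edges
          adj := h.adj
          nodup := h.nodup
          scanned := fun x w hxw => by
            rw [h.scanned x w hxw, ha]
            simp only [Option.some_inj, reduceCtorEq, false_and, or_false]
            constructor
            · rintro (h | h)
              · exact .inl h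
              · exact .inr (.inl h)
            · rintro (h₁ | h₁ | ⟨rfl, h₁⟩ | ⟨rfl, h₁⟩)
              · exact .inl h₁
              · exact .inr h₁
              · exact absurd ((h.adj _ _).2 hxw) h₁
              · exact absurd ((h.adj _ _).2 hxw.symm) h₁
          active := fun w hw => Option.some.inj hw ▸ hvS
          ptr := fun w hw => by
            obtain rfl : v = w := Option.some.inj hw
            exact ⟨rfl, h.nodup _, fun w hw => (h.adj _ _).1 hw⟩
          idle := fun hw => by simp at hw
          acyclic := h.acyclic
          fresh := fun w ρ hw => h.fresh w ρ (upd w ρ hw).2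
          leaf := fun w ρ hw => h.leaf w ρ (upd w ρ hw).2 }
    · rw [pop_stale hb hv]
      exact ⟨S, .refl, { h with
        bucket := fun w ρ hw => hmem w ρ hw fun he hρ => hv (by rw [← he, hw, hρ]) }⟩

/-- Recording `x` as parent of `y` on the level of the old rank of `y` stores the new edge in that
class. By `fresh` no pointer is overwritten there, and by `leaf` nothing points to `y`, since only
chosen vertices become parents; so the parent relation stays acyclic. -/
theorem ScanMem.Represents.visit {S : ScanState V} {a : ScanMem V} {x : V} (h : a.Represents G S)
    (hx : S.active = some x) (hp : a.ptr ≠ []) :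
    ∃ S', Relation.ReflTransGen (ScanStep G) S S' ∧ a.visit.Represents G S' ∧
      S'.active = some x := by
  obtain ⟨hcur, hnd, hadj⟩ := h.ptr x hx
  cases hl : a.ptr with
  | nil => exact absurd hl hp
  | cons y l =>
    rw [hl] at hnd hadj
    have hxy : G.Adj x y := hadj y (List.mem_cons_self ..)
    have hyl : y ∉ l := (List.nodup_cons.1 hnd).1
    cases hr : a.rank y with
    | none =>
      rw [visit_done hl hr]
      -- A neighbour without rank is scanned, as it differs from the active vertex. The edge was
      -- treated from its other end, and the scan makes no step.
      have hyS : y ∈ S.scannedV := by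
        rcases (h.unranked y).1 hr with h₁ | h₁
        · exact h₁
        · exact absurd (Option.some.inj (hx.symm.trans h₁)) hxy.ne
      refine ⟨S, .refl, { h with scanned := ?_, ptr := ?_, idle := ?_ }, hx⟩
      · intro v w hvw
        rw [h.scanned v w hvw, hl, hx]
        simp only [List.mem_cons, not_or]
        by_cases hvy : v = y
        · subst hvy; simp [hyS]
        · by_cases hwy : w = y
          · subst hwy; simp [hyS]
          · simp [hvy, hwy]
      · rintro v hv
        obtain rfl : x = v := Option.some.inj (hx.symm.trans hv)
        exact ⟨hcur, (List.nodup_cons.1 hnd).2, fun w hw => hadj w (List.mem_cons_of_mem _ hw)⟩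
      · intro hv; simp [hx] at hv
    | some ρ =>
      rw [visit_live hl hr]
      have hy : y ∉ S.scannedV ∧ S.active ≠ some y := by
        have := (h.unranked y).not.1 (by simp [hr])
        exact not_or.1 this
      have hxr : a.rank x = none := (h.unranked x).2 (.inr hx)
      have hxS : s(x, y) ∉ S.scannedE := by
        rw [h.scanned x y hxy, hl]
        simp [h.active x hx, hy.1, hy.2]
      have hρ := h.rank y ρ hr
      have hparn := h.fresh y ρ hr ρ le_rfl
      have upd : ∀ w σ, Function.update a.rank y (some (ρ + 1)) w = some σ →
          w = y ∧ σ = ρ + 1 ∨ w ≠ y ∧ a.rank w = some σ := by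
        intro w σ hw
        by_cases hwy : w = y
        · subst hwy; simp at hw; exact .inl ⟨rfl, hw.symm⟩
        · exact .inr ⟨hwy, by simpa [hwy] using hw⟩
      refine ⟨_, .single (.edge S x y hx hxy hxS), ?_, hx⟩
      exact
      { unranked := fun w => by
          by_cases hw : w = y
          · subst hw
            simp [hy.1, hy.2]
          · simpa [Function.update_of_ne hw] using h.unranked w
        rank := fun w σ hw => by
          rcases upd w σ hw with ⟨rfl, rfl⟩ | ⟨hwy, hw⟩
          · simp [hρ]
          · have hwx : w ≠ x := by rintro rfl; simp [hxr] at hw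
            simp [hwy, hwx, h.rank w σ hw]
        bucket := fun w σ hw => by
          rcases upd w σ hw with ⟨rfl, rfl⟩ | ⟨hwy, hw⟩
          · simp
          · obtain ⟨h₁, h₂⟩ := h.bucket w σ hw
            refine ⟨?_, lt_max_of_lt_left h₂⟩
            by_cases hs : σ = ρ + 1
            · subst hs; simp [h₁]
            · simpa [hs] using h₁
        edges := fun i e => by
          by_cases hi : i = ρ
          · subst hi
            simp only [hρ, Function.update_self, Set.mem_insert_iff, h.edges]
            constructor
            · rintro (rfl | ⟨u, w, huw, rfl⟩)
              · exact ⟨x, y, by simp [hcur], rfl⟩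
              · refine ⟨u, w, ?_, rfl⟩
                have : w ≠ y := by rintro rfl; simp [hparn] at huw
                simpa [this] using huw
            · rintro ⟨u, w, huw, rfl⟩
              by_cases hwy : w = y
              · subst hwy
                simp only [Function.update_self, hcur, Option.some_inj] at huw
                subst huw
                exact .inl rfl
              · exact .inr ⟨u, w, by simpa [hwy] using huw, rfl⟩
          · simp only [hρ, Function.update_of_ne hi, h.edges]
        adj := h.adj
        nodup := h.nodup
        scanned := fun v w hvw => by
          rw [Set.mem_insert_iff, h.scanned v w hvw, hl, hx]
          simp only [List.mem_cons, not_or, Option.some_inj]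
          have hne := hxy.ne
          by_cases hvx : v = x
          · subst hvx
            by_cases hwy : w = y
            · subst hwy; simp [hyl]
            · simp [hwy, hne]
          · by_cases hwx : w = x
            · subst hwx
              by_cases hvy : v = y
              · subst hvy; simp [hyl, Sym2.eq_swap]
              · simp [hvy, hvx, hvw.ne.symm]
            · simp [hvx, hwx, Ne.symm hvx, Ne.symm hwx]
        active := h.active
        ptr := fun v hv => by
          obtain rfl : x = v := Option.some.inj (hx.symm.trans hv)
          exact ⟨hcur, (List.nodup_cons.1 hnd).2, fun w hw => hadj w (List.mem_cons_of_mem _ hw)⟩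
        idle := fun hv => by simp [hx] at hv
        acyclic := fun i => by
          by_cases hs : i = ρ
          · subst hs
            simpa [hcur] using (h.acyclic i).update_leaf hxy.ne (h.leaf y i hr i)
          · simpa [hs] using h.acyclic i
        fresh := fun w σ hw i hi => by
          rcases upd w σ hw with ⟨rfl, rfl⟩ | ⟨hwy, hw'⟩
          · have : i ≠ ρ := by omega
            simpa [this] using h.fresh w ρ hr i (by omega)
          · by_cases hs : i = ρ
            · subst hs; simpa [hwy] using h.fresh w σ hw' i hi
            · simpa [hs] using h.fresh w σ hw' i hi
        leaf := fun w σ hw i u => by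
          have hwr : ∃ τ, a.rank w = some τ := by
            rcases upd w σ hw with ⟨rfl, rfl⟩ | ⟨hwy, hw⟩
            exacts [⟨_, hr⟩, ⟨_, hw⟩]
          obtain ⟨τ, hτ⟩ := hwr
          have := h.leaf w τ hτ i u
          by_cases hs : i = ρ
          · subst hs
            by_cases huy : u = y
            · subst huy
              simp only [Function.update_self, hcur]
              rintro he
              rw [Option.some.inj he, hτ] at hxr
              simp at hxr
            · simpa [huy] using this
          · simpa [hs] using this }

/-- Closing a vertex needs no operation: an exhausted neighbour list represents both the state
before the closing step and the one after it. -/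
theorem ScanMem.Represents.close {S : ScanState V} {a : ScanMem V} (h : a.Represents G S)
    (hp : a.ptr = []) :
    ∃ S', Relation.ReflTransGen (ScanStep G) S S' ∧ a.Represents G S' ∧ S'.active = none := by
  cases hx : S.active with
  | none => exact ⟨S, .refl, h, hx⟩
  | some x =>
    refine ⟨_, .single (.close S x hx fun y hxy => ?_), ?_, rfl⟩
    · rw [h.scanned x y hxy, hp]
      simp [hx]
    · exact { h with
        unranked := fun v => by
          rw [h.unranked, hx]
          simp [or_comm, eq_comm]
        scanned := fun v w hvw => by
          rw [h.scanned v w hvw, hx, hp]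
          simp only [Set.mem_insert_iff, Option.some_inj, List.not_mem_nil, not_false_eq_true,
            and_true, reduceCtorEq, or_false]
          rw [eq_comm (a := x), eq_comm (a := x)]
          tauto
        active := fun v hv => by simp at hv
        ptr := fun v hv => by simp at hv
        idle := fun _ => hp }

variable [Fintype V]

namespace ScanMem

/-- The number of visits that are still to come. -/
def remaining (a : ScanMem V) : ℕ :=
  (∑ v, if a.rank v = none then 0 else (a.adj v).length) + a.ptr.length

/-- The number of entries of the first `M` buckets. -/
def load (M : ℕ) (a : ScanMem V) : ℕ := ∑ b ∈ Finset.range M, (a.bucket b).length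

/-- An upper bound for the number of operations that are still to come. -/
def weight (M : ℕ) (a : ScanMem V) : ℕ := a.top + a.load M + 3 * a.remaining

theorem sum_update_add {ι : Type} [DecidableEq ι] {s : Finset ι} {i : ι} (hi : i ∈ s)
    (f : ι → List V) (l : List V) :
    (∑ j ∈ s, (Function.update f i l j).length) + (f i).length =
      (∑ j ∈ s, (f j).length) + l.length := by
  rw [← Finset.add_sum_erase s _ hi, ← Finset.add_sum_erase s (fun j => (f j).length) hi,
    Function.update_self, Finset.sum_congr rfl fun j hj => by
      rw [Function.update_of_ne (Finset.ne_of_mem_erase hj)]]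
  ring

/-- The bounds on the use of memory that the scan maintains. -/
structure Fits (M U : ℕ) (a : ScanMem V) : Prop where
  used : a.used + a.remaining ≤ U
  top : a.top + a.remaining ≤ M

variable {M U : ℕ} {a : ScanMem V}

/-- A pop lowers `top` or removes a bucket entry. Choosing a vertex only moves its neighbours from
the pending sum to the current list, so `remaining` is unchanged. -/
theorem pop_fits (h : a.Fits M U) (hp : a.ptr = []) (ht : 0 < a.top) :
    a.pop.Fits M U ∧ a.pop.weight M + 1 ≤ a.weight M := by
  have key : a.pop.remaining = a.remaining ∧ a.pop.used = a.used ∧ a.pop.top ≤ a.top ∧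
      a.pop.top + a.pop.load M + 1 ≤ a.top + a.load M := by
    cases hb : a.bucket (a.top - 1) with
    | nil =>
      rw [pop_nil hb]
      exact ⟨rfl, rfl, Nat.sub_le .., by simp only [load]; omega⟩
    | cons v l =>
      have hl := sum_update_add (Finset.mem_range.2 (by have := h.top; omega : a.top - 1 < M))
        a.bucket l
      rw [hb, List.length_cons] at hl
      by_cases hv : a.rank v = some (a.top - 1)
      · rw [pop_live hb hv]
        refine ⟨?_, rfl, le_rfl, by simp only [load]; omega⟩
        simp only [remaining, hp, List.length_nil, add_zero]
        rw [← Finset.add_sum_erase _ _ (Finset.mem_univ v),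
          ← Finset.add_sum_erase (a := v) _ (fun w => if a.rank w = none then 0 else _)
            (Finset.mem_univ v),
          Finset.sum_congr rfl fun w hw => by
            rw [Function.update_of_ne (Finset.ne_of_mem_erase hw)]]
        simp [hv, add_comm]
      · rw [pop_stale hb hv]
        exact ⟨rfl, rfl, le_rfl, by simp only [load]; omega⟩
  obtain ⟨h₁, h₂, h₃, h₄⟩ := key
  have := h.used
  have := h.top
  exact ⟨⟨by omega, by omega⟩, by simp only [weight, h₁]; omega⟩

/-- A visit consumes one pending neighbour and adds at most one bucket entry and one to `top`. The
coefficient 3 in the weight outweighs both additions by one. -/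
theorem visit_fits (h : a.Fits M U) (hp : a.ptr ≠ [])
    (hr : ∀ v ρ, a.rank v = some ρ → ρ < a.top) :
    a.visit.Fits M U ∧ a.visit.weight M + 1 ≤ a.weight M := by
  obtain ⟨y, l, hl⟩ := List.exists_cons_of_ne_nil hp
  have key : a.visit.remaining + 1 = a.remaining ∧ a.visit.used ≤ a.used + 1 ∧
      a.visit.top ≤ a.top + 1 ∧ a.visit.load M ≤ a.load M + 1 := by
    cases hy : a.rank y with
    | none =>
      rw [visit_done hl hy]
      exact ⟨by simp [remaining, hl, add_assoc], by simp, by simp, by simp [load]⟩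
    | some ρ =>
      have hρ := hr y ρ hy
      rw [visit_live hl hy]
      refine ⟨?_, le_rfl, by simp; omega, ?_⟩
      · simp only [remaining, hl, List.length_cons, ← add_assoc]
        congr 2
        refine Finset.sum_congr rfl fun w _ => ?_
        by_cases hw : w = y
        · subst hw; simp [hy]
        · simp [hw]
      · have := sum_update_add (s := Finset.range M) (i := ρ + 1)
          (Finset.mem_range.2 (by
            have := h.top
            simp only [remaining, hl, List.length_cons] at this
            omega)) a.bucket (y :: a.bucket (ρ + 1))
        simp only [List.length_cons] at this
        simp only [load]
        omega
  obtain ⟨h₁, h₂, h₃, h₄⟩ := key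
  have := h.used
  have := h.top
  exact ⟨⟨by omega, by omega⟩, by simp only [weight]; omega⟩

end ScanMem

theorem visit_loop {M U : ℕ} : ∀ (N : ℕ) {S : ScanState V} {a : ScanMem V},
    a.ptr.length = N → a.Represents G S → a.Fits M U →
    CTri (scanSem V M U) (.loop .next (.prim .visit)) a fun a' t =>
      ∃ S', Relation.ReflTransGen (ScanStep G) S S' ∧ a'.Represents G S' ∧ a'.ptr = [] ∧
        a'.Fits M U ∧ t + 3 * a'.weight M ≤ 3 * a.weight M + 1 := by
  intro N
  induction N with
  | zero =>
    intro S a hN h hf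
    have hp : a.ptr = [] := List.length_eq_zero_iff.1 hN
    exact .loop_done (fun hb => hb hp) ⟨S, .refl, h, hp, hf, by omega⟩
  | succ N ih =>
    intro S a hN h hf
    have hp : a.ptr ≠ [] := fun hp => by simp [hp] at hN
    have hrt : ∀ v ρ, a.rank v = some ρ → ρ < a.top := fun v ρ hv => (h.bucket v ρ hv).2
    have hrem : 1 ≤ a.remaining := by simp only [ScanMem.remaining]; omega
    have := hf.used
    have := hf.top
    refine .loop_step hp (.prim ⟨hp, by omega, by omega, hrt⟩ ?_)
    change CTri _ _ a.visit _
    cases hx : S.active with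
    | none => exact absurd (h.idle hx) hp
    | some x =>
      obtain ⟨S₁, hS₁, h₁, -⟩ := h.visit hx hp
      obtain ⟨hf₁, hw₁⟩ := visit_fits hf hp hrt
      have hlen : a.visit.ptr.length = N := by
        obtain ⟨y, l, hl⟩ := List.exists_cons_of_ne_nil hp
        cases hy : a.rank y with
        | none => rw [visit_done hl hy]; simpa [hl] using hN
        | some ρ => rw [visit_live hl hy]; simpa [hl] using hN
      refine (ih hlen h₁ hf₁).mono fun a' t ⟨S', hS', h', hp', hf', ht'⟩ => ?_
      exact ⟨S', hS₁.trans hS', h', hp', hf', by omega⟩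

/-- The factor 3 covers an outer round: the pop, the outer test and the final inner test cost three
steps, and the pop lowers the weight by at least one. An inner round needs only two. -/
theorem scan_loop {M U : ℕ} : ∀ (N : ℕ) {S : ScanState V} {a : ScanMem V},
    a.weight M ≤ N → a.Represents G S → S.active = none → a.Fits M U →
    CTri (scanSem V M U) scanC a fun a' t =>
      ∃ S', Relation.ReflTransGen (ScanStep G) S S' ∧ a'.Represents G S' ∧ S'.active = none ∧
        a'.top = 0 ∧ t ≤ 3 * a.weight M + 1 := by
  intro N
  induction N with
  | zero =>
    intro S a hN h ha hf
    have ht : a.top = 0 := by simp only [ScanMem.weight] at hN; omega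
    exact .loop_done (fun hb => absurd ht (Nat.ne_of_gt hb)) ⟨S, .refl, h, ha, ht, by omega⟩
  | succ N ih =>
    intro S a hN h ha hf
    rcases Nat.eq_zero_or_pos a.top with ht | ht
    · exact .loop_done (fun hb => absurd ht (Nat.ne_of_gt hb)) ⟨S, .refl, h, ha, ht, by omega⟩
    · refine .loop_step ht (.seq (.prim ht ?_))
      change CTri _ _ a.pop _
      obtain ⟨S₁, hS₁, h₁⟩ := h.pop ha
      obtain ⟨hf₁, hw₁⟩ := pop_fits hf (h.idle ha) ht
      refine (visit_loop _ rfl h₁ hf₁).mono fun a₂ t₂ ⟨S₂, hS₂, h₂, hp₂, hf₂, ht₂⟩ => ?_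
      obtain ⟨S₃, hS₃, h₃, ha₃⟩ := h₂.close hp₂
      refine (ih (by omega) h₃ ha₃ hf₂).mono fun a' t ⟨S', hS', h', ha', ht', hw'⟩ => ?_
      exact ⟨S', hS₁.trans (hS₂.trans (hS₃.trans hS')), h', ha', ht', by omega⟩

end ScanCorrect

/-! ### The memory of the scan on the word RAM -/

/-- `l` is stored as a linked list of two-cell nodes in the heap between `H` and `fp`, and `p` is its
address; vertices are represented by the addresses of their slots. -/
def Chain {n : ℕ} (D H : ℕ) (mem : ℕ → ℕ) (fp : ℕ) : ℕ → List (Fin n) → Prop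
  | p, [] => p = 0
  | p, v :: l => H ≤ p ∧ p + 1 < fp ∧ mem p = D + 8 * v ∧ Chain D H mem fp (mem (p + 1)) l

theorem Chain.frame {n D H fp fp' : ℕ} {mem mem' : ℕ → ℕ} (hfp : fp ≤ fp')
    (hm : ∀ x, H ≤ x → x < fp → mem' x = mem x) :
    ∀ {l : List (Fin n)} {p : ℕ}, Chain D H mem fp p l → Chain D H mem' fp' p l := by
  intro l
  induction l with
  | nil => exact fun h => h
  | cons v l ih =>
    rintro p ⟨h₁, h₂, h₃, h₄⟩
    refine ⟨h₁, by omega, by rw [hm p h₁ (by omega), h₃], ?_⟩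
    rw [hm (p + 1) (by omega) h₂]
    exact ih h₄

theorem Chain.eq_zero_iff {n D H fp p : ℕ} {mem : ℕ → ℕ} {l : List (Fin n)} (hH : 0 < H)
    (h : Chain D H mem fp p l) : p = 0 ↔ l = [] := by
  cases l with
  | nil => simpa [Chain] using h
  | cons v l => simp only [reduceCtorEq, iff_false]; have := h.1; omega

/-- Link-cut structures all of whose auxiliary trees consist of one node. -/
def LinkCut.ofParent {V : Type} (par : V → Option V) : LinkCut V :=
  ⟨par, fun _ => none, fun _ => none, fun _ => false⟩

/-- The memory during the scan: `k` arrays of records from `B` on, slots of eight cells for the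
vertices from `D` on, which hold the rank (in terms of the address of a bucket), the list of
neighbours, the address of the record on the level of the rank, and the name of the vertex; the
buckets are interleaved with the slots; list cells lie between `H` and `fp`. -/
structure MemRep (n k M B D H : ℕ) (inp : ℕ → ℕ) (mem : ℕ → ℕ) (fp : ℕ) (a : ScanMem (Fin n)) :
    Prop where
  D_eq : D = B + 4 * (k * n)
  H_ge : D + 8 * (n + M + 1) ≤ H
  fp_ge : H ≤ fp
  input : ∀ x < B, mem x = inp x
  records : ∀ i < k, ∀ (f : Fin 4) (v : Fin n),
    mem (B + 4 * (i * n) + 4 * v + f) = (LinkCut.ofParent (a.par i)).field f v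
  unranked : ∀ v, a.rank v = none → mem (D + 8 * v) = 0
  ranked : ∀ v ρ, a.rank v = some ρ → mem (D + 8 * v) = D + 8 * (ρ + 1) ∧
    mem (D + 8 * v + 2) = B + 4 * (ρ * n) + 4 * v ∧ mem (D + 8 * v + 3) = v + 1
  adj : ∀ v : Fin n, Chain D H mem fp (mem (D + 8 * v + 1)) (a.adj v)
  bucket : ∀ b < M, Chain D H mem fp (mem (D + 8 * (b + 1) + 4)) (a.bucket b)

namespace MemRep

variable {n k M B D H fp : ℕ} {inp mem : ℕ → ℕ} {a : ScanMem (Fin n)}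

theorem record_lt (h : MemRep n k M B D H inp mem fp a) {i : ℕ} (hi : i < k) (f : Fin 4)
    (v : Fin n) : B + 4 * (i * n) + 4 * v + f < D := by
  have : i * n + n ≤ k * n := by rw [← Nat.succ_mul]; exact Nat.mul_le_mul_right n hi
  have := h.D_eq
  omega

/-- Allocation of a list cell. -/
theorem push (h : MemRep n k M B D H inp mem fp a) (v : Fin n) {p : ℕ} {l : List (Fin n)}
    (hp : Chain D H mem fp p l) :
    MemRep n k M B D H inp (Function.update (Function.update mem fp (D + 8 * v)) (fp + 1) p)
      (fp + 2) a ∧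
    Chain D H (Function.update (Function.update mem fp (D + 8 * v)) (fp + 1) p) (fp + 2) fp
      (v :: l) := by
  have hH := h.H_ge
  have hfp := h.fp_ge
  have hm : ∀ x, x < fp → Function.update (Function.update mem fp (D + 8 * v)) (fp + 1) p x =
      mem x := fun x hx => by
    rw [Function.update_of_ne (by omega), Function.update_of_ne (by omega)]
  have fr : ∀ {l : List (Fin n)} {p : ℕ}, Chain D H mem fp p l → _ :=
    Chain.frame (by omega : fp ≤ fp + 2) fun x _ => hm x
  refine ⟨⟨h.D_eq, hH, by omega, fun x hx => ?_, fun i hi f w => ?_, fun w hw => ?_,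
    fun w ρ hw => ?_, fun w => ?_, fun b hb => ?_⟩, hfp, by omega, ?_, ?_⟩
  · have := h.D_eq
    rw [hm x (by omega), h.input x hx]
  · have := h.record_lt hi f w
    rw [hm _ (by omega), h.records i hi]
  · rw [hm _ (by omega), h.unranked w hw]
  · rw [hm _ (by omega), hm _ (by omega), hm _ (by omega)]
    exact h.ranked w ρ hw
  · rw [hm _ (by omega)]
    exact fr (h.adj w)
  · rw [hm _ (by omega)]
    exact fr (h.bucket b hb)
  · simp
  · simpa using fr hp

theorem chain_update {x y : ℕ} (hx : x < H) {p : ℕ} {l : List (Fin n)} (hp : Chain D H mem fp p l) :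
    Chain D H (Function.update mem x y) fp p l :=
  hp.frame le_rfl fun z hz _ => Function.update_of_ne (by omega) _ _

theorem setBucket (h : MemRep n k M B D H inp mem fp a) {b : ℕ} (hb : b < M) {p : ℕ}
    {l : List (Fin n)} (hp : Chain D H mem fp p l) :
    MemRep n k M B D H inp (Function.update mem (D + 8 * (b + 1) + 4) p) fp
      { a with bucket := Function.update a.bucket b l } := by
  have hH := h.H_ge
  have hD := h.D_eq
  have hx : D + 8 * (b + 1) + 4 < H := by omega
  refine ⟨h.D_eq, hH, h.fp_ge, fun x hx => ?_, fun i hi f w => ?_, fun w hw => ?_,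
    fun w ρ hw => ?_, fun w => ?_, fun c hc => ?_⟩
  · rw [Function.update_of_ne (by omega), h.input x hx]
  · have := h.record_lt hi f w
    rw [Function.update_of_ne (by omega), h.records i hi]
  · rw [Function.update_of_ne (by omega), h.unranked w hw]
  · rw [Function.update_of_ne (by omega), Function.update_of_ne (by omega),
      Function.update_of_ne (by omega)]
    exact h.ranked w ρ hw
  · rw [Function.update_of_ne (by omega)]
    exact chain_update hx (h.adj w)
  · by_cases hcb : c = b
    · subst hcb
      simpa using chain_update hx hp
    · rw [Function.update_of_ne (by omega)]
      simpa [hcb] using chain_update hx (h.bucket c hc)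

theorem setAdj (h : MemRep n k M B D H inp mem fp a) (v : Fin n) {p : ℕ}
    {l : List (Fin n)} (hp : Chain D H mem fp p l) :
    MemRep n k M B D H inp (Function.update mem (D + 8 * v + 1) p) fp
      { a with adj := Function.update a.adj v l } := by
  have hH := h.H_ge
  have hD := h.D_eq
  have hx : D + 8 * v + 1 < H := by omega
  refine ⟨h.D_eq, hH, h.fp_ge, fun x hx => ?_, fun i hi f w => ?_, fun w hw => ?_,
    fun w ρ hw => ?_, fun w => ?_, fun c hc => ?_⟩
  · rw [Function.update_of_ne (by omega), h.input x hx]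
  · have := h.record_lt hi f w
    rw [Function.update_of_ne (by omega), h.records i hi]
  · rw [Function.update_of_ne (by omega), h.unranked w hw]
  · rw [Function.update_of_ne (by omega), Function.update_of_ne (by omega),
      Function.update_of_ne (by omega)]
    exact h.ranked w ρ hw
  · by_cases hwv : w = v
    · subst hwv
      simpa using chain_update hx hp
    · have : (w : ℕ) ≠ v := fun he => hwv (Fin.ext he)
      rw [Function.update_of_ne (by omega)]
      simpa [hwv] using chain_update hx (h.adj w)
  · rw [Function.update_of_ne (by omega)]
    exact chain_update hx (h.bucket c hc)

theorem setUnranked (h : MemRep n k M B D H inp mem fp a) (v : Fin n) :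
    MemRep n k M B D H inp (Function.update mem (D + 8 * v) 0) fp
      { a with rank := Function.update a.rank v none } := by
  have hH := h.H_ge
  have hD := h.D_eq
  have hx : D + 8 * v < H := by omega
  refine ⟨h.D_eq, hH, h.fp_ge, fun x hx => ?_, fun i hi f w => ?_, fun w hw => ?_,
    fun w ρ hw => ?_, fun w => ?_, fun c hc => ?_⟩
  · rw [Function.update_of_ne (by omega), h.input x hx]
  · have := h.record_lt hi f w
    rw [Function.update_of_ne (by omega), h.records i hi]
  · by_cases hwv : w = v
    · subst hwv; simp
    · have : (w : ℕ) ≠ v := fun he => hwv (Fin.ext he)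
      rw [Function.update_of_ne (by omega)]
      exact h.unranked w (by simpa [hwv] using hw)
  · have hwv : w ≠ v := by rintro rfl; simp at hw
    have : (w : ℕ) ≠ v := fun he => hwv (Fin.ext he)
    rw [Function.update_of_ne (by omega), Function.update_of_ne (by omega),
      Function.update_of_ne (by omega)]
    exact h.ranked w ρ (by simpa [hwv] using hw)
  · rw [Function.update_of_ne (by omega)]
    exact chain_update hx (h.adj w)
  · rw [Function.update_of_ne (by omega)]
    exact chain_update hx (h.bucket c hc)

/-- Writing a slot: the values of the cells other than the list of neighbours. -/
theorem setRanked (h : MemRep n k M B D H inp mem fp a) (v : Fin n) (ρ : ℕ) {mem' : ℕ → ℕ}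
    (hm : ∀ x, x ≠ D + 8 * v → x ≠ D + 8 * v + 2 → x ≠ D + 8 * v + 3 → mem' x = mem x)
    (h₀ : mem' (D + 8 * v) = D + 8 * (ρ + 1)) (h₂ : mem' (D + 8 * v + 2) = B + 4 * (ρ * n) + 4 * v)
    (h₃ : mem' (D + 8 * v + 3) = v + 1) :
    MemRep n k M B D H inp mem' fp { a with rank := Function.update a.rank v (some ρ) } := by
  have hH := h.H_ge
  have hD := h.D_eq
  have fr : ∀ {l : List (Fin n)} {p : ℕ}, Chain D H mem fp p l → _ :=
    Chain.frame (mem' := mem') le_rfl fun x _ _ => hm x (by omega) (by omega) (by omega)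
  refine ⟨h.D_eq, hH, h.fp_ge, fun x hx => ?_, fun i hi f w => ?_, fun w hw => ?_,
    fun w σ hw => ?_, fun w => ?_, fun c hc => ?_⟩
  · rw [hm _ (by omega) (by omega) (by omega), h.input x hx]
  · have := h.record_lt hi f w
    rw [hm _ (by omega) (by omega) (by omega), h.records i hi]
  · have hwv : w ≠ v := by rintro rfl; simp at hw
    have : (w : ℕ) ≠ v := fun he => hwv (Fin.ext he)
    rw [hm _ (by omega) (by omega) (by omega)]
    exact h.unranked w (by simpa [hwv] using hw)
  · by_cases hwv : w = v
    · subst hwv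
      obtain rfl : ρ = σ := by simpa using hw
      exact ⟨h₀, h₂, h₃⟩
    · have : (w : ℕ) ≠ v := fun he => hwv (Fin.ext he)
      rw [hm _ (by omega) (by omega) (by omega), hm _ (by omega) (by omega) (by omega),
        hm _ (by omega) (by omega) (by omega)]
      exact h.ranked w σ (by simpa [hwv] using hw)
  · rw [hm _ (by omega) (by omega) (by omega)]
    exact fr (h.adj w)
  · rw [hm _ (by omega) (by omega) (by omega)]
    exact fr (h.bucket c hc)

theorem setPar (h : MemRep n k M B D H inp mem fp a) (v : Fin n) {ρ : ℕ} (hρ : ρ < k)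
    (o : Option (Fin n)) :
    MemRep n k M B D H inp (Function.update mem (B + 4 * (ρ * n) + 4 * v) (encodePtr o)) fp
      { a with par := Function.update a.par ρ (Function.update (a.par ρ) v o) } := by
  have hH := h.H_ge
  have hD := h.D_eq
  have hx : B + 4 * (ρ * n) + 4 * v < D := by simpa using h.record_lt hρ 0 v
  refine ⟨h.D_eq, hH, h.fp_ge, fun x hx => ?_, fun i hi f w => ?_, fun w hw => ?_,
    fun w ρ hw => ?_, fun w => ?_, fun c hc => ?_⟩
  · rw [Function.update_of_ne (by omega), h.input x hx]
  · have hf := f.2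
    by_cases hiρ : i = ρ
    · subst hiρ
      by_cases hwv : w = v
      · subst hwv
        by_cases hf0 : f = 0
        · subst hf0
          simp [LinkCut.field, LinkCut.ofParent]
        · have : (f : ℕ) ≠ 0 := fun he => hf0 (Fin.ext he)
          rw [Function.update_of_ne (by omega), h.records i hi]
          fin_cases f <;> simp [LinkCut.field, LinkCut.ofParent] at hf0 ⊢
      · have : (w : ℕ) ≠ v := fun he => hwv (Fin.ext he)
        rw [Function.update_of_ne (by omega), h.records i hi]
        fin_cases f <;> simp [LinkCut.field, LinkCut.ofParent, hwv]
    · have hv := v.2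
      have hw := w.2
      have : B + 4 * (i * n) + 4 * w + f ≠ B + 4 * (ρ * n) + 4 * v := by
        rcases Nat.lt_or_gt_of_ne hiρ with hlt | hlt
        · have : i * n + n ≤ ρ * n := by rw [← Nat.succ_mul]; exact Nat.mul_le_mul_right n hlt
          omega
        · have : ρ * n + n ≤ i * n := by rw [← Nat.succ_mul]; exact Nat.mul_le_mul_right n hlt
          omega
      rw [Function.update_of_ne this, h.records i hi]
      simp [hiρ]
  · rw [Function.update_of_ne (by omega), h.unranked w hw]
  · rw [Function.update_of_ne (by omega), Function.update_of_ne (by omega),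
      Function.update_of_ne (by omega)]
    exact h.ranked w ρ hw
  · rw [Function.update_of_ne (by omega)]
    exact chain_update (by omega) (h.adj w)
  · rw [Function.update_of_ne (by omega)]
    exact chain_update (by omega) (h.bucket c hc)

/-- Parents on levels from `k` on are part of the abstract scan but have no place in memory; only
the first `k` forests are kept. -/
theorem setPar_high (h : MemRep n k M B D H inp mem fp a) {ρ : ℕ} (hρ : k ≤ ρ)
    (g : Fin n → Option (Fin n)) :
    MemRep n k M B D H inp mem fp { a with par := Function.update a.par ρ g } :=
  { h with
    records := fun i hi f v => by
      rw [h.records i hi]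
      simp [(hi.trans_le hρ).ne] }

end MemRep

/-! ### The scan on the word RAM -/

theorem RAMState.setMem_mem_eq (s : RAMState) (a x : ℕ) :
    (s.setMem a x).mem = Function.update s.mem a x := rfl

/-- The machine state during the scan; registers `16` to `19` hold constants. -/
structure ScanRep (n k M B D H U : ℕ) (inp : ℕ → ℕ) (s : RAMState) (a : ScanMem (Fin n)) : Prop where
  mem : MemRep n k M B D H inp s.mem (s.reg 6) a
  used : s.reg 6 = H + 2 * a.used
  reg3 : s.reg 3 = B
  reg4 : s.reg 4 = 4 * n
  reg5 : s.reg 5 = D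
  reg10 : s.reg 10 = 0
  reg12 : s.reg 12 = D + 8 * a.top
  reg16 : s.reg 16 = 1
  reg17 : s.reg 17 = 2
  reg18 : s.reg 18 = 4
  reg19 : s.reg 19 = 8
  top_le : a.top ≤ M
  used_le : a.used ≤ U
  cur : s.reg 13 = encodePtr a.cur
  ptr : Chain D H s.mem (s.reg 6) (s.reg 14) a.ptr

/-- Implementation of the operations of the scan. -/
def scanPrim : ScanPrim → RAMProg
  | .pop =>
    .seq (.add 7 12 18) <| .seq (.load 8 7) <| .ite (.eq 8 10) (.sub 12 12 19) <|
    .seq (.add 9 8 16) <| .seq (.load 9 9) <| .seq (.load 8 8) <| .seq (.load 11 8) <|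
    .seq (.store 7 9) <| .ite (.eq 11 12)
      (.seq (.add 9 8 16) <| .seq (.load 14 9) <| .seq (.add 9 9 17) <| .seq (.load 13 9)
        (.store 8 10))
      .skip
  | .visit =>
    .seq (.load 7 14) <| .seq (.add 8 14 16) <| .seq (.load 14 8) <| .seq (.load 8 7) <|
    .ite (.eq 8 10) .skip <|
    .seq (.add 9 7 17) <| .seq (.load 11 9) <| .seq (.add 8 8 19) <| .seq (.add 15 8 18) <|
    .seq (.load 1 15) <| .seq (.add 2 11 4) <|
    .seq (.store 6 7) <| .seq (.add 6 6 16) <| .seq (.store 6 1) <| .seq (.sub 1 6 16) <|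
    .seq (.add 6 6 16) <| .seq (.store 15 1) <|
    .seq (.store 7 8) <| .seq (.store 9 2) <|
    .seq (.ite (.lt 11 5) (.store 11 13) .skip) <|
    .ite (.lt 12 8) (.add 12 8 10) .skip

/-- Implementation of the tests of the scan. -/
def scanTest : ScanTest → RAMTest
  | .more => .lt 5 12
  | .next => .lt 10 14

section

variable {W n k M B D H U : ℕ} {inp : ℕ → ℕ} {s : RAMState} {a : ScanMem (Fin n)}

theorem scanTest_spec (b : ScanTest) (h : ScanRep n k M B D H U inp s a) (hH : 0 < H) :
    (scanTest b).Holds s ↔ (scanSem (Fin n) M U).holds b a := by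
  cases b with
  | more => simp only [scanTest, RAMTest.Holds, scanSem, h.reg5, h.reg12]; omega
  | next =>
    simp only [scanTest, RAMTest.Holds, scanSem, h.reg10, ne_eq, ← h.ptr.eq_zero_iff hH]
    omega

theorem ScanRep.update (h : ScanRep n k M B D H U inp s a) {s' : RAMState} {a' : ScanMem (Fin n)}
    (hreg : ∀ r ∈ [3, 4, 5, 10, 16, 17, 18, 19], s'.reg r = s.reg r)
    (mem : MemRep n k M B D H inp s'.mem (s'.reg 6) a') (used : s'.reg 6 = H + 2 * a'.used)
    (reg12 : s'.reg 12 = D + 8 * a'.top) (top_le : a'.top ≤ M) (used_le : a'.used ≤ U)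
    (cur : s'.reg 13 = encodePtr a'.cur) (ptr : Chain D H s'.mem (s'.reg 6) (s'.reg 14) a'.ptr) :
    ScanRep n k M B D H U inp s' a' where
  mem := mem
  used := used
  reg3 := by rw [hreg 3 (by simp), h.reg3]
  reg4 := by rw [hreg 4 (by simp), h.reg4]
  reg5 := by rw [hreg 5 (by simp), h.reg5]
  reg10 := by rw [hreg 10 (by simp), h.reg10]
  reg12 := reg12
  reg16 := by rw [hreg 16 (by simp), h.reg16]
  reg17 := by rw [hreg 17 (by simp), h.reg17]
  reg18 := by rw [hreg 18 (by simp), h.reg18]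
  reg19 := by rw [hreg 19 (by simp), h.reg19]
  top_le := top_le
  used_le := used_le
  cur := cur
  ptr := ptr

theorem pop_spec (hH : 0 < H) (hW : H + 2 * U + 4 ≤ W) (h : ScanRep n k M B D H U inp s a)
    (ht : 0 < a.top) :
    RAMTri W (scanPrim .pop) s fun s' t => ScanRep n k M B D H U inp s' a.pop ∧ t ≤ 30 := by
  have hge := h.mem.H_ge
  have htM := h.top_le
  have hu := h.used
  have huU := h.used_le
  obtain ⟨b, hb⟩ : ∃ b, a.top = b + 1 := ⟨a.top - 1, by omega⟩
  have hbucket := h.mem.bucket b (by omega)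
  refine .seq (.add (by rw [h.reg12, h.reg18]; omega) (.seq (.load ?_)))
  simp only [RAMState.setReg_reg, RAMState.setReg_mem, h.reg12, h.reg18, if_true, hb]
  set p := s.mem (D + 8 * (b + 1) + 4) with hp
  cases hl : a.bucket b with
  | nil =>
    rw [hl] at hbucket
    refine .ite (fun _ => .sub ?_) fun hb => absurd (?_ : p = s.reg 10) hb
    · rw [ScanMem.pop_nil (by simpa [hb] using hl)]
      exact ⟨h.update (by simp) { h.mem with } (by simpa using hu)
        (by simp [h.reg12, h.reg19, hb]; omega) ((Nat.sub_le ..).trans htM) huU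
        (by simpa using h.cur) (by simpa using h.ptr), by omega⟩
    · rw [h.reg10]; exact hbucket
  | cons v l =>
    rw [hl] at hbucket
    obtain ⟨h₁, h₂, h₃, h₄⟩ := hbucket
    have hv := v.2
    have hmem := h.mem.setBucket (b := b) (by omega) h₄
    refine .ite (fun hb => ?_) fun _ => .seq <| .add ?_ <| .seq <| .load <| .seq <| .load <|
      .seq <| .load <| .seq <| .store ?_
    · have : p = s.reg 10 := hb
      rw [h.reg10] at this
      omega
    · simp [h.reg16]; omega
    simp only [RAMState.setReg_reg, RAMState.setReg_mem, h.reg16, h₃, if_true,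
      Nat.reduceEqDiff, if_false]
    refine .ite (fun he => .seq <| .add ?_ <| .seq <| .load <| .seq <| .add ?_ <| .seq <| .load <|
      .store ?_) fun he => .skip ?_
    · simp [h.reg16]; omega
    · simp [h.reg16, h.reg17]; omega
    -- The cell of the slot holds the address of the bucket of the current rank, or 0 after the
    -- vertex was chosen. Equality with the address of the highest bucket therefore recognizes
    -- current entries.
    · have hr : a.rank v = some b := by
        cases hr : a.rank v with
        | none =>
          have := h.mem.unranked v hr
          simp [RAMTest.Holds, this, h.reg12] at he
          omega
        | some ρ =>
          have := (h.mem.ranked v ρ hr).1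
          simp [RAMTest.Holds, this, h.reg12] at he
          rw [show ρ = b by omega]
      rw [ScanMem.pop_live (by simpa [hb] using hl) (by simpa [hb] using hr)]
      have hid := (hmem.ranked v b hr).2.2
      have hmem' := hmem.setUnranked v
      refine ⟨h.update (by simp) ?_ (by simpa using hu) (by simpa using h.reg12) htM huU ?_ ?_,
        by omega⟩
      · simpa [RAMState.setMem_mem_eq, -RAMState.setMem_mem, h.reg10, hb] using { hmem' with }
      · simpa [RAMState.setMem_mem_eq, -RAMState.setMem_mem, h.reg16, h.reg17, encodePtr] using hid
      · simpa [RAMState.setMem_mem_eq, -RAMState.setMem_mem, h.reg10, h.reg16, hb] using hmem'.adj v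
    · have hr : a.rank v ≠ some b := by
        intro hr
        have := (h.mem.ranked v b hr).1
        simp [RAMTest.Holds, this, h.reg12] at he
        omega
      rw [ScanMem.pop_stale (by simpa [hb] using hl) (by simpa [hb] using hr)]
      refine ⟨h.update (by simp) ?_ (by simpa using hu) (by simpa using h.reg12) htM huU
        (by simpa using h.cur) ?_, by omega⟩
      · simpa [RAMState.setMem_mem_eq, -RAMState.setMem_mem, hb] using hmem
      · simpa [RAMState.setMem_mem_eq, -RAMState.setMem_mem] using
          MemRep.chain_update (by omega) h.ptr

/-- The record address kept in a slot advances by `4 * n` with every increase of rank, which avoids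
multiplication. It is computed even for levels beyond `k`, so `hW'` requires words that hold such an
address for all `M` possible ranks. -/
theorem visit_spec (hk : D = B + 4 * (k * n)) (hW : H + 2 * U + 4 ≤ W)
    (hW' : B + 4 * (M * n) + 4 * n ≤ W) (h : ScanRep n k M B D H U inp s a)
    (hp : a.ptr ≠ []) (hU : a.used < U) (hM : a.top < M)
    (hrt : ∀ v ρ, a.rank v = some ρ → ρ < a.top) :
    RAMTri W (scanPrim .visit) s fun s' t => ScanRep n k M B D H U inp s' a.visit ∧ t ≤ 30 := by
  have hge := h.mem.H_ge
  have hu := h.used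
  obtain ⟨y, l, hl⟩ := List.exists_cons_of_ne_nil hp
  have hptr := h.ptr
  rw [hl] at hptr
  set p := s.reg 14 with hpdef
  obtain ⟨h₁, h₂, h₃, h₄⟩ := hptr
  have hy := y.2
  refine .seq <| .load <| .seq <| .add ?_ <| .seq <| .load <| .seq <| .load ?_
  · simp [h.reg16]; omega
  simp [h.reg16, ← hpdef, h₃]
  cases hr : a.rank y with
  | none =>
    have hr0 := h.mem.unranked y hr
    refine .ite (fun _ => .skip ?_) fun hb => absurd ?_ hb
    · rw [ScanMem.visit_done hl hr]
      exact ⟨h.update (by simp) { h.mem with } (by simpa using hu) (by simpa using h.reg12) h.top_le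
        h.used_le (by simpa using h.cur) (by simpa using h₄), by omega⟩
    · simpa [RAMTest.Holds, h.reg10] using hr0
  | some ρ =>
    obtain ⟨hr0, hr2, hr3⟩ := h.mem.ranked y ρ hr
    have hρ := hrt y ρ hr
    have hbucket := h.mem.bucket (ρ + 1) (by omega)
    have hρn : ρ * n + n ≤ M * n := by
      rw [← Nat.succ_mul]; exact Nat.mul_le_mul_right n (by omega)
    refine .ite (fun hb => ?_) fun _ => .seq <| .add ?_ <| .seq <| .load <| .seq <| .add ?_ <|
      .seq <| .add ?_ <| .seq <| .load <| .seq <| .add ?_ <| .seq <| .store <| .seq <| .add ?_ <|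
      .seq <| .store <| .seq <| .sub <| .seq <| .add ?_ <| .seq <| .store <| .seq <| .store <|
      .seq <| .store ?_
    · simp [RAMTest.Holds, h.reg10, hr0] at hb
    · simp [h.reg17]; omega
    · simp [h.reg19, hr0]; omega
    · simp [h.reg19, h.reg18, hr0]; omega
    · simp [h.reg17, h.reg4, hr2]; omega
    · simp [h.reg16, hu]; omega
    · simp [h.reg16, hu]; omega
    simp [-RAMState.setMem_mem, h.reg16, h.reg17, h.reg18, h.reg19, h.reg4, hr0, hr2]
    rw [show D + 8 * (ρ + 1) + 8 = D + 8 * (ρ + 1 + 1) from by ring,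
      show B + 4 * (ρ * n) + 4 * (y : ℕ) + 4 * n = B + 4 * ((ρ + 1) * n) + 4 * y from by ring]
    generalize hs₁ : RAMState.setMem _ (D + 8 * (y : ℕ) + 2) _ = s₁
    have hmem₁ : s₁.mem = Function.update (Function.update (Function.update (Function.update
        (Function.update s.mem (s.reg 6) (D + 8 * y)) (s.reg 6 + 1)
          (s.mem (D + 8 * (ρ + 1 + 1) + 4))) (D + 8 * (ρ + 1 + 1) + 4) (s.reg 6))
        (D + 8 * y) (D + 8 * (ρ + 1 + 1))) (D + 8 * y + 2) (B + 4 * ((ρ + 1) * n) + 4 * y) := by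
      subst hs₁; rfl
    have hreg : ∀ r ∈ [3, 4, 5, 10, 16, 17, 18, 19], s₁.reg r = s.reg r := by
      subst hs₁; simp
    have h6 : s₁.reg 6 = s.reg 6 + 2 := by subst hs₁; simp
    have h8 : s₁.reg 8 = D + 8 * (ρ + 1 + 1) := by subst hs₁; simp
    have h11 : s₁.reg 11 = B + 4 * (ρ * n) + 4 * y := by subst hs₁; simp
    have h12 : s₁.reg 12 = s.reg 12 := by subst hs₁; simp
    have h13 : s₁.reg 13 = s.reg 13 := by subst hs₁; simp
    have h14 : s₁.reg 14 = s.mem (p + 1) := by subst hs₁; simp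
    clear hs₁
    obtain ⟨g₁, g₂⟩ := h.mem.push y hbucket
    have g₃ := (g₁.setBucket (b := ρ + 1) (by omega) g₂).setRanked y (ρ + 1) (mem' := s₁.mem)
      (fun x hx₁ hx₂ _ => by
        rw [hmem₁, Function.update_of_ne hx₂, Function.update_of_ne hx₁])
      (by rw [hmem₁, Function.update_of_ne (by omega), Function.update_self])
      (by rw [hmem₁, Function.update_self])
      (by
        rw [hmem₁, Function.update_of_ne (by omega), Function.update_of_ne (by omega),
          Function.update_of_ne (by omega), Function.update_of_ne (by omega),
          Function.update_of_ne (by omega), hr3])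
    have hfr : ∀ x, H ≤ x → x < s.reg 6 → s₁.mem x = s.mem x := fun x hx₁ hx₂ => by
      rw [hmem₁, Function.update_of_ne (by omega), Function.update_of_ne (by omega),
        Function.update_of_ne (by omega), Function.update_of_ne (by omega),
        Function.update_of_ne (by omega)]
    have hchain := h₄.frame (by omega : s.reg 6 ≤ s.reg 6 + 2) hfr
    have h10 := hreg 10 (by simp)
    have h5 := hreg 5 (by simp)
    rw [h.reg10] at h10
    rw [h.reg5] at h5
    rw [ScanMem.visit_live hl hr]
    have fin : ∀ s₂ : RAMState, s₂.reg = s₁.reg → MemRep n k M B D H inp s₂.mem (s.reg 6 + 2)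
        { a with
          rank := Function.update a.rank y (some (ρ + 1))
          par := Function.update a.par ρ (Function.update (a.par ρ) y a.cur)
          bucket := Function.update a.bucket (ρ + 1) (y :: a.bucket (ρ + 1)) } →
        Chain D H s₂.mem (s.reg 6 + 2) (s.mem (p + 1)) l → ∀ N ≤ 26,
        RAMTri W (.ite (.lt 12 8) (.add 12 8 10) .skip) s₂ fun s' t =>
          ScanRep n k M B D H U inp s'
            { a with
              ptr := l
              rank := Function.update a.rank y (some (ρ + 1))
              par := Function.update a.par ρ (Function.update (a.par ρ) y a.cur)
              bucket := Function.update a.bucket (ρ + 1) (y :: a.bucket (ρ + 1))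
              top := max a.top (ρ + 2)
              used := a.used + 1 } ∧ N + t ≤ 30 := by
      intro s₂ hr₂ hm₂ hc₂ N hN
      have htop := h.reg12
      refine .ite (fun hb => .add ?_ ⟨h.update ?_ ?_ ?_ ?_ ?_ hU ?_ ?_, by omega⟩)
        fun hb => .skip ⟨h.update ?_ ?_ ?_ ?_ ?_ hU ?_ ?_, by omega⟩
      all_goals
        simp only [RAMTest.Holds, hr₂, h12, h8, htop] at hb
      · simp only [hr₂, h8, h10]; omega
      · simpa [hr₂] using hreg
      · simpa [hr₂, h6] using { hm₂ with }
      · simp [hr₂, h6, hu]; ring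
      · simp [hr₂, h8, h10]; omega
      · simp; omega
      · simpa [hr₂, h13] using h.cur
      · simpa [hr₂, h6, h14] using hc₂
      · simpa [hr₂] using hreg
      · simpa [hr₂, h6] using { hm₂ with }
      · simp [hr₂, h6, hu]; ring
      · simp [hr₂, h12, htop]; omega
      · simp; omega
      · simpa [hr₂, h13] using h.cur
      · simpa [hr₂, h6, h14] using hc₂
    refine .seq <| .ite (fun hb => .store ?_) fun hb => .skip ?_
    all_goals simp only [RAMTest.Holds, h11, h5] at hb
    -- The record on level ρ lies below `D` exactly if ρ < k, so a comparison of addresses decides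
    -- whether the parent has to be stored.
    · have hρk : ρ < k := by
        by_contra hge
        have : k * n ≤ ρ * n := Nat.mul_le_mul_right n (by omega)
        omega
      have hx : B + 4 * (ρ * n) + 4 * (y : ℕ) < H := by omega
      have := fin (s₁.setMem (s₁.reg 11) (s₁.reg 13)) rfl ?_ ?_ 26 le_rfl
      · refine this.mono ?_
        rintro s' t ⟨h₁, h₂⟩
        refine ⟨h₁, ?_⟩
        clear * - h₂
        omega
      · simpa [RAMState.setMem_mem_eq, -RAMState.setMem_mem, h11, h13, h.cur] using
          g₃.setPar y hρk a.cur
      · simpa [RAMState.setMem_mem_eq, -RAMState.setMem_mem, h11] using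
          MemRep.chain_update hx hchain
    · have hρk : k ≤ ρ := by
        by_contra hlt
        have : ρ * n + n ≤ k * n := by
          rw [← Nat.succ_mul]; exact Nat.mul_le_mul_right n (by omega)
        omega
      refine (fin s₁ rfl (g₃.setPar_high hρk _) hchain 26 le_rfl).mono ?_
      rintro s' t ⟨h₁, h₂⟩
      refine ⟨h₁, ?_⟩
      clear * - h₂
      omega

end

/-! ### Initialization -/

/-- The scan on the word RAM. -/
def scanP : RAMProg := scanC.compile scanPrim scanTest

/-- Set up the constants and the layout of the memory. -/
def layoutP : RAMProg :=
  .seq (.const 16 1) <| .seq (.const 17 2) <| .seq (.const 18 4) <| .seq (.const 19 8) <|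
  .seq (.add 3 2 2) <| .seq (.add 4 0 0) <| .seq (.add 4 4 4) <| .seq (.add 5 3 10) <|
  .seq (.loop (.lt 10 1) (.seq (.add 5 5 4) (.sub 1 1 16))) <|
  .seq (.add 6 0 3) <| .seq (.add 6 6 17) <| .seq (.add 6 6 6) <| .seq (.add 6 6 6) <|
  .seq (.add 6 6 6) <| .seq (.add 6 6 5) <| .seq (.add 20 5 10) <| .seq (.add 21 3 10)
  (.add 12 5 10)

/-- Push the vertex whose slot is in register `y` on the list at the address in register `9`. -/
def consP (y : ℕ) : RAMProg :=
  .seq (.load 11 9) <| .seq (.store 6 y) <| .seq (.add 6 6 16) <| .seq (.store 6 11) <|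
  .seq (.sub 11 6 16) <| .seq (.add 6 6 16) (.store 9 11)

/-- Give rank `0` to the next vertex. -/
def vertexP : RAMProg :=
  .seq (.add 1 1 16) <| .seq (.add 8 5 19) <| .seq (.add 9 8 18) <| .seq (consP 20) <|
  .seq (.store 20 8) <| .seq (.add 9 20 17) <| .seq (.store 9 21) <| .seq (.add 9 9 16) <|
  .seq (.store 9 1) <| .seq (.add 20 20 19) (.add 21 21 18)

/-- Add the vertex whose slot is in register `y` to the neighbours of the one in register `x`. -/
def arcP (x y : ℕ) : RAMProg := .seq (.add 9 x 16) (consP y)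

/-- Read an edge of the input. -/
def edgeP : RAMProg :=
  .seq (.load 7 1) <| .seq (.add 1 1 16) <| .seq (.load 8 1) <| .seq (.add 1 1 16) <|
  .seq (.add 7 7 7) <| .seq (.add 7 7 7) <| .seq (.add 7 7 7) <| .seq (.add 7 7 5) <|
  .seq (.add 8 8 8) <| .seq (.add 8 8 8) <| .seq (.add 8 8 8) <| .seq (.add 8 8 5) <|
  .seq (arcP 7 8) (arcP 8 7)

/-- The initialization program. -/
def initP : RAMProg :=
  .seq layoutP <| .seq (.loop (.lt 1 0) vertexP) <| .seq (.add 1 10 10) <|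
  .seq (.loop (.lt 1 3) edgeP) <| .seq (.add 12 5 19) scanP

/-- Give rank `0` to a vertex. -/
def ScanMem.addVertex {V : Type} [DecidableEq V] (a : ScanMem V) (v : V) : ScanMem V :=
  { a with
    rank := Function.update a.rank v (some 0)
    bucket := Function.update a.bucket 0 (v :: a.bucket 0)
    used := a.used + 1 }

/-- Add a neighbour to the list of a vertex. -/
def ScanMem.addArc {V : Type} [DecidableEq V] (a : ScanMem V) (u w : V) : ScanMem V :=
  { a with
    adj := Function.update a.adj u (w :: a.adj u)
    used := a.used + 1 }

/-- The memory at the beginning. -/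
def ScanMem.empty (V : Type) : ScanMem V :=
  ⟨fun _ => none, fun _ _ => none, fun _ => [], fun _ => [], 0, none, [], 0⟩

section

variable {W n k M B D H U : ℕ} {inp : ℕ → ℕ} {s : RAMState} {a : ScanMem (Fin n)}

theorem scanP_spec {G : SimpleGraph (Fin n)} {S : ScanState (Fin n)} (hk : D = B + 4 * (k * n))
    (hH : 0 < H) (hW : H + 2 * U + 4 ≤ W) (hW' : B + 4 * (M * n) + 4 * n ≤ W)
    (h : ScanRep n k M B D H U inp s a) (hS : a.Represents G S) (hact : S.active = none)
    (hf : a.Fits M U) :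
    RAMTri W scanP s fun s' t => ∃ a' S', ScanRep n k M B D H U inp s' a' ∧
      Relation.ReflTransGen (ScanStep G) S S' ∧ a'.Represents G S' ∧ S'.active = none ∧
      a'.top = 0 ∧ t ≤ 30 * (3 * a.weight M + 1) := by
  obtain ⟨a', t, he, S', h₁, h₂, h₃, h₄, h₅⟩ := scan_loop (M := M) (U := U) _ le_rfl hS hact hf
  refine (he.compile (cP := scanPrim) (cB := scanTest) (W := W) (K := 30)
    (R := ScanRep n k M B D H U inp) (by norm_num) (fun p s a hR hp => ?_)
    (fun b s a hR => scanTest_spec b hR hH) s h).mono fun s' t' ⟨h₆, h₇⟩ =>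
      ⟨a', S', h₆, h₁, h₂, h₃, h₄, h₇.trans (Nat.mul_le_mul_left _ h₅)⟩
  cases p with
  | pop => exact pop_spec hH hW hR hp
  | visit => exact visit_spec hk hW hW' hR hp.1 hp.2.1 hp.2.2.1 hp.2.2.2

theorem consP_spec {y q : ℕ} {Q : RAMState → ℕ → Prop} (h16 : s.reg 16 = 1) (h9 : s.reg 9 = q)
    (hy : y ≠ 6 ∧ y ≠ 9 ∧ y ≠ 11) (hW : s.reg 6 + 2 ≤ W)
    (h : ∀ s' : RAMState, s'.mem = Function.update (Function.update (Function.update s.mem (s.reg 6)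
      (s.reg y)) (s.reg 6 + 1) (s.mem q)) q (s.reg 6) → s'.reg 6 = s.reg 6 + 2 →
      (∀ r, r ≠ 6 → r ≠ 11 → s'.reg r = s.reg r) → Q s' 7) :
    RAMTri W (consP y) s Q := by
  refine .seq <| .load <| .seq <| .store <| .seq <| .add ?_ <| .seq <| .store <| .seq <| .sub <|
    .seq <| .add ?_ <| .store (h _ ?_ ?_ ?_)
  · simp [h16]; omega
  · simp [h16]; omega
  · simp [RAMState.setMem_mem_eq, -RAMState.setMem_mem, h16, h9, hy]
  · simp [h16]
  · intro r h₁ h₂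
    simp [h₁, h₂]

theorem vertexP_spec (hW : H + 2 * U + 4 ≤ W) (hM : 0 < M)
    (h : ScanRep n k M B D H U inp s a) {v : Fin n} (h1 : s.reg 1 = v) (h20 : s.reg 20 = D + 8 * v)
    (h21 : s.reg 21 = B + 4 * v) (hU : a.used < U) :
    RAMTri W vertexP s fun s' t => ScanRep n k M B D H U inp s' (a.addVertex v) ∧
      s'.reg 0 = s.reg 0 ∧ s'.reg 1 = v + 1 ∧ s'.reg 20 = D + 8 * (v + 1) ∧
      s'.reg 21 = B + 4 * (v + 1) ∧ t = 17 := by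
  have hge := h.mem.H_ge
  have hD := h.mem.D_eq
  have hu := h.used
  have hv := v.2
  refine .seq <| .add ?_ <| .seq <| .add ?_ <| .seq <| .add ?_ <| .seq <|
    consP_spec (q := D + 8 * (0 + 1) + 4) ?_ ?_ (by simp) ?_ fun s₁ hm₁ h6 hreg => ?_
  · simp [h.reg16, h1]; omega
  · simp [h.reg19, h.reg5]; omega
  · simp [h.reg19, h.reg5, h.reg18]; omega
  · simp [h.reg16]
  · simp [h.reg19, h.reg5, h.reg18]
  · simp; omega
  have k1 : s₁.reg 1 = v + 1 := by rw [hreg 1 (by simp) (by simp)]; simp [h1, h.reg16]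
  have k8 : s₁.reg 8 = D + 8 * (0 + 1) := by
    rw [hreg 8 (by simp) (by simp)]; simp [h.reg5, h.reg19]
  have k : ∀ r, r ≠ 1 → r ≠ 6 → r ≠ 8 → r ≠ 9 → r ≠ 11 → s₁.reg r = s.reg r := by
    intro r h₁ h₂ h₃ h₄ h₅
    rw [hreg r h₂ h₅]
    simp [h₁, h₃, h₄]
  have k16 := k 16 (by simp) (by simp) (by simp) (by simp) (by simp)
  have k17 := k 17 (by simp) (by simp) (by simp) (by simp) (by simp)
  have k18 := k 18 (by simp) (by simp) (by simp) (by simp) (by simp)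
  have k19 := k 19 (by simp) (by simp) (by simp) (by simp) (by simp)
  have k20 := k 20 (by simp) (by simp) (by simp) (by simp) (by simp)
  have k21 := k 21 (by simp) (by simp) (by simp) (by simp) (by simp)
  rw [h.reg16] at k16
  rw [h.reg17] at k17
  rw [h.reg18] at k18
  rw [h.reg19] at k19
  rw [h20] at k20
  rw [h21] at k21
  simp [h20] at hm₁ h6
  obtain ⟨g₁, g₂⟩ := h.mem.push v (h.mem.bucket 0 hM)
  have g₃ := g₁.setBucket hM g₂
  have g₄ := h.ptr.frame (mem' := s₁.mem) (by omega : s.reg 6 ≤ s.reg 6 + 2) fun x hx₁ hx₂ => by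
    rw [hm₁, Function.update_of_ne (by omega), Function.update_of_ne (by omega),
      Function.update_of_ne (by omega)]
  simp only [zero_add, mul_one] at g₃
  rw [← hm₁] at g₃
  refine .seq <| .store <| .seq <| .add ?_ <| .seq <| .store <| .seq <| .add ?_ <|
    .seq <| .store <| .seq <| .add ?_ <| .add ?_ ?_
  · simp [k17, k20]; omega
  · simp [k16, k17, k20]; omega
  · simp [k19, k20]; omega
  · simp [k18, k21]; omega
  refine ⟨h.update ?_ ?_ ?_ ?_ h.top_le hU ?_ ?_, ?_, by simp [k1], ?_, ?_, rfl⟩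
  · intro r hr
    have : r ≠ 9 ∧ r ≠ 20 ∧ r ≠ 21 ∧ r ≠ 1 ∧ r ≠ 6 ∧ r ≠ 8 ∧ r ≠ 11 := by
      simp only [List.mem_cons, List.not_mem_nil, or_false] at hr
      omega
    simp [this, k r this.2.2.2.1]
  · simp only [RAMState.setReg_mem, RAMState.setReg_reg, RAMState.setMem_reg,
      RAMState.setMem_mem_eq]
    simp only [k1, k8, k16, k17, k18, k19, k20, k21, h6, if_true, Nat.reduceEqDiff, if_false]
    have g₅ := g₃.setRanked v 0 (mem' := Function.update (Function.update (Function.update s₁.mem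
        (D + 8 * v) (D + 8 * (0 + 1))) (D + 8 * v + 2) (B + 4 * v)) (D + 8 * v + 2 + 1) (v + 1))
      (fun x hx₁ hx₂ hx₃ => by
        rw [Function.update_of_ne (by omega), Function.update_of_ne hx₂, Function.update_of_ne hx₁])
      (by rw [Function.update_of_ne (by omega), Function.update_of_ne (by omega),
        Function.update_self])
      (by rw [Function.update_of_ne (by omega), Function.update_self]; ring)
      (by rw [Function.update_self])
    exact { g₅ with }
  · simp [h6, hu, ScanMem.addVertex]; ring
  · simpa [k 12, ScanMem.addVertex] using h.reg12
  · simpa [k 13, ScanMem.addVertex] using h.cur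
  · have k14 := k 14 (by simp) (by simp) (by simp) (by simp) (by simp)
    simp only [RAMState.setReg_mem, RAMState.setReg_reg, RAMState.setMem_reg,
      RAMState.setMem_mem_eq]
    simp only [k1, k8, k14, k16, k17, k18, k19, k20, k21, h6, if_true, Nat.reduceEqDiff, if_false]
    refine MemRep.chain_update (by omega) (MemRep.chain_update (by omega)
      (MemRep.chain_update (by omega) ?_))
    exact g₄
  · simp [k 0]
  · simp [k19, k20]; ring
  · simp [k18, k21]; ring

theorem arcP_spec (hW : H + 2 * U + 4 ≤ W) (h : ScanRep n k M B D H U inp s a) {x y : ℕ}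
    (hy : y = 7 ∨ y = 8) {u w : Fin n} (hxu : s.reg x = D + 8 * u)
    (hyw : s.reg y = D + 8 * w) (hU : a.used < U) :
    RAMTri W (arcP x y) s fun s' t => ScanRep n k M B D H U inp s' (a.addArc u w) ∧
      (∀ r, r < 6 ∨ r = 7 ∨ r = 8 → s'.reg r = s.reg r) ∧ t = 8 := by
  have hge := h.mem.H_ge
  have hD := h.mem.D_eq
  have hu := h.used
  have hu' := u.2
  have hy9 : y ≠ 9 := by omega
  refine .seq <| .add ?_ <| consP_spec (q := D + 8 * u + 1) ?_ ?_ (by omega) ?_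
    fun s₁ hm₁ h6 hreg => ?_
  · simp [h.reg16, hxu]; omega
  · simp [h.reg16]
  · simp [h.reg16, hxu]
  · simp; omega
  simp [hy9, hyw] at hm₁ h6
  obtain ⟨g₁, g₂⟩ := h.mem.push w (h.mem.adj u)
  have g₃ := g₁.setAdj u g₂
  have hchain := h.ptr.frame (mem' := s₁.mem) (by omega : s.reg 6 ≤ s.reg 6 + 2) fun x hx₁ hx₂ => by
      rw [hm₁, Function.update_of_ne (by omega), Function.update_of_ne (by omega),
        Function.update_of_ne (by omega)]
  have k : ∀ r, r ≠ 6 → r ≠ 9 → r ≠ 11 → s₁.reg r = s.reg r := by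
    intro r h₁ h₂ h₃
    rw [hreg r h₁ h₃]
    simp [h₂]
  rw [← hm₁] at g₃
  refine ⟨h.update (fun r hr => k r ?_ ?_ ?_) ?_ ?_ ?_ h.top_le hU ?_ ?_, fun r hr =>
    k r (by omega) (by omega) (by omega), rfl⟩
  iterate 3 rintro rfl; simp at hr
  · rw [h6]
    exact { g₃ with }
  · simp [h6, hu, ScanMem.addArc]; ring
  · rw [k 12 (by simp) (by simp) (by simp)]; exact h.reg12
  · rw [k 13 (by simp) (by simp) (by simp)]; exact h.cur
  · rw [k 14 (by simp) (by simp) (by simp), h6]; exact hchain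

theorem edgeP_spec (hW : H + 2 * U + 4 ≤ W) (h : ScanRep n k M B D H U inp s a) {u w : Fin n}
    (hu : s.mem (s.reg 1) = u) (hw : s.mem (s.reg 1 + 1) = w) (h1 : s.reg 1 + 2 ≤ B)
    (hU : a.used + 1 < U) :
    RAMTri W edgeP s fun s' t => ScanRep n k M B D H U inp s' ((a.addArc u w).addArc w u) ∧
      s'.reg 1 = s.reg 1 + 2 ∧ t = 28 := by
  have hge := h.mem.H_ge
  have hD := h.mem.D_eq
  have hu' := u.2
  have hw' := w.2
  refine .seq <| .load <| .seq <| .add ?_ <| .seq <| .load <| .seq <| .add ?_ <|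
    .seq <| .add ?_ <| .seq <| .add ?_ <| .seq <| .add ?_ <| .seq <| .add ?_ <|
    .seq <| .add ?_ <| .seq <| .add ?_ <| .seq <| .add ?_ <| .seq <| .add ?_ <| .seq ?_
  · simp [h.reg16]; omega
  · simp [h.reg16]; omega
  · simp [hu]; omega
  · simp [hu]; omega
  · simp [hu]; omega
  · simp [hu, h.reg5]; omega
  · simp [h.reg16, hw]; omega
  · simp [h.reg16, hw]; omega
  · simp [h.reg16, hw]; omega
  · simp [h.reg16, hw, h.reg5]; omega
  refine (arcP_spec hW (h.update ?_ ?_ ?_ ?_ h.top_le h.used_le ?_ ?_) (.inr rfl)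
    (u := u) (w := w) ?_ ?_ (by omega)).mono fun s₁ t₁ ⟨h₁, h₂, h₃⟩ => ?_
  · simp
  · simpa using h.mem
  · simpa using h.used
  · simpa using h.reg12
  · simpa using h.cur
  · simpa using h.ptr
  · simp [hu, h.reg5]; ring
  · simp [hw, h.reg16, h.reg5]; ring
  · refine (arcP_spec hW h₁ (.inl rfl) (u := w) (w := u) ?_ ?_ hU).mono
      fun s₂ t₂ ⟨h₄, h₅, h₆⟩ => ⟨h₄, ?_, by omega⟩
    · rw [h₂ 8 (by omega)]
      simp [hw, h.reg16, h.reg5]; ring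
    · rw [h₂ 7 (by omega)]
      simp [hu, h.reg5]; ring
    · rw [h₅ 1 (by omega), h₂ 1 (by omega)]
      simp [h.reg16]

end

/-! ### Loading the graph -/

/-- The memory of the scan after `j` vertices and the edges in `L` have been read. -/
structure ScanMem.Loaded {n : ℕ} (j : ℕ) (L : List (Fin n × Fin n)) (a : ScanMem (Fin n)) :
    Prop where
  rank : ∀ v, a.rank v = if (v : ℕ) < j then some 0 else none
  par : ∀ i v, a.par i v = none
  bucket : ∀ v : Fin n, (v : ℕ) < j → v ∈ a.bucket 0
  size : (a.bucket 0).length = j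
  empty : ∀ b, b ≠ 0 → a.bucket b = []
  top : a.top = 0
  ptr : a.ptr = []
  used : a.used = j + 2 * L.length
  adj : ∀ v w, w ∈ a.adj v ↔ (v, w) ∈ L ∨ (w, v) ∈ L
  nodup : ∀ v, (a.adj v).Nodup
  degrees : ∑ v, (a.adj v).length = 2 * L.length

section

variable {W n k M B D H U : ℕ} {inp : ℕ → ℕ} {s : RAMState} {a : ScanMem (Fin n)}

namespace ScanMem

theorem Loaded.empty_zero : (ScanMem.empty (Fin n)).Loaded 0 [] := by
  constructor <;> simp [ScanMem.empty]

theorem Loaded.addVertex {j : ℕ} {L : List (Fin n × Fin n)} (h : a.Loaded j L) {v : Fin n}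
    (hv : (v : ℕ) = j) : (a.addVertex v).Loaded (j + 1) L where
  rank w := by
    by_cases hw : w = v
    · subst hw; simp [ScanMem.addVertex, hv]
    · have : (w : ℕ) ≠ j := fun he => hw (Fin.ext (he.trans hv.symm))
      simp only [ScanMem.addVertex, Function.update_of_ne hw, h.rank]
      congr 1
      simp only [eq_iff_iff]
      omega
  par := h.par
  bucket w hw := by
    simp only [ScanMem.addVertex, Function.update_self, List.mem_cons]
    rcases Nat.lt_succ_iff_lt_or_eq.1 hw with hw | hw
    · exact .inr (h.bucket w hw)
    · exact .inl (Fin.ext (hw.trans hv.symm))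
  size := by simp [ScanMem.addVertex, h.size]
  empty b hb := by simp [ScanMem.addVertex, hb, h.empty b hb]
  top := h.top
  ptr := h.ptr
  used := by simp only [ScanMem.addVertex, h.used]; ring
  adj := h.adj
  nodup := h.nodup
  degrees := h.degrees

/-- Since the edge is new in both orientations, the neighbour lists stay free of repetitions, on
which the correctness of the visits depends. -/
theorem Loaded.addEdge {j : ℕ} {L : List (Fin n × Fin n)} (h : a.Loaded j L) {u w : Fin n}
    (huw : u ≠ w) (hnew : s(u, w) ∉ L.map fun e => s(e.1, e.2)) :
    ((a.addArc u w).addArc w u).Loaded j (L ++ [(u, w)]) := by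
  have h₁ : (u, w) ∉ L := fun hm => hnew (List.mem_map_of_mem (f := fun e => s(e.1, e.2)) hm)
  have h₂ : (w, u) ∉ L := fun hm => hnew (by
    rw [Sym2.eq_swap]; exact List.mem_map_of_mem (f := fun e => s(e.1, e.2)) hm)
  have hadj : ((a.addArc u w).addArc w u).adj =
      Function.update (Function.update a.adj u (w :: a.adj u)) w (u :: a.adj w) := by
    simp [ScanMem.addArc, huw.symm]
  refine ⟨h.rank, h.par, h.bucket, h.size, h.empty, h.top, h.ptr, ?_, fun v x => ?_, fun v => ?_, ?_⟩
  · simp only [ScanMem.addArc, h.used, List.length_append, List.length_singleton]; ring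
  · rw [hadj]
    simp only [List.mem_append, List.mem_singleton, Prod.mk.injEq]
    by_cases hvw : v = w
    · subst hvw
      simp [h.adj, huw.symm]
      tauto
    · by_cases hvu : v = u
      · subst hvu
        simp [h.adj, huw]
        tauto
      · simp [h.adj, hvw, hvu]
  · rw [hadj]
    by_cases hvw : v = w
    · subst hvw
      simp [h.adj, h.nodup, h₁, h₂]
    · by_cases hvu : v = u
      · subst hvu
        simp [h.adj, h.nodup, h₁, h₂, huw]
      · simp [h.nodup, hvw, hvu]
  · rw [hadj]
    have e₁ := sum_update_add (Finset.mem_univ w) (Function.update a.adj u (w :: a.adj u))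
      (u :: a.adj w)
    have e₂ := sum_update_add (Finset.mem_univ u) a.adj (w :: a.adj u)
    rw [Function.update_of_ne huw.symm] at e₁
    simp only [List.length_cons, List.length_append, List.length_nil, h.degrees] at e₁ e₂ ⊢
    omega

end ScanMem

theorem vertexLoop_spec (hW : H + 2 * U + 4 ≤ W) (hM : 0 < M) (hU : n ≤ U) :
    ∀ {d j : ℕ} {s : RAMState} {a : ScanMem (Fin n)}, j + d = n → ScanRep n k M B D H U inp s a →
    a.Loaded j [] → s.reg 0 = n → s.reg 1 = j → s.reg 20 = D + 8 * j → s.reg 21 = B + 4 * j →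
    RAMTri W (.loop (.lt 1 0) vertexP) s fun s' t => ∃ a', ScanRep n k M B D H U inp s' a' ∧
      a'.Loaded n [] ∧ t ≤ 18 * d + 1 := by
  intro d
  induction d with
  | zero =>
    intro j s a hj h hl h0 h1 h20 h21
    obtain rfl : j = n := hj
    exact .loop_done (by simp [RAMTest.Holds, h0, h1]) ⟨a, h, hl, by omega⟩
  | succ d ih =>
    intro j s a hj h hl h0 h1 h20 h21
    have hu := hl.used
    simp only [List.length_nil] at hu
    refine .loop_step (by simp only [RAMTest.Holds, h0, h1]; omega)
      ((vertexP_spec hW hM h (v := ⟨j, by omega⟩) h1 h20 h21 (by omega)).mono ?_)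
    rintro s₁ t₁ ⟨h₁, k0, k1, k20, k21, rfl⟩
    refine (ih (j := j + 1) (by omega) h₁ (hl.addVertex rfl) (k0.trans h0) k1 k20 k21).mono ?_
    rintro s₂ t₂ ⟨a', h₂, h₃, h₄⟩
    exact ⟨a', h₂, h₃, by omega⟩

theorem inputState_mem {L₁ L₂ : List (Fin n × Fin n)} {e : Fin n × Fin n} :
    (inputState n k (L₁ ++ e :: L₂)).mem (2 * L₁.length) = e.1 ∧
      (inputState n k (L₁ ++ e :: L₂)).mem (2 * L₁.length + 1) = e.2 := by
  have h₁ : (2 * L₁.length) / 2 = L₁.length := by omega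
  have h₂ : (2 * L₁.length + 1) / 2 = L₁.length := by omega
  have h₃ : (2 * L₁.length + 1) % 2 = 1 := by omega
  constructor
  · simp [inputState]
  · simp [inputState, h₂]

theorem edgeLoop_spec {L : List (Fin n × Fin n)} (hW : H + 2 * U + 4 ≤ W)
    (hU : n + 2 * L.length ≤ U) (hB : B = 2 * L.length)
    (hnd : (L.map fun e => s(e.1, e.2)).Nodup) (hne : ∀ e ∈ L, e.1 ≠ e.2) :
    ∀ {L₂ L₁ : List (Fin n × Fin n)} {s : RAMState} {a : ScanMem (Fin n)}, L = L₁ ++ L₂ →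
    ScanRep n k M B D H U (inputState n k L).mem s a → a.Loaded n L₁ → s.reg 1 = 2 * L₁.length →
    RAMTri W (.loop (.lt 1 3) edgeP) s fun s' t => ∃ a',
      ScanRep n k M B D H U (inputState n k L).mem s' a' ∧ a'.Loaded n L ∧
      t ≤ 29 * L₂.length + 1 := by
  intro L₂
  induction L₂ with
  | nil =>
    intro L₁ s a hL h hl h1
    rw [List.append_nil] at hL
    subst hL
    exact .loop_done (by simp [RAMTest.Holds, h1, h.reg3, hB]) ⟨a, h, hl, by omega⟩
  | cons e L₂ ih =>
    intro L₁ s a hL h hl h1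
    have hlen : L.length = L₁.length + (L₂.length + 1) := by rw [hL]; simp
    have hu := hl.used
    have hin : ∀ x < B, s.mem x = (inputState n k L).mem x := h.mem.input
    obtain ⟨i₁, i₂⟩ := inputState_mem (k := k) (L₁ := L₁) (L₂ := L₂) (e := e)
    refine .loop_step (by simp only [RAMTest.Holds, h1, h.reg3]; omega)
      ((edgeP_spec hW h (u := e.1) (w := e.2) ?_ ?_ (by omega) (by omega)).mono ?_)
    · rw [hin _ (by omega), h1, hL, i₁]
    · rw [hin _ (by omega), h1, hL, i₂]
    rintro s₁ t₁ ⟨h₁, k1, rfl⟩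
    refine (ih (L₁ := L₁ ++ [e]) (by simp [hL]) h₁ (hl.addEdge (hne e (by simp [hL])) ?_)
      (by rw [k1, h1]; simp; ring)).mono ?_
    · rw [hL, List.map_append, List.nodup_append] at hnd
      intro hm
      exact hnd.2.2 _ hm _ (by simp) rfl
    · rintro s₂ t₂ ⟨a', h₂, h₃, h₄⟩
      exact ⟨a', h₂, h₃, by simp only [List.length_cons]; omega⟩

theorem levelLoop_spec {N : ℕ} : ∀ {j : ℕ} {s : RAMState} {Q : RAMState → ℕ → Prop},
    s.reg 1 = j → s.reg 10 = 0 → s.reg 16 = 1 → s.reg 4 = 4 * N → s.reg 5 + 4 * (j * N) ≤ W →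
    (∀ s' : RAMState, s'.mem = s.mem → (∀ r, r ≠ 1 → r ≠ 5 → s'.reg r = s.reg r) →
      s'.reg 1 = 0 → s'.reg 5 = s.reg 5 + 4 * (j * N) → Q s' (3 * j + 1)) →
    RAMTri W (.loop (.lt 10 1) (.seq (.add 5 5 4) (.sub 1 1 16))) s Q := by
  intro j
  induction j with
  | zero =>
    intro s Q h1 h10 h16 h4 hW h
    exact .loop_done (by simp [RAMTest.Holds, h1, h10]) (h s rfl (fun _ _ _ => rfl) h1 (by simp))
  | succ j ih =>
    intro s Q h1 h10 h16 h4 hW h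
    have e : (j + 1) * N = j * N + N := by ring
    rw [e] at hW h
    refine .loop_step (by simp [RAMTest.Holds, h1, h10]) <| .seq <| .add (by rw [h4]; omega) <|
      .sub <| ih (by simp [h1, h16]) (by simpa using h10) (by simpa using h16)
      (by simpa using h4) (by simp [h4]; omega) fun s' h₁ h₂ h₃ h₄ => ?_
    have := h s' h₁ (fun r hr hr' => by rw [h₂ r hr hr']; simp [hr, hr']) h₃
      (by rw [h₄]; simp [h4]; ring)
    rwa [show 1 + 1 + (3 * j + 1) + 1 = 3 * (j + 1) + 1 by ring]

/-- Below `B` lies the input, up to `D` the `k` arrays of records, up to `H` the slots and `B + 1`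
buckets, and above `H` the list cells. The product of `k` and `4 * n` is formed by repeated
addition, which takes a number of steps linear in `k`. -/
theorem layoutP_spec {L : List (Fin n × Fin n)} (hB : B = 2 * L.length) (hD : D = B + 4 * (k * n))
    (hH : H = D + 8 * (n + B + 2)) (hW : H + 2 * U + 8 ≤ W) :
    RAMTri W layoutP (inputState n k L) fun s t =>
      ScanRep n k (B + 1) B D H U (inputState n k L).mem s (ScanMem.empty (Fin n)) ∧
      s.reg 0 = n ∧ s.reg 1 = 0 ∧ s.reg 20 = D ∧ s.reg 21 = B ∧ t ≤ 3 * k + 18 := by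
  refine .seq <| .const (by omega) <| .seq <| .const (by omega) <| .seq <| .const (by omega) <|
    .seq <| .const (by omega) <| .seq <| .add ?_ <| .seq <| .add ?_ <| .seq <| .add ?_ <|
    .seq <| .add ?_ <| .seq <| levelLoop_spec (N := n) (j := k) ?_ ?_ ?_ ?_ ?_
      fun s hm hr h1 h5 => ?_
  · simp [inputState]; omega
  · simp [inputState]; omega
  · simp [inputState]; omega
  · simp [inputState]; omega
  · simp [inputState]
  · simp [inputState]
  · simp
  · simp [inputState]; ring
  · simp [inputState]; omega
  have r0 : s.reg 0 = n := by rw [hr 0 (by simp) (by simp)]; simp [inputState]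
  have r3 : s.reg 3 = B := by rw [hr 3 (by simp) (by simp)]; simp [inputState, hB]; ring
  have r4 : s.reg 4 = 4 * n := by rw [hr 4 (by simp) (by simp)]; simp [inputState]; ring
  have r5 : s.reg 5 = D := by rw [h5]; simp [inputState, hB, hD]; ring
  have r10 : s.reg 10 = 0 := by rw [hr 10 (by simp) (by simp)]; simp [inputState]
  have r13 : s.reg 13 = 0 := by rw [hr 13 (by simp) (by simp)]; simp [inputState]
  have r14 : s.reg 14 = 0 := by rw [hr 14 (by simp) (by simp)]; simp [inputState]
  have r16 : s.reg 16 = 1 := by rw [hr 16 (by simp) (by simp)]; simp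
  have r17 : s.reg 17 = 2 := by rw [hr 17 (by simp) (by simp)]; simp
  have r18 : s.reg 18 = 4 := by rw [hr 18 (by simp) (by simp)]; simp
  have r19 : s.reg 19 = 8 := by rw [hr 19 (by simp) (by simp)]; simp
  simp only [RAMState.setReg_mem] at hm
  clear hr h5
  -- Cells beyond the input are 0, which encodes null pointers, cleared bits, empty lists and
  -- missing ranks; no clearing is needed.
  have hzero : ∀ x, B ≤ x → s.mem x = 0 := by
    intro x hx
    rw [hm]
    have : L.length ≤ x / 2 := by omega
    simp [inputState, List.getElem?_eq_none this]
  refine .seq <| .add ?_ <| .seq <| .add ?_ <| .seq <| .add ?_ <| .seq <| .add ?_ <|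
    .seq <| .add ?_ <| .seq <| .add ?_ <| .seq <| .add ?_ <| .seq <| .add ?_ <| .add ?_ ?_
  · simp [r0, r3]; omega
  · simp [r0, r3, r17]; omega
  · simp [r0, r3, r17]; omega
  · simp [r0, r3, r17]; omega
  · simp [r0, r3, r17]; omega
  · simp [r0, r3, r17, r5]; omega
  · simp [r5, r10]; omega
  · simp [r3, r10]; omega
  · simp [r5, r10]; omega
  have h6 : n + B + 2 + (n + B + 2) + (n + B + 2 + (n + B + 2)) +
      (n + B + 2 + (n + B + 2) + (n + B + 2 + (n + B + 2))) + D = H := by omega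
  refine ⟨⟨?_, ?_, ?_, ?_, ?_, ?_, ?_, ?_, ?_, ?_, ?_, ?_, ?_, ?_, ?_⟩, ?_, ?_, ?_, ?_, by omega⟩
  · simp only [RAMState.setReg_mem, RAMState.setReg_reg, Nat.reduceEqDiff, if_true, if_false, r0,
      r3, r17, r5, h6]
    refine ⟨hD, by omega, le_rfl, fun x hx => by rw [hm], fun i hi f v => ?_, fun v _ => ?_,
      fun v ρ hv => ?_, fun v => ?_, fun b hb => ?_⟩
    · rw [hzero _ (by omega)]
      fin_cases f <;> simp [LinkCut.field, LinkCut.ofParent, ScanMem.empty, encodePtr]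
    · exact hzero _ (by omega)
    · simp [ScanMem.empty] at hv
    · exact hzero _ (by omega)
    · exact hzero _ (by omega)
  all_goals simp [r0, r3, r4, r5, r10, r13, r14, r16, r17, r18, r19, ScanMem.empty, encodePtr, h6, h1,
    Chain]

end

/-! ### The link-cut structures produced by the scan -/

namespace LinkCut

variable {V : Type} {par : V → Option V}

theorem ofParent_inOrder {v : V} {l : List V} : (ofParent par).InOrder (some v) l ↔ l = [v] := by
  rw [inOrder_some_of_rev rfl]
  constructor
  · rintro ⟨l₁, l₂, h₁, h₂, rfl⟩
    rw [inOrder_none.1 h₁, inOrder_none.1 h₂]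
    rfl
  · rintro rfl
    exact ⟨[], [], .nil, .nil, rfl⟩

theorem ofParent_isSolidPath {v : V} {l : List V} :
    (ofParent par).IsSolidPath v l ↔ l = [v] := by
  rw [IsSolidPath, ofParent_inOrder]
  simp [IsAuxRoot, IsChild, ofParent]

/-- All paths consist of one vertex, so every edge is a path-parent edge and no splay tree has to be
built. -/
theorem ofParent_forestParent {x y : V} :
    (ofParent par).ForestParent x y ↔ par x = some y := by
  constructor
  · rintro (⟨r, l, h, hl⟩ | ⟨r, l, h, hl, hr⟩)
    · rw [ofParent_isSolidPath] at h
      subst h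
      have := hl.length_le
      simp at this
    · rw [ofParent_isSolidPath] at h
      subst h
      obtain rfl : r = x := by simpa using hl
      exact hr
  · intro h
    exact .inr ⟨x, [x], ofParent_isSolidPath.2 rfl, rfl, h⟩

theorem ofParent_wellFormed (h : PAcyclic par) : (ofParent par).WellFormed where
  parent_of_child v c hc := by simp [IsChild, ofParent] at hc
  left_ne_right v c hc := by simp [ofParent] at hc
  acyclic := h

theorem ofParent_forest {E : Set (Sym2 V)}
    (h : ∀ e, e ∈ E ↔ ∃ x y, par y = some x ∧ e = s(x, y)) :
    (ofParent par).forest = SimpleGraph.fromEdgeSet E := by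
  ext x y
  simp only [forest_adj, ofParent_forestParent, SimpleGraph.fromEdgeSet_adj, h]
  constructor
  · rintro ⟨hne, h | h⟩
    · exact ⟨⟨y, x, h, Sym2.eq_swap⟩, hne⟩
    · exact ⟨⟨x, y, h, rfl⟩, hne⟩
  · rintro ⟨⟨u, w, h, he⟩, hne⟩
    rcases Sym2.eq_iff.1 he with ⟨rfl, rfl⟩ | ⟨rfl, rfl⟩
    · exact ⟨hne, .inr h⟩
    · exact ⟨hne, .inl h⟩

end LinkCut

/-! ### Assembly of the bounds for initialization and additions -/

section

variable {W n k : ℕ} {G : SimpleGraph (Fin n)} {L : List (Fin n × Fin n)}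

theorem ScanMem.Loaded.represents {a : ScanMem (Fin n)} (h : a.Loaded n L) (hL : ListsEdges G L) :
    ({ a with top := 1 } : ScanMem (Fin n)).Represents G (ScanState.start (Fin n)) where
  unranked v := by simp [h.rank, ScanState.start]
  rank v ρ hv := by
    simp [h.rank] at hv
    simp [ScanState.start, hv]
  bucket v ρ hv := by
    simp [h.rank] at hv
    subst hv
    exact ⟨h.bucket v v.2, Nat.one_pos⟩
  edges i e := by simp [ScanState.start, h.par]
  adj v w := by
    rw [h.adj, ← SimpleGraph.mem_edgeSet, ← hL.2, List.mem_map]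
    constructor
    · rintro (hm | hm)
      · exact ⟨_, hm, rfl⟩
      · exact ⟨_, hm, Sym2.eq_swap⟩
    · rintro ⟨⟨x, y⟩, hm, he⟩
      rcases Sym2.eq_iff.1 he with ⟨rfl, rfl⟩ | ⟨rfl, rfl⟩
      · exact .inl hm
      · exact .inr hm
  nodup := h.nodup
  scanned v w _ := by simp [ScanState.start]
  active v hv := by simp [ScanState.start] at hv
  ptr v hv := by simp [ScanState.start] at hv
  idle _ := h.ptr
  acyclic i := ⟨fun v => ⟨_, fun p hp => by simp [h.par] at hp⟩⟩
  fresh v ρ _ i _ := h.par i v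
  leaf v ρ _ i w := by simp [h.par]

/-- Loading uses one list cell per vertex and two per edge, and at most two visits per edge are
still to come. This fixes the numbers of buckets, 2m + 1, and of list cells, n + 4m. -/
theorem ScanMem.Loaded.fits {a : ScanMem (Fin n)} (h : a.Loaded n L) :
    ({ a with top := 1 } : ScanMem (Fin n)).Fits (2 * L.length + 1) (n + 4 * L.length) ∧
    ({ a with top := 1 } : ScanMem (Fin n)).weight (2 * L.length + 1) = 1 + n + 6 * L.length := by
  have hr : ({ a with top := 1 } : ScanMem (Fin n)).remaining = 2 * L.length := by
    simp [remaining, h.rank, h.ptr, h.degrees]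
  have hl : ({ a with top := 1 } : ScanMem (Fin n)).load (2 * L.length + 1) = n := by
    simp only [load]
    rw [Finset.sum_eq_single 0 (fun b _ hb => by simp [h.empty b hb]) (by simp), h.size]
  refine ⟨⟨?_, ?_⟩, ?_⟩
  · rw [hr]; simp only [h.used]; omega
  · rw [hr]; dsimp only; omega
  · rw [weight, hr, hl]; dsimp only; omega

theorem ListsEdges.ne (h : ListsEdges G L) {e : Fin n × Fin n} (he : e ∈ L) : e.1 ≠ e.2 := by
  have := (h.2 s(e.1, e.2)).1 (List.mem_map_of_mem (f := fun e => s(e.1, e.2)) he)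
  exact SimpleGraph.Adj.ne (G := G) this

theorem initP_spec (hL : ListsEdges G L)
    (hW : 26 * L.length + 4 * (k * n) + 10 * n + 24 ≤ W)
    (hW' : 2 * L.length + 4 * ((2 * L.length + 1) * n) + 4 * n ≤ W) :
    RAMTri W initP (inputState n k L) fun s t => ∃ (T : ℕ → LinkCut (Fin n))
      (E : ℕ → Set (Sym2 (Fin n))), IsScanPartition G E ∧ Maintains n k (2 * L.length) s T ∧
      (∀ j, (T j).WellFormed ∧ (T j).forest = SimpleGraph.fromEdgeSet (E j)) ∧
      t ≤ 3 * k + 108 * n + 569 * L.length + 145 := by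
  obtain ⟨B, hB⟩ : ∃ B, B = 2 * L.length := ⟨_, rfl⟩
  obtain ⟨D, hD⟩ : ∃ D, D = B + 4 * (k * n) := ⟨_, rfl⟩
  obtain ⟨H, hH⟩ : ∃ H, H = D + 8 * (n + B + 2) := ⟨_, rfl⟩
  obtain ⟨U, hU⟩ : ∃ U, U = n + 4 * L.length := ⟨_, rfl⟩
  have hWU : H + 2 * U + 8 ≤ W := by omega
  refine .seq <| (layoutP_spec hB hD hH hWU).mono ?_
  rintro s₁ t₁ ⟨h₁, r0, r1, r20, r21, ht₁⟩
  refine .seq <| (vertexLoop_spec (by omega) (by omega) (by omega) (d := n) (j := 0) (by omega) h₁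
    ScanMem.Loaded.empty_zero r0 r1 (by simpa using r20) (by simpa using r21)).mono ?_
  rintro s₂ t₂ ⟨a₂, h₂, hl₂, ht₂⟩
  refine .seq <| .add (by rw [h₂.reg10]; omega) <| .seq <| (edgeLoop_spec (L := L) (L₁ := [])
    (by omega) (by omega) hB hL.1 (fun e he => hL.ne he) (L₂ := L) rfl (h₂.update ?_ ?_ ?_ ?_
    h₂.top_le h₂.used_le ?_ ?_) hl₂ ?_).mono ?_
  · simp
  · simpa using h₂.mem
  · simpa using h₂.used
  · simpa using h₂.reg12
  · simpa using h₂.cur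
  · simpa using h₂.ptr
  · simp [h₂.reg10]
  rintro s₃ t₃ ⟨a₃, h₃, hl₃, ht₃⟩
  obtain ⟨hf, hw⟩ := hl₃.fits
  rw [← hB, ← hU] at hf
  rw [← hB] at hw
  -- All vertices are in bucket 0, so the bound on the ranks is raised to 1 before the scan starts.
  have h₃' : ScanRep n k (B + 1) B D H U (inputState n k L).mem
      (s₃.setReg 12 (s₃.reg 5 + s₃.reg 19)) { a₃ with top := 1 } :=
    h₃.update (by simp) { h₃.mem with } (by simpa using h₃.used) (by simp [h₃.reg5, h₃.reg19])
      (Nat.le_add_left 1 B) h₃.used_le (by simpa using h₃.cur) (by simpa using h₃.ptr)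
  refine .seq <| .add (by rw [h₃.reg5, h₃.reg19]; omega) <| (scanP_spec hD (by omega)
    (by omega) (by rw [hB]; exact hW') h₃' (hl₃.represents hL) rfl hf).mono ?_
  rintro s₄ t₄ ⟨a₄, S, h₄, hS, hrep, hact, htop, ht₄⟩
  rw [hw] at ht₄
  refine ⟨fun i => LinkCut.ofParent (a₄.par i), S.E, ⟨S, hS, hact, fun x => ?_, rfl⟩,
    ⟨by rw [h₄.reg3, hB], h₄.reg4, by rw [h₄.reg5, hD, hB], fun j hj f v => ?_⟩,
    fun j => ⟨LinkCut.ofParent_wellFormed (hrep.acyclic j), LinkCut.ofParent_forest (hrep.edges j)⟩,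
    by omega⟩
  · cases hr : a₄.rank x with
    | none => simpa [hact] using (hrep.unranked x).1 hr
    | some ρ => have := (hrep.bucket x ρ hr).2; omega
  · rw [← hB]; exact h₄.mem.records j hj f v

/-- What is known after initialization and some additions; `P` bounds the total time. -/
structure RunInv (n k B : ℕ) (A : SimpleGraph (Fin n)) (s : RAMState) (t : ℕ) (P : ℝ)
    (T : ℕ → LinkCut (Fin n)) (sz : ℕ → Fin n → ℕ) : Prop where
  maintains : Maintains n k B s T
  sound : ∀ j < k, (T j).WellFormed ∧ IsSize (T j).parent (sz j)
  cert : IsSparseCertificate A fun i : Fin k => (T i).forest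
  time : (t : ℝ) + 2500 * ∑ j ∈ Finset.range k, potential (sz j) ≤ P

theorem Maintains.storedLinkCut {B : ℕ} {s : RAMState} {T : ℕ → LinkCut (Fin n)}
    (h : Maintains n k B s T) (i : Fin k) : storedLinkCut n s i = T i :=
  Stores.storedLinkCut (by rw [h.reg3]; exact h.stores i i.2)

theorem Maintains.storedForests {B : ℕ} {s : RAMState} {T : ℕ → LinkCut (Fin n)}
    (h : Maintains n k B s T) : storedForests n k s = fun i : Fin k => (T i).forest := by
  funext i
  rw [_root_.storedForests, h.storedLinkCut]

theorem lg_le_two_log (n : ℕ) : lg n ≤ 2 * Real.log n := by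
  have h₁ : 0 ≤ Real.log n := Real.log_natCast_nonneg n
  have h₂ := Real.log_two_gt_d9
  rw [lg, Real.logb, div_le_iff₀ (by linarith)]
  nlinarith

theorem half_le_log {n : ℕ} (hn : 2 ≤ n) : 1 / 2 ≤ Real.log n := by
  have h₁ : Real.log 2 ≤ Real.log n := Real.log_le_log (by norm_num) (by exact_mod_cast hn)
  have h₂ := Real.log_two_gt_d9
  linarith

/-- Besides its running time, initialization is charged for the potential of the structures it
leaves behind, at most n lg n for each of the `k` forests. Since n ≥ 2, log n ≥ 1/2 absorbs the
terms linear in n and k and the constant. -/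
theorem RunInv.init (hn : 2 ≤ n) (hk : 1 ≤ k) (hL : ListsEdges G L)
    (hW : 26 * L.length + 4 * (k * n) + 10 * n + 24 ≤ W)
    (hW' : 2 * L.length + 4 * ((2 * L.length + 1) * n) + 4 * n ≤ W) :
    RAMTri W initP (inputState n k L) fun s t => ∃ (T : ℕ → LinkCut (Fin n))
      (sz : ℕ → Fin n → ℕ) (E : ℕ → Set (Sym2 (Fin n))), IsScanPartition G E ∧
      (∀ i : Fin k, (T i).forest = SimpleGraph.fromEdgeSet (E i)) ∧
      RunInv n k (2 * L.length) G s t (200000 * (L.length + k * n * Real.log n)) T sz := by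
  refine (initP_spec hL hW hW').mono ?_
  rintro s t ⟨T, E, hE, hM, hT, ht⟩
  choose sz hsz using fun j => (hT j).1.pacyclic.exists_isSize
  refine ⟨T, sz, E, hE, fun i => (hT i).2, hM, fun j _ => ⟨(hT j).1, hsz j⟩, ?_, ?_⟩
  · have := hE.isSparseCertificate k
    simpa only [← (hT _).2] using this
  · have hpot : ∑ j ∈ Finset.range k, potential (sz j) ≤ k * (n * lg n) := by
      refine (Finset.sum_le_sum fun j _ => potential_le (hsz j) (hT j).1.pacyclic).trans ?_
      simp
    have hlog := half_le_log hn
    have hlg := lg_le_two_log n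
    have hk' : (1 : ℝ) ≤ k := by exact_mod_cast hk
    have hn' : (2 : ℝ) ≤ n := by exact_mod_cast hn
    have ht' : (t : ℝ) ≤ 3 * k + 108 * n + 569 * L.length + 145 := by exact_mod_cast ht
    have hm : (0 : ℝ) ≤ L.length := by positivity
    have h₁ : (k : ℝ) ≤ k * n := by nlinarith
    have h₂ : (n : ℝ) ≤ k * n := by nlinarith
    have h₃ : (k * n : ℝ) * (1 / 2) ≤ k * n * Real.log n :=
      mul_le_mul_of_nonneg_left hlog (by positivity)
    have h₄ : (k : ℝ) * (n * lg n) ≤ 2 * (k * n * Real.log n) := by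
      have := mul_le_mul_of_nonneg_left hlg (by positivity : (0 : ℝ) ≤ k * n)
      linarith
    linarith

theorem RunInv.addition {B t₀ : ℕ} {A : SimpleGraph (Fin n)} {s : RAMState} {P : ℝ}
    {T : ℕ → LinkCut (Fin n)} {sz : ℕ → Fin n → ℕ} (hn : 2 ≤ n) (hk : 1 ≤ k)
    (hW : B + 4 * (k * n) + 4 ≤ W) (h : RunInv n k B A s t₀ P T sz) {u v : Fin n}
    (hnew : IsNewEdge n k s u v) :
    RAMTri W insP (withRequest s u v) fun s' t => ∃ (T' : ℕ → LinkCut (Fin n))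
      (sz' : ℕ → Fin n → ℕ) (out : Option (Fin n × Fin n)),
      RunInv n k B (A ⊔ SimpleGraph.edge u v) s' (t₀ + t) (P + 200000 * (k * Real.log n)) T' sz' ∧
      HandleAddition (storedForests n k s) u v (storedForests n k s') out ∧
      ReportsDiscarded s' out ∧
      (out = none → storedGraph n k s' = storedGraph n k s ⊔ SimpleGraph.edge u v) ∧
      ∀ x y : Fin n, out = some (x, y) →
        s(x, y) ≠ s(u, v) ∧ (storedGraph n k s).Adj x y ∧
        storedGraph n k s' =
          (storedGraph n k s ⊔ SimpleGraph.edge u v).deleteEdges {s(x, y)} ∧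
        HasEdgeDisjointPaths (storedGraph n k s') k x y := by
  refine (insP_spec hW hn hk hnew.1 h.maintains h.sound).mono ?_
  rintro s' t ⟨T', sz', out, hM, hT', hH, hout, ht⟩
  have hF := h.maintains.storedForests
  have hF' := hM.storedForests
  have hnew' := hnew.2
  rw [storedGraph, hF] at hnew'
  obtain ⟨e, hc, rfl⟩ := hH.cascade h.cert hk hnew.1 hnew'
  refine ⟨T', sz', _, ⟨hM, hT', hc.certificate, ?_⟩, by rw [hF, hF']; exact hH, hout,
    fun ho => ?_, fun x y ho => ?_⟩
  · have h₁ := h.time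
    have h₂ := mul_le_mul_of_nonneg_left (lg_le_two_log n) (by positivity : (0 : ℝ) ≤ k)
    have h₃ : (0 : ℝ) ≤ k * Real.log n := mul_nonneg (by positivity) (Real.log_natCast_nonneg n)
    push_cast
    linarith
  · rw [storedGraph, storedGraph, hF, hF']
    exact hc.union_of_none ho
  · rw [storedGraph, storedGraph, hF, hF']
    exact hc.of_some ho

end

/-- Both quantities are at most 25 N² for N = n + k + m + 2, and N ≥ 5 turns 25 N² into at most N⁴;
this is the exponent of the word size. -/
theorem word_bounds {n k m : ℕ} (hn : 2 ≤ n) (hk : 1 ≤ k) :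
    26 * m + 4 * (k * n) + 10 * n + 24 ≤ (n + k + m + 2) ^ 4 ∧
      2 * m + 4 * ((2 * m + 1) * n) + 4 * n ≤ (n + k + m + 2) ^ 4 := by
  have h₁ : 25 * (n + k + m + 2) ^ 2 ≤ (n + k + m + 2) ^ 4 := by
    have : 5 ^ 2 ≤ (n + k + m + 2) ^ 2 := Nat.pow_le_pow_left (by omega) 2
    calc 25 * (n + k + m + 2) ^ 2 ≤ (n + k + m + 2) ^ 2 * (n + k + m + 2) ^ 2 :=
          Nat.mul_le_mul_right _ this
      _ = (n + k + m + 2) ^ 4 := by ring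
  constructor <;> refine le_trans ?_ h₁ <;> nlinarith [Nat.zero_le (k * n), Nat.zero_le (m * n)]

theorem mainTheorem7 :
    ∃ (init ins : RAMProg) (c : ℕ) (C : ℝ),
      ∀ (n k : ℕ) (G : SimpleGraph (Fin n)) (L : List (Fin n × Fin n)),
        2 ≤ n → 1 ≤ k → ListsEdges G L →
        ∀ W : ℕ, W = (n + k + L.length + 2) ^ c →
          -- initialization
          (∃ (s : RAMState) (t : ℕ),
            RAMExec W init (inputState n k L) s t ∧
            (t : ℝ) ≤ C * ((L.length : ℝ) + k * n * Real.log n) ∧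
            ∃ E : ℕ → Set (Sym2 (Fin n)), IsScanPartition G E ∧
              ∀ i : Fin k, (storedLinkCut n s i).WellFormed ∧
                storedForests n k s i = SimpleGraph.fromEdgeSet (E i)) ∧
          -- any number of edge additions
          ∀ (q : ℕ) (A : SimpleGraph (Fin n)) (T : ℕ) (s : RAMState),
            IsRun W init ins k G L q A T s →
            (T : ℝ) ≤ C * ((L.length : ℝ) + k * n * Real.log n) + q * (C * (k * Real.log n)) ∧
            IsSparseCertificate A (storedForests n k s) ∧
            ∀ u v : Fin n, IsNewEdge n k s u v →
              ∃ (s' : RAMState) (t : ℕ) (out : Option (Fin n × Fin n)),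
                RAMExec W ins (withRequest s u v) s' t ∧
                (∀ i : Fin k, (storedLinkCut n s' i).WellFormed) ∧
                HandleAddition (storedForests n k s) u v (storedForests n k s') out ∧
                ReportsDiscarded s' out ∧
                (out = none → storedGraph n k s' = storedGraph n k s ⊔ SimpleGraph.edge u v) ∧
                ∀ x y : Fin n, out = some (x, y) →
                  s(x, y) ≠ s(u, v) ∧ (storedGraph n k s).Adj x y ∧
                  storedGraph n k s' =
                    (storedGraph n k s ⊔ SimpleGraph.edge u v).deleteEdges {s(x, y)} ∧
                  HasEdgeDisjointPaths (storedGraph n k s') k x y := by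
  -- 200000 exceeds 2 · 80100: the amortized cost of an addition is 80100 k lg n, and lg n ≤ 2 log
  -- n.
  refine ⟨initP, insP, 4, 200000, fun n k G L hn hk hL W hW => ?_⟩
  obtain ⟨hW₁, hW₂⟩ := word_bounds (m := L.length) hn hk
  rw [← hW] at hW₁ hW₂
  obtain ⟨s₀, t₀, hex₀, T₀, sz₀, E, hE, hF, h₀⟩ := RunInv.init hn hk hL hW₁ hW₂
  have hpot : ∀ sz : ℕ → Fin n → ℕ, 0 ≤ ∑ j ∈ Finset.range k, potential (sz j) := fun sz =>
    Finset.sum_nonneg fun j _ => potential_nonneg _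
  refine ⟨⟨s₀, t₀, hex₀, ?_, E, hE, fun i => ⟨?_, ?_⟩⟩, fun q A T s hrun => ?_⟩
  · have := h₀.time
    have := hpot sz₀
    linarith
  · rw [h₀.maintains.storedLinkCut]
    exact (h₀.sound i i.2).1
  · rw [h₀.maintains.storedForests, ← hF]
  -- The triples provide one execution from each state; determinism identifies it with the one in
  -- the given run, so the invariant holds along every run.
  have key : ∃ L' sz, RunInv n k (2 * L.length) A s T
      (200000 * (L.length + k * n * Real.log n) + q * (200000 * (k * Real.log n))) L' sz := by
    induction hrun with
    | start h =>
      obtain ⟨rfl, rfl⟩ := hex₀.deterministic h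
      exact ⟨T₀, sz₀, by simpa using h₀⟩
    | step u v _ hnew hex ih =>
      obtain ⟨T₁, sz₁, h₁⟩ := ih
      obtain ⟨s', t', hex', T', sz', out, h', -⟩ :=
        h₁.addition (W := W) hn hk (by omega) hnew
      obtain ⟨rfl, rfl⟩ := hex'.deterministic hex
      refine ⟨T', sz', h'.maintains, h'.sound, h'.cert, h'.time.trans (le_of_eq ?_)⟩
      push_cast
      ring
  obtain ⟨T₁, sz₁, h₁⟩ := key
  refine ⟨?_, ?_, fun u v hnew => ?_⟩
  · have := h₁.time
    have := hpot sz₁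
    linarith
  · rw [h₁.maintains.storedForests]
    exact h₁.cert
  · obtain ⟨s', t', hex', T', sz', out, h', hH, hout⟩ :=
      h₁.addition (W := W) hn hk (by omega) hnew
    refine ⟨s', t', out, hex', fun i => ?_, hH, hout⟩
    rw [h'.maintains.storedLinkCut]
    exact (h'.sound i i.2).1
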